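/- Let $n\ge 0$ and $[2n]=\{1,\dots,2n\}$. **The algebra.** Let $\mathcal S_n$ be the free $\mathbb Q[u_1,\dots,u_{2n}]$-module on the monotone bijections $S\to T$ between $n$-element subsets $S,T\subset[2n]$. Its product is bilinear over $\mathbb Q[u_1,\dots,u_{2n}]$, with $(S\to T)(T\to W)=\prod_i u_i^{\alpha_i}\,(S\to W)$, where $\alpha_i$ is the number of strands which pass from one side of the gap between $i$ and $i+1$ to the other in $S\to T$ and pass back in $T\to W$; all other products of monotone bijections are $0$. Let $\iota_S$ be the identity of $S$, $\iota_j=\sum_{S\ni j}\iota_S$, let $R_j$ be the sum of all $S\to T$ with $j\in S$, $j+1\notin S$, $T=(S\setminus\{j\})\cup\{j+1\}\subset[2n]$ (write $S\xrightarrow{j}T$), and let $L_j$ be the sum of the reverse bijections $T\to S$. Let $\mathcal A_n$ be the quotient of $\mathcal S_n$ by the two-sided ideal generated by $R_jL_j-u_j\iota_j$ and $L_jR_j-u_j\iota_{j+1}$ for $1\le j\le 2n$, and by $R_jR_{j-1}$ and $L_{j-1}L_j$ for $2\le j\le 2n$. **The bimodules.** $\mathsf M[S_{id}]$ is the $(\mathcal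 A_n,\mathcal A_n)$-bimodule with generators $x_S$ for the $n$-element sets $S\subset[2n]$ and relations $\iota_Sx_S\iota_S=x_S$, $u_jx_S=x_Su_j$, and $L_jx_S=x_{S'}L_j$, $x_SR_j=R_jx_{S'}$ whenever $S\xrightarrow{j}S'$. For $1\le i<2n$, a cycle $Z$ in the singular braid $\mathsf X_i$ (in which the strands $i,i+1$ meet in a vertex) is a pair of $n$-element sets $b=b(Z)$, $t=t(Z)\subset[2n]$ which agree outside $\{i,i+1\}$, with $\{i,i+1\}\not\subset b$. $\mathsf M[\mathsf X_i]$ is the bimodule with generators $x_Z$ for the cycles $Z$ and the relations: $\iota_{b}x_Z\iota_{t}=x_Z$; $u_jx_Z=x_Zu_j$ for $j\ne i,i+1$; $(u_i+u_{i+1})x_Z=x_Z(u_i+u_{i+1})$; $u_iu_{i+1}x_Z=x_Zu_iu_{i+1}$; $L_jx_Z=x_{Z'}L_j$ and $x_ZR_j=R_jx_{Z'}$ if $j\neq i,i+1$, $b(Z)\xrightarrow{j}b(Z')$ and $t(Z)\xrightarrow{j}t(Z')$; $L_ix_Z=x_{Z'}$ if $b(Z)\xrightarrow{i}b(Z')$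 and $t(Z)=t(Z')$; $x_ZR_i=x_{Z'}$ if $b(Z)=b(Z')$ and $t(Z)\xrightarrow{i}t(Z')$; and, for cycles $Z_0$ with $b(Z_0)\cap\{i,i+1\}=\emptyset$ (so that $b(Z_0)=t(Z_0)$): $x_ZR_{i+1}=R_iR_{i+1}x_{Z_0}$ if $i\in b(Z)$ and $t(Z)\xrightarrow{i+1}t(Z_0)$; $L_{i+1}x_Z=x_{Z_0}L_{i+1}L_i$ if $b(Z)\xrightarrow{i+1}b(Z_0)$ and $i\in t(Z)$; $L_{i+1}x_Z=x_{Z_0}u_iL_{i+1}$ and $x_ZR_{i+1}=R_{i+1}u_ix_{Z_0}$ if $b(Z)\xrightarrow{i+1}b(Z_0)$ and $t(Z)\xrightarrow{i+1}t(Z_0)$. **The maps.** The bimodule homomorphism $d^-:\mathsf M[\mathsf X_i]\to\mathsf M[S_{id}]$ sends $x_Z$ to $x_{b(Z)}$ if $i+1\notin b(Z)\cup t(Z)$, to $x_{b(Z)}L_i$ if $i+1\in b(Z)\setminus t(Z)$, to $R_ix_{t(Z)}$ if $i+1\in t(Z)\setminus b(Z)$, and to $u_ix_{b(Z)}$ if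 $i+1\in b(Z)\cap t(Z)$. Write $x_{S,S}\in\mathsf M[\mathsf X_i]$ for the generator of the cycle with $b=t=S$, and $x_{S,S}=0$ if $\{i,i+1\}\subset S$. The bimodule homomorphism $d^+:\mathsf M[S_{id}]\to\mathsf M[\mathsf X_i]$ sends $x_S$ to $x_{S,S}u_i-u_{i+1}x_{S,S}$ if $i+1\notin S$; if $i+1\in S$, it sends $x_S$ to $x_{S,S}-R_{i+1}x_{T,T}L_{i+1}$ when there is a $T$ with $S\xrightarrow{i+1}T$, and to $x_{S,S}$ otherwise. **The complex of an open braid.** A positive crossing of the strands $i,i+1$ is assigned the complex $\mathsf M[S_{id}]\xrightarrow{d^+}\mathsf M[\mathsf X_i]$ in degrees $0,1$, and a negative crossing the complex $\mathsf M[\mathsf X_i]\xrightarrow{d^-}\mathsf M[S_{id}]$ in degrees $-1,0$. To an open braid diagram $T$ on $2n$ strands, with crossings $c_1,\dots,c_k$ from bottom to top, one assigns the cochain complex of $(\mathcal A_n,\mathcal A_n)$-bimodules $\mathsf M[T]=\mathsf M[c_1]\otimes_{\mathcal A_n}\cdots\otimes_{\mathcal A_n}\mathsf M[c_k]\otimes_{\mathcal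 A_n}\mathsf M[S_{id}]$. **Theorem.** The chain homotopy type of $\mathsf M[T]$ is an invariant of open braids: if $T$ and $T'$ are related by a finite sequence of braid-like Reidemeister II moves ($\sigma_i^{\pm1}\sigma_i^{\mp1}\leftrightarrow 1$), braid-like Reidemeister III moves ($\sigma_i^{r}\sigma_{i+1}^{s}\sigma_i^{t}\leftrightarrow\sigma_{i+1}^{t}\sigma_i^{s}\sigma_{i+1}^{r}$ with signs $r,s,t\in\{\pm1\}$, not $r=t\ne s$), and planar isotopies exchanging the heights of crossings without common strands, then $\mathsf M[T]$ and $\mathsf M[T']$ are homotopy equivalent complexes of $(\mathcal A_n,\mathcal A_n)$-bimodules. Moreover, if $T'$ arises from $T$ by removing two crossings in a braid-like Reidemeister II move, then there are chain maps of bimodule complexes $f:\mathsf M[T']\to\mathsf M[T]$ and $g:\mathsf M[T]\to\mathsf M[T']$ with $g\circ f=\mathrm{id}$ and $f\circ g\simeq\mathrm{id}$. -/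

import Mathlib

open CategoryTheory TensorProduct MulOpposite

noncomputable section

namespace OpenBraid

/-! ### The strands algebra -/

/-- The `n`-element subsets of `[2n] = {1, …, 2n}`; they label the basic idempotents. -/
abbrev Idem (n : ℕ) : Type := {S : Finset ℕ // S ∈ (Finset.Icc 1 (2 * n)).powersetCard n}

/-- The polynomial ring `ℚ[u₁, …, u₂ₙ]`. -/
abbrev Poly (n : ℕ) : Type := MvPolynomial (Finset.Icc 1 (2 * n)) ℚ

variable {n : ℕ}

theorem Idem.card (S : Idem n) : S.1.card = n := (Finset.mem_powersetCard.1 S.2).2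

theorem Idem.mem_Icc (S : Idem n) {j : ℕ} (h : j ∈ S.1) : 1 ≤ j ∧ j ≤ 2 * n :=
  Finset.mem_Icc.1 ((Finset.mem_powersetCard.1 S.2).1 h)

/-- The `k`-th smallest element of `S`. The unique monotone bijection `S → T` sends
`S.pos k` to `T.pos k`, for every `k`. -/
def Idem.pos (S : Idem n) (k : Fin n) : ℕ := S.1.orderEmbOfFin S.card k

/-- The exponent of `uᵢ` in the product of the monotone bijections `S → T` and `T → W`: the
number of strands that cross from one side of the gap between `i` and `i + 1` to the other
in `S → T` and cross back in `T → W`. -/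
def strandExp (S T W : Idem n) (i : ℕ) : ℕ :=
  (Finset.univ.filter fun k : Fin n =>
    (max (S.pos k) (W.pos k) ≤ i ∧ i < T.pos k) ∨
    (T.pos k ≤ i ∧ i < min (S.pos k) (W.pos k))).card

/-- The monomial `∏ uᵢ ^ αᵢ` in the product of `S → T` and `T → W`. -/
def strandMon (S T W : Idem n) : Poly n :=
  ∏ i : Finset.Icc 1 (2 * n), MvPolynomial.X i ^ strandExp S T W i

theorem strandExp_cocycle (S T W V : Idem n) (i : ℕ) :
    strandExp S T W i + strandExp S W V i = strandExp T W V i + strandExp S T V i := by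
  simp only [strandExp, Finset.card_filter, ← Finset.sum_add_distrib]
  refine Finset.sum_congr rfl fun k _ => ?_
  by_cases h1 : S.pos k ≤ i <;> by_cases h2 : T.pos k ≤ i <;> by_cases h3 : W.pos k ≤ i <;>
    by_cases h4 : V.pos k ≤ i <;> simp [h1, h2, h3, h4, not_lt.2, not_le.1]

theorem strandMon_cocycle (S T W V : Idem n) :
    strandMon S T W * strandMon S W V = strandMon T W V * strandMon S T V := by
  simp only [strandMon, ← Finset.prod_mul_distrib, ← pow_add]
  exact Finset.prod_congr rfl fun i _ => by rw [strandExp_cocycle]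

theorem strandExp_left (S W : Idem n) (i : ℕ) : strandExp S S W i = 0 := by
  simp only [strandExp, Finset.card_eq_zero, Finset.filter_eq_empty_iff]
  intro k _; omega

theorem strandExp_right (S W : Idem n) (i : ℕ) : strandExp S W W i = 0 := by
  simp only [strandExp, Finset.card_eq_zero, Finset.filter_eq_empty_iff]
  intro k _; omega

@[simp] theorem strandMon_left (S W : Idem n) : strandMon S S W = 1 := by
  simp [strandMon, strandExp_left]

@[simp] theorem strandMon_right (S W : Idem n) : strandMon S W W = 1 := by
  simp [strandMon, strandExp_right]

/-- The free `ℚ[u₁, …, u₂ₙ]`-module on the monotone bijections between `n`-element subsets of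
`[2n]`. Such a bijection `S → T` is determined by `S` and `T`, and the value of `x` at `S`, `T`
is the coefficient of that bijection in `x`. -/
def Strands (n : ℕ) : Type := Idem n → Idem n → Poly n

namespace Strands

@[ext] theorem ext {x y : Strands n} (h : ∀ S T, x S T = y S T) : x = y :=
  funext fun S => funext fun T => h S T

instance : AddCommGroup (Strands n) := inferInstanceAs (AddCommGroup (Idem n → Idem n → Poly n))

instance : Module ℚ (Strands n) := inferInstanceAs (Module ℚ (Idem n → Idem n → Poly n))

instance : One (Strands n) := ⟨fun S T => if S = T then 1 else 0⟩

/-- Concatenation of strands: `(S → T) (T → W) = ∏ uᵢ ^ αᵢ (S → W)`, extended bilinearly; the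
other products of monotone bijections are zero. -/
instance : Mul (Strands n) := ⟨fun x y S W => ∑ T, strandMon S T W * x S T * y T W⟩

@[simp] theorem add_apply (x y : Strands n) (S T : Idem n) : (x + y) S T = x S T + y S T := rfl
@[simp] theorem zero_apply (S T : Idem n) : (0 : Strands n) S T = 0 := rfl
@[simp] theorem smul_apply (q : ℚ) (x : Strands n) (S T : Idem n) : (q • x) S T = q • x S T := rfl
theorem one_apply (S T : Idem n) : (1 : Strands n) S T = if S = T then 1 else 0 := rfl
theorem mul_apply (x y : Strands n) (S W : Idem n) :
    (x * y) S W = ∑ T, strandMon S T W * x S T * y T W := rfl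

instance : Ring (Strands n) :=
  { (inferInstance : AddCommGroup (Strands n)), (inferInstance : Mul (Strands n)),
    (inferInstance : One (Strands n)) with
    left_distrib := fun x y z => by
      ext1 S W; simp [mul_apply, mul_add, Finset.sum_add_distrib]
    right_distrib := fun x y z => by
      ext1 S W; simp [mul_apply, mul_add, add_mul, Finset.sum_add_distrib]
    zero_mul := fun x => by ext1 S W; simp [mul_apply]
    mul_zero := fun x => by ext1 S W; simp [mul_apply]
    one_mul := fun x => by
      ext1 S W
      simp [mul_apply, one_apply]
    mul_one := fun x => by
      ext1 S W
      simp [mul_apply, one_apply]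
    mul_assoc := fun x y z => by
      ext1 S V
      simp only [mul_apply, Finset.mul_sum, Finset.sum_mul]
      rw [Finset.sum_comm]
      refine Finset.sum_congr rfl fun T _ => Finset.sum_congr rfl fun W _ => ?_
      linear_combination (x S T * y T W * z W V) * strandMon_cocycle S T W V }

instance : Algebra ℚ (Strands n) := Algebra.ofModule
  (fun q x y => by ext1 S W; simp [mul_apply, Finset.smul_sum])
  (fun q x y => by ext1 S W; simp [mul_apply, Finset.smul_sum])

/-- The idempotent `ι_S`, the identity bijection of `S`. -/
def ι (S : Idem n) : Strands n := fun A B => if A = S ∧ B = S then 1 else 0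

/-- The central element `uⱼ`, for `1 ≤ j ≤ 2n`. -/
def u (j : ℕ) : Strands n := fun A B =>
  if h : j ∈ Finset.Icc 1 (2 * n) then (if A = B then MvPolynomial.X ⟨j, h⟩ else 0) else 0

end Strands

/-- `T = r_j(S)`, that is, `T` arises from `S` by moving the element `j` to the free
slot `j + 1`. Equivalently `S = l_j(T)`. -/
def IsShift (j : ℕ) (S T : Idem n) : Prop :=
  j ∈ S.1 ∧ j + 1 ∉ S.1 ∧ T.1 = insert (j + 1) (S.1.erase j)

instance (j : ℕ) (S T : Idem n) : Decidable (IsShift j S T) := by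
  unfold IsShift; infer_instance

namespace Strands

/-- The sum of the monotone bijections `S → T` over all `S`, `T` in the relation `p`. -/
def ind (p : Idem n → Idem n → Prop) [∀ S T, Decidable (p S T)] : Strands n :=
  fun S T => if p S T then 1 else 0

/-- `R_j`, the sum of all moves of a strand from slot `j` to slot `j + 1`. It is zero unless
`1 ≤ j < 2n`. -/
def R (j : ℕ) : Strands n := ind fun S T => IsShift j S T

/-- `L_j`, the sum of all moves of a strand from slot `j + 1` to slot `j`. It is zero unless
`1 ≤ j < 2n`. -/
def L (j : ℕ) : Strands n := ind fun S T => IsShift j T S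

/-- `ι_j = ∑ ι_S`, over all `S` that contain `j`. -/
def ιAt (j : ℕ) : Strands n := ∑ S : Idem n, if j ∈ S.1 then ι S else 0

/-- The relators of the algebra: `R_j L_j = u_j ι_j` and `L_j R_j = u_j ι_{j+1}`, and the
vanishing of the products `R_j R_{j-1}` and `L_{j-1} L_j` that move two adjacent strands in the
same direction. -/
def relators (n : ℕ) : Set (Strands n) :=
  {x | ∃ j ∈ Finset.Icc 1 (2 * n), x = R j * L j - u j * ιAt j} ∪
  {x | ∃ j ∈ Finset.Icc 1 (2 * n), x = L j * R j - u j * ιAt (j + 1)} ∪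
  {x | ∃ j ∈ Finset.Icc 2 (2 * n), x = R j * R (j - 1)} ∪
  {x | ∃ j ∈ Finset.Icc 2 (2 * n), x = L (j - 1) * L j}

end Strands

/-- The algebra `𝒜ₙ`. -/
def Alg (n : ℕ) : Type := (TwoSidedIdeal.span (Strands.relators n)).ringCon.Quotient

instance : Ring (Alg n) :=
  inferInstanceAs (Ring (TwoSidedIdeal.span (Strands.relators n)).ringCon.Quotient)

instance : Algebra ℚ (Alg n) :=
  inferInstanceAs (Algebra ℚ (TwoSidedIdeal.span (Strands.relators n)).ringCon.Quotient)

/-- The quotient map from the strands algebra. -/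
def Alg.mk (n : ℕ) : Strands n →+* Alg n := (TwoSidedIdeal.span (Strands.relators n)).ringCon.mk'

theorem IsShift.ext {j : ℕ} {S T T' : Idem n} (h : IsShift j S T) (h' : IsShift j S T') :
    T = T' := Subtype.ext (h.2.2.trans h'.2.2.symm)

theorem IsShift.mem {j : ℕ} {S T : Idem n} (h : IsShift j S T) (x : ℕ) :
    x ∈ T.1 ↔ x = j + 1 ∨ (x ≠ j ∧ x ∈ S.1) := by
  rw [h.2.2, Finset.mem_insert, Finset.mem_erase]

theorem IsShift.mem' {j : ℕ} {S T : Idem n} (h : IsShift j S T) (x : ℕ) :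
    x ∈ S.1 ↔ x = j ∨ (x ≠ j + 1 ∧ x ∈ T.1) := by
  rw [h.mem]
  have := h.1; have := h.2.1
  by_cases h1 : x = j
  · subst h1; simp [h.1]
  · by_cases h2 : x = j + 1
    · subst h2; simp [h.2.1]
    · simp [h1, h2]

theorem Idem.ext {S T : Idem n} (h : ∀ x, x ∈ S.1 ↔ x ∈ T.1) : S = T :=
  Subtype.ext (Finset.ext h)

theorem IsShift.ext' {j : ℕ} {S S' T : Idem n} (h : IsShift j S T) (h' : IsShift j S' T) :
    S = S' := Idem.ext fun x => by rw [h.mem', h'.mem']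

theorem isShift_iff {j : ℕ} {S T : Idem n} : IsShift j S T ↔
    j ∈ S.1 ∧ j + 1 ∉ S.1 ∧ ∀ x, x ∈ T.1 ↔ x = j + 1 ∨ (x ≠ j ∧ x ∈ S.1) := by
  constructor
  · intro h; exact ⟨h.1, h.2.1, h.mem⟩
  · rintro ⟨h1, h2, h3⟩
    exact ⟨h1, h2, Finset.ext fun x => by rw [h3, Finset.mem_insert, Finset.mem_erase]⟩

theorem isShift_iff' {j : ℕ} {S T : Idem n} : IsShift j S T ↔
    j + 1 ∈ T.1 ∧ j ∉ T.1 ∧ ∀ x, x ∈ S.1 ↔ x = j ∨ (x ≠ j + 1 ∧ x ∈ T.1) := by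
  constructor
  · intro h; exact ⟨by simp [h.mem], by simp [h.mem], h.mem'⟩
  · rintro ⟨h1, h2, h3⟩
    refine isShift_iff.2 ⟨by simp [h3], by simp [h3], fun x => ?_⟩
    rw [h3]
    by_cases e : x = j
    · subst e; simp [h2]
    · by_cases e2 : x = j + 1
      · subst e2; simp [h1]
      · simp [e, e2]

theorem exists_shift {j : ℕ} {S : Idem n} (h1 : j ∈ S.1) (h2 : j + 1 ∉ S.1) (h3 : j + 1 ≤ 2 * n) :
    ∃ T, IsShift j S T := by
  refine ⟨⟨insert (j + 1) (S.1.erase j), Finset.mem_powersetCard.2 ⟨?_, ?_⟩⟩, h1, h2, rfl⟩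
  · intro x hx
    rw [Finset.mem_insert, Finset.mem_erase] at hx
    rcases hx with rfl | ⟨_, hx⟩
    · exact Finset.mem_Icc.2 ⟨by omega, h3⟩
    · exact Finset.mem_Icc.2 (S.mem_Icc hx)
  · rw [Finset.card_insert_of_notMem (by simp [h2]), Finset.card_erase_of_mem h1, S.card]
    have := Finset.card_pos.2 ⟨j, h1⟩
    rw [S.card] at this; omega

theorem exists_shift' {j : ℕ} {T : Idem n} (h1 : j + 1 ∈ T.1) (h2 : j ∉ T.1) (h3 : 1 ≤ j) :
    ∃ S, IsShift j S T := by
  refine ⟨⟨insert j (T.1.erase (j + 1)), Finset.mem_powersetCard.2 ⟨?_, ?_⟩⟩,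
    isShift_iff'.2 ⟨h1, h2, fun x => by simp⟩⟩
  · intro x hx
    rw [Finset.mem_insert, Finset.mem_erase] at hx
    rcases hx with rfl | ⟨_, hx⟩
    · exact Finset.mem_Icc.2 ⟨h3, by have := (T.mem_Icc h1).2; omega⟩
    · exact Finset.mem_Icc.2 (T.mem_Icc hx)
  · rw [Finset.card_insert_of_notMem (by simp [h2]), Finset.card_erase_of_mem h1, T.card]
    have := Finset.card_pos.2 ⟨j + 1, h1⟩
    rw [T.card] at this; omega

theorem IsShift.pos {j : ℕ} {S T : Idem n} (h : IsShift j S T) (k : Fin n) :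
    T.pos k = if S.pos k = j then j + 1 else S.pos k := by
  have key : (fun k => if S.pos k = j then j + 1 else S.pos k) = T.1.orderEmbOfFin T.card := by
    refine Finset.orderEmbOfFin_unique T.card (fun k => ?_) ?_
    · have := Finset.orderEmbOfFin_mem S.1 S.card k
      rw [h.mem]
      split_ifs with e
      · exact Or.inl rfl
      · exact Or.inr ⟨e, this⟩
    · intro k l hkl
      have h1 : S.pos k < S.pos l := (S.1.orderEmbOfFin S.card).strictMono hkl
      have h2 : S.pos l ≠ j + 1 := fun e =>
        h.2.1 (e ▸ Finset.orderEmbOfFin_mem S.1 S.card l)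
      dsimp only
      split_ifs <;> omega
  exact (congrFun key k).symm

theorem IsShift.pos_le {j i : ℕ} {S T : Idem n} (h : IsShift j S T) (hij : i ≠ j) (k : Fin n) :
    T.pos k ≤ i ↔ S.pos k ≤ i := by
  rw [h.pos]; split_ifs <;> omega

theorem strandMon_eq_one {S T W : Idem n}
    (h : ∀ i, (∀ k, T.pos k ≤ i ↔ S.pos k ≤ i) ∨ (∀ k, T.pos k ≤ i ↔ W.pos k ≤ i)) :
    strandMon S T W = 1 := by
  refine Finset.prod_eq_one fun i _ => ?_
  have : strandExp S T W i = 0 := by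
    simp only [strandExp, Finset.card_eq_zero, Finset.filter_eq_empty_iff]
    intro k _
    rcases h i with h | h <;> have := h k <;> omega
  rw [this, pow_zero]

namespace Strands

theorem comm_aux {p q p' q' : Idem n → Idem n → Prop} [∀ S T, Decidable (p S T)]
    [∀ S T, Decidable (q S T)] [∀ S T, Decidable (p' S T)] [∀ S T, Decidable (q' S T)]
    (hp : ∀ {S T T'}, p S T → p S T' → T = T') (hp' : ∀ {S T T'}, p' S T → p' S T' → T = T')
    (h1 : ∀ {S T W}, p S T → q T W → strandMon S T W = 1)
    (h2 : ∀ {S T W}, p' S T → q' T W → strandMon S T W = 1)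
    (h : ∀ S W, (∃ T, p S T ∧ q T W) ↔ ∃ T, p' S T ∧ q' T W) :
    ind p * ind q = ind p' * ind q' := by
  have aux : ∀ (p q : Idem n → Idem n → Prop) [∀ S T, Decidable (p S T)]
      [∀ S T, Decidable (q S T)] (_ : ∀ {S T T'}, p S T → p S T' → T = T')
      (_ : ∀ {S T W}, p S T → q T W → strandMon S T W = 1) (S W : Idem n),
      (ind p * ind q) S W
        = open Classical in if ∃ T, p S T ∧ q T W then 1 else 0 := by
    intro p q _ _ hp h1 S W
    rw [mul_apply]
    split_ifs with hT
    · obtain ⟨T, hT1, hT2⟩ := hT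
      rw [Finset.sum_eq_single T]
      · simp [ind, hT1, hT2, h1 hT1 hT2]
      · intro T' _ hne
        have : ¬ p S T' := fun h' => hne (hp h' hT1)
        simp [ind, this]
      · simp
    · refine Finset.sum_eq_zero fun T _ => ?_
      by_cases h3 : p S T
      · have : ¬ q T W := fun h4 => hT ⟨T, h3, h4⟩
        simp [ind, this]
      · simp [ind, h3]
  ext1 S W
  rw [aux p q hp h1, aux p' q' hp' h2]
  simp only [h]

theorem mon_RR {i j : ℕ} (hij : i ≠ j) {S T W : Idem n} (h : IsShift i S T) (h' : IsShift j T W) :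
    strandMon S T W = 1 := by
  refine strandMon_eq_one fun k => ?_
  by_cases e : k = i
  · right; intro l; rw [h'.pos_le (by omega)]
  · left; intro l; rw [h.pos_le e]

theorem mon_LL {i j : ℕ} (hij : i ≠ j) {S T W : Idem n} (h : IsShift i T S) (h' : IsShift j W T) :
    strandMon S T W = 1 := by
  refine strandMon_eq_one fun k => ?_
  by_cases e : k = i
  · right; intro l; rw [h'.pos_le (by omega)]
  · left; intro l; rw [h.pos_le e]

theorem mon_RL {i j : ℕ} (hij : i ≠ j) {S T W : Idem n} (h : IsShift i S T) (h' : IsShift j W T) :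
    strandMon S T W = 1 := by
  refine strandMon_eq_one fun k => ?_
  by_cases e : k = i
  · right; intro l; rw [h'.pos_le (by omega)]
  · left; intro l; rw [h.pos_le e]

theorem mon_LR {i j : ℕ} (hij : i ≠ j) {S T W : Idem n} (h : IsShift i T S) (h' : IsShift j T W) :
    strandMon S T W = 1 := by
  refine strandMon_eq_one fun k => ?_
  by_cases e : k = i
  · right; intro l; rw [h'.pos_le (by omega)]
  · left; intro l; rw [h.pos_le e]

theorem sq_RR {i j : ℕ} (hij : i + 2 ≤ j ∨ j + 2 ≤ i) {S T W : Idem n} (h : IsShift i S T)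
    (h' : IsShift j T W) : ∃ T', IsShift j S T' ∧ IsShift i T' W := by
  have a := h.mem; have b := h'.mem
  obtain ⟨T', hT⟩ := exists_shift (j := j) (S := S) (((a j).1 h'.1).resolve_left (by omega)).2
    (fun e => h'.2.1 ((a _).2 (Or.inr ⟨by omega, e⟩)))
    ((W.mem_Icc ((b (j + 1)).2 (Or.inl rfl))).2)
  refine ⟨T', hT, isShift_iff.2 ⟨(hT.mem i).2 (Or.inr ⟨by omega, h.1⟩), fun e => ?_, fun x => ?_⟩⟩
  · have := (hT.mem _).1 e
    rcases this with e | e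
    · omega
    · exact h.2.1 e.2
  · rw [b, a, hT.mem]
    by_cases h1 : x = j <;> by_cases h2 : x = j + 1 <;> by_cases h3 : x = i <;>
      by_cases h4 : x = i + 1 <;> simp [h1, h2, h3, h4] <;> omega

theorem sq_LR {i j : ℕ} (hij : i + 2 ≤ j ∨ j + 2 ≤ i) {S T W : Idem n} (h : IsShift i T S)
    (h' : IsShift j T W) : ∃ T', IsShift j S T' ∧ IsShift i W T' := by
  have a := h.mem; have b := h'.mem
  obtain ⟨T', hT⟩ := exists_shift (j := j) (S := S) ((a j).2 (Or.inr ⟨by omega, h'.1⟩))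
    (fun e => by
      rcases (a _).1 e with e | e
      · omega
      · exact h'.2.1 e.2)
    ((W.mem_Icc ((b (j + 1)).2 (Or.inl rfl))).2)
  refine ⟨T', hT, isShift_iff.2 ⟨(b i).2 (Or.inr ⟨by omega, h.1⟩), fun e => ?_, fun x => ?_⟩⟩
  · rcases (b _).1 e with e | e
    · omega
    · exact h.2.1 e.2
  · rw [hT.mem, a, b]
    by_cases h1 : x = j <;> by_cases h2 : x = j + 1 <;> by_cases h3 : x = i <;>
      by_cases h4 : x = i + 1 <;> simp [h1, h2, h3, h4] <;> omega

theorem R_comm_R {i j : ℕ} (hij : i + 2 ≤ j ∨ j + 2 ≤ i) :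
    (R i * R j : Strands n) = R j * R i :=
  comm_aux (n := n) (p := fun S T => IsShift i S T) (q := fun S T => IsShift j S T)
    (p' := fun S T => IsShift j S T) (q' := fun S T => IsShift i S T)
    (fun h h' => h.ext h') (fun h h' => h.ext h') (mon_RR (by omega)) (mon_RR (by omega))
    fun S W => ⟨fun ⟨_, h, h'⟩ => sq_RR hij h h', fun ⟨_, h, h'⟩ => sq_RR hij.symm h h'⟩

theorem L_comm_L {i j : ℕ} (hij : i + 2 ≤ j ∨ j + 2 ≤ i) :
    (L i * L j : Strands n) = L j * L i :=
  comm_aux (n := n) (p := fun S T => IsShift i T S) (q := fun S T => IsShift j T S)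
    (p' := fun S T => IsShift j T S) (q' := fun S T => IsShift i T S)
    (fun h h' => h.ext' h') (fun h h' => h.ext' h') (mon_LL (by omega)) (mon_LL (by omega))
    fun S W => ⟨fun ⟨_, h, h'⟩ => (sq_RR hij.symm h' h).imp fun _ h => ⟨h.2, h.1⟩,
      fun ⟨_, h, h'⟩ => (sq_RR hij h' h).imp fun _ h => ⟨h.2, h.1⟩⟩

theorem R_comm_L {i j : ℕ} (hij : i + 2 ≤ j ∨ j + 2 ≤ i) :
    (R i * L j : Strands n) = L j * R i := by
  refine comm_aux (n := n) (p := fun S T => IsShift i S T) (q := fun S T => IsShift j T S)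
    (p' := fun S T => IsShift j T S) (q' := fun S T => IsShift i S T)
    (fun h h' => h.ext h') (fun h h' => h.ext' h') (mon_RL (by omega)) (mon_LR (by omega))
    fun S W => ⟨fun ⟨T, h, h'⟩ => ?_, fun ⟨T, h, h'⟩ => ?_⟩
  · -- `S → T ← W`: pull both moves back
    have a := h.mem; have b := h'.mem'
    have hj : j ∈ W.1 := h'.1
    have e1 : j + 1 ∈ S.1 := by
      have := h.mem' (j + 1); rw [this]
      exact Or.inr ⟨by omega, (h'.mem _).2 (Or.inl rfl)⟩
    have e2 : j ∉ S.1 := by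
      rw [h.mem']; rintro (e | e)
      · omega
      · have := (h'.mem j).1 e.2; omega
    obtain ⟨T', hT⟩ := exists_shift' e1 e2 (W.mem_Icc hj).1
    refine ⟨T', hT, isShift_iff.2 ⟨?_, ?_, fun x => ?_⟩⟩
    · rw [hT.mem']; exact Or.inr ⟨by omega, h.1⟩
    · rw [hT.mem']; rintro (e | e)
      · omega
      · exact h.2.1 e.2
    · rw [b, a, hT.mem']
      by_cases h1 : x = j <;> by_cases h2 : x = j + 1 <;> by_cases h3 : x = i <;>
        by_cases h4 : x = i + 1 <;> simp [h1, h2, h3, h4] <;> omega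
  · exact (sq_LR hij.symm h h').imp fun _ h => h

theorem u_mul_apply (j : ℕ) (hj : j ∈ Finset.Icc 1 (2 * n)) (x : Strands n) (S T : Idem n) :
    (u (n := n) j * x) S T = MvPolynomial.X ⟨j, hj⟩ * x S T := by
  rw [mul_apply, Finset.sum_eq_single S]
  · simp [u, Finset.mem_Icc.1 hj]
  · intro T' _ hne; simp [u, Ne.symm hne]
  · simp

theorem u_comm (j : ℕ) (x : Strands n) : u j * x = x * u j := by
  by_cases hj : j ∈ Finset.Icc 1 (2 * n)
  · ext1 S T
    rw [u_mul_apply j hj, mul_apply, Finset.sum_eq_single T]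
    · rw [u, dif_pos hj, if_pos rfl, strandMon_right]; ring
    · intro T' _ hne; simp [u, hne]
    · simp
  · have : (u j : Strands n) = 0 := by
      ext1 S T; simp only [u, dif_neg hj, zero_apply]
    rw [this, zero_mul, mul_zero]

theorem ι_mul_apply (S : Idem n) (x : Strands n) (A B : Idem n) :
    (ι S * x) A B = if A = S then x A B else 0 := by
  rw [mul_apply, Finset.sum_eq_single A]
  · by_cases h : A = S <;> simp [ι, h]
  · intro T' _ hne
    have : ¬ (A = S ∧ T' = S) := fun h => hne (h.2.trans h.1.symm)
    simp [ι, this]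
  · simp

theorem mul_ι_apply (S : Idem n) (x : Strands n) (A B : Idem n) :
    (x * ι S) A B = if B = S then x A B else 0 := by
  rw [mul_apply, Finset.sum_eq_single B]
  · by_cases h : B = S <;> simp [ι, h]
  · intro T' _ hne
    have : ¬ (T' = S ∧ B = S) := fun h => hne (h.1.trans h.2.symm)
    simp [ι, this]
  · simp

theorem ι_mul_ι_self (S : Idem n) : ι S * ι S = ι S := by
  ext1 A B; rw [ι_mul_apply]; by_cases h : A = S <;> simp [ι, h]

theorem ι_mul_ι_ne {S T : Idem n} (h : S ≠ T) : ι S * ι T = 0 := by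
  ext1 A B; rw [ι_mul_apply]; by_cases h' : A = S <;> simp [ι, h', h]

theorem ι_mul_R {j : ℕ} {S T : Idem n} (h : IsShift j S T) : ι S * R j = R j * ι T := by
  ext1 A B
  rw [ι_mul_apply, mul_ι_apply]
  by_cases h1 : IsShift j A B
  · have : A = S ↔ B = T := ⟨fun e => (e ▸ h1 : IsShift j S B).ext h,
      fun e => (e ▸ h1 : IsShift j A T).ext' h⟩
    simp [R, ind, h1, this]
  · simp [R, ind, h1]

theorem L_mul_ι {j : ℕ} {S T : Idem n} (h : IsShift j S T) : L j * ι S = ι T * L j := by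
  ext1 A B
  rw [ι_mul_apply, mul_ι_apply]
  by_cases h1 : IsShift j B A
  · have : B = S ↔ A = T := ⟨fun e => (e ▸ h1 : IsShift j S A).ext h,
      fun e => (e ▸ h1 : IsShift j B T).ext' h⟩
    simp [L, ind, h1, this]
  · simp [L, ind, h1]

theorem ι_mul_R_zero {j : ℕ} {S : Idem n} (h : ∀ T, ¬ IsShift j S T) : ι S * R j = 0 := by
  ext1 A B; rw [ι_mul_apply]
  by_cases e : A = S
  · subst e; simp [R, ind, h]
  · simp [e]

theorem R_mul_ι_zero {j : ℕ} {T : Idem n} (h : ∀ S, ¬ IsShift j S T) : R j * ι T = 0 := by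
  ext1 A B; rw [mul_ι_apply]
  by_cases e : B = T
  · subst e; simp [R, ind, h]
  · simp [e]

theorem ι_mul_L_zero {j : ℕ} {T : Idem n} (h : ∀ S, ¬ IsShift j S T) : ι T * L j = 0 := by
  ext1 A B; rw [ι_mul_apply]
  by_cases e : A = T
  · subst e; simp [L, ind, h]
  · simp [e]

theorem L_mul_ι_zero {j : ℕ} {S : Idem n} (h : ∀ T, ¬ IsShift j S T) : L j * ι S = 0 := by
  ext1 A B; rw [mul_ι_apply]
  by_cases e : B = S
  · subst e; simp [L, ind, h]
  · simp [e]

theorem ιAt_mul_ι (j : ℕ) (S : Idem n) : ιAt j * ι S = if j ∈ S.1 then ι S else 0 := by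
  rw [ιAt, Finset.sum_mul, Finset.sum_eq_single S]
  · split_ifs
    · exact ι_mul_ι_self S
    · simp
  · intro T _ hne
    split_ifs
    · exact ι_mul_ι_ne hne
    · simp
  · simp

end Strands

namespace Alg

/-- The idempotent `ι_S` in `𝒜ₙ`. -/
def ι (S : Idem n) : Alg n := mk n (Strands.ι S)
/-- The central element `u_j` of `𝒜ₙ`. -/
def u (j : ℕ) : Alg n := mk n (Strands.u j)
/-- The element `R_j` of `𝒜ₙ`. -/
def R (j : ℕ) : Alg n := mk n (Strands.R j)
/-- The element `L_j` of `𝒜ₙ`. -/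
def L (j : ℕ) : Alg n := mk n (Strands.L j)

theorem mk_eq_zero {x : Strands n} (h : x ∈ Strands.relators n) : mk n x = 0 := by
  have : x ∈ TwoSidedIdeal.span (Strands.relators n) := TwoSidedIdeal.subset_span h
  rw [← map_zero (mk n)]
  exact (RingCon.eq _).2 ((TwoSidedIdeal.mem_iff _ _).1 this)

theorem mk_surjective : Function.Surjective (mk n) := RingCon.mk'_surjective _

theorem u_comm (j : ℕ) (x : Alg n) : u j * x = x * u j := by
  obtain ⟨x, rfl⟩ := mk_surjective x
  simp only [u, ← map_mul, Strands.u_comm]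

theorem ι_mul_ι (S : Idem n) : ι S * ι S = ι S := by
  simp only [ι, ← map_mul, Strands.ι_mul_ι_self]

theorem ι_mul_R {j : ℕ} {S T : Idem n} (h : IsShift j S T) : ι S * R j = R j * ι T := by
  simp only [ι, R, ← map_mul, Strands.ι_mul_R h]

theorem L_mul_ι {j : ℕ} {S T : Idem n} (h : IsShift j S T) : L j * ι S = ι T * L j := by
  simp only [ι, L, ← map_mul, Strands.L_mul_ι h]

theorem ι_mul_R_zero {j : ℕ} {S : Idem n} (h : ∀ T, ¬ IsShift j S T) : ι S * R j = 0 := by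
  simp only [ι, R, ← map_mul, Strands.ι_mul_R_zero h, map_zero]

theorem R_mul_ι_zero {j : ℕ} {T : Idem n} (h : ∀ S, ¬ IsShift j S T) : R j * ι T = 0 := by
  simp only [ι, R, ← map_mul, Strands.R_mul_ι_zero h, map_zero]

theorem ι_mul_L_zero {j : ℕ} {T : Idem n} (h : ∀ S, ¬ IsShift j S T) : ι T * L j = 0 := by
  simp only [ι, L, ← map_mul, Strands.ι_mul_L_zero h, map_zero]

theorem L_mul_ι_zero {j : ℕ} {S : Idem n} (h : ∀ T, ¬ IsShift j S T) : L j * ι S = 0 := by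
  simp only [ι, L, ← map_mul, Strands.L_mul_ι_zero h, map_zero]

theorem R_comm_R {i j : ℕ} (h : i + 2 ≤ j ∨ j + 2 ≤ i) : (R i * R j : Alg n) = R j * R i := by
  simp only [R, ← map_mul, Strands.R_comm_R h]

theorem L_comm_L {i j : ℕ} (h : i + 2 ≤ j ∨ j + 2 ≤ i) : (L i * L j : Alg n) = L j * L i := by
  simp only [L, ← map_mul, Strands.L_comm_L h]

theorem R_comm_L {i j : ℕ} (h : i + 2 ≤ j ∨ j + 2 ≤ i) : (R i * L j : Alg n) = L j * R i := by
  simp only [R, L, ← map_mul, Strands.R_comm_L h]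

theorem R_mul_R {j : ℕ} : (R (j + 1) * R j : Alg n) = 0 := by
  by_cases hj : j + 1 ∈ Finset.Icc 2 (2 * n)
  · simp only [R, ← map_mul]
    exact mk_eq_zero (Or.inl (Or.inr ⟨j + 1, hj, rfl⟩))
  · have : (Strands.R (j + 1) * Strands.R j : Strands n) = 0 := by
      ext1 S W
      rw [Strands.mul_apply]
      refine Finset.sum_eq_zero fun T _ => ?_
      have h1 : IsShift (j + 1) S T → ¬ IsShift j T W := fun h h' => hj <| Finset.mem_Icc.2
        ⟨by have := (T.mem_Icc h'.1).1; omega, (S.mem_Icc h.1).2⟩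
      by_cases h : IsShift (j + 1) S T <;> simp [Strands.R, Strands.ind, h, h1]
    simp only [R, ← map_mul, this, map_zero]

theorem L_mul_L {j : ℕ} : (L j * L (j + 1) : Alg n) = 0 := by
  by_cases hj : j + 1 ∈ Finset.Icc 2 (2 * n)
  · simp only [L, ← map_mul]
    exact mk_eq_zero (Or.inr ⟨j + 1, hj, rfl⟩)
  · have : (Strands.L j * Strands.L (j + 1) : Strands n) = 0 := by
      ext1 S W
      rw [Strands.mul_apply]
      refine Finset.sum_eq_zero fun T _ => ?_
      have h1 : IsShift j T S → ¬ IsShift (j + 1) W T := fun h h' => hj <| Finset.mem_Icc.2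
        ⟨by have := (T.mem_Icc h.1).1; omega, (W.mem_Icc h'.1).2⟩
      by_cases h : IsShift j T S <;> simp [Strands.L, Strands.ind, h, h1]
    simp only [L, ← map_mul, this, map_zero]

theorem R_mul_L_ι {j : ℕ} {S : Idem n} (h : j ∈ S.1) : R j * L j * ι S = u j * ι S := by
  have h1 := mk_eq_zero (n := n) (Or.inl (Or.inl (Or.inl
    ⟨j, Finset.mem_Icc.2 (S.mem_Icc h), rfl⟩)) : Strands.R j * Strands.L j -
      Strands.u j * Strands.ιAt j ∈ Strands.relators n)
  rw [map_sub, sub_eq_zero] at h1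
  simp only [R, L, ι, u, ← map_mul]
  rw [map_mul, h1, ← map_mul, mul_assoc, Strands.ιAt_mul_ι, if_pos h]

theorem L_mul_R_ι {j : ℕ} {S : Idem n} (h0 : 1 ≤ j) (h : j + 1 ∈ S.1) :
    L j * R j * ι S = u j * ι S := by
  have h1 := mk_eq_zero (n := n) (Or.inl (Or.inl (Or.inr
    ⟨j, Finset.mem_Icc.2 ⟨h0, by have := (S.mem_Icc h).2; omega⟩, rfl⟩)) :
      Strands.L j * Strands.R j - Strands.u j * Strands.ιAt (j + 1) ∈ Strands.relators n)
  rw [map_sub, sub_eq_zero] at h1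
  simp only [R, L, ι, u, ← map_mul]
  rw [map_mul, h1, ← map_mul, mul_assoc, Strands.ιAt_mul_ι, if_pos h]

/-- `u_j ι_S = 0` if `j ∈ S` and the strand in slot `j` cannot move to the right. -/
theorem u_mul_ι_zero {j : ℕ} {S : Idem n} (h : j ∈ S.1) (h' : ∀ T, ¬ IsShift j S T) :
    u j * ι S = 0 := by
  rw [← R_mul_L_ι h, mul_assoc, L_mul_ι_zero h', mul_zero]

end Alg

/-! ### Bimodules -/

/-- The enveloping algebra `𝒜ₙ ⊗ 𝒜ₙᵒᵖ`; its left modules are the `(𝒜ₙ, 𝒜ₙ)`-bimodules. -/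
def Env (n : ℕ) : Type := Alg n ⊗[ℚ] (Alg n)ᵐᵒᵖ

instance : Ring (Env n) := inferInstanceAs (Ring (Alg n ⊗[ℚ] (Alg n)ᵐᵒᵖ))

instance : Algebra ℚ (Env n) := inferInstanceAs (Algebra ℚ (Alg n ⊗[ℚ] (Alg n)ᵐᵒᵖ))

/-- The element `a ⊗ b` of the enveloping algebra, which acts by `x ↦ a x b`. -/
def Env.mk (a b : Alg n) : Env n := a ⊗ₜ[ℚ] op b

namespace Env

theorem mk_mul (a b c d : Alg n) : mk a b * mk c d = mk (a * c) (d * b) :=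
  Algebra.TensorProduct.tmul_mul_tmul a c (op b) (op d)

theorem mk_one : mk (1 : Alg n) 1 = 1 := rfl

theorem mk_add_left (a a' b : Alg n) : mk (a + a') b = mk a b + mk a' b :=
  TensorProduct.add_tmul a a' (op b)

theorem mk_add_right (a b b' : Alg n) : mk a (b + b') = mk a b + mk a b' :=
  TensorProduct.tmul_add a (op b) (op b')

theorem mk_zero_left (b : Alg n) : mk 0 b = 0 := TensorProduct.zero_tmul (Alg n) (op b)

theorem mk_zero_right (a : Alg n) : mk a 0 = 0 := TensorProduct.tmul_zero (Alg n)ᵐᵒᵖ a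

end Env

section bi

variable {M : Type*} [AddCommGroup M] [Module (Env n) M]

/-- `bi a b x` is the element `a x b` of a bimodule. -/
def bi (a b : Alg n) (x : M) : M := Env.mk a b • x

theorem bi_bi (a b c d : Alg n) (x : M) : bi a b (bi c d x) = bi (a * c) (d * b) x := by
  simp only [bi, smul_smul, Env.mk_mul]

@[simp] theorem bi_one (x : M) : bi (1 : Alg n) 1 x = x := by
  rw [bi, Env.mk_one, one_smul]

@[simp] theorem bi_zero_left (b : Alg n) (x : M) : bi 0 b x = 0 := by
  rw [bi, Env.mk_zero_left, zero_smul]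

@[simp] theorem bi_zero_right (a : Alg n) (x : M) : bi a 0 x = 0 := by
  rw [bi, Env.mk_zero_right, zero_smul]

@[simp] theorem bi_zero (a b : Alg n) : bi a b (0 : M) = 0 := smul_zero _

theorem bi_sub (a b : Alg n) (x y : M) : bi a b (x - y) = bi a b x - bi a b y := smul_sub _ _ _

theorem bi_add (a b : Alg n) (x y : M) : bi a b (x + y) = bi a b x + bi a b y := smul_add _ _ _

theorem bi_neg (a b : Alg n) (x : M) : bi a b (-x) = -bi a b x := smul_neg _ _

theorem bi_add_left (a a' b : Alg n) (x : M) : bi (a + a') b x = bi a b x + bi a' b x := by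
  simp only [bi, Env.mk_add_left, add_smul]

theorem bi_add_right (a b b' : Alg n) (x : M) : bi a (b + b') x = bi a b x + bi a b' x := by
  simp only [bi, Env.mk_add_right, add_smul]

theorem map_bi {N : Type*} [AddCommGroup N] [Module (Env n) N] (f : M →ₗ[Env n] N)
    (a b : Alg n) (x : M) : f (bi a b x) = bi a b (f x) := f.map_smul _ _

end bi

section presented

variable {Z : Type} (r : (Z →₀ Env n) → (Z →₀ Env n) → Prop)

/-- The bimodule with one generator for each element of `Z`, and with the relations
`r`. The free bimodule on `Z` is `Z →₀ 𝒜ₙ ⊗ 𝒜ₙᵒᵖ`. -/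
def Presented : Type :=
  (Z →₀ Env n) ⧸ Submodule.span (Env n) {w | ∃ w₁ w₂, r w₁ w₂ ∧ w = w₁ - w₂}

instance : AddCommGroup (Presented r) := inferInstanceAs (AddCommGroup (_ ⧸ _))

instance : Module (Env n) (Presented r) := inferInstanceAs (Module (Env n) (_ ⧸ _))

/-- The quotient map from the free bimodule. -/
def Presented.mk : (Z →₀ Env n) →ₗ[Env n] Presented r := Submodule.mkQ _

/-- A bimodule homomorphism out of a presented bimodule, from the images of the generators. -/
def Presented.lift {N : Type} [AddCommGroup N] [Module (Env n) N] (y : Z → N)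
    (h : ∀ w₁ w₂, r w₁ w₂ →
      Finsupp.linearCombination (Env n) y w₁ = Finsupp.linearCombination (Env n) y w₂) :
    Presented r →ₗ[Env n] N :=
  Submodule.liftQ _ (Finsupp.linearCombination (Env n) y) <| by
    rw [Submodule.span_le]
    rintro _ ⟨w₁, w₂, hr, rfl⟩
    rw [SetLike.mem_coe, LinearMap.mem_ker, map_sub, h _ _ hr, sub_self]

end presented

open Alg

/-- The element `a x_z b` of the free bimodule on `Z`. -/
def fterm {Z : Type} (a b : Alg n) (z : Z) : Z →₀ Env n := Finsupp.single z (Env.mk a b)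

theorem linearCombination_fterm {Z N : Type} [AddCommGroup N] [Module (Env n) N] (y : Z → N)
    (a b : Alg n) (z : Z) :
    Finsupp.linearCombination (Env n) y (fterm a b z) = bi a b (y z) := by
  rw [fterm, Finsupp.linearCombination_single, bi]

/-! ### The bimodule of the identity braid -/

/-- The relations of the bimodule of the identity braid on `2n` strands. Its cycles are the sets
of `n` of the `2n` vertical strands, so the generators are labelled by `Idem n`. -/
inductive IdRel : (Idem n →₀ Env n) → (Idem n →₀ Env n) → Prop
  | idem (S : Idem n) : IdRel (fterm (ι S) (ι S) S) (fterm 1 1 S)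
  | var (S : Idem n) (j : ℕ) : IdRel (fterm (u j) 1 S) (fterm 1 (u j) S)
  | left (j : ℕ) (S S' : Idem n) : IsShift j S S' →
      IdRel (fterm (L j) 1 S) (fterm 1 (L j) S')
  | right (j : ℕ) (S S' : Idem n) : IsShift j S S' →
      IdRel (fterm 1 (R j) S) (fterm (R j) 1 S')

variable (n) in
/-- The bimodule of the identity braid. -/
abbrev IdBimod : Type := Presented (IdRel (n := n))

/-- The generator `x_S` of the bimodule of the identity braid. -/
def idGen (S : Idem n) : IdBimod n := Presented.mk _ (fterm 1 1 S)

/-! ### The bimodule of an elementary singular braid -/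

variable (n) in
/-- The positions `i` of crossings between strands `i` and `i + 1` out of `2n`. -/
abbrev Pos : Type := {i : ℕ // 1 ≤ i ∧ i + 1 ≤ 2 * n}

/-- A cycle in the singular braid `X_i`, that is, `n` disjoint upward paths: at most one of them
passes through the vertex, and the others are vertical strands. A cycle is determined by the set
`b` of its bottom ends and the set `t` of its top ends. -/
structure XCycle (i : Pos n) where
  b : Idem n
  t : Idem n
  sdiff : b.1 \ {i.1, i.1 + 1} = t.1 \ {i.1, i.1 + 1}
  vertex : ¬ ({i.1, i.1 + 1} ⊆ b.1)

/-- The relations of the bimodule of `X_i`. -/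
inductive XRel (i : Pos n) : (XCycle i →₀ Env n) → (XCycle i →₀ Env n) → Prop
  | idem (Z : XCycle i) : XRel i (fterm (ι Z.b) (ι Z.t) Z) (fterm 1 1 Z)
  | var (Z : XCycle i) (j : ℕ) : j ≠ i → j ≠ i + 1 →
      XRel i (fterm (u j) 1 Z) (fterm 1 (u j) Z)
  | sum (Z : XCycle i) :
      XRel i (fterm (u i + u (i + 1)) 1 Z) (fterm 1 (u i + u (i + 1)) Z)
  | prod (Z : XCycle i) :
      XRel i (fterm (u i * u (i + 1)) 1 Z) (fterm 1 (u i * u (i + 1)) Z)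
  -- the disk between the strand `j` of the cycle and the path to the right of it
  | left (j : ℕ) (Z Z' : XCycle i) : j ≠ i → j ≠ i + 1 → IsShift j Z.b Z'.b → IsShift j Z.t Z'.t →
      XRel i (fterm (L j) 1 Z) (fterm 1 (L j) Z')
  | right (j : ℕ) (Z Z' : XCycle i) : j ≠ i → j ≠ i + 1 → IsShift j Z.b Z'.b → IsShift j Z.t Z'.t →
      XRel i (fterm 1 (R j) Z) (fterm (R j) 1 Z')
  -- the disks between the two incoming edges and between the two outgoing edges of the vertex
  | bottom (Z Z' : XCycle i) : IsShift i Z.b Z'.b → Z.t = Z'.t →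
      XRel i (fterm (L i) 1 Z) (fterm 1 1 Z')
  | top (Z Z' : XCycle i) : Z.b = Z'.b → IsShift i Z.t Z'.t →
      XRel i (fterm 1 (R i) Z) (fterm 1 1 Z')
  -- the disks between a path through the vertex and the strand `i + 2`; `Z₀` misses the vertex
  -- and contains the strand `i + 2`
  | corner₁ (Z Z₀ : XCycle i) : i.1 ∈ Z.b.1 → IsShift (i + 1) Z.t Z₀.t → i.1 ∉ Z₀.b.1 →
      i.1 + 1 ∉ Z₀.b.1 → XRel i (fterm 1 (R (i + 1)) Z) (fterm (R i * R (i + 1)) 1 Z₀)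
  | corner₂ (Z Z₀ : XCycle i) : IsShift (i + 1) Z.b Z₀.b → i.1 ∈ Z.t.1 → i.1 ∉ Z₀.b.1 →
      i.1 + 1 ∉ Z₀.b.1 → XRel i (fterm (L (i + 1)) 1 Z) (fterm 1 (L (i + 1) * L i) Z₀)
  | corner₃ (Z Z₀ : XCycle i) : IsShift (i + 1) Z.b Z₀.b → IsShift (i + 1) Z.t Z₀.t →
      XRel i (fterm (L (i + 1)) 1 Z) (fterm 1 (u i * L (i + 1)) Z₀)
  | corner₄ (Z Z₀ : XCycle i) : IsShift (i + 1) Z.b Z₀.b → IsShift (i + 1) Z.t Z₀.t →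
      XRel i (fterm 1 (R (i + 1)) Z) (fterm (R (i + 1) * u i) 1 Z₀)

/-- The bimodule of the elementary singular braid `X_i`. -/
abbrev XBimod (i : Pos n) : Type := Presented (XRel i)

/-- The generator `x_Z` of the bimodule of `X_i`. -/
def xGen {i : Pos n} (Z : XCycle i) : XBimod i := Presented.mk _ (fterm 1 1 Z)

theorem Presented.mk_fterm {Z : Type} {r : (Z →₀ Env n) → (Z →₀ Env n) → Prop} (a b : Alg n)
    (z : Z) : Presented.mk r (fterm a b z) = bi a b (Presented.mk r (fterm 1 1 z)) := by
  rw [← map_bi]; congr 1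
  rw [bi, fterm, fterm, Finsupp.smul_single, smul_eq_mul, Env.mk_mul, mul_one, one_mul]

theorem Presented.mk_eq {Z : Type} {r : (Z →₀ Env n) → (Z →₀ Env n) → Prop} {w₁ w₂ : Z →₀ Env n}
    (h : r w₁ w₂) : Presented.mk r w₁ = Presented.mk r w₂ := by
  rw [← sub_eq_zero, ← map_sub]
  exact (Submodule.Quotient.mk_eq_zero _).2 (Submodule.subset_span ⟨w₁, w₂, h, rfl⟩)

theorem idGen_rel {a b c d : Alg n} {S T : Idem n} (h : IdRel (fterm a b S) (fterm c d T)) :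
    bi a b (idGen S) = bi c d (idGen T) := by
  rw [idGen, idGen, ← Presented.mk_fterm, ← Presented.mk_fterm]; exact Presented.mk_eq h

theorem xGen_rel {i : Pos n} {a b c d : Alg n} {Z Z' : XCycle i}
    (h : XRel i (fterm a b Z) (fterm c d Z')) : bi a b (xGen Z) = bi c d (xGen Z') := by
  rw [xGen, xGen, ← Presented.mk_fterm, ← Presented.mk_fterm]; exact Presented.mk_eq h

section relations

variable {M : Type*} [AddCommGroup M] [Module (Env n) M]

/-- A relation `a x b = c y d` may be multiplied from both sides. -/
theorem bi_mul {a b c d : Alg n} {x y : M} (h : bi a b x = bi c d y) (e f : Alg n) :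
    bi (e * a) (b * f) x = bi (e * c) (d * f) y := by
  rw [← bi_bi, h, bi_bi]

end relations

namespace XCycle

variable {i : Pos n} (Z : XCycle i)

theorem mem_iff {x : ℕ} (h : x ≠ i) (h' : x ≠ i + 1) : x ∈ Z.b.1 ↔ x ∈ Z.t.1 := by
  have := congrArg (x ∈ ·) Z.sdiff
  simpa [h, h'] using this

theorem not_both (h : i.1 ∈ Z.b.1) : i.1 + 1 ∉ Z.b.1 := fun h' => Z.vertex <| by
  intro x hx
  rcases Finset.mem_insert.1 hx with rfl | hx
  · exact h
  · rw [Finset.mem_singleton.1 hx]; exact h'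

theorem card_inter (Z : XCycle i) :
    (Z.b.1 ∩ {i.1, i.1 + 1}).card = (Z.t.1 ∩ {i.1, i.1 + 1}).card := by
  have h1 := Finset.card_sdiff_add_card_inter Z.b.1 {i.1, i.1 + 1}
  have h2 := Finset.card_sdiff_add_card_inter Z.t.1 {i.1, i.1 + 1}
  rw [Z.sdiff, Z.b.card] at h1
  rw [Z.t.card] at h2
  omega

theorem inter_pair (S : Finset ℕ) (j : ℕ) : (S ∩ {j, j + 1}).card =
    (if j ∈ S then 1 else 0) + (if j + 1 ∈ S then 1 else 0) := by
  by_cases h1 : j ∈ S <;> by_cases h2 : j + 1 ∈ S <;>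
    simp [h1, h2, Finset.inter_insert_of_mem, Finset.inter_insert_of_notMem,
      Finset.inter_singleton_of_mem, Finset.inter_singleton_of_notMem]

/-- The five types of cycles: empty at the vertex, or passing through it on one of four paths. -/
theorem cases : (i.1 ∉ Z.b.1 ∧ i.1 + 1 ∉ Z.b.1 ∧ Z.t = Z.b) ∨
    (i.1 ∈ Z.b.1 ∧ i.1 + 1 ∉ Z.b.1 ∧ Z.t = Z.b) ∨
    (i.1 ∉ Z.b.1 ∧ i.1 + 1 ∈ Z.b.1 ∧ Z.t = Z.b) ∨
    IsShift i Z.b Z.t ∨ IsShift i Z.t Z.b := by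
  have h := Z.card_inter
  rw [inter_pair, inter_pair] at h
  have nb := Z.not_both
  have key : (i.1 ∈ Z.b.1 ↔ i.1 ∈ Z.t.1) → (i.1 + 1 ∈ Z.b.1 ↔ i.1 + 1 ∈ Z.t.1) → Z.t = Z.b := by
    intro h1 h2
    refine Idem.ext fun x => ?_
    by_cases e1 : x = i
    · rw [e1, h1]
    · by_cases e2 : x = i + 1
      · rw [e2, h2]
      · rw [Z.mem_iff e1 e2]
  have key2 : i.1 ∈ Z.b.1 → i.1 + 1 ∉ Z.b.1 → i.1 ∉ Z.t.1 → i.1 + 1 ∈ Z.t.1 →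
      IsShift i Z.b Z.t := by
    intro h1 h2 h3 h4
    refine isShift_iff.2 ⟨h1, h2, fun x => ?_⟩
    by_cases e1 : x = i
    · simp [e1, h3]
    · by_cases e2 : x = i + 1
      · simp [e2, h4]
      · simp [← Z.mem_iff e1 e2, e1, e2]
  have key3 : i.1 ∈ Z.t.1 → i.1 + 1 ∉ Z.t.1 → i.1 ∉ Z.b.1 → i.1 + 1 ∈ Z.b.1 →
      IsShift i Z.t Z.b := by
    intro h1 h2 h3 h4
    refine isShift_iff.2 ⟨h1, h2, fun x => ?_⟩
    by_cases e1 : x = i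
    · simp [e1, h3]
    · by_cases e2 : x = i + 1
      · simp [e2, h4]
      · simp [Z.mem_iff e1 e2, e1, e2]
  by_cases h1 : i.1 ∈ Z.b.1 <;> by_cases h2 : i.1 + 1 ∈ Z.b.1 <;> by_cases h3 : i.1 ∈ Z.t.1 <;>
    by_cases h4 : i.1 + 1 ∈ Z.t.1 <;> simp [h1, h2, h3, h4] at h nb key key2 key3 ⊢ <;>
    tauto

end XCycle

theorem id_left {j : ℕ} {S S' : Idem n} (h : IsShift j S S') (a b : Alg n) :
    bi (a * L j) b (idGen S) = bi a (L j * b) (idGen S') := by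
  simpa using bi_mul (idGen_rel (IdRel.left j S S' h)) a b

theorem id_right {j : ℕ} {S S' : Idem n} (h : IsShift j S S') (a b : Alg n) :
    bi a (R j * b) (idGen S) = bi (a * R j) b (idGen S') := by
  simpa using bi_mul (idGen_rel (IdRel.right j S S' h)) a b

theorem id_var (j : ℕ) (S : Idem n) (a b : Alg n) :
    bi (a * u j) b (idGen S) = bi a (u j * b) (idGen S) := by
  simpa using bi_mul (idGen_rel (IdRel.var S j)) a b

theorem id_idem (S : Idem n) (a b : Alg n) :
    bi (a * ι S) (ι S * b) (idGen S) = bi a b (idGen S) := by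
  simpa using bi_mul (idGen_rel (IdRel.idem S)) a b

theorem id_idem_left (S : Idem n) (a b : Alg n) :
    bi (a * ι S) b (idGen S) = bi a b (idGen S) := by
  rw [← id_idem, mul_assoc, ι_mul_ι, id_idem]

theorem id_idem_right (S : Idem n) (a b : Alg n) :
    bi a (ι S * b) (idGen S) = bi a b (idGen S) := by
  rw [← id_idem, ← mul_assoc, ι_mul_ι, id_idem]

/-- The images of the generators under `d⁻`. -/
def dMinusGen (i : Pos n) (Z : XCycle i) : IdBimod n :=
  if i.1 + 1 ∈ Z.b.1 then
    if i.1 + 1 ∈ Z.t.1 then bi (u (n := n) i) 1 (idGen Z.b) else bi 1 (L (n := n) i) (idGen Z.b)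
  else
    if i.1 + 1 ∈ Z.t.1 then bi (R (n := n) i) 1 (idGen Z.t) else idGen Z.b

theorem XCycle.eq_of_notMem {i : Pos n} (Z : XCycle i) (h1 : i.1 + 1 ∉ Z.b.1)
    (h2 : i.1 + 1 ∉ Z.t.1) : Z.t = Z.b := by
  rcases Z.cases with h | h | h | h | h
  · exact h.2.2
  · exact h.2.2
  · exact h.2.2
  · exact absurd ((h.mem _).2 (Or.inl rfl)) h2
  · exact absurd ((h.mem _).2 (Or.inl rfl)) h1

theorem XCycle.eq_of_mem {i : Pos n} (Z : XCycle i) (h1 : i.1 + 1 ∈ Z.b.1)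
    (h2 : i.1 + 1 ∈ Z.t.1) : Z.t = Z.b := by
  rcases Z.cases with h | h | h | h | h
  · exact h.2.2
  · exact h.2.2
  · exact h.2.2
  · exact absurd h1 h.2.1
  · exact absurd h2 h.2.1

theorem XCycle.shift {i : Pos n} (Z : XCycle i) (h1 : i.1 + 1 ∉ Z.b.1)
    (h2 : i.1 + 1 ∈ Z.t.1) : IsShift i Z.b Z.t := by
  rcases Z.cases with h | h | h | h | h
  · exact absurd (h.2.2 ▸ h2) h1
  · exact absurd (h.2.2 ▸ h2) h1
  · exact absurd (h.2.2 ▸ h2) h1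
  · exact h
  · exact absurd h2 h.2.1

theorem XCycle.shift' {i : Pos n} (Z : XCycle i) (h1 : i.1 + 1 ∈ Z.b.1)
    (h2 : i.1 + 1 ∉ Z.t.1) : IsShift i Z.t Z.b := by
  rcases Z.cases with h | h | h | h | h
  · exact absurd h1 (h.2.2 ▸ h2)
  · exact absurd h1 (h.2.2 ▸ h2)
  · exact absurd h1 (h.2.2 ▸ h2)
  · exact absurd h1 h.2.1
  · exact h

theorem IsShift.mem_iff {j x : ℕ} {S T : Idem n} (h : IsShift j S T) (h1 : x ≠ j)
    (h2 : x ≠ j + 1) : x ∈ T.1 ↔ x ∈ S.1 := by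
  rw [h.mem]; tauto

/-- If `c` is central and commutes with all `x_S`, then it commutes with `d⁻(x_Z)`. -/
theorem dMinusGen_central {i : Pos n} (Z : XCycle i) {c : Alg n} (hc : ∀ x, c * x = x * c)
    (h : ∀ S : Idem n, ∀ a b, bi (a * c) b (idGen S) = bi a (c * b) (idGen S)) :
    bi c 1 (dMinusGen i Z) = bi 1 c (dMinusGen i Z) := by
  have h' : ∀ (S : Idem n) (a b : Alg n), bi (c * a) b (idGen S) = bi a (b * c) (idGen S) := by
    intro S a b; rw [hc, h, hc]
  unfold dMinusGen
  split_ifs <;> try simp only [bi_bi, mul_one, one_mul]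
  · rw [h', one_mul]
  · rw [← mul_one c, h', mul_one]
  · rw [h', one_mul]
  · rw [← mul_one c, h', one_mul, mul_one]

set_option maxHeartbeats 400000 in
theorem dMinusGen_rel (i : Pos n) (w₁ w₂ : XCycle i →₀ Env n) (h : XRel i w₁ w₂) :
    Finsupp.linearCombination (Env n) (dMinusGen i) w₁ =
      Finsupp.linearCombination (Env n) (dMinusGen i) w₂ := by
  have far : ∀ {j : ℕ}, j ≠ i → j ≠ i + 1 → j + 1 ≠ i → i.1 + 2 ≤ j ∨ j + 2 ≤ i := by omega
  rcases h with Z | ⟨Z, j, h1, h2⟩ | Z | Z | ⟨j, Z, Z', h1, h2, hb, ht⟩ |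
    ⟨j, Z, Z', h1, h2, hb, ht⟩ | ⟨Z, Z', hb, ht⟩ | ⟨Z, Z', hb, ht⟩ | ⟨Z, Z', hb, ht, h1, h2⟩ |
    ⟨Z, Z', hb, ht, h1, h2⟩ | ⟨Z, Z', hb, ht⟩ | ⟨Z, Z', hb, ht⟩ <;>
    simp only [linearCombination_fterm]
  · -- idem
    unfold dMinusGen
    split_ifs with h1 h2 h2
    · rw [Z.eq_of_mem h1 h2, bi_bi, ← u_comm]
      simpa using id_idem Z.b (u i) 1
    · have := Z.shift' h1 h2
      rw [bi_bi, L_mul_ι this, mul_one, bi_one]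
      simpa using id_idem Z.b 1 (L i)
    · have := Z.shift h1 h2
      rw [bi_bi, ι_mul_R this, one_mul, bi_one]
      simpa using id_idem Z.t (R i) 1
    · rw [Z.eq_of_notMem h1 h2]
      simpa using id_idem Z.b 1 1
  · -- var
    exact dMinusGen_central Z (u_comm j) (id_var j)
  · -- sum
    refine dMinusGen_central Z (fun x => ?_) fun S a b => ?_
    · rw [add_mul, mul_add, u_comm, u_comm (i + 1)]
    · rw [mul_add, add_mul, bi_add_left, bi_add_right, id_var, id_var]
  · -- prod
    refine dMinusGen_central Z (fun x => ?_) fun S a b => ?_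
    · rw [mul_assoc, u_comm (i + 1), ← mul_assoc, u_comm i, mul_assoc]
    · rw [← mul_assoc, id_var, id_var, ← mul_assoc]
  · -- left
    have eb := hb.mem_iff (x := i + 1) (by omega) (by omega)
    have et := ht.mem_iff (x := i + 1) (by omega) (by omega)
    unfold dMinusGen
    simp only [eb, et]
    split_ifs with e1 e2 e2
    · rw [bi_bi, bi_bi, ← u_comm i (L j)]
      simpa using id_left hb (u i) 1
    · have hs := Z.shift' e1 e2
      have : j + 1 ≠ i := fun e => ht.2.1 (e ▸ hs.1)
      rw [bi_bi, bi_bi, L_comm_L (far h1 h2 this)]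
      simpa using id_left hb 1 (L i)
    · have hs := Z.shift e1 e2
      have : j + 1 ≠ i := fun e => hb.2.1 (e ▸ hs.1)
      rw [bi_bi, bi_bi, ← R_comm_L (far h1 h2 this)]
      simpa using id_left ht (R i) 1
    · simpa using id_left hb 1 1
  · -- right
    have eb := hb.mem_iff (x := i + 1) (by omega) (by omega)
    have et := ht.mem_iff (x := i + 1) (by omega) (by omega)
    unfold dMinusGen
    simp only [eb, et]
    split_ifs with e1 e2 e2
    · rw [bi_bi, bi_bi, ← u_comm i (R j)]
      simpa using id_right hb (u i) 1
    · have hs := Z.shift' e1 e2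
      have : j + 1 ≠ i := fun e => ht.2.1 (e ▸ hs.1)
      rw [bi_bi, bi_bi, ← R_comm_L (far h1 h2 this).symm]
      simpa using id_right hb 1 (L i)
    · have hs := Z.shift e1 e2
      have : j + 1 ≠ i := fun e => hb.2.1 (e ▸ hs.1)
      rw [bi_bi, bi_bi, R_comm_R (far h1 h2 this).symm]
      simpa using id_right ht (R i) 1
    · simpa using id_right hb 1 1
  · -- bottom
    have e1 : i.1 + 1 ∉ Z.b.1 := hb.2.1
    have e2 : i.1 + 1 ∈ Z'.b.1 := (hb.mem _).2 (Or.inl rfl)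
    simp only [dMinusGen, e1, e2, ht, if_true, if_false, bi_one]
    split_ifs with e3
    · rw [bi_bi, Z'.eq_of_mem e2 e3, ← id_idem_left, L_mul_R_ι i.2.1 e2, id_idem_left, mul_one]
    · simpa using id_left hb 1 1
  · -- top
    have e1 : i.1 + 1 ∉ Z.t.1 := ht.2.1
    have e2 : i.1 + 1 ∈ Z'.t.1 := (ht.mem _).2 (Or.inl rfl)
    simp only [dMinusGen, e1, e2, ← hb, if_true, if_false, bi_one]
    split_ifs with e3
    · have hs := Z.shift' e3 e1
      have h1 := id_left hs 1 (R i)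
      have h2 := id_right hs (L i) 1
      rw [mul_one] at h2
      rw [one_mul, h2, ← id_idem_left, L_mul_R_ι i.2.1 e3, id_idem_left] at h1
      rw [bi_bi, one_mul, ← h1]
    · rw [← Z.eq_of_notMem e3 e1]
      simpa using id_right ht 1 1
  · -- corner₁
    have e1 := Z.not_both hb
    have e2 : i.1 + 1 ∈ Z.t.1 := ht.1
    have e3 : i.1 + 1 ∉ Z'.t.1 := fun e => by have := (ht.mem _).1 e; omega
    simp only [dMinusGen, e1, e2, h2, e3, if_true, if_false]
    rw [bi_bi, ← Z'.eq_of_notMem h2 e3]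
    simpa using id_right ht (R i) 1
  · -- corner₂
    have e1 : i.1 + 1 ∈ Z.b.1 := hb.1
    have e2 : i.1 + 1 ∉ Z.t.1 := fun e => by
      have := Z.eq_of_mem e1 e
      exact Z.not_both (this ▸ ht) e1
    have e3 : i.1 + 1 ∉ Z'.t.1 := fun e => h1 (Z'.shift h2 e).1
    simp only [dMinusGen, e1, e2, h2, e3, if_true, if_false]
    rw [bi_bi]
    simpa using id_left hb 1 (L i)
  · -- corner₃
    have e1 : i.1 + 1 ∈ Z.b.1 := hb.1
    have e2 : i.1 + 1 ∈ Z.t.1 := ht.1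
    have e3 : i.1 + 1 ∉ Z'.b.1 := fun e => by have := (hb.mem _).1 e; omega
    have e4 : i.1 + 1 ∉ Z'.t.1 := fun e => by have := (ht.mem _).1 e; omega
    simp only [dMinusGen, e1, e2, e3, e4, if_true, if_false]
    rw [bi_bi, ← u_comm]
    have := id_left hb (u i) 1
    have h2 := id_var i Z'.b 1 (L (i + 1))
    simp only [one_mul, mul_one] at this h2 ⊢
    rw [this, h2]
  · -- corner₄
    have e1 : i.1 + 1 ∈ Z.b.1 := hb.1
    have e2 : i.1 + 1 ∈ Z.t.1 := ht.1
    have e3 : i.1 + 1 ∉ Z'.b.1 := fun e => by have := (hb.mem _).1 e; omega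
    have e4 : i.1 + 1 ∉ Z'.t.1 := fun e => by have := (ht.mem _).1 e; omega
    simp only [dMinusGen, e1, e2, e3, e4, if_true, if_false]
    rw [bi_bi, ← u_comm i (R (i + 1))]
    simpa using id_right hb (u i) 1

/-- The homomorphism `d⁻` from the bimodule of `X_i` to the bimodule of the identity braid. -/
def dMinus (i : Pos n) : XBimod i →ₗ[Env n] IdBimod n :=
  Presented.lift _ (dMinusGen i) (dMinusGen_rel i)

/-! ### The homomorphism `d⁺` -/

theorem Alg.ι_mul_R_mul_L {j : ℕ} {S : Idem n} (h : j ∈ S.1) : ι S * (R j * L j) = u j * ι S := by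
  by_cases hT : ∃ T, IsShift j S T
  · obtain ⟨T, hT⟩ := hT
    rw [← mul_assoc, ι_mul_R hT, mul_assoc, ← L_mul_ι hT, ← mul_assoc, R_mul_L_ι h]
  · rw [not_exists] at hT
    rw [← mul_assoc, ι_mul_R_zero hT, zero_mul, u_mul_ι_zero h hT]

theorem Alg.ι_mul_L_mul_R {j : ℕ} {S : Idem n} (h0 : 1 ≤ j) (h : j + 1 ∈ S.1) :
    ι S * (L j * R j) = u j * ι S := by
  by_cases hT : ∃ T, IsShift j T S
  · obtain ⟨T, hT⟩ := hT
    rw [← mul_assoc, ← L_mul_ι hT, mul_assoc, ι_mul_R hT, ← mul_assoc, L_mul_R_ι h0 h]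
  · rw [not_exists] at hT
    rw [← mul_assoc, ι_mul_L_zero hT, zero_mul, ← L_mul_R_ι h0 h, mul_assoc, R_mul_ι_zero hT,
      mul_zero]

section dPlus

variable {i : Pos n}

/-- The cycle of `X_i` with bottom and top ends `S`. -/
def diag (S : Idem n) (h : ¬ ({i.1, i.1 + 1} ⊆ S.1)) : XCycle i := ⟨S, S, rfl, h⟩

variable (i) in
/-- The generator of the bimodule of `X_i` for the cycle with bottom and top ends `S`, and zero if
there is no such cycle, that is, if `S` contains both `i` and `i + 1`. -/
def xDiag (S : Idem n) : XBimod i :=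
  if h : ¬ ({i.1, i.1 + 1} ⊆ S.1) then xGen (diag S h) else 0

theorem pair_subset {S : Idem n} : {i.1, i.1 + 1} ⊆ S.1 ↔ i.1 ∈ S.1 ∧ i.1 + 1 ∈ S.1 := by
  simp [Finset.insert_subset_iff]

theorem xDiag_eq {S : Idem n} (h : ¬ ({i.1, i.1 + 1} ⊆ S.1)) : xDiag i S = xGen (diag S h) :=
  dif_pos h

theorem xDiag_zero {S : Idem n} (h : i.1 ∈ S.1) (h' : i.1 + 1 ∈ S.1) : xDiag i S = 0 :=
  dif_neg (not_not.2 (pair_subset.2 ⟨h, h'⟩))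

theorem xDiag_idem (S : Idem n) (a b : Alg n) :
    bi (a * ι S) (ι S * b) (xDiag i S) = bi a b (xDiag i S) := by
  by_cases h : {i.1, i.1 + 1} ⊆ S.1
  · rw [xDiag_zero (pair_subset.1 h).1 (pair_subset.1 h).2, bi_zero, bi_zero]
  · rw [xDiag_eq h]
    simpa [diag] using bi_mul (xGen_rel (XRel.idem (diag S h))) a b

theorem xDiag_idem_left (S : Idem n) (a b : Alg n) :
    bi (a * ι S) b (xDiag i S) = bi a b (xDiag i S) := by
  rw [← xDiag_idem, mul_assoc, ι_mul_ι, xDiag_idem]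

theorem xDiag_idem_right (S : Idem n) (a b : Alg n) :
    bi a (ι S * b) (xDiag i S) = bi a b (xDiag i S) := by
  rw [← xDiag_idem, ← mul_assoc, ι_mul_ι, xDiag_idem]

theorem xDiag_var {j : ℕ} (h1 : j ≠ i) (h2 : j ≠ i + 1) (S : Idem n) (a b : Alg n) :
    bi (a * u j) b (xDiag i S) = bi a (u j * b) (xDiag i S) := by
  by_cases h : {i.1, i.1 + 1} ⊆ S.1
  · rw [xDiag_zero (pair_subset.1 h).1 (pair_subset.1 h).2, bi_zero, bi_zero]
  · rw [xDiag_eq h]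
    simpa using bi_mul (xGen_rel (XRel.var (diag S h) j h1 h2)) a b

theorem xDiag_sum (S : Idem n) (a b : Alg n) :
    bi (a * u i) b (xDiag i S) + bi (a * u (i + 1)) b (xDiag i S) =
      bi a (u i * b) (xDiag i S) + bi a (u (i + 1) * b) (xDiag i S) := by
  by_cases h : {i.1, i.1 + 1} ⊆ S.1
  · simp only [xDiag_zero (pair_subset.1 h).1 (pair_subset.1 h).2, bi_zero]
  · rw [xDiag_eq h, ← bi_add_left, ← bi_add_right, ← mul_add, ← add_mul]
    simpa using bi_mul (xGen_rel (XRel.sum (diag S h))) a b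

theorem xDiag_prod (S : Idem n) (a b : Alg n) :
    bi (a * (u i * u (i + 1))) b (xDiag i S) = bi a (u i * u (i + 1) * b) (xDiag i S) := by
  by_cases h : {i.1, i.1 + 1} ⊆ S.1
  · simp only [xDiag_zero (pair_subset.1 h).1 (pair_subset.1 h).2, bi_zero]
  · rw [xDiag_eq h]
    simpa using bi_mul (xGen_rel (XRel.prod (diag S h))) a b

/-- `L_i x_S R_i = x_{S'}`. -/
theorem xDiag_shift {S S' : Idem n} (h : IsShift i S S') (a b : Alg n) :
    bi (a * L i) (R i * b) (xDiag i S) = bi a b (xDiag i S') := by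
  have h1 : ¬ ({i.1, i.1 + 1} ⊆ S.1) := fun e => h.2.1 (pair_subset.1 e).2
  have h2 : ¬ ({i.1, i.1 + 1} ⊆ S'.1) := fun e => by
    have := (h.mem _).1 (pair_subset.1 e).1; omega
  have e : S.1 \ {i.1, i.1 + 1} = S'.1 \ {i.1, i.1 + 1} := by
    ext x; simp only [Finset.mem_sdiff, h.mem, Finset.mem_insert, Finset.mem_singleton]; tauto
  rw [xDiag_eq h1, xDiag_eq h2]
  have r1 := bi_mul (xGen_rel (XRel.top (diag S h1) ⟨S, S', e, h1⟩ rfl h)) (a * L i) b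
  have r2 := bi_mul (xGen_rel (XRel.bottom ⟨S, S', e, h1⟩ (diag S' h2) h rfl)) a b
  simp only [mul_one, one_mul] at r1 r2
  rw [r1, r2]

theorem xDiag_left {j : ℕ} (h1 : j ≠ i) (h2 : j ≠ i + 1) {S S' : Idem n} (h : IsShift j S S')
    (a b : Alg n) : bi (a * L j) b (xDiag i S) = bi a (L j * b) (xDiag i S') := by
  have m : i.1 + 1 ∈ S'.1 ↔ i.1 + 1 ∈ S.1 := h.mem_iff (by omega) (by omega)
  by_cases h3 : i.1 + 1 ∈ S.1
  · by_cases h4 : i.1 ∈ S.1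
    · rw [xDiag_zero h4 h3, xDiag_zero ((h.mem _).2 (Or.inr ⟨by omega, h4⟩)) (m.2 h3)]
      simp only [bi_zero]
    · by_cases h5 : i.1 ∈ S'.1
      · have e : i.1 = j + 1 := ((h.mem _).1 h5).resolve_right fun e => h4 e.2
        obtain ⟨W, hW⟩ := exists_shift' h3 h4 i.2.1
        rw [xDiag_zero h5 (m.2 h3), bi_zero, ← xDiag_shift hW, mul_assoc, e, L_mul_L, mul_zero,
          bi_zero_left]
      · have c : ¬ ({i.1, i.1 + 1} ⊆ S.1) := fun e => h4 (pair_subset.1 e).1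
        have c' : ¬ ({i.1, i.1 + 1} ⊆ S'.1) := fun e => h5 (pair_subset.1 e).1
        rw [xDiag_eq c, xDiag_eq c']
        simpa using bi_mul (xGen_rel (XRel.left j (diag S c) (diag S' c') h1 h2 h h)) a b
  · have c : ¬ ({i.1, i.1 + 1} ⊆ S.1) := fun e => h3 (pair_subset.1 e).2
    have c' : ¬ ({i.1, i.1 + 1} ⊆ S'.1) := fun e => h3 (m.1 (pair_subset.1 e).2)
    rw [xDiag_eq c, xDiag_eq c']
    simpa using bi_mul (xGen_rel (XRel.left j (diag S c) (diag S' c') h1 h2 h h)) a b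

theorem xDiag_right {j : ℕ} (h1 : j ≠ i) (h2 : j ≠ i + 1) {S S' : Idem n} (h : IsShift j S S')
    (a b : Alg n) : bi a (R j * b) (xDiag i S) = bi (a * R j) b (xDiag i S') := by
  have m : i.1 + 1 ∈ S'.1 ↔ i.1 + 1 ∈ S.1 := h.mem_iff (by omega) (by omega)
  by_cases h3 : i.1 + 1 ∈ S.1
  · by_cases h4 : i.1 ∈ S.1
    · rw [xDiag_zero h4 h3, xDiag_zero ((h.mem _).2 (Or.inr ⟨by omega, h4⟩)) (m.2 h3)]
      simp only [bi_zero]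
    · by_cases h5 : i.1 ∈ S'.1
      · have e : i.1 = j + 1 := ((h.mem _).1 h5).resolve_right fun e => h4 e.2
        obtain ⟨W, hW⟩ := exists_shift' h3 h4 i.2.1
        rw [xDiag_zero h5 (m.2 h3), bi_zero, ← xDiag_shift hW, ← mul_assoc, e, R_mul_R, zero_mul,
          bi_zero_right]
      · have c : ¬ ({i.1, i.1 + 1} ⊆ S.1) := fun e => h4 (pair_subset.1 e).1
        have c' : ¬ ({i.1, i.1 + 1} ⊆ S'.1) := fun e => h5 (pair_subset.1 e).1
        rw [xDiag_eq c, xDiag_eq c']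
        simpa using bi_mul (xGen_rel (XRel.right j (diag S c) (diag S' c') h1 h2 h h)) a b
  · have c : ¬ ({i.1, i.1 + 1} ⊆ S.1) := fun e => h3 (pair_subset.1 e).2
    have c' : ¬ ({i.1, i.1 + 1} ⊆ S'.1) := fun e => h3 (m.1 (pair_subset.1 e).2)
    rw [xDiag_eq c, xDiag_eq c']
    simpa using bi_mul (xGen_rel (XRel.right j (diag S c) (diag S' c') h1 h2 h h)) a b

theorem xDiag_corner₃ {S S' : Idem n} (h : IsShift (i + 1) S S') (h0 : i.1 ∉ S.1) (a b : Alg n) :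
    bi (a * L (i + 1)) b (xDiag i S) = bi a (u i * L (i + 1) * b) (xDiag i S') := by
  have c : ¬ ({i.1, i.1 + 1} ⊆ S.1) := fun e => h0 (pair_subset.1 e).1
  have c' : ¬ ({i.1, i.1 + 1} ⊆ S'.1) := fun e => by
    have := (h.mem _).1 (pair_subset.1 e).2; omega
  rw [xDiag_eq c, xDiag_eq c']
  simpa using bi_mul (xGen_rel (XRel.corner₃ (diag S c) (diag S' c') h h)) a b

theorem xDiag_corner₄ {S S' : Idem n} (h : IsShift (i + 1) S S') (h0 : i.1 ∉ S.1) (a b : Alg n) :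
    bi a (R (i + 1) * b) (xDiag i S) = bi (a * (R (i + 1) * u i)) b (xDiag i S') := by
  have c : ¬ ({i.1, i.1 + 1} ⊆ S.1) := fun e => h0 (pair_subset.1 e).1
  have c' : ¬ ({i.1, i.1 + 1} ⊆ S'.1) := fun e => by
    have := (h.mem _).1 (pair_subset.1 e).2; omega
  rw [xDiag_eq c, xDiag_eq c']
  simpa using bi_mul (xGen_rel (XRel.corner₄ (diag S c) (diag S' c') h h)) a b

theorem xDiag_corner₁ {S S' T : Idem n} (h : IsShift i S S') (h' : IsShift (i + 1) S' T)
    (a b : Alg n) : bi a (R i * R (i + 1) * b) (xDiag i S) =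
      bi (a * (R i * R (i + 1))) b (xDiag i T) := by
  have h1 : ¬ ({i.1, i.1 + 1} ⊆ S.1) := fun e => h.2.1 (pair_subset.1 e).2
  have m0 : i.1 ∉ T.1 := fun e => by
    rcases (h'.mem _).1 e with e | e
    · omega
    · exact (isShift_iff'.1 h).2.1 e.2
  have m1 : i.1 + 1 ∉ T.1 := fun e => by have := (h'.mem _).1 e; omega
  have h2 : ¬ ({i.1, i.1 + 1} ⊆ T.1) := fun e => m0 (pair_subset.1 e).1
  have e : S.1 \ {i.1, i.1 + 1} = S'.1 \ {i.1, i.1 + 1} := by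
    ext x; simp only [Finset.mem_sdiff, h.mem, Finset.mem_insert, Finset.mem_singleton]; tauto
  rw [xDiag_eq h1, xDiag_eq h2]
  have r1 := bi_mul (xGen_rel (XRel.top (diag S h1) ⟨S, S', e, h1⟩ rfl h)) a (R (i + 1) * b)
  have r2 := bi_mul (xGen_rel (XRel.corner₁ ⟨S, S', e, h1⟩ (diag T h2) h.1 h' m0 m1)) a b
  simp only [mul_one, one_mul] at r1 r2
  rw [mul_assoc, r1, r2]

theorem xDiag_corner₂ {S S' T : Idem n} (h : IsShift i S S') (h' : IsShift (i + 1) S' T)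
    (a b : Alg n) : bi (a * (L (i + 1) * L i)) b (xDiag i S) =
      bi a (L (i + 1) * L i * b) (xDiag i T) := by
  have h1 : ¬ ({i.1, i.1 + 1} ⊆ S.1) := fun e => h.2.1 (pair_subset.1 e).2
  have m0 : i.1 ∉ T.1 := fun e => by
    rcases (h'.mem _).1 e with e | e
    · omega
    · exact (isShift_iff'.1 h).2.1 e.2
  have m1 : i.1 + 1 ∉ T.1 := fun e => by have := (h'.mem _).1 e; omega
  have h2 : ¬ ({i.1, i.1 + 1} ⊆ T.1) := fun e => m0 (pair_subset.1 e).1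
  have h3 : ¬ ({i.1, i.1 + 1} ⊆ S'.1) := fun e => by
    have := (h.mem _).1 (pair_subset.1 e).1; omega
  have e : S'.1 \ {i.1, i.1 + 1} = S.1 \ {i.1, i.1 + 1} := by
    ext x; simp only [Finset.mem_sdiff, h.mem, Finset.mem_insert, Finset.mem_singleton]; tauto
  rw [xDiag_eq h1, xDiag_eq h2]
  have r1 := bi_mul (xGen_rel (XRel.bottom (diag S h1) ⟨S', S, e, h3⟩ h rfl)) (a * L (i + 1)) b
  have r2 := bi_mul (xGen_rel (XRel.corner₂ ⟨S', S, e, h3⟩ (diag T h2) h' h.1 m0 m1)) a b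
  simp only [mul_one, one_mul] at r1 r2
  rw [← mul_assoc, r1, r2]

variable (i) in
/-- The images of the generators under `d⁺`. -/
def dPlusGen (S : Idem n) : XBimod i :=
  if i.1 + 1 ∈ S.1 then
    xDiag i S - ∑ T : Idem n,
      if IsShift (i + 1) S T then bi (R (n := n) (i + 1)) (L (n := n) (i + 1)) (xDiag i T) else 0
  else bi 1 (u (n := n) i) (xDiag i S) - bi (u (n := n) (i + 1)) 1 (xDiag i S)

theorem dPlusGen_of_shift {S T : Idem n} (h : IsShift (i + 1) S T) :
    dPlusGen i S = xDiag i S - bi (R (n := n) (i + 1)) (L (n := n) (i + 1)) (xDiag i T) := by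
  rw [dPlusGen, if_pos h.1, Finset.sum_eq_single T, if_pos h]
  · intro T' _ hne
    exact if_neg fun e => hne (e.ext h)
  · simp

theorem dPlusGen_of_no_shift {S : Idem n} (h0 : i.1 + 1 ∈ S.1) (h : ∀ T, ¬ IsShift (i + 1) S T) :
    dPlusGen i S = xDiag i S := by
  rw [dPlusGen, if_pos h0, Finset.sum_eq_zero, sub_zero]
  intro T _; exact if_neg (h T)

theorem dPlusGen_of_notMem {S : Idem n} (h0 : i.1 + 1 ∉ S.1) : dPlusGen i S =
    bi 1 (u (n := n) i) (xDiag i S) - bi (u (n := n) (i + 1)) 1 (xDiag i S) :=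
  if_neg h0

theorem dPlusGen_idem (S : Idem n) (a b : Alg n) :
    bi (a * ι S) (ι S * b) (dPlusGen i S) = bi a b (dPlusGen i S) := by
  by_cases h0 : i.1 + 1 ∈ S.1
  · by_cases h : ∃ T, IsShift (i + 1) S T
    · obtain ⟨T, h⟩ := h
      rw [dPlusGen_of_shift h, bi_sub, bi_sub, xDiag_idem, bi_bi, bi_bi, mul_assoc, ι_mul_R h,
        ← mul_assoc, ← mul_assoc, L_mul_ι h, mul_assoc (ι T), xDiag_idem]
    · rw [not_exists] at h
      rw [dPlusGen_of_no_shift h0 h, xDiag_idem]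
  · rw [dPlusGen_of_notMem h0, bi_sub, bi_sub]
    simp only [bi_bi, mul_one, one_mul]
    rw [xDiag_idem_left, mul_assoc a, ← u_comm (i + 1) (ι S), ← mul_assoc a, xDiag_idem,
      ← mul_assoc (u i.1), u_comm i (ι S), mul_assoc, xDiag_idem_right]

theorem dPlusGen_idem_left (S : Idem n) (a b : Alg n) :
    bi (a * ι S) b (dPlusGen i S) = bi a b (dPlusGen i S) := by
  rw [← dPlusGen_idem, mul_assoc, ι_mul_ι, dPlusGen_idem]

theorem dPlusGen_idem_right (S : Idem n) (a b : Alg n) :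
    bi a (ι S * b) (dPlusGen i S) = bi a b (dPlusGen i S) := by
  rw [← dPlusGen_idem, ← mul_assoc, ι_mul_ι, dPlusGen_idem]

theorem dPlusGen_right {j : ℕ} {S S' : Idem n} (h : IsShift j S S') (a b : Alg n) :
    bi a (R j * b) (dPlusGen i S) = bi (a * R j) b (dPlusGen i S') := by
  by_cases hi : j = i
  · subst hi
    have m : i.1 + 1 ∈ S'.1 := (h.mem _).2 (Or.inl rfl)
    have r : bi (a * R i) b (xDiag i S') = bi (a * u i) (R i * b) (xDiag i S) := by
      rw [← xDiag_shift h, ← xDiag_idem_left, mul_assoc a, mul_assoc a, R_mul_L_ι h.1,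
        ← mul_assoc, xDiag_idem_left]
    have s := xDiag_sum (i := i) S a (R i * b)
    have key : bi (a * R i) b (dPlusGen i S') =
        bi (a * R i) b (xDiag i S') - bi a (u (i + 1) * (R i * b)) (xDiag i S) := by
      by_cases hT : ∃ T, IsShift (i + 1) S' T
      · obtain ⟨T, hT⟩ := hT
        rw [dPlusGen_of_shift hT, bi_sub, bi_bi, mul_assoc a, ← xDiag_corner₁ h hT,
          ← xDiag_idem_right S]
        have : ι S * (R i * R (i + 1) * (L (i + 1) * b)) = ι S * (u (i + 1) * (R i * b)) := by
          calc ι S * (R i * R (i + 1) * (L (i + 1) * b))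
              = ι S * R i * (R (i + 1) * L (i + 1)) * b := by simp only [mul_assoc]
            _ = R i * (u (i + 1) * ι S') * b := by
              rw [ι_mul_R h, mul_assoc (R i.1), ι_mul_R_mul_L m]
            _ = ι S * (u (i + 1) * (R i * b)) := by
              rw [u_comm, ← mul_assoc, ← ι_mul_R h, mul_assoc, mul_assoc,
                ← mul_assoc (R i.1), ← u_comm, mul_assoc]
        rw [this, xDiag_idem_right]
      · rw [not_exists] at hT
        rw [dPlusGen_of_no_shift m hT, ← xDiag_idem_right S a (u (i + 1) * (R i * b)),
          ← mul_assoc (u (i.1 + 1)), u_comm, ← mul_assoc, ← mul_assoc, ι_mul_R h,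
          mul_assoc (R i.1), ← u_comm, u_mul_ι_zero m hT, mul_zero, zero_mul, bi_zero_right,
          sub_zero]
    rw [key, r, dPlusGen_of_notMem h.2.1, bi_sub, bi_bi, bi_bi, mul_one, one_mul,
      sub_eq_sub_iff_add_eq_add, s]
  by_cases hi' : j = i + 1
  · subst hi'
    have m : i.1 + 1 ∉ S'.1 := (isShift_iff'.1 h).2.1
    rw [dPlusGen_of_shift h, dPlusGen_of_notMem m]
    simp only [bi_sub, bi_bi, mul_one, one_mul]
    have r1 : bi a (R (i + 1) * b) (xDiag i S) = bi (a * R (i + 1) * u i) b (xDiag i S') := by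
      by_cases h0 : i.1 ∈ S.1
      · rw [xDiag_zero h0 h.1, bi_zero, ← xDiag_idem_left, mul_assoc, mul_assoc, u_comm,
          ← mul_assoc (R (i.1 + 1)), ← ι_mul_R h, mul_assoc, ← u_comm, ← mul_assoc (ι S), ← u_comm,
          u_mul_ι_zero h0 (fun T hT => hT.2.1 h.1), zero_mul, mul_zero, bi_zero_left]
      · rw [xDiag_corner₄ h h0, mul_assoc a]
    have r2 : bi (a * R (i + 1)) (L (i + 1) * (R (i + 1) * b)) (xDiag i S') =
        bi (a * R (i + 1)) (u (i + 1) * b) (xDiag i S') := by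
      rw [← xDiag_idem_right, ← mul_assoc (L (i.1 + 1)), ← mul_assoc,
        ι_mul_L_mul_R (by omega) ((h.mem _).2 (Or.inl rfl)), u_comm, mul_assoc, xDiag_idem_right]
    rw [r1, r2]
    have s := xDiag_sum (i := i) S' (a * R (i + 1)) b
    rw [sub_eq_sub_iff_add_eq_add, s]
  have m : i.1 + 1 ∈ S'.1 ↔ i.1 + 1 ∈ S.1 := h.mem_iff (by omega) (by omega)
  by_cases h0 : i.1 + 1 ∈ S.1
  · by_cases hj : j = i + 2
    · subst hj
      have e : ∀ T, ¬ IsShift (i + 1) S T := fun T hT => hT.2.1 h.1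
      rw [dPlusGen_of_no_shift h0 e, xDiag_right hi hi' h]
      by_cases hT : ∃ T, IsShift (i + 1) S' T
      · obtain ⟨T, hT⟩ := hT
        rw [dPlusGen_of_shift hT, bi_sub, bi_bi, mul_assoc a, R_mul_R, mul_zero, bi_zero_left,
          sub_zero]
      · rw [not_exists] at hT
        rw [dPlusGen_of_no_shift (m.2 h0) hT]
    · have far : i.1 + 1 + 2 ≤ j ∨ j + 2 ≤ i.1 + 1 := by omega
      by_cases hT : ∃ T, IsShift (i + 1) S T
      · obtain ⟨T, hT⟩ := hT
        obtain ⟨T', h1, h2⟩ := Strands.sq_LR far hT h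
        rw [dPlusGen_of_shift hT, dPlusGen_of_shift h2, bi_sub, bi_sub, xDiag_right hi hi' h,
          bi_bi, bi_bi, ← mul_assoc, ← R_comm_L far.symm, mul_assoc (R j), xDiag_right hi hi' h1,
          mul_assoc a, R_comm_R far, mul_assoc a]
      · have hT' : ∀ T, ¬ IsShift (i + 1) S' T := fun T' h' => hT <| by
          obtain ⟨T, h1, _⟩ := Strands.sq_RR far.symm h h'
          exact ⟨T, h1⟩
        rw [not_exists] at hT
        rw [dPlusGen_of_no_shift h0 hT, dPlusGen_of_no_shift (m.2 h0) hT', xDiag_right hi hi' h]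
  · rw [dPlusGen_of_notMem h0, dPlusGen_of_notMem (mt m.1 h0)]
    simp only [bi_sub, bi_bi, mul_one, one_mul]
    rw [← mul_assoc (u i.1), u_comm i, mul_assoc (R j), xDiag_right hi hi' h, xDiag_right hi hi' h,
      mul_assoc a (u _), u_comm (i + 1) (R j), ← mul_assoc a]

theorem dPlusGen_left {j : ℕ} {S S' : Idem n} (h : IsShift j S S') (a b : Alg n) :
    bi (a * L j) b (dPlusGen i S) = bi a (L j * b) (dPlusGen i S') := by
  by_cases hi : j = i
  · subst hi
    have m : i.1 + 1 ∈ S'.1 := (h.mem _).2 (Or.inl rfl)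
    have r : bi a (L i * b) (xDiag i S') = bi (a * L i) (u i * b) (xDiag i S) := by
      rw [← xDiag_shift h, ← xDiag_idem_right, ← mul_assoc (R i.1), ← mul_assoc,
        ι_mul_R_mul_L h.1, u_comm, mul_assoc, xDiag_idem_right]
    have key : bi a (L i * b) (dPlusGen i S') =
        bi a (L i * b) (xDiag i S') - bi (a * L i * u (i + 1)) b (xDiag i S) := by
      by_cases hT : ∃ T, IsShift (i + 1) S' T
      · obtain ⟨T, hT⟩ := hT
        rw [dPlusGen_of_shift hT, bi_sub, bi_bi, ← mul_assoc, ← xDiag_corner₂ h hT,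
          ← xDiag_idem_left S]
        have : a * R (i + 1) * (L (i + 1) * L i) * ι S = a * L i * u (i + 1) * ι S := by
          calc a * R (i + 1) * (L (i + 1) * L i) * ι S
              = a * (R (i + 1) * L (i + 1) * (L i * ι S)) := by simp only [mul_assoc]
            _ = a * (u (i + 1) * (L i * ι S)) := by
              rw [L_mul_ι h, ← mul_assoc (R (i.1 + 1) * L (i.1 + 1)), R_mul_L_ι m, mul_assoc]
            _ = a * L i * u (i + 1) * ι S := by
              rw [← mul_assoc (u (i.1 + 1)), u_comm]; simp only [mul_assoc]
        rw [this, xDiag_idem_left]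
      · rw [not_exists] at hT
        rw [dPlusGen_of_no_shift m hT, ← xDiag_idem_left S (a * L i * u (i + 1)), mul_assoc,
          u_comm, mul_assoc a, ← mul_assoc (L i.1), L_mul_ι h, mul_assoc (ι S'), ← u_comm,
          ← mul_assoc (ι S'), ← u_comm, u_mul_ι_zero m hT, zero_mul, mul_zero, bi_zero_left,
          sub_zero]
    rw [key, r, dPlusGen_of_notMem h.2.1, bi_sub, bi_bi, bi_bi, mul_one, one_mul]
  by_cases hi' : j = i + 1
  · subst hi'
    have m : i.1 + 1 ∉ S'.1 := (isShift_iff'.1 h).2.1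
    rw [dPlusGen_of_shift h, dPlusGen_of_notMem m]
    simp only [bi_sub, bi_bi, mul_one, one_mul]
    have r1 : bi (a * L (i + 1)) b (xDiag i S) = bi a (u i * (L (i + 1) * b)) (xDiag i S') := by
      by_cases h0 : i.1 ∈ S.1
      · rw [xDiag_zero h0 h.1, bi_zero, ← xDiag_idem_right, ← mul_assoc (u i.1), u_comm,
          ← mul_assoc, ← mul_assoc, ← L_mul_ι h, mul_assoc (L (i.1 + 1)), ← u_comm,
          u_mul_ι_zero h0 (fun T hT => hT.2.1 h.1), mul_zero, zero_mul, bi_zero_right]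
      · rw [xDiag_corner₃ h h0, mul_assoc (u i.1)]
    have r2 : bi (a * L (i + 1) * R (i + 1)) (L (i + 1) * b) (xDiag i S') =
        bi (a * u (i + 1)) (L (i + 1) * b) (xDiag i S') := by
      rw [← xDiag_idem_left, mul_assoc a, mul_assoc a,
        L_mul_R_ι (by omega) ((h.mem _).2 (Or.inl rfl)), ← mul_assoc, xDiag_idem_left]
    rw [r1, r2]
  have m : i.1 + 1 ∈ S'.1 ↔ i.1 + 1 ∈ S.1 := h.mem_iff (by omega) (by omega)
  by_cases h0 : i.1 + 1 ∈ S.1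
  · by_cases hj : j = i + 2
    · subst hj
      have e : ∀ T, ¬ IsShift (i + 1) S T := fun T hT => hT.2.1 h.1
      rw [dPlusGen_of_no_shift h0 e, xDiag_left hi hi' h]
      by_cases hT : ∃ T, IsShift (i + 1) S' T
      · obtain ⟨T, hT⟩ := hT
        rw [dPlusGen_of_shift hT, bi_sub, bi_bi, ← mul_assoc, L_mul_L, zero_mul, bi_zero_right,
          sub_zero]
      · rw [not_exists] at hT
        rw [dPlusGen_of_no_shift (m.2 h0) hT]
    · have far : i.1 + 1 + 2 ≤ j ∨ j + 2 ≤ i.1 + 1 := by omega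
      by_cases hT : ∃ T, IsShift (i + 1) S T
      · obtain ⟨T, hT⟩ := hT
        obtain ⟨T', h1, h2⟩ := Strands.sq_LR far hT h
        rw [dPlusGen_of_shift hT, dPlusGen_of_shift h2, bi_sub, bi_sub, xDiag_left hi hi' h,
          bi_bi, bi_bi, mul_assoc a, ← R_comm_L far, ← mul_assoc, xDiag_left hi hi' h1,
          ← mul_assoc, L_comm_L far.symm, mul_assoc (L (i.1 + 1))]
      · have hT' : ∀ T, ¬ IsShift (i + 1) S' T := fun T' h' => hT <| by
          obtain ⟨T, h1, _⟩ := Strands.sq_RR far.symm h h'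
          exact ⟨T, h1⟩
        rw [not_exists] at hT
        rw [dPlusGen_of_no_shift h0 hT, dPlusGen_of_no_shift (m.2 h0) hT', xDiag_left hi hi' h]
  · rw [dPlusGen_of_notMem h0, dPlusGen_of_notMem (mt m.1 h0)]
    simp only [bi_sub, bi_bi, mul_one, one_mul]
    rw [xDiag_left hi hi' h, mul_assoc a, ← u_comm (i + 1) (L j), ← mul_assoc a,
      xDiag_left hi hi' h, ← mul_assoc (L j), ← u_comm i, mul_assoc (u i.1)]

theorem dPlusGen_zero {j : ℕ} {S : Idem n} (h : u j * ι S = 0) (a b : Alg n) :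
    bi (a * u j) b (dPlusGen i S) = bi a (u j * b) (dPlusGen i S) := by
  rw [← dPlusGen_idem_left, mul_assoc, h, mul_zero, bi_zero_left, ← dPlusGen_idem_right,
    ← mul_assoc, ← u_comm, h, zero_mul, bi_zero_right]

theorem dPlusGen_var (j : ℕ) (S : Idem n) (a b : Alg n) :
    bi (a * u j) b (dPlusGen i S) = bi a (u j * b) (dPlusGen i S) := by
  by_cases hi : j = i
  · subst hi
    by_cases h0 : i.1 + 1 ∈ S.1
    · by_cases h1 : i.1 ∈ S.1
      · exact dPlusGen_zero (u_mul_ι_zero h1 fun T hT => hT.2.1 h0) a b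
      · obtain ⟨T, hT⟩ := exists_shift' h0 h1 i.2.1
        rw [← dPlusGen_idem_left, mul_assoc, ← L_mul_R_ι i.2.1 h0, ← mul_assoc, dPlusGen_idem_left,
          ← mul_assoc, ← dPlusGen_right hT, dPlusGen_left hT, ← dPlusGen_idem_right,
          ← mul_assoc (L i.1), ← mul_assoc, ι_mul_L_mul_R i.2.1 h0, u_comm, mul_assoc,
          dPlusGen_idem_right]
    · rw [dPlusGen_of_notMem h0]
      simp only [bi_sub, bi_bi, mul_one, one_mul]
      have s := xDiag_sum (i := i) S a (u i * b)
      have p := xDiag_prod (i := i) S a b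
      rw [mul_assoc a, p, sub_eq_sub_iff_add_eq_add, s, ← mul_assoc (u (i.1 + 1)),
        ← u_comm i (u (i.1 + 1))]
  by_cases hi' : j = i + 1
  · subst hi'
    by_cases h0 : i.1 + 1 ∈ S.1
    · by_cases h1 : ∃ T, IsShift (i + 1) S T
      · obtain ⟨T, hT⟩ := h1
        rw [← dPlusGen_idem_left, mul_assoc, ← R_mul_L_ι h0, ← mul_assoc, dPlusGen_idem_left,
          ← mul_assoc, dPlusGen_left hT, ← dPlusGen_right hT, ← dPlusGen_idem_right,
          ← mul_assoc (R (i.1 + 1)), ← mul_assoc, ι_mul_R_mul_L h0, u_comm, mul_assoc,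
          dPlusGen_idem_right]
      · exact dPlusGen_zero (u_mul_ι_zero h0 (not_exists.1 h1)) a b
    · rw [dPlusGen_of_notMem h0]
      simp only [bi_sub, bi_bi, mul_one, one_mul]
      have s := xDiag_sum (i := i) S (a * u (i + 1)) b
      have p := xDiag_prod (i := i) S a b
      rw [← mul_assoc (u i.1), ← p, sub_eq_sub_iff_add_eq_add, ← s, u_comm i, ← mul_assoc a]
  by_cases h0 : i.1 + 1 ∈ S.1
  · by_cases h1 : ∃ T, IsShift (i + 1) S T
    · obtain ⟨T, hT⟩ := h1
      rw [dPlusGen_of_shift hT, bi_sub, bi_sub, xDiag_var hi hi', bi_bi, bi_bi, mul_assoc a, u_comm j (R (i + 1)),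
        ← mul_assoc a, xDiag_var hi hi', ← mul_assoc (u j), u_comm j (L (i + 1)), mul_assoc]
    · rw [dPlusGen_of_no_shift h0 (not_exists.1 h1), xDiag_var hi hi']
  · rw [dPlusGen_of_notMem h0]
    simp only [bi_sub, bi_bi, mul_one, one_mul]
    rw [xDiag_var hi hi', mul_assoc a, u_comm j (u (i + 1)), ← mul_assoc a, xDiag_var hi hi',
      ← mul_assoc (u j), u_comm j (u i), mul_assoc (u i.1)]

variable (i) in
theorem dPlusGen_rel (w₁ w₂ : Idem n →₀ Env n) (h : IdRel w₁ w₂) :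
    Finsupp.linearCombination (Env n) (dPlusGen i) w₁ =
      Finsupp.linearCombination (Env n) (dPlusGen i) w₂ := by
  rcases h with S | ⟨S, j⟩ | ⟨j, S, S', h⟩ | ⟨j, S, S', h⟩ <;>
    simp only [linearCombination_fterm]
  · simpa using dPlusGen_idem (i := i) S 1 1
  · simpa using dPlusGen_var (i := i) j S 1 1
  · simpa using dPlusGen_left (i := i) h 1 1
  · simpa using dPlusGen_right (i := i) h 1 1

variable (i) in
/-- The homomorphism `d⁺` from the bimodule of the identity braid to the bimodule of `X_i`. -/
def dPlus : IdBimod n →ₗ[Env n] XBimod i := Presented.lift _ (dPlusGen i) (dPlusGen_rel i)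

end dPlus

/-! ### Tensor products of bimodules -/

namespace Env

/-- The homomorphism `a ↦ a ⊗ 1`, which gives the left action on a bimodule. -/
def inl : Alg n →ₐ[ℚ] Env n := Algebra.TensorProduct.includeLeft (R := ℚ) (B := (Alg n)ᵐᵒᵖ)

/-- The homomorphism `b ↦ 1 ⊗ b`, which gives the right action on a bimodule. -/
def inr : (Alg n)ᵐᵒᵖ →ₐ[ℚ] Env n := Algebra.TensorProduct.includeRight (R := ℚ) (A := Alg n)

/-- The homomorphism from the enveloping algebra that is given by a commuting pair of a left and a
right action. -/
def lift {B : Type} [Ring B] [Algebra ℚ B] (f : Alg n →ₐ[ℚ] B) (g : (Alg n)ᵐᵒᵖ →ₐ[ℚ] B)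
    (h : ∀ x y, Commute (f x) (g y)) : Env n →ₐ[ℚ] B :=
  Algebra.TensorProduct.lift f g h

theorem lift_mk {B : Type} [Ring B] [Algebra ℚ B] (f : Alg n →ₐ[ℚ] B) (g : (Alg n)ᵐᵒᵖ →ₐ[ℚ] B)
    (h : ∀ x y, Commute (f x) (g y)) (a b : Alg n) : lift f g h (mk a b) = f a * g (op b) :=
  Algebra.TensorProduct.lift_tmul f g h a (op b)

theorem mem_span_mk (e : Env n) : e ∈ AddSubmonoid.closure {x | ∃ a b : Alg n, x = mk a b} := by
  induction e using TensorProduct.induction_on with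
  | zero => exact zero_mem _
  | tmul a b => exact AddSubmonoid.subset_closure ⟨a, unop b, rfl⟩
  | add x y hx hy => exact add_mem hx hy

end Env

/-- An additive map that commutes with the actions from both sides is a bimodule homomorphism. -/
theorem map_env_smul {M N : Type*} [AddCommGroup M] [AddCommGroup N] [Module (Env n) M]
    [Module (Env n) N] (f : M →+ N) (h : ∀ (a b : Alg n) (x : M), f (bi a b x) = bi a b (f x)) (e : Env n) (x : M) :
    f (e • x) = e • f x := by
  induction Env.mem_span_mk e using AddSubmonoid.closure_induction with
  | mem e he => obtain ⟨a, b, rfl⟩ := he; exact h a b x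
  | zero => rw [zero_smul, zero_smul, map_zero]
  | add e e' _ _ h1 h2 => rw [add_smul, add_smul, map_add, h1, h2]

variable (n) in
/-- The category of `(𝒜ₙ, 𝒜ₙ)`-bimodules. -/
abbrev Bimod : Type 1 := ModuleCat.{0} (Env n)

open scoped ModuleCat

/-- The tensor product `M ⊗ N` over `ℚ` of two bimodules. -/
def OuterTensor (M N : Bimod n) : Type := M ⊗[ℚ] N

namespace OuterTensor

variable (M N : Bimod n)

instance : AddCommGroup (OuterTensor M N) := inferInstanceAs (AddCommGroup (M ⊗[ℚ] N))

instance : Module ℚ (OuterTensor M N) := inferInstanceAs (Module ℚ (M ⊗[ℚ] N))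

variable {M N} in
/-- The element `x ⊗ y`. -/
def tmul (x : M) (y : N) : OuterTensor M N := x ⊗ₜ[ℚ] y

/-- The left action of `𝒜ₙ` on `M ⊗ N`, through `M`. -/
def leftAction : Alg n →ₐ[ℚ] Module.End ℚ (OuterTensor M N) :=
  (Module.End.rTensorAlgHom ℚ M N).comp ((Algebra.lsmul ℚ ℚ M).comp Env.inl)

/-- The right action of `𝒜ₙ` on `M ⊗ N`, through `N`. -/
def rightAction : (Alg n)ᵐᵒᵖ →ₐ[ℚ] Module.End ℚ (OuterTensor M N) :=
  (Module.End.lTensorAlgHom ℚ N M).comp ((Algebra.lsmul ℚ ℚ N).comp Env.inr)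

theorem action_commute (a : Alg n) (b : (Alg n)ᵐᵒᵖ) :
    Commute (leftAction M N a) (rightAction M N b) :=
  TensorProduct.ext' fun _ _ => rfl

/-- The bimodule structure `a (x ⊗ y) b = a x ⊗ y b`. -/
instance : Module (Env n) (OuterTensor M N) :=
  Module.compHom _ (Env.lift _ _ (action_commute M N)).toRingHom

variable {M N}

theorem bi_tmul (a b : Alg n) (x : M) (y : N) :
    bi a b (tmul x y) = tmul (bi a 1 x) (bi 1 b y) := by
  change Env.lift _ _ (action_commute M N) (Env.mk a b) (tmul x y) = _
  rw [Env.lift_mk]; rfl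

theorem addHom_ext {P : Type*} [AddCommGroup P] {f g : OuterTensor M N →+ P}
    (h : ∀ x y, f (tmul x y) = g (tmul x y)) : f = g :=
  AddMonoidHom.ext fun z => by
    induction z using TensorProduct.induction_on with
    | zero => exact (map_zero f).trans (map_zero g).symm
    | tmul x y => exact h x y
    | add z w hz hw => exact (map_add f z w).trans ((congrArg₂ _ hz hw).trans (map_add g z w).symm)

variable {M' N' : Bimod n}

/-- The homomorphism `f ⊗ g` of bimodules. -/
def map (f : M ⟶ M') (g : N ⟶ N') : OuterTensor M N →ₗ[Env n] OuterTensor M' N' :=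
  let φ : OuterTensor M N →+ OuterTensor M' N' :=
    (TensorProduct.map (f.hom.restrictScalars ℚ) (g.hom.restrictScalars ℚ)).toAddMonoidHom
  { φ with
    map_smul' := map_env_smul φ fun a b z => by
      have : φ.comp (DistribSMul.toAddMonoidHom _ (Env.mk a b)) =
          (DistribSMul.toAddMonoidHom _ (Env.mk a b)).comp φ := addHom_ext fun x y => by
        change φ (bi a b (tmul x y)) = bi a b (tmul (f.hom x) (g.hom y))
        rw [bi_tmul, bi_tmul, ← map_bi, ← map_bi]; rfl
      exact DFunLike.congr_fun this z }

theorem map_tmul (f : M ⟶ M') (g : N ⟶ N') (x : M) (y : N) :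
    map f g (tmul x y) = tmul (f.hom x) (g.hom y) := rfl

variable (M N) in
/-- The subbimodule of `M ⊗ N` generated by the elements `x a ⊗ y - x ⊗ a y`. -/
def balanced : Submodule (Env n) (OuterTensor M N) :=
  Submodule.span (Env n) {z | ∃ (x : M) (a : Alg n) (y : N),
    z = tmul (bi 1 a x) y - tmul x (bi a 1 y)}

theorem balanced_le (f : M ⟶ M') (g : N ⟶ N') :
    balanced M N ≤ (balanced M' N').comap (map f g) := by
  rw [balanced, Submodule.span_le]
  rintro _ ⟨x, a, y, rfl⟩
  rw [SetLike.mem_coe, Submodule.mem_comap, map_sub, map_tmul, map_tmul, map_bi, map_bi]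
  exact Submodule.subset_span ⟨f.hom x, a, g.hom y, rfl⟩

end OuterTensor

open OuterTensor

/-- The tensor product `M ⊗ N` over `𝒜ₙ`. -/
def tensorObj (M N : Bimod n) : Bimod n := ModuleCat.of (Env n) (OuterTensor M N ⧸ balanced M N)

/-- The homomorphism `f ⊗ g` between tensor products over `𝒜ₙ`. -/
def tensorMap {M M' N N' : Bimod n} (f : M ⟶ M') (g : N ⟶ N') : tensorObj M N ⟶ tensorObj M' N' :=
  ModuleCat.ofHom (Submodule.mapQ _ _ (map f g) (balanced_le f g))

theorem tensor_ext {M N P : Bimod n} {f g : tensorObj M N ⟶ P}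
    (h : ∀ x y, f.hom (Submodule.Quotient.mk (tmul x y)) =
      g.hom (Submodule.Quotient.mk (tmul x y))) : f = g := by
  apply ModuleCat.hom_ext
  refine Submodule.linearMap_qext _ (LinearMap.toAddMonoidHom_injective (addHom_ext ?_))
  exact h

variable (n) in
/-- The tensor product over `𝒜ₙ` as a bifunctor. -/
def tensor : Bimod n ⥤ Bimod n ⥤ Bimod n where
  obj M :=
    { obj := fun N => tensorObj M N
      map := fun g => tensorMap (𝟙 M) g
      map_id := fun _ => tensor_ext fun _ _ => rfl
      map_comp := fun _ _ => tensor_ext fun _ _ => rfl }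
  map f :=
    { app := fun N => tensorMap f (𝟙 N)
      naturality := fun _ _ _ => tensor_ext fun _ _ => rfl }
  map_id _ := by ext N : 2; exact tensor_ext fun _ _ => rfl
  map_comp _ _ := by ext N : 2; exact tensor_ext fun _ _ => rfl

instance (M : Bimod n) : ((tensor n).obj M).Additive where
  map_add {_ _ f g} := tensor_ext fun x y =>
    congrArg Submodule.Quotient.mk (TensorProduct.tmul_add x (f.hom y) (g.hom y))

instance : (tensor n).Additive where
  map_add {_ _ f g} := by
    ext N : 2
    exact tensor_ext fun x y =>
      congrArg Submodule.Quotient.mk (TensorProduct.add_tmul (f.hom x) (g.hom x) y)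

/-! ### The complex of an open braid -/

/-- The tensor product over `𝒜ₙ` of two complexes of bimodules. -/
def tensorComplex (K L : CochainComplex (Bimod n) ℤ) : CochainComplex (Bimod n) ℤ :=
  HomologicalComplex.mapBifunctor K L (tensor n) (ComplexShape.up ℤ)

variable (n) in
/-- A crossing between the strands `i` and `i + 1`, with its sign: `true` for a positive and
`false` for a negative crossing. -/
abbrev Crossing : Type := Pos n × Bool

/-- The complex of a single crossing, that is, the cone of `d⁺` or `d⁻`. For a positive crossing
the bimodule of the identity braid is in degree `0` and the bimodule of `X_i` in degree `1`, and
for a negative crossing the bimodule of `X_i` is in degree `-1` and the bimodule of the identity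
braid in degree `0`. -/
def crossingComplex : Crossing n → CochainComplex (Bimod n) ℤ
  | (i, true) => HomologicalComplex.double (ModuleCat.ofHom (dPlus i))
      (show (ComplexShape.up ℤ).Rel 0 1 by simp)
  | (i, false) => HomologicalComplex.double (ModuleCat.ofHom (dMinus i))
      (show (ComplexShape.up ℤ).Rel (-1) 0 by simp)

/-- The complex of bimodules of an open braid on `2n` strands. The braid is given by the list of
its crossings from bottom to top, and its complex is the tensor product over `𝒜ₙ` of the
complexes of the crossings, with the bimodule of the identity braid as the last factor. -/
def braidComplex : List (Crossing n) → CochainComplex (Bimod n) ℤ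
  | [] => (HomologicalComplex.single (Bimod n) (ComplexShape.up ℤ) 0).obj
      (ModuleCat.of (Env n) (IdBimod n))
  | c :: T => tensorComplex (crossingComplex c) (braidComplex T)

/-! ### Braid moves -/

/-- `T'` arises from `T` by removing two consecutive crossings of opposite signs in the same
position. -/
def ReidemeisterII (T T' : List (Crossing n)) : Prop :=
  ∃ (v w : List (Crossing n)) (i : Pos n) (s : Bool),
    T = v ++ [(i, s), (i, !s)] ++ w ∧ T' = v ++ w

/-- `T'` arises from `T` by replacing `σᵢʳ σⱼˢ σᵢᵗ` by `σⱼᵗ σᵢˢ σⱼʳ`, where `j = i + 1` and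
`r`, `s`, `t` are signs. The sign patterns `+ - +` and `- + -` do not occur in a braid-like move. -/
def ReidemeisterIII (T T' : List (Crossing n)) : Prop :=
  ∃ (v w : List (Crossing n)) (i j : Pos n) (r s t : Bool),
    j.1 = i.1 + 1 ∧ ¬ (r = t ∧ s ≠ r) ∧
    T = v ++ [(i, r), (j, s), (i, t)] ++ w ∧ T' = v ++ [(j, t), (i, s), (j, r)] ++ w

/-- `T'` arises from `T` by exchanging the heights of two consecutive crossings that have no strand
in common. This is a planar isotopy of the braid diagram. -/
def FarCommutation (T T' : List (Crossing n)) : Prop :=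
  ∃ (v w : List (Crossing n)) (i j : Pos n) (r s : Bool),
    i.1 + 2 ≤ j.1 ∧
    T = v ++ [(i, r), (j, s)] ++ w ∧ T' = v ++ [(j, s), (i, r)] ++ w

/-- The diagrams `T` and `T'` represent the same open braid: they are related by a sequence of
braid-like Reidemeister moves II and III, planar isotopies, and inverses of these. -/
def BraidIsotopic : List (Crossing n) → List (Crossing n) → Prop :=
  Relation.EqvGen fun T T' => ReidemeisterII T T' ∨ ReidemeisterIII T T' ∨ FarCommutation T T'

end OpenBraid

end

noncomputable section

namespace OpenBraid

variable {n : ℕ}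

/-! ### Positions of strands -/

/-! The argument is Rouquier's treatment of braids by complexes of Soergel bimodules, with the
polynomial ring replaced by the strands algebra.

The bimodule of `X_i` plays the role of the polynomial ring tensored with itself over the
polynomials symmetric in `u_i` and `u_{i+1}`. Let `e i` be the sum of the idempotents of the sets
that avoid `i + 1`. After tensoring with a bimodule `L`, the elements `y l`, sums of `x_{S,S} ⊗ l`
over these sets, generate from the left (`XT_induction`). An additive map on `L` that respects the
right action and is linear over the symmetric elements `SymGen` extends to a homomorphism (`xLift`).

The main tool is a Demazure operator `dem i` on the algebra. It is the entrywise divided difference,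
and it descends to the quotient because the vanishing coefficients of every `S → T` are known
exactly: they form the monomial ideal `gapIdeal S T` (`mk_eq_zero_iff`), which divided differences
preserve (`dd_mem_gapIdeal`). The operators are linear over symmetric elements, square to zero,
commute at a distance and satisfy the braid relation. The operator gives a pairing `ev`, and the
formula for `d⁺` (`dP_apply`) is its Casimir element, so the four test elements `1`, `u_i`, `R_i`,
`L_{i+1}` detect zero (`casimir`, `ev_eq_zero`). The bimodule of `X_i` thus resembles a Frobenius
object: `dP` is the unit, `dM` the counit, `mu` the multiplication and `sig` the comultiplication.

For the second Reidemeister move, the term `X_i X_i` is cancelled by contractions built from `mu`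
and `sig`. The identities `dP_mu_add` and `xMap_dP_mu_add` verify the homotopies, and `mu_sig` makes
the retraction strict.

Distant singular crossings commute because their Demazure operators do. For adjacent ones, `X_a X_b
X_a` is generated by the elements `yyy` and a copy of `X_a` that splits off (`proj_incl`). The braid
relation for `dem` identifies what remains with the corresponding part of `X_b X_a X_b`
(`Adjacent.braid`). Both maps are defined by their graphs, and nondegeneracy of the iterated
pairings makes the graphs single-valued. The complex of three negative crossings can then be
compared with that of the reversed word by an explicit homotopy equivalence
(`Adjacent.tripleMap_comm`, `Adjacent.triple_homotopy`).

Only negative crossings need this work. Words modulo homotopy equivalence after tensoring with every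
complex form a monoid (`wordCon`), in which the second Reidemeister move makes a positive crossing
inverse to the negative one. The other sign patterns follow by computing in its group of units
(`braid_signs`). The strict retraction of the last claim is carried through the word by
functoriality. -/

theorem Idem.pos_strictMono (S : Idem n) : StrictMono S.pos :=
  (S.1.orderEmbOfFin S.card).strictMono

theorem Idem.pos_mem (S : Idem n) (k : Fin n) : S.pos k ∈ S.1 :=
  Finset.orderEmbOfFin_mem S.1 S.card k

theorem Idem.pos_bounds (S : Idem n) (k : Fin n) : 1 ≤ S.pos k ∧ S.pos k ≤ 2 * n :=
  S.mem_Icc (S.pos_mem k)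

theorem Idem.exists_pos {S : Idem n} {x : ℕ} (h : x ∈ S.1) : ∃ k, S.pos k = x := by
  have : x ∈ Set.range (S.1.orderEmbOfFin S.card) := by
    rw [Finset.range_orderEmbOfFin]; exact h
  exact this

theorem Idem.mem_iff_exists_pos {S : Idem n} {x : ℕ} : x ∈ S.1 ↔ ∃ k, S.pos k = x :=
  ⟨Idem.exists_pos, fun ⟨k, h⟩ => h ▸ S.pos_mem k⟩

theorem Idem.ext_pos {S T : Idem n} (h : ∀ k, S.pos k = T.pos k) : S = T :=
  Idem.ext fun x => by simp only [Idem.mem_iff_exists_pos, h]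

/-- The set with prescribed positions. -/
def Idem.ofPos (f : Fin n → ℕ) (hf : StrictMono f) (h : ∀ k, 1 ≤ f k ∧ f k ≤ 2 * n) : Idem n :=
  ⟨Finset.univ.image f, Finset.mem_powersetCard.2 ⟨fun x hx => by
    obtain ⟨k, _, rfl⟩ := Finset.mem_image.1 hx
    exact Finset.mem_Icc.2 (h k), by
    rw [Finset.card_image_of_injective _ hf.injective, Finset.card_univ, Fintype.card_fin]⟩⟩

theorem Idem.pos_ofPos (f : Fin n → ℕ) (hf : StrictMono f) (h : ∀ k, 1 ≤ f k ∧ f k ≤ 2 * n)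
    (k : Fin n) : (Idem.ofPos f hf h).pos k = f k := by
  have := Finset.orderEmbOfFin_unique (Idem.ofPos f hf h).card (f := f)
    (fun k => Finset.mem_image.2 ⟨k, Finset.mem_univ _, rfl⟩) hf
  exact (congrFun this k).symm

theorem isShift_of_pos {S T : Idem n} {j : ℕ} {k : Fin n} (h1 : S.pos k = j) (h2 : T.pos k = j + 1)
    (h : ∀ l, l ≠ k → S.pos l = T.pos l) : IsShift j S T := by
  refine isShift_iff.2 ⟨h1 ▸ S.pos_mem k, fun e => ?_, fun x => ⟨fun e => ?_, fun e => ?_⟩⟩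
  · obtain ⟨l, hl⟩ := Idem.exists_pos e
    by_cases hlk : l = k
    · subst hlk; omega
    · rw [h l hlk] at hl
      exact hlk (T.pos_strictMono.injective (hl.trans h2.symm))
  · obtain ⟨l, rfl⟩ := Idem.exists_pos e
    by_cases hlk : l = k
    · subst hlk; exact Or.inl h2
    · rw [← h l hlk]
      exact Or.inr ⟨fun e => hlk (S.pos_strictMono.injective (e.trans h1.symm)), S.pos_mem l⟩
  · rcases e with rfl | ⟨e1, e2⟩
    · exact h2 ▸ T.pos_mem k
    · obtain ⟨l, rfl⟩ := Idem.exists_pos e2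
      by_cases hlk : l = k
      · subst hlk; exact absurd h1 e1
      · rw [h l hlk]; exact T.pos_mem l

theorem strandExp_pos {S T W : Idem n} {i : ℕ} (k : Fin n)
    (h : (max (S.pos k) (W.pos k) ≤ i ∧ i < T.pos k) ∨
      (T.pos k ≤ i ∧ i < min (S.pos k) (W.pos k))) : 1 ≤ strandExp S T W i :=
  Finset.card_pos.2 ⟨k, Finset.mem_filter.2 ⟨Finset.mem_univ _, h⟩⟩

/-- No strand turns back if its middle position lies between its ends. Such a `T` therefore factors
`S → W` without a coefficient, which is how bijections are cut into shorter pieces below. -/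
theorem strandMon_between {S T W : Idem n}
    (h : ∀ k, min (S.pos k) (W.pos k) ≤ T.pos k ∧ T.pos k ≤ max (S.pos k) (W.pos k)) :
    strandMon S T W = 1 := by
  refine Finset.prod_eq_one fun i _ => ?_
  have : strandExp S T W i = 0 := by
    simp only [strandExp, Finset.card_eq_zero, Finset.filter_eq_empty_iff]
    intro k _
    have := h k
    omega
  rw [this, pow_zero]

/-! ### Matrix units -/

namespace Strands

/-- The multiple `p (S → T)` of a monotone bijection. -/
def sg (S T : Idem n) (p : Poly n) : Strands n := fun A B => if A = S ∧ B = T then p else 0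

theorem sg_mul (S T W : Idem n) (p q : Poly n) :
    sg S T p * sg T W q = sg S W (strandMon S T W * p * q) := by
  ext1 A B
  rw [mul_apply]
  by_cases hA : A = S
  · by_cases hB : B = W
    · subst hA hB
      rw [Finset.sum_eq_single T]
      · simp [sg]
      · intro V _ hV; simp [sg, hV]
      · simp
    · simp [sg, hB]
  · simp [sg, hA]

theorem sg_add (S T : Idem n) (p q : Poly n) : sg S T (p + q) = sg S T p + sg S T q := by
  ext1 A B
  by_cases h : A = S ∧ B = T <;> simp [sg, h]

theorem sg_zero (S T : Idem n) : sg S T 0 = 0 := by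
  ext1 A B; simp [sg]

theorem sg_one (S : Idem n) : sg S S 1 = ι S := rfl

theorem eq_sum_sg (x : Strands n) : x = ∑ S, ∑ T, sg S T (x S T) := by
  have key : ∀ A B : Idem n, (∑ S, ∑ T, sg S T (x S T)) A B = x A B := by
    intro A B
    have happ : ∀ (f : Idem n → Strands n), (∑ S, f S) A B = ∑ S, f S A B := by
      intro f
      have h1 : (∑ S, f S) A = ∑ S, f S A :=
        Finset.sum_apply (M := fun _ : Idem n => Idem n → Poly n) A Finset.univ f
      have h2 : (∑ S, f S A) B = ∑ S, f S A B :=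
        Finset.sum_apply (M := fun _ : Idem n => Poly n) B Finset.univ (fun S => f S A)
      rw [h1, h2]
    rw [happ, Finset.sum_eq_single A]
    · rw [happ, Finset.sum_eq_single B]
      · simp [sg]
      · intro T _ hT; simp [sg, Ne.symm hT]
      · simp
    · intro S _ hS
      rw [happ]; exact Finset.sum_eq_zero fun T _ => by simp [sg, Ne.symm hS]
    · simp
  exact Strands.ext fun A B => (key A B).symm

theorem sg_mul_ι (S T : Idem n) (p : Poly n) : sg S T p * ι T = sg S T p := by
  rw [← sg_one, sg_mul, strandMon_right, one_mul, mul_one]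

theorem ι_mul_R_eq {j : ℕ} {S T : Idem n} (h : IsShift j S T) : ι S * R j = sg S T 1 := by
  ext1 A B
  rw [ι_mul_apply]
  by_cases hA : A = S
  · subst hA
    have : IsShift j A B ↔ B = T := ⟨fun e => e.ext h, fun e => e ▸ h⟩
    simp [sg, R, ind, this]
  · simp [sg, hA]

theorem ι_mul_L_eq {j : ℕ} {S T : Idem n} (h : IsShift j S T) : ι T * L j = sg T S 1 := by
  ext1 A B
  rw [ι_mul_apply]
  by_cases hA : A = T
  · subst hA
    have : IsShift j B A ↔ B = S := ⟨fun e => e.ext' h, fun e => e ▸ h⟩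
    simp [sg, L, ind, this]
  · simp [sg, hA]

end Strands

/-! ### The ideal of relations -/

/-- The variables in the gap between the strand `k` and the strands to the right of it. -/
def InGap (S T : Idem n) (k : Fin n) (m : ℕ) : Prop :=
  max (S.pos k) (T.pos k) ≤ m ∧ ∀ l, k < l → m < S.pos l ∧ m < T.pos l

open Classical in
/-- The product of the variables in a gap. -/
def gapMon (S T : Idem n) (k : Fin n) : Poly n :=
  ∏ m : Finset.Icc 1 (2 * n), MvPolynomial.X m ^ (if InGap S T k m then 1 else 0)

/-- The coefficients of `S → T` that vanish in the quotient algebra. -/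
def gapIdeal (S T : Idem n) : Ideal (Poly n) := Ideal.span (Set.range (gapMon S T))

theorem gapMon_mem (S T : Idem n) (k : Fin n) : gapMon S T k ∈ gapIdeal S T :=
  Ideal.subset_span ⟨k, rfl⟩

/-- If `m` lies in the gap for `S`, `W` but not for `S`, `T`, then some strand of `T` is on the
wrong side of `m`. That strand crosses `m` and comes back, so `strandMon S T W` supplies the missing
variable. -/
theorem gapMon_dvd_right (S T W : Idem n) (k : Fin n) :
    gapMon S W k ∣ strandMon S T W * gapMon S T k := by
  rw [gapMon, gapMon, strandMon, ← Finset.prod_mul_distrib]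
  refine Finset.prod_dvd_prod_of_dvd _ _ fun m _ => ?_
  rw [← pow_add]
  refine pow_dvd_pow _ ?_
  split_ifs with h1 h2 h2 <;> try omega
  simp only [InGap, not_and_or, not_forall] at h1 h2
  have : 1 ≤ strandExp S T W m := by
    rcases h2 with h2 | ⟨l, hl, h2⟩
    · exact strandExp_pos k (Or.inl (by omega))
    · have := h1.2 l hl
      exact strandExp_pos l (Or.inr (by omega))
  omega

theorem gapMon_dvd_left (S T W : Idem n) (k : Fin n) :
    gapMon S W k ∣ strandMon S T W * gapMon T W k := by
  rw [gapMon, gapMon, strandMon, ← Finset.prod_mul_distrib]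
  refine Finset.prod_dvd_prod_of_dvd _ _ fun m _ => ?_
  rw [← pow_add]
  refine pow_dvd_pow _ ?_
  split_ifs with h1 h2 h2 <;> try omega
  simp only [InGap, not_and_or, not_forall] at h1 h2
  have : 1 ≤ strandExp S T W m := by
    rcases h2 with h2 | ⟨l, hl, h2⟩
    · exact strandExp_pos k (Or.inl (by omega))
    · have := h1.2 l hl
      exact strandExp_pos l (Or.inr (by omega))
  omega

theorem gapIdeal_right {S T W : Idem n} {p : Poly n} (h : p ∈ gapIdeal S T) :
    strandMon S T W * p ∈ gapIdeal S W := by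
  induction h using Submodule.span_induction with
  | mem x hx =>
    obtain ⟨k, rfl⟩ := hx
    exact Ideal.mem_of_dvd _ (gapMon_dvd_right S T W k) (gapMon_mem S W k)
  | zero => rw [mul_zero]; exact zero_mem _
  | add x y _ _ hx hy => rw [mul_add]; exact add_mem hx hy
  | smul a x _ hx => rw [smul_eq_mul, mul_left_comm]; exact Ideal.mul_mem_left _ _ hx

theorem gapIdeal_left {S T W : Idem n} {p : Poly n} (h : p ∈ gapIdeal T W) :
    strandMon S T W * p ∈ gapIdeal S W := by
  induction h using Submodule.span_induction with
  | mem x hx =>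
    obtain ⟨k, rfl⟩ := hx
    exact Ideal.mem_of_dvd _ (gapMon_dvd_left S T W k) (gapMon_mem S W k)
  | zero => rw [mul_zero]; exact zero_mem _
  | add x y _ _ hx hy => rw [mul_add]; exact add_mem hx hy
  | smul a x _ hx => rw [smul_eq_mul, mul_left_comm]; exact Ideal.mul_mem_left _ _ hx

/-- Once the range of a strand further right reaches the range of strand `k`, no slot remains
between them. The gap ideal is then everything, which matches the vanishing of `R_j R_{j-1}` and
`L_{j-1} L_j`. -/
theorem gapMon_eq_one {S T : Idem n} {k l : Fin n} (hkl : k < l)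
    (h : min (S.pos l) (T.pos l) ≤ max (S.pos k) (T.pos k)) : gapMon S T k = 1 := by
  refine Finset.prod_eq_one fun m _ => ?_
  rw [if_neg, pow_zero]
  rintro ⟨h1, h2⟩
  have := h2 l hkl
  omega

/-- The matrices all of whose entries vanish in the quotient algebra. -/
def gapTwoSided (n : ℕ) : TwoSidedIdeal (Strands n) :=
  TwoSidedIdeal.mk' {x | ∀ S T, x S T ∈ gapIdeal S T}
    (fun S T => zero_mem _)
    (fun {x y} hx hy S T => add_mem (hx S T) (hy S T))
    (fun {x} hx S T => neg_mem (hx S T))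
    (fun {x y} hy S W => by
      rw [Strands.mul_apply]
      refine sum_mem fun T _ => ?_
      rw [mul_right_comm]
      exact Ideal.mul_mem_right _ _ (gapIdeal_left (hy T W)))
    (fun {x y} hx S W => by
      rw [Strands.mul_apply]
      exact sum_mem fun T _ => Ideal.mul_mem_right _ _ (gapIdeal_right (hx S T)))

theorem mem_gapTwoSided {x : Strands n} : x ∈ gapTwoSided n ↔ ∀ S T, x S T ∈ gapIdeal S T :=
  TwoSidedIdeal.mem_mk' {x : Strands n | ∀ S T, x S T ∈ gapIdeal S T} _ _ _ _ _ x

/-- Only the strand in slot `j` moves, and it crosses the gap `j` once in each direction. -/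
theorem strandExp_shift {j : ℕ} {S T : Idem n} (h : IsShift j S T) (i : ℕ) :
    strandExp S T S i = if i = j then 1 else 0 := by
  obtain ⟨k, hk⟩ := Idem.exists_pos h.1
  split_ifs with hi
  · subst hi
    rw [strandExp, Finset.card_eq_one]
    refine ⟨k, Finset.ext fun l => ?_⟩
    have h1 := h.pos l
    have h2 : S.pos l = i → l = k := fun e => S.pos_strictMono.injective (e.trans hk.symm)
    simp only [Finset.mem_filter, Finset.mem_univ, true_and, Finset.mem_singleton]
    constructor
    · intro e
      apply h2
      by_contra hne
      rw [if_neg hne] at h1; omega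
    · rintro rfl; rw [if_pos hk] at h1; omega
  · simp only [strandExp, Finset.card_eq_zero, Finset.filter_eq_empty_iff]
    intro l _
    have := h.pos_le (i := i) hi l
    omega

theorem strandExp_shift' {j : ℕ} {S T : Idem n} (h : IsShift j S T) (i : ℕ) :
    strandExp T S T i = if i = j then 1 else 0 := by
  rw [← strandExp_shift h i]
  -- In this instance of the cocycle identity the two exponents with a repeated neighbouring set
  -- vanish, which equates the other two.
  have := strandExp_cocycle S T S T i
  rw [strandExp_left, strandExp_right] at this
  omega

theorem prod_X_pow_ite {j : ℕ} (hj : j ∈ Finset.Icc 1 (2 * n)) :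
    ∏ i : Finset.Icc 1 (2 * n), (MvPolynomial.X i : Poly n) ^ (if i.1 = j then 1 else 0) =
      MvPolynomial.X ⟨j, hj⟩ := by
  rw [Finset.prod_eq_single ⟨j, hj⟩]
  · simp
  · intro b _ hb
    rw [if_neg (fun e => hb (Subtype.ext e)), pow_zero]
  · simp

theorem strandMon_shift {j : ℕ} {S T : Idem n} (h : IsShift j S T)
    (hj : j ∈ Finset.Icc 1 (2 * n)) : strandMon S T S = MvPolynomial.X ⟨j, hj⟩ := by
  simp only [strandMon, strandExp_shift h, prod_X_pow_ite hj]

theorem strandMon_shift' {j : ℕ} {S T : Idem n} (h : IsShift j S T)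
    (hj : j ∈ Finset.Icc 1 (2 * n)) : strandMon T S T = MvPolynomial.X ⟨j, hj⟩ := by
  simp only [strandMon, strandExp_shift' h, prod_X_pow_ite hj]

/-- For the identity bijection, the gap of a strand in slot `j` is just `j` when the slot `j + 1` is
occupied or does not exist. This accounts for `u_j ι_S = 0` when the strand is blocked. -/
theorem X_mem_gapIdeal {j : ℕ} {S : Idem n} (hj : j ∈ S.1) (h : j + 1 ∈ S.1 ∨ j = 2 * n) :
    MvPolynomial.X ⟨j, Finset.mem_Icc.2 (S.mem_Icc hj)⟩ ∈ gapIdeal S S := by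
  obtain ⟨k, hk⟩ := Idem.exists_pos hj
  have : gapMon S S k = MvPolynomial.X ⟨j, Finset.mem_Icc.2 (S.mem_Icc hj)⟩ := by
    rw [← prod_X_pow_ite]
    refine Finset.prod_congr rfl fun m _ => ?_
    have : InGap S S k m ↔ m.1 = j := by
      refine ⟨fun ⟨h1, h2⟩ => ?_, fun e => ⟨by omega, fun l hl => ?_⟩⟩
      · rcases h with h | h
        · obtain ⟨l, hl⟩ := Idem.exists_pos h
          have := h2 l (S.pos_strictMono.lt_iff_lt.1 (by omega))
          omega
        · have := (Finset.mem_Icc.1 m.2).2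
          omega
      · have := S.pos_strictMono hl
        omega
    simp only [this]
  rw [← this]; exact gapMon_mem S S k

namespace Strands

theorem u_mul_ι_eq {j : ℕ} (hj : j ∈ Finset.Icc 1 (2 * n)) (S : Idem n) :
    u j * ι S = sg S S (MvPolynomial.X ⟨j, hj⟩) := by
  ext1 A B
  rw [u_mul_apply j hj]
  by_cases h : A = S ∧ B = S <;> simp [ι, sg, h]

theorem ι_mul_ιAt (j : ℕ) (S : Idem n) : ι S * ιAt j = if j ∈ S.1 then ι S else 0 := by
  rw [ιAt, Finset.mul_sum, Finset.sum_eq_single S]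
  · split_ifs
    · exact ι_mul_ι_self S
    · simp
  · intro T _ hne
    split_ifs
    · exact ι_mul_ι_ne hne.symm
    · simp
  · simp

theorem mem_gapTwoSided_of_ι_mul {x : Strands n} (h : ∀ S, ι S * x ∈ gapTwoSided n) :
    x ∈ gapTwoSided n := by
  rw [mem_gapTwoSided]
  intro S T
  have := mem_gapTwoSided.1 (h S) S T
  rwa [ι_mul_apply, if_pos rfl] at this

theorem sg_mem_gapTwoSided {S T : Idem n} {p : Poly n} (h : p ∈ gapIdeal S T) :
    sg S T p ∈ gapTwoSided n := by
  rw [mem_gapTwoSided]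
  intro A B
  by_cases e : A = S ∧ B = T
  · obtain ⟨rfl, rfl⟩ := e
    simpa [sg] using h
  · simp [sg, e]

/-- Each relator is examined one row at a time. When the required moves exist, a quadratic relator
cancels exactly; when the strand is blocked, the term `u_j ι_S` is left and is a gap monomial. -/
theorem relators_subset : relators n ⊆ gapTwoSided n := by
  rintro x (((⟨j, hj, rfl⟩ | ⟨j, hj, rfl⟩) | ⟨j, hj, rfl⟩) | ⟨j, hj, rfl⟩) <;>
    refine mem_gapTwoSided_of_ι_mul fun S => ?_
  · rw [mul_sub, ← mul_assoc, ← mul_assoc, ← u_comm, mul_assoc (u j), ι_mul_ιAt]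
    by_cases h : j ∈ S.1
    · rw [if_pos h]
      by_cases hT : ∃ T, IsShift j S T
      · obtain ⟨T, hT⟩ := hT
        rw [ι_mul_R_eq hT, ← sg_mul_ι, mul_assoc, ι_mul_L_eq hT, sg_mul, mul_one, mul_one,
          strandMon_shift hT hj, u_mul_ι_eq hj, sub_self]
        exact zero_mem _
      · rw [ι_mul_R_zero (not_exists.1 hT), zero_mul, zero_sub, u_mul_ι_eq hj]
        refine neg_mem (sg_mem_gapTwoSided (X_mem_gapIdeal h ?_))
        by_contra hc
        push Not at hc
        have := (S.mem_Icc h).2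
        exact hT (exists_shift h hc.1 (by omega))
    · rw [if_neg h, mul_zero, ι_mul_R_zero (fun T hT => h hT.1), zero_mul, sub_zero]
      exact zero_mem _
  · rw [mul_sub, ← mul_assoc, ← mul_assoc, ← u_comm, mul_assoc (u j), ι_mul_ιAt]
    by_cases h : j + 1 ∈ S.1
    · rw [if_pos h]
      by_cases hT : ∃ T, IsShift j T S
      · obtain ⟨T, hT⟩ := hT
        rw [ι_mul_L_eq hT, ← sg_mul_ι, mul_assoc, ι_mul_R_eq hT, sg_mul, mul_one, mul_one,
          strandMon_shift' hT hj, u_mul_ι_eq hj, sub_self]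
        exact zero_mem _
      · rw [ι_mul_L_zero (not_exists.1 hT), zero_mul, zero_sub, u_mul_ι_eq hj]
        have : j ∈ S.1 := by
          by_contra hc
          exact hT (exists_shift' h hc (Finset.mem_Icc.1 hj).1)
        exact neg_mem (sg_mem_gapTwoSided (X_mem_gapIdeal this (Or.inl h)))
    · rw [if_neg h, mul_zero, ι_mul_L_zero (fun T hT => h ((hT.mem _).2 (Or.inl rfl))), zero_mul,
        sub_zero]
      exact zero_mem _
  -- The index is at least 2, so writing it as a successor removes the truncated subtraction `j -
  -- 1`.
  · obtain ⟨j, rfl⟩ : ∃ m, j = m + 1 := ⟨j - 1, by have := (Finset.mem_Icc.1 hj).1; omega⟩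
    rw [← mul_assoc, Nat.add_sub_cancel]
    by_cases hT : ∃ T, IsShift (j + 1) S T
    · obtain ⟨T, hT⟩ := hT
      rw [ι_mul_R_eq hT, ← sg_mul_ι, mul_assoc]
      by_cases hW : ∃ W, IsShift j T W
      · obtain ⟨W, hW⟩ := hW
        rw [ι_mul_R_eq hW, sg_mul]
        refine sg_mem_gapTwoSided ?_
        obtain ⟨k, hk⟩ := Idem.exists_pos hW.1
        obtain ⟨l, hl⟩ := Idem.exists_pos hT.1
        have h1 := hT.pos k
        have h2 := hT.pos l
        have h3 := hW.pos k
        have h4 := hW.pos l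
        rw [if_pos hl] at h2
        rw [if_pos hk] at h3
        have hk' : S.pos k = j := by split_ifs at h1 <;> omega
        have hkl : k < l := S.pos_strictMono.lt_iff_lt.1 (by omega)
        -- Strand `k` ends in slot `j + 1`, where strand `l` started, so the two ranges meet and the
        -- gap ideal is everything.
        have : gapMon S W k = 1 := gapMon_eq_one hkl (by omega)
        have h1 : (1 : Poly n) ∈ gapIdeal S W := this ▸ gapMon_mem S W k
        rw [(Ideal.eq_top_iff_one _).2 h1]
        exact Submodule.mem_top
      · rw [ι_mul_R_zero (not_exists.1 hW), mul_zero]; exact zero_mem _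
    · rw [ι_mul_R_zero (not_exists.1 hT), zero_mul]; exact zero_mem _
  · obtain ⟨j, rfl⟩ : ∃ m, j = m + 1 := ⟨j - 1, by have := (Finset.mem_Icc.1 hj).1; omega⟩
    rw [← mul_assoc, Nat.add_sub_cancel]
    by_cases hT : ∃ T, IsShift j T S
    · obtain ⟨T, hT⟩ := hT
      rw [ι_mul_L_eq hT, ← sg_mul_ι, mul_assoc]
      by_cases hW : ∃ W, IsShift (j + 1) W T
      · obtain ⟨W, hW⟩ := hW
        rw [ι_mul_L_eq hW, sg_mul]
        refine sg_mem_gapTwoSided ?_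
        obtain ⟨k, hk⟩ := Idem.exists_pos hT.1
        obtain ⟨l, hl⟩ := Idem.exists_pos hW.1
        have h1 := hT.pos k
        have h3 := hW.pos k
        have h4 := hW.pos l
        rw [if_pos hl] at h4
        rw [if_pos hk] at h1
        have hk' : W.pos k = j := by split_ifs at h3 <;> omega
        have hkl : k < l := W.pos_strictMono.lt_iff_lt.1 (by omega)
        have : gapMon S W k = 1 := gapMon_eq_one hkl (by omega)
        have h1 : (1 : Poly n) ∈ gapIdeal S W := this ▸ gapMon_mem S W k
        rw [(Ideal.eq_top_iff_one _).2 h1]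
        exact Submodule.mem_top
      · rw [ι_mul_L_zero (not_exists.1 hW), mul_zero]; exact zero_mem _
    · rw [ι_mul_L_zero (not_exists.1 hT), zero_mul]; exact zero_mem _

end Strands

/-! ### Vanishing of the gap monomials in the quotient algebra -/

namespace Alg

/-- The class of `p (S → T)`. -/
def sg (S T : Idem n) (p : Poly n) : Alg n := mk n (Strands.sg S T p)

theorem sg_mul (S T W : Idem n) (p q : Poly n) :
    sg S T p * sg T W q = sg S W (strandMon S T W * p * q) := by
  simp only [sg, ← map_mul, Strands.sg_mul]

theorem sg_add (S T : Idem n) (p q : Poly n) : sg S T (p + q) = sg S T p + sg S T q := by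
  simp only [sg, ← map_add, Strands.sg_add]

theorem sg_zero (S T : Idem n) : sg S T 0 = 0 := by
  simp only [sg, Strands.sg_zero, map_zero]

theorem mk_eq_sum (x : Strands n) : mk n x = ∑ S, ∑ T, sg S T (x S T) := by
  conv_lhs => rw [Strands.eq_sum_sg x]
  simp only [map_sum, sg]

theorem sg_between {S T W : Idem n}
    (h : ∀ k, min (S.pos k) (W.pos k) ≤ T.pos k ∧ T.pos k ≤ max (S.pos k) (W.pos k))
    (p : Poly n) : sg S W p = sg S T 1 * sg T W p := by
  rw [sg_mul, strandMon_between h, mul_one, one_mul]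

theorem ι_mul_R_eq {j : ℕ} {S T : Idem n} (h : IsShift j S T) : ι S * R j = sg S T 1 := by
  simp only [ι, R, ← map_mul, Strands.ι_mul_R_eq h, sg]

theorem ι_mul_L_eq {j : ℕ} {S T : Idem n} (h : IsShift j S T) : ι T * L j = sg T S 1 := by
  simp only [ι, L, ← map_mul, Strands.ι_mul_L_eq h, sg]

theorem R_mul_ι_eq {j : ℕ} {S T : Idem n} (h : IsShift j S T) : R j * ι T = sg S T 1 := by
  rw [← ι_mul_R h, ι_mul_R_eq h]

theorem L_mul_ι_eq {j : ℕ} {S T : Idem n} (h : IsShift j S T) : L j * ι S = sg T S 1 := by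
  rw [L_mul_ι h, ι_mul_L_eq h]

theorem u_mul_ι_eq {j : ℕ} (hj : j ∈ Finset.Icc 1 (2 * n)) (S : Idem n) :
    u j * ι S = sg S S (MvPolynomial.X ⟨j, hj⟩) := by
  simp only [u, ι, ← map_mul, Strands.u_mul_ι_eq hj, sg]

theorem sg_X_eq_zero {j : ℕ} (hj : j ∈ Finset.Icc 1 (2 * n)) {S : Idem n} (h : j ∈ S.1)
    (h' : j + 1 ∈ S.1 ∨ j = 2 * n) : sg S S (MvPolynomial.X ⟨j, hj⟩) = 0 := by
  rw [← u_mul_ι_eq, u_mul_ι_zero h]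
  intro T hT
  rcases h' with h' | h'
  · exact hT.2.1 h'
  · have := (T.mem_Icc ((hT.mem _).2 (Or.inl rfl))).2
    omega

theorem sg_eq_zero_of_RR {P Q W : Idem n} {j : ℕ} (h1 : IsShift (j + 1) P Q) (h2 : IsShift j Q W) :
    sg P W 1 = 0 := by
  have : sg P W 1 = sg P Q 1 * sg Q W 1 := by
    rw [sg_mul, Strands.mon_RR (by omega) h1 h2, mul_one, mul_one]
  rw [this, ← ι_mul_R_eq h1, ← R_mul_ι_eq h2, mul_assoc, ← mul_assoc (R (j + 1)), R_mul_R, zero_mul,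
    mul_zero]

theorem sg_eq_zero_of_LL {P Q W : Idem n} {j : ℕ} (h1 : IsShift (j + 1) P Q) (h2 : IsShift j Q W) :
    sg W P 1 = 0 := by
  have : sg W P 1 = sg W Q 1 * sg Q P 1 := by
    rw [sg_mul, Strands.mon_LL (by omega) h2 h1, mul_one, mul_one]
  rw [this, ← ι_mul_L_eq h2, ← L_mul_ι_eq h1, mul_assoc, ← mul_assoc (L j), L_mul_L, zero_mul,
    mul_zero]

end Alg

/-- Two strands that move to the right through a common slot. -/
theorem exists_overlap {S T : Idem n} {k l : Fin n} (hkl : l.1 = k.1 + 1)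
    (h : S.pos l ≤ T.pos k) :
    ∃ (j : ℕ) (P Q W : Idem n), IsShift (j + 1) P Q ∧ IsShift j Q W ∧
      (∀ m, min (S.pos m) (T.pos m) ≤ P.pos m ∧ P.pos m ≤ max (S.pos m) (T.pos m)) ∧
      (∀ m, min (P.pos m) (T.pos m) ≤ W.pos m ∧ W.pos m ≤ max (P.pos m) (T.pos m)) ∧
      (∀ m, min (S.pos m) (W.pos m) ≤ P.pos m ∧ P.pos m ≤ max (S.pos m) (W.pos m)) ∧
      (∀ m, min (S.pos m) (T.pos m) ≤ W.pos m ∧ W.pos m ≤ max (S.pos m) (T.pos m)) := by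
  have hS := S.pos_strictMono
  have hT := T.pos_strictMono
  have hlt : k < l := by rw [Fin.lt_def]; omega
  have hSk := hS hlt
  have hTk := hT hlt
  have bS := S.pos_bounds
  have bT := T.pos_bounds
  -- The slot `j + 1` where strand `l` starts is one that strand `k` reaches or passes. Strand `l`
  -- has to clear it first.
  obtain ⟨j, hj⟩ : ∃ j, S.pos l = j + 1 := ⟨S.pos l - 1, by have := (bS l).1; omega⟩
  -- Strands `k` and `l` are put in prescribed slots. The strands on either side are moved as far
  -- away as the ranges between `S` and `T` allow, which leaves enough room.
  let f : ℕ → ℕ → Fin n → ℕ := fun a b m =>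
    if m = k then a else if m = l then b else
      if m < k then min (S.pos m) (T.pos m) else max (S.pos m) (T.pos m)
  have hf : ∀ a b, S.pos k ≤ a → a < b → b ≤ T.pos l → StrictMono (f a b) := by
    intro a b h1 h2 h3 x y hxy
    have e1 := hS hxy
    have e2 := hT hxy
    have e3 : x < k → S.pos x < S.pos k := fun h => hS h
    have e4 : l < y → T.pos l < T.pos y := fun h => hT h
    have e5 : y < k → S.pos y < S.pos k := fun h => hS h
    have e6 : l < x → T.pos l < T.pos x := fun h => hT h
    simp only [f]
    simp only [Fin.lt_def, Fin.ext_iff] at *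
    split_ifs <;> omega
  have hb : ∀ a b, S.pos k ≤ a → a < b → b ≤ T.pos l → ∀ m, 1 ≤ f a b m ∧ f a b m ≤ 2 * n := by
    intro a b h1 h2 h3 m
    have e1 := bS m; have e2 := bT m; have e3 := bS k; have e4 := bT l
    simp only [f]
    split_ifs <;> omega
  have hk : S.pos k ≤ j := by omega
  have hle : j + 2 ≤ T.pos l := by omega
  have hne : l ≠ k := fun e => by rw [e] at hkl; omega
  -- The strands `k` and `l` occupy `j`, `j + 1` in `P`, then `j`, `j + 2` in `Q`, and `j + 1`, `j +
  -- 2` in `W`: two consecutive moves to the right by neighbours.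
  refine ⟨j, Idem.ofPos (f j (j + 1)) (hf _ _ hk (by omega) (by omega))
      (hb _ _ hk (by omega) (by omega)),
    Idem.ofPos (f j (j + 2)) (hf _ _ hk (by omega) (by omega)) (hb _ _ hk (by omega) (by omega)),
    Idem.ofPos (f (j + 1) (j + 2)) (hf _ _ (by omega) (by omega) (by omega))
      (hb _ _ (by omega) (by omega) (by omega)),
    isShift_of_pos (k := l) ?_ ?_ fun m hm => ?_, isShift_of_pos (k := k) ?_ ?_ fun m hm => ?_,
    fun m => ?_, fun m => ?_, fun m => ?_, fun m => ?_⟩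
  · simp [Idem.pos_ofPos, f, hne]
  · simp [Idem.pos_ofPos, f, hne]
  · simp [Idem.pos_ofPos, f, hm]
  · simp [Idem.pos_ofPos, f]
  · simp [Idem.pos_ofPos, f]
  · simp [Idem.pos_ofPos, f, hm]
  all_goals
    simp only [Idem.pos_ofPos, f]
    by_cases e1 : m = k
    · subst e1; simp only [if_true]; omega
    · by_cases e2 : m = l
      · subst e2; simp only [if_neg e1, if_true]; omega
      · simp only [if_neg e1, if_neg e2]; split_ifs <;> omega

/-- A strand that can move to the right up to the next strand. -/
theorem exists_gap {S T : Idem n} {k : Fin n}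
    (h : ∀ l, k < l → max (S.pos k) (T.pos k) < min (S.pos l) (T.pos l)) :
    ∃ (j : ℕ) (hj : j ∈ Finset.Icc 1 (2 * n)) (P : Idem n), j ∈ P.1 ∧ (j + 1 ∈ P.1 ∨ j = 2 * n) ∧
      gapMon S T k = strandMon S P T * MvPolynomial.X ⟨j, hj⟩ := by
  have hS := S.pos_strictMono
  have hT := T.pos_strictMono
  have bS := S.pos_bounds
  have bT := T.pos_bounds
  -- The slot `j` is the last one of the gap: just before the nearest position of the next strand,
  -- or `2 * n` if there is no next strand.
  obtain ⟨j, hj1, hj2, hj3⟩ : ∃ j, max (S.pos k) (T.pos k) ≤ j ∧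
      (∀ l, k < l → j < min (S.pos l) (T.pos l)) ∧
      (j = 2 * n ∨ ∃ l, k < l ∧ (∀ m, k < m → l ≤ m) ∧ min (S.pos l) (T.pos l) = j + 1) := by
    by_cases hk : k.1 + 1 < n
    · refine ⟨min (S.pos ⟨k + 1, hk⟩) (T.pos ⟨k + 1, hk⟩) - 1, ?_, fun l hl => ?_,
        Or.inr ⟨⟨k + 1, hk⟩, ?_, ?_, ?_⟩⟩
      · have := h ⟨k + 1, hk⟩ (by simp [Fin.lt_def]); omega
      · have h1 : (⟨k + 1, hk⟩ : Fin n) ≤ l := by rw [Fin.le_def]; exact hl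
        have := hS.monotone h1; have := hT.monotone h1
        have := bS ⟨k + 1, hk⟩; have := bT ⟨k + 1, hk⟩
        omega
      · simp [Fin.lt_def]
      · intro m hm; rw [Fin.le_def]; exact hm
      · have := bS ⟨k + 1, hk⟩; have := bT ⟨k + 1, hk⟩
        omega
    · refine ⟨2 * n, ?_, fun l hl => ?_, Or.inl rfl⟩
      · have := bS k; have := bT k; omega
      · have := l.2; rw [Fin.lt_def] at hl; omega
  have hjn : 1 ≤ j ∧ j ≤ 2 * n := by
    refine ⟨by have := (bS k).1; omega, ?_⟩
    rcases hj3 with h | ⟨l, _, _, h⟩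
    · omega
    · have := (bS l).2; omega
  -- Strand `k` makes a detour to the end of its gap. The other strands are placed at an end of
  -- their range on the side of the gap, so that the next strand, if there is one, blocks strand `k`
  -- in the resulting set.
  let f : Fin n → ℕ := fun m =>
    if m = k then j else if m < k then max (S.pos m) (T.pos m) else min (S.pos m) (T.pos m)
  have hf : StrictMono f := by
    clear hj3
    intro x y hxy
    have e1 := hS hxy
    have e2 := hT hxy
    have e3 := hj2 y
    have e4 : x < k → S.pos x < S.pos k ∧ T.pos x < T.pos k := fun h => ⟨hS h, hT h⟩
    simp only [f]
    simp only [Fin.lt_def, Fin.ext_iff] at *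
    split_ifs <;> omega
  have hb : ∀ m, 1 ≤ f m ∧ f m ≤ 2 * n := by
    intro m
    have e1 := bS m; have e2 := bT m
    simp only [f]
    split_ifs <;> omega
  refine ⟨j, Finset.mem_Icc.2 hjn, Idem.ofPos f hf hb, ?_, ?_, ?_⟩
  · rw [Idem.mem_iff_exists_pos]
    exact ⟨k, by simp [Idem.pos_ofPos, f]⟩
  · rcases hj3 with h | ⟨l, hl, -, h⟩
    · exact Or.inr h
    · refine Or.inl (Idem.mem_iff_exists_pos.2 ⟨l, ?_⟩)
      simp [Idem.pos_ofPos, f, hl.ne', hl.not_gt, h]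
  · rw [← prod_X_pow_ite (Finset.mem_Icc.2 hjn), strandMon, ← Finset.prod_mul_distrib]
    refine Finset.prod_congr rfl fun m _ => ?_
    rw [← pow_add]
    congr 1
    -- Strand `k` is the only one that turns back, and its detour crosses every slot of the gap
    -- except the last. The factor `X_j` supplies that one.
    have hexp : strandExp S (Idem.ofPos f hf hb) T m =
        if max (S.pos k) (T.pos k) ≤ m ∧ m.1 < j then 1 else 0 := by
      clear hj3
      simp only [strandExp, Idem.pos_ofPos]
      split_ifs with hm
      · rw [Finset.card_eq_one]
        refine ⟨k, Finset.ext fun l => ?_⟩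
        simp only [Finset.mem_filter, Finset.mem_univ, true_and, Finset.mem_singleton, f]
        by_cases e : l = k
        · subst e; simp only [if_true]; simp; omega
        · simp only [if_neg e]
          split_ifs <;> omega
      · rw [Finset.card_eq_zero, Finset.filter_eq_empty_iff]
        intro l _
        simp only [f]
        by_cases e : l = k
        · subst e; simp only [if_true]; omega
        · simp only [if_neg e]
          split_ifs <;> omega
    have hgap : InGap S T k m ↔ max (S.pos k) (T.pos k) ≤ m ∧ m.1 ≤ j := by
      refine and_congr_right fun h1 => ⟨fun h2 => ?_, fun h2 l hl => ?_⟩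
      · rcases hj3 with h | ⟨l, hl, -, h⟩
        · have := (Finset.mem_Icc.1 m.2).2; omega
        · have := h2 l hl; omega
      · have := hj2 l hl; omega
    rw [hexp]
    simp only [hgap]
    split_ifs <;> omega

namespace Alg

theorem sg_mul_poly (S T : Idem n) (p q : Poly n) : sg S T (p * q) = sg S T p * sg T T q := by
  rw [sg_mul, strandMon_right, one_mul]

/-- When two ranges meet, so do those of strand `k` and its right neighbour. The bijection then
factors through two neighbouring strands moving in the same direction, which is a zero product.
Moves to the left are handled by exchanging `S` and `T` in the overlap lemma. -/
theorem sg_one_eq_zero {S T : Idem n} {k l : Fin n} (hkl : k < l)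
    (h : min (S.pos l) (T.pos l) ≤ max (S.pos k) (T.pos k)) : sg S T 1 = 0 := by
  have hl : k.1 + 1 < n := by have := l.2; rw [Fin.lt_def] at hkl; omega
  have hle : (⟨k + 1, hl⟩ : Fin n) ≤ l := by rw [Fin.le_def]; exact hkl
  have h1 := S.pos_strictMono.monotone hle
  have h2 := T.pos_strictMono.monotone hle
  have hlt : k < (⟨k + 1, hl⟩ : Fin n) := by simp [Fin.lt_def]
  have h3 := S.pos_strictMono hlt
  have h4 := T.pos_strictMono hlt
  by_cases h5 : S.pos ⟨k + 1, hl⟩ ≤ T.pos k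
  · obtain ⟨j, P, Q, W, e1, e2, e3, e4, -, -⟩ := exists_overlap (k := k) (l := ⟨k + 1, hl⟩) rfl h5
    rw [sg_between e3, sg_between e4, sg_eq_zero_of_RR e1 e2, zero_mul, mul_zero]
  · have h6 : T.pos ⟨k + 1, hl⟩ ≤ S.pos k := by omega
    obtain ⟨j, P, Q, W, e1, e2, -, -, e3, e4⟩ := exists_overlap (k := k) (l := ⟨k + 1, hl⟩) rfl h6
    have e3' : ∀ m, min (W.pos m) (T.pos m) ≤ P.pos m ∧ P.pos m ≤ max (W.pos m) (T.pos m) :=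
      fun m => by have := e3 m; omega
    have e4' : ∀ m, min (S.pos m) (T.pos m) ≤ W.pos m ∧ W.pos m ≤ max (S.pos m) (T.pos m) :=
      fun m => by have := e4 m; omega
    rw [sg_between e4', sg_between e3', sg_eq_zero_of_LL e1 e2, zero_mul, mul_zero]

/-- If the gap is genuine, its monomial comes from the detour of strand `k` into a blocked slot,
where `u_j` acts by zero. Otherwise the bijection itself vanishes. -/
theorem sg_gapMon (S T : Idem n) (k : Fin n) : sg S T (gapMon S T k) = 0 := by
  by_cases h : ∀ l, k < l → max (S.pos k) (T.pos k) < min (S.pos l) (T.pos l)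
  · obtain ⟨j, hj, P, h1, h2, h3⟩ := exists_gap h
    have : sg S T (gapMon S T k) = sg S P 1 * (sg P P (MvPolynomial.X ⟨j, hj⟩) * sg P T 1) := by
      rw [sg_mul, sg_mul, h3, strandMon_left]; congr 1; ring
    rw [this, sg_X_eq_zero hj h1 h2, zero_mul, mul_zero]
  · push Not at h
    obtain ⟨l, hl, h⟩ := h
    rw [gapMon_eq_one hl h, sg_one_eq_zero hl h]

theorem sg_eq_zero {S T : Idem n} {p : Poly n} (h : p ∈ gapIdeal S T) : sg S T p = 0 := by
  induction h using Submodule.span_induction with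
  | mem x hx =>
    obtain ⟨k, rfl⟩ := hx
    exact sg_gapMon S T k
  | zero => exact sg_zero S T
  | add x y _ _ hx hy => rw [sg_add, hx, hy, add_zero]
  | smul a x _ hx => rw [smul_eq_mul, mul_comm, sg_mul_poly, hx, zero_mul]

/-- The lower bound is the two-sided ideal of gap coefficients, which contains the relators; the
upper bound is the vanishing of gap monomials. This explicit description is what allows operators on
matrix entries to descend to the algebra. -/
theorem mk_eq_zero_iff {x : Strands n} : mk n x = 0 ↔ ∀ S T, x S T ∈ gapIdeal S T := by
  refine ⟨fun h => ?_, fun h => ?_⟩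
  · have h1 : x ∈ TwoSidedIdeal.span (Strands.relators n) := by
      rw [TwoSidedIdeal.mem_iff]
      exact (RingCon.eq _).1 (h.trans (map_zero (mk n)).symm)
    exact mem_gapTwoSided.1 (TwoSidedIdeal.span_le.2 Strands.relators_subset h1)
  · rw [mk_eq_sum]
    exact Finset.sum_eq_zero fun S _ => Finset.sum_eq_zero fun T _ => sg_eq_zero (h S T)

/-! ### Generators of the algebra -/

/-- Disjoint ranges mean that a strand which has not arrived can take one step towards its target
without meeting another strand. -/
theorem exists_step {S T : Idem n} (hST : S ≠ T)
    (h : ∀ k l, k < l → max (S.pos k) (T.pos k) < min (S.pos l) (T.pos l)) :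
    ∃ (j : ℕ) (S' : Idem n), (IsShift j S S' ∨ IsShift j S' S) ∧
      (∀ m, min (S.pos m) (T.pos m) ≤ S'.pos m ∧ S'.pos m ≤ max (S.pos m) (T.pos m)) ∧
      ∑ m, ((S'.pos m : ℤ) - T.pos m).natAbs < ∑ m, ((S.pos m : ℤ) - T.pos m).natAbs := by
  obtain ⟨k, hk⟩ : ∃ k, S.pos k ≠ T.pos k := by
    by_contra hc; push Not at hc; exact hST (Idem.ext_pos hc)
  have bS := S.pos_bounds
  have bT := T.pos_bounds
  let f : Fin n → ℕ := fun m =>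
    if m = k then (if S.pos k < T.pos k then S.pos k + 1 else S.pos k - 1) else S.pos m
  have hf : StrictMono f := by
    intro x y hxy
    have e1 := S.pos_strictMono hxy
    have e2 := h x y hxy
    simp only [f]
    by_cases hx : x = k <;> by_cases hy : y = k
    · rw [hx, hy] at hxy; exact absurd hxy (lt_irrefl _)
    · subst hx; simp only [if_true, if_neg hy]; split_ifs <;> omega
    · subst hy; simp only [if_true, if_neg hx]; split_ifs <;> omega
    · simp only [if_neg hx, if_neg hy]; exact e1
  have hb : ∀ m, 1 ≤ f m ∧ f m ≤ 2 * n := by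
    intro m
    have e1 := bS m; have e2 := bT k; have e3 := bS k
    simp only [f]
    split_ifs <;> omega
  have hbt : ∀ m, min (S.pos m) (T.pos m) ≤ f m ∧ f m ≤ max (S.pos m) (T.pos m) := by
    intro m
    simp only [f]
    by_cases hm : m = k
    · subst hm; simp only [if_true]; split_ifs <;> omega
    · simp only [if_neg hm]; omega
  refine ⟨min (S.pos k) (f k), Idem.ofPos f hf hb, ?_, ?_, ?_⟩
  · by_cases hlt : S.pos k < T.pos k
    · refine Or.inl (isShift_of_pos (k := k) ?_ ?_ fun m hm => ?_) <;>
        simp [Idem.pos_ofPos, f, *]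
    · refine Or.inr (isShift_of_pos (k := k) ?_ ?_ fun m hm => ?_)
      · simp [Idem.pos_ofPos, f, hlt]
      -- Strand `k` moves left towards a slot that is at least 1, so the subtraction of 1 is not
      -- truncated.
      · have := (bT k).1; simp [f, hlt]; omega
      · simp [Idem.pos_ofPos, f, hm]
  · simpa only [Idem.pos_ofPos] using hbt
  · refine Finset.sum_lt_sum (fun m _ => ?_) ⟨k, Finset.mem_univ _, ?_⟩
    · have := hbt m
      rw [Idem.pos_ofPos]; omega
    · rw [Idem.pos_ofPos]
      simp only [f, if_true]
      have := bT k
      split_ifs <;> omega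

/-- An induction principle for the elements `S → T` of the algebra. -/
theorem sg_induction {p : Alg n → Prop} {T : Idem n} (h0 : p 0) (h1 : p (ι T))
    (hR : ∀ j S a, p a → p (ι S * (R j * a))) (hL : ∀ j S a, p a → p (ι S * (L j * a)))
    (S : Idem n) : p (sg S T 1) := by
  generalize hN : ∑ m, ((S.pos m : ℤ) - T.pos m).natAbs = N
  induction N using Nat.strong_induction_on generalizing S with
  | _ N ih =>
    by_cases hST : S = T
    · subst hST; exact h1
    -- Either all ranges are disjoint and a step can be split off, or two ranges meet and the
    -- element is zero. This is why the case of zero belongs to the principle.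
    by_cases h : ∀ k l, k < l → max (S.pos k) (T.pos k) < min (S.pos l) (T.pos l)
    · obtain ⟨j, S', hS', hb, hlt⟩ := exists_step hST h
      have := ih _ (hN ▸ hlt) S' rfl
      rw [sg_between hb]
      rcases hS' with hS' | hS'
      · rw [← ι_mul_R_eq hS', mul_assoc]; exact hR j S _ this
      · rw [← ι_mul_L_eq hS', mul_assoc]; exact hL j S _ this
    · push Not at h
      obtain ⟨k, l, hkl, h⟩ := h
      rw [sg_one_eq_zero hkl h]; exact h0

theorem sum_ι : ∑ S : Idem n, ι S = 1 := by
  have : (1 : Strands n) = ∑ S, Strands.ι S := by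
    rw [Strands.eq_sum_sg 1]
    refine Finset.sum_congr rfl fun S _ => ?_
    rw [Finset.sum_eq_single S]
    · rw [Strands.one_apply, if_pos rfl, Strands.sg_one]
    · intro T _ hT; rw [Strands.one_apply, if_neg hT.symm, Strands.sg_zero]
    · simp
  simp only [ι]
  rw [← map_sum, ← this, map_one]

theorem ι_mul_ι_ne {S T : Idem n} (h : S ≠ T) : ι S * ι T = 0 := by
  simp only [ι, ← map_mul, Strands.ι_mul_ι_ne h, map_zero]

theorem smul_sg (q : ℚ) (S T : Idem n) (p : Poly n) :
    algebraMap ℚ (Alg n) q * sg S T p = sg S T (MvPolynomial.C q * p) := by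
  have h1 : algebraMap ℚ (Alg n) q = mk n (algebraMap ℚ (Strands n) q) := rfl
  rw [h1, sg, ← map_mul, ← Algebra.smul_def, sg]
  congr 1
  ext1 A B
  rw [Strands.smul_apply]
  by_cases h : A = S ∧ B = T
  · simp [Strands.sg, h, MvPolynomial.smul_eq_C_mul]
  · simp [Strands.sg, h]

/-- The algebra is generated by the idempotents, the variables and the elementary moves. -/
theorem closure_induction {p : Alg n → Prop} (hq : ∀ q : ℚ, p (algebraMap ℚ (Alg n) q))
    (hι : ∀ S, p (ι S)) (hu : ∀ j, p (u j)) (hR : ∀ j, p (R j)) (hL : ∀ j, p (L j))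
    (hadd : ∀ a b, p a → p b → p (a + b)) (hmul : ∀ a b, p a → p b → p (a * b)) (a : Alg n) :
    p a := by
  have h0 : p 0 := by simpa using hq 0
  have hsum : ∀ f : Idem n → Alg n, (∀ S, p (f S)) → p (∑ S, f S) := fun f hf =>
    Finset.sum_induction f p hadd h0 fun S _ => hf S
  obtain ⟨x, rfl⟩ := mk_surjective a
  rw [mk_eq_sum]
  refine hsum _ fun S => hsum _ fun T => ?_
  generalize x S T = f
  induction f using MvPolynomial.induction_on with
  | C q =>
    rw [← mul_one (MvPolynomial.C q), ← smul_sg]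
    refine hmul _ _ (hq q) (sg_induction h0 (hι T) (fun j S a ha => ?_) (fun j S a ha => ?_) S)
    · exact hmul _ _ (hι S) (hmul _ _ (hR j) ha)
    · exact hmul _ _ (hι S) (hmul _ _ (hL j) ha)
  | add f g hf hg => rw [sg_add]; exact hadd _ _ hf hg
  | mul_X f m hf =>
    rw [sg_mul_poly, ← u_mul_ι_eq m.2]
    exact hmul _ _ hf (hmul _ _ (hu _) (hι _))

end Alg

/-! ### Divided differences of polynomials -/

theorem Pos.mem (i : Pos n) : i.1 ∈ Finset.Icc 1 (2 * n) :=
  Finset.mem_Icc.2 ⟨i.2.1, by have := i.2.2; omega⟩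

theorem Pos.succ_mem (i : Pos n) : i.1 + 1 ∈ Finset.Icc 1 (2 * n) :=
  Finset.mem_Icc.2 ⟨by omega, i.2.2⟩

namespace Poly

/-- The variable `u_i`. -/
def xl (i : Pos n) : Poly n := MvPolynomial.X ⟨i, i.mem⟩

/-- The variable `u_{i+1}`. -/
def xr (i : Pos n) : Poly n := MvPolynomial.X ⟨i + 1, i.succ_mem⟩

/-- The exchange of `u_i` and `u_{i+1}`. -/
def swap (i : Pos n) : Poly n →ₐ[ℚ] Poly n :=
  MvPolynomial.rename (Equiv.swap ⟨i.1, i.mem⟩ ⟨i.1 + 1, i.succ_mem⟩)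

variable (i : Pos n)

theorem swap_xl : swap i (xl i) = xr i := by
  simp [swap, xl, xr, MvPolynomial.rename_X]

theorem swap_xr : swap i (xr i) = xl i := by
  simp [swap, xl, xr, MvPolynomial.rename_X]

theorem swap_X {m : Finset.Icc 1 (2 * n)} (h : m.1 ≠ i) (h' : m.1 ≠ i + 1) :
    swap i (MvPolynomial.X m) = MvPolynomial.X m := by
  rw [swap, MvPolynomial.rename_X, Equiv.swap_apply_of_ne_of_ne]
  · exact fun e => h (congrArg Subtype.val e)
  · exact fun e => h' (congrArg Subtype.val e)

theorem swap_swap (f : Poly n) : swap i (swap i f) = f := by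
  rw [swap, MvPolynomial.rename_rename]
  convert MvPolynomial.rename_id_apply f
  ext x
  simp

theorem xl_sub_xr_ne : xl i - xr i ≠ 0 := by
  rw [sub_ne_zero]
  intro h
  have := congrArg Subtype.val (MvPolynomial.X_injective h)
  simp at this

theorem X_cases (m : Finset.Icc 1 (2 * n)) :
    MvPolynomial.X m = xl i ∨ MvPolynomial.X m = xr i ∨
      (swap i (MvPolynomial.X m) = MvPolynomial.X m ∧ m.1 ≠ i ∧ m.1 ≠ i + 1) := by
  by_cases h : m.1 = i
  · left; rw [xl]; congr 1; exact Subtype.ext h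
  by_cases h' : m.1 = i + 1
  · right; left; rw [xr]; congr 1; exact Subtype.ext h'
  · exact Or.inr (Or.inr ⟨swap_X i h h', h, h'⟩)

/-- The twisted product rule reduces divisibility to a single variable, where the difference is
`±(u_i - u_{i+1})` or zero. -/
theorem dvd_sub_swap (f : Poly n) : xl i - xr i ∣ f - swap i f := by
  induction f using MvPolynomial.induction_on with
  | C q => rw [← MvPolynomial.algebraMap_eq, AlgHom.commutes, sub_self]; exact dvd_zero _
  | add f g hf hg =>
    rw [map_add, add_sub_add_comm]; exact dvd_add hf hg
  | mul_X f m hf =>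
    have : f * MvPolynomial.X m - swap i (f * MvPolynomial.X m) =
        (f - swap i f) * MvPolynomial.X m +
          swap i f * (MvPolynomial.X m - swap i (MvPolynomial.X m)) := by
      rw [map_mul]; ring
    rw [this]
    refine dvd_add (hf.mul_right _) (Dvd.dvd.mul_left ?_ _)
    rcases X_cases i m with h | h | h
    · rw [h, swap_xl]
    · rw [h, swap_xr]; exact ⟨-1, by ring⟩
    · rw [h.1, sub_self]; exact dvd_zero _

/-- The divided difference `(f - sᵢ f) / (u_i - u_{i+1})`. -/
def dd (f : Poly n) : Poly n := (dvd_sub_swap i f).choose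

theorem dd_spec (f : Poly n) : (xl i - xr i) * dd i f = f - swap i f :=
  (dvd_sub_swap i f).choose_spec.symm

variable {i}

theorem dd_eq {f g : Poly n} (h : (xl i - xr i) * g = f - swap i f) : dd i f = g :=
  mul_left_cancel₀ (xl_sub_xr_ne i) (by rw [dd_spec, h])

theorem dd_zero : dd i 0 = 0 := dd_eq (by simp)

theorem dd_add (f g : Poly n) : dd i (f + g) = dd i f + dd i g :=
  dd_eq (by rw [mul_add, dd_spec, dd_spec, map_add]; ring)

theorem dd_mul {g : Poly n} (h : swap i g = g) (f : Poly n) : dd i (g * f) = g * dd i f :=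
  dd_eq (by rw [mul_left_comm, dd_spec, map_mul, h]; ring)

theorem dd_eq_zero {g : Poly n} (h : swap i g = g) : dd i g = 0 := dd_eq (by rw [h]; ring)

theorem dd_C (q : ℚ) : dd i (MvPolynomial.C q) = 0 :=
  dd_eq_zero (by rw [← MvPolynomial.algebraMap_eq, AlgHom.commutes])

theorem dd_xl_mul (f : Poly n) : dd i (xl i * f) = f + xr i * dd i f :=
  dd_eq (by rw [mul_add, mul_left_comm, dd_spec, map_mul, swap_xl]; ring)

theorem dd_xr_mul (f : Poly n) : dd i (xr i * f) = -f + xl i * dd i f :=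
  dd_eq (by rw [mul_add, mul_left_comm, dd_spec, map_mul, swap_xr]; ring)

theorem dd_neg (f : Poly n) : dd i (-f) = -dd i f :=
  dd_eq (by rw [mul_neg, dd_spec, map_neg]; ring)

theorem swap_dd (f : Poly n) : swap i (dd i f) = dd i f := by
  refine mul_left_cancel₀ (xl_sub_xr_ne i) ?_
  have := congrArg (swap i) (dd_spec i f)
  rw [map_mul, map_sub, map_sub, swap_xl, swap_xr, swap_swap] at this
  rw [dd_spec]
  linear_combination -this

theorem dd_dd (f : Poly n) : dd i (dd i f) = 0 := dd_eq_zero (swap_dd f)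

variable {j : Pos n}

theorem swap_xl_of_far (h : j.1 ≠ i.1) (h' : j.1 ≠ i.1 + 1) : swap i (xl j) = xl j := swap_X i h h'

theorem swap_xr_of_far (h : j.1 + 1 ≠ i.1) (h' : j.1 ≠ i.1) : swap i (xr j) = xr j :=
  swap_X i h (by simpa using h')

theorem dd_far (h : i.1 + 2 ≤ j.1) (f : Poly n) : dd i (dd j f) = dd j (dd i f) := by
  have e1 : swap i (xl j) = xl j := swap_xl_of_far (by omega) (by omega)
  have e2 : swap i (xr j) = xr j := swap_xr_of_far (by omega) (by omega)
  have e3 : swap j (xl i) = xl i := swap_xl_of_far (by omega) (by omega)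
  have e4 : swap j (xr i) = xr i := swap_xr_of_far (by omega) (by omega)
  induction f using MvPolynomial.induction_on with
  | C q => simp only [dd_C, dd_zero]
  | add f g hf hg => simp only [dd_add, hf, hg]
  | mul_X f m hf =>
    rw [mul_comm]
    rcases X_cases i m with h1 | h1 | h1
    · simp only [h1, dd_mul e3, dd_xl_mul, dd_add, dd_mul e4, hf]
    · simp only [h1, dd_mul e4, dd_xr_mul, dd_add, dd_mul e3, hf, dd_neg]
    · rcases X_cases j m with h2 | h2 | h2
      · simp only [h2, dd_mul e1, dd_xl_mul, dd_add, dd_mul e2, hf]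
      · simp only [h2, dd_mul e2, dd_xr_mul, dd_add, dd_mul e1, hf, dd_neg]
      · simp only [dd_mul h1.1, dd_mul h2.1, hf]

/-- Multiplying by one more variable changes both sides by the same terms: the product rules move
the variable to the front, and the leftover terms agree after using that a repeated divided
difference vanishes. -/
theorem dd_braid (h : j.1 = i.1 + 1) (f : Poly n) :
    dd i (dd j (dd i f)) = dd j (dd i (dd j f)) := by
  have e1 : xl j = xr i := by
    rw [xl, xr]; congr 1; exact Subtype.ext h
  have e2 : swap i (xr j) = xr j := swap_xr_of_far (by omega) (by omega)
  have e3 : swap j (xl i) = xl i := swap_xl_of_far (by omega) (by omega)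
  have b1 : ∀ f, dd j (xr i * f) = f + xr j * dd j f := fun f => by rw [← e1, dd_xl_mul]
  have b2 : ∀ f, dd j (xr j * f) = -f + xr i * dd j f := fun f => by rw [dd_xr_mul, e1]
  induction f using MvPolynomial.induction_on with
  | C q => simp only [dd_C, dd_zero]
  | add f g hf hg => simp only [dd_add, hf, hg]
  | mul_X f m hf =>
    rw [mul_comm]
    rcases X_cases i m with h1 | h1 | h1
    · simp only [h1, dd_xl_mul, dd_add, b1, dd_mul e2, dd_mul e3, dd_dd, hf]; ring
    · simp only [h1, dd_xr_mul, dd_add, dd_neg, b1, b2, dd_mul e2, dd_mul e3, dd_xl_mul, hf]; ring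
    · rcases X_cases j m with h2 | h2 | h2
      -- A variable fixed by the first exchange cannot be the variable `u_{i+1}` that the two
      -- exchanges share.
      · exact absurd ((MvPolynomial.X_injective (h2.trans e1) : m = _) ▸ rfl) h1.2.2
      · simp only [h2, dd_mul e2, dd_xr_mul, dd_add, dd_neg, b2, dd_mul e3, dd_dd, hf]; ring
      · simp only [dd_mul h1.1, dd_mul h2.1, hf]

end Poly

/-! ### The Demazure operator of the algebra -/

/-- With slot `i + 1` empty in all three sets, a strand lies on the same side of the gap `i` as of
the gap `i + 1`. The two variables therefore occur with equal exponents. -/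
theorem swap_strandMon {i : Pos n} {S T W : Idem n} (hS : i.1 + 1 ∉ S.1) (hT : i.1 + 1 ∉ T.1)
    (hW : i.1 + 1 ∉ W.1) : Poly.swap i (strandMon S T W) = strandMon S T W := by
  have hpos : ∀ {S : Idem n}, i.1 + 1 ∉ S.1 → ∀ k, S.pos k ≠ i.1 + 1 :=
    fun h k e => h (e ▸ Idem.pos_mem _ k)
  have hexp : strandExp S T W i.1 = strandExp S T W (i.1 + 1) := by
    simp only [strandExp]
    congr 1
    refine Finset.filter_congr fun k _ => ?_
    have h1 := hpos hS k; have h2 := hpos hT k; have h3 := hpos hW k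
    omega
  simp only [strandMon, map_prod, map_pow, Poly.swap, MvPolynomial.rename_X]
  refine Finset.prod_equiv (Equiv.swap ⟨i.1, i.mem⟩ ⟨i.1 + 1, i.succ_mem⟩) (by simp) fun m _ => ?_
  congr 1
  by_cases h : m = ⟨i.1, i.mem⟩
  · subst h; rw [Equiv.swap_apply_left]; exact hexp
  by_cases h' : m = ⟨i.1 + 1, i.succ_mem⟩
  · subst h'; rw [Equiv.swap_apply_right]; exact hexp.symm
  · rw [Equiv.swap_apply_of_ne_of_ne h h']

open Classical in
theorem swap_gapMon {i : Pos n} {S T : Idem n} (hS : i.1 + 1 ∉ S.1) (hT : i.1 + 1 ∉ T.1)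
    (k : Fin n) : Poly.swap i (gapMon S T k) = gapMon S T k := by
  have hpos : ∀ {S : Idem n}, i.1 + 1 ∉ S.1 → ∀ k, S.pos k ≠ i.1 + 1 :=
    fun h k e => h (e ▸ Idem.pos_mem _ k)
  have hexp : InGap S T k i.1 ↔ InGap S T k (i.1 + 1) := by
    unfold InGap
    have h1 := hpos hS k; have h2 := hpos hT k
    refine and_congr (by omega) (forall_congr' fun l => imp_congr_right fun _ => ?_)
    have h1 := hpos hS l; have h2 := hpos hT l
    omega
  simp only [gapMon, map_prod, map_pow, Poly.swap, MvPolynomial.rename_X]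
  refine Finset.prod_equiv (Equiv.swap ⟨i.1, i.mem⟩ ⟨i.1 + 1, i.succ_mem⟩) (by simp) fun m _ => ?_
  congr 1
  by_cases h : m = ⟨i.1, i.mem⟩
  · subst h; rw [Equiv.swap_apply_left]; exact if_congr hexp rfl rfl
  by_cases h' : m = ⟨i.1 + 1, i.succ_mem⟩
  · subst h'; rw [Equiv.swap_apply_right]; exact if_congr hexp.symm rfl rfl
  · rw [Equiv.swap_apply_of_ne_of_ne h h']

/-- The ideal is generated by monomials symmetric in `u_i` and `u_{i+1}`, and divided differences
are linear over symmetric polynomials. This is where the restriction to sets avoiding `i + 1` is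
needed. -/
theorem dd_mem_gapIdeal {i : Pos n} {S T : Idem n} (hS : i.1 + 1 ∉ S.1) (hT : i.1 + 1 ∉ T.1)
    {p : Poly n} (h : p ∈ gapIdeal S T) : Poly.dd i p ∈ gapIdeal S T := by
  rw [gapIdeal, Ideal.mem_span_range_iff_exists_fun] at h
  obtain ⟨c, rfl⟩ := h
  induction (Finset.univ : Finset (Fin n)) using Finset.induction_on with
  | empty => rw [Finset.sum_empty, Poly.dd_zero]; exact zero_mem _
  | insert a s ha ih =>
    rw [Finset.sum_insert ha, Poly.dd_add, mul_comm (c a), Poly.dd_mul (swap_gapMon hS hT a)]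
    exact add_mem (Ideal.mul_mem_right _ _ (gapMon_mem S T a)) ih

/-! ### The Demazure operator on the strands algebra -/

namespace Strands

/-- The entrywise divided difference. -/
def dem (i : Pos n) (x : Strands n) : Strands n := fun S T =>
  if i.1 + 1 ∉ S.1 ∧ i.1 + 1 ∉ T.1 then Poly.dd i (x S T) else 0

theorem dem_apply (i : Pos n) (x : Strands n) (S T : Idem n) : dem i x S T =
  if i.1 + 1 ∉ S.1 ∧ i.1 + 1 ∉ T.1 then Poly.dd i (x S T) else 0 := rfl

theorem dem_add (i : Pos n) (x y : Strands n) : dem i (x + y) = dem i x + dem i y := by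
  ext1 S T
  simp only [dem_apply, add_apply, Poly.dd_add]
  split_ifs <;> simp

/-- The matrices that respect the position `i + 1` and whose entries are symmetric in `u_i` and
`u_{i+1}`. -/
def IsSym (i : Pos n) (b : Strands n) : Prop := ∀ S T,
  (b S T ≠ 0 → (i.1 + 1 ∈ S.1 ↔ i.1 + 1 ∈ T.1)) ∧ (i.1 + 1 ∉ S.1 → Poly.swap i (b S T) = b S T)

/-- A nonzero entry of `b` cannot leave the sets that avoid `i + 1`. Every contributing summand then
has all three sets in this block, and both the entry and the concatenation monomial are symmetric
and can be pulled out. -/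
theorem dem_mul {i : Pos n} {b : Strands n} (hb : IsSym i b) (x : Strands n) :
    dem i (b * x) = b * dem i x := by
  ext1 S W
  rw [dem_apply, mul_apply, mul_apply]
  by_cases hS : i.1 + 1 ∉ S.1
  · by_cases hW : i.1 + 1 ∉ W.1
    · rw [if_pos ⟨hS, hW⟩]
      have hsum : ∀ (s : Finset (Idem n)) (f : Idem n → Poly n),
          Poly.dd i (∑ T ∈ s, f T) = ∑ T ∈ s, Poly.dd i (f T) := fun s f =>
        map_sum (⟨⟨Poly.dd i, Poly.dd_zero⟩, Poly.dd_add⟩ : Poly n →+ Poly n) f s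
      rw [hsum]
      refine Finset.sum_congr rfl fun T _ => ?_
      by_cases h0 : b S T = 0
      · rw [h0]; simp [Poly.dd_zero]
      · have hT : i.1 + 1 ∉ T.1 := mt ((hb S T).1 h0).2 hS
        rw [dem_apply, if_pos ⟨hT, hW⟩, Poly.dd_mul]
        rw [map_mul, swap_strandMon hS hT hW, (hb S T).2 hS]
    · rw [if_neg (fun h => hW h.2)]
      refine (Finset.sum_eq_zero fun T _ => ?_).symm
      rw [dem_apply, if_neg (fun h => hW h.2), mul_zero]
  · rw [if_neg (fun h => hS h.1)]
    refine (Finset.sum_eq_zero fun T _ => ?_).symm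
    by_cases h0 : b S T = 0
    · rw [h0]; simp
    · rw [dem_apply, if_neg (fun h => h.1 (((hb S T).1 h0).1 (not_not.1 hS))), mul_zero]

theorem mul_dem {i : Pos n} {b : Strands n} (hb : IsSym i b) (x : Strands n) :
    dem i (x * b) = dem i x * b := by
  ext1 S W
  rw [dem_apply, mul_apply, mul_apply]
  by_cases hW : i.1 + 1 ∉ W.1
  · by_cases hS : i.1 + 1 ∉ S.1
    · rw [if_pos ⟨hS, hW⟩]
      have hsum : ∀ (s : Finset (Idem n)) (f : Idem n → Poly n),
          Poly.dd i (∑ T ∈ s, f T) = ∑ T ∈ s, Poly.dd i (f T) := fun s f =>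
        map_sum (⟨⟨Poly.dd i, Poly.dd_zero⟩, Poly.dd_add⟩ : Poly n →+ Poly n) f s
      rw [hsum]
      refine Finset.sum_congr rfl fun T _ => ?_
      by_cases h0 : b T W = 0
      · rw [h0]; simp [Poly.dd_zero]
      · have hT : i.1 + 1 ∉ T.1 := mt ((hb T W).1 h0).1 hW
        have hs : Poly.swap i (strandMon S T W * b T W) = strandMon S T W * b T W := by
          rw [map_mul, swap_strandMon hS hT hW, (hb T W).2 hT]
        have := Poly.dd_mul hs (x S T)
        rw [dem_apply, if_pos ⟨hS, hT⟩, mul_right_comm, this, mul_right_comm]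
    · rw [if_neg (fun h => hS h.1)]
      refine (Finset.sum_eq_zero fun T _ => ?_).symm
      rw [dem_apply, if_neg (fun h => hS h.1), mul_zero, zero_mul]
  · rw [if_neg (fun h => hW h.2)]
    refine (Finset.sum_eq_zero fun T _ => ?_).symm
    by_cases h0 : b T W = 0
    · rw [h0]; simp
    · rw [dem_apply, if_neg (fun h => h.2 (((hb T W).1 h0).2 (not_not.1 hW))), mul_zero, zero_mul]

theorem isSym_ind {i : Pos n} {p : Idem n → Idem n → Prop} [∀ S T, Decidable (p S T)]
    (h : ∀ S T, p S T → (i.1 + 1 ∈ S.1 ↔ i.1 + 1 ∈ T.1)) : IsSym i (ind p) := by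
  refine fun S T => ⟨fun h0 => h S T ?_, fun _ => ?_⟩
  · by_contra hc; exact h0 (if_neg hc)
  · rw [ind]; split_ifs <;> simp

theorem isSym_R {i : Pos n} {j : ℕ} (h : j ≠ i) (h' : j ≠ i + 1) : IsSym i (R j) :=
  isSym_ind fun _ _ hs => (hs.mem_iff (by omega) (by omega)).symm

theorem isSym_L {i : Pos n} {j : ℕ} (h : j ≠ i) (h' : j ≠ i + 1) : IsSym i (L j) :=
  isSym_ind fun _ _ hs => hs.mem_iff (by omega) (by omega)

theorem ind_mul_ind {p q : Idem n → Idem n → Prop} [∀ S T, Decidable (p S T)]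
    [∀ S T, Decidable (q S T)] (h1 : ∀ {S T W}, p S T → q T W → strandMon S T W = 1)
    {i : Pos n} (h : ∀ S T W, p S T → q T W → i.1 + 1 ∉ S.1 ∧ i.1 + 1 ∉ W.1) :
    IsSym i (ind p * ind q) := by
  refine fun S W => ⟨fun h0 => ?_, fun _ => ?_⟩
  · rw [mul_apply] at h0
    obtain ⟨T, -, hT⟩ := Finset.exists_ne_zero_of_sum_ne_zero h0
    have hp : p S T := by
      by_contra hc; rw [ind, if_neg hc, mul_zero, zero_mul] at hT; exact hT rfl
    have hq : q T W := by
      by_contra hc; rw [ind, ind, if_neg hc, mul_zero] at hT; exact hT rfl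
    have := h S T W hp hq
    exact iff_of_false this.1 this.2
  · rw [mul_apply, map_sum]
    refine Finset.sum_congr rfl fun T _ => ?_
    by_cases hp : p S T
    · by_cases hq : q T W
      · simp [ind, hp, hq, h1 hp hq]
      · simp [ind, hq]
    · simp [ind, hp]

/-- The two moves carry a strand from `i` to `i + 2`. Only the intermediate set contains `i + 1`, so
the product is symmetric although its factors are not. -/
theorem isSym_RR (i : Pos n) : IsSym i (R i * R (i + 1)) :=
  ind_mul_ind (p := fun S T => IsShift i S T) (q := fun S T => IsShift (i + 1) S T) (mon_RR (by omega)) fun _ _ _ h h' => ⟨h.2.1, (isShift_iff'.1 h').2.1⟩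

theorem isSym_LL (i : Pos n) : IsSym i (L (i + 1) * L i) :=
  ind_mul_ind (p := fun S T => IsShift (i + 1) T S) (q := fun S T => IsShift i T S) (mon_LL (by omega)) fun _ _ _ h h' => ⟨(isShift_iff'.1 h).2.1, h'.2.1⟩

theorem isSym_ι (i : Pos n) (S : Idem n) : IsSym i (ι S) :=
  isSym_ind (p := fun A B => A = S ∧ B = S) fun A B h => by rw [h.1, h.2]

/-- The scalar matrix of a polynomial. -/
def scal (p : Poly n) : Strands n := fun A B => if A = B then p else 0

theorem scal_mul_apply (p : Poly n) (x : Strands n) (S T : Idem n) :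
    (scal p * x) S T = p * x S T := by
  rw [mul_apply, Finset.sum_eq_single S]
  · simp [scal]
  · intro W _ hW; simp [scal, hW.symm]
  · simp

theorem isSym_scal {i : Pos n} {p : Poly n} (h : Poly.swap i p = p) : IsSym i (scal p) := by
  refine fun S T => ⟨fun h0 => ?_, fun _ => ?_⟩
  · have : S = T := by by_contra hc; exact h0 (if_neg hc)
    rw [this]
  · rw [scal]; split_ifs
    · exact h
    · simp

theorem u_eq_scal {j : ℕ} (hj : j ∈ Finset.Icc 1 (2 * n)) :
    u j = scal (MvPolynomial.X ⟨j, hj⟩) := by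
  ext1 A B; rw [u, dif_pos hj]; rfl

theorem u_eq_zero {j : ℕ} (hj : j ∉ Finset.Icc 1 (2 * n)) : (u j : Strands n) = 0 := by
  ext1 A B; rw [u, dif_neg hj]; rfl

theorem isSym_zero (i : Pos n) : IsSym i 0 := fun S T => ⟨fun h => absurd rfl h, fun _ => by simp⟩

theorem isSym_u {i : Pos n} {j : ℕ} (h : j ≠ i) (h' : j ≠ i + 1) : IsSym i (u j) := by
  by_cases hj : j ∈ Finset.Icc 1 (2 * n)
  · rw [u_eq_scal hj]; exact isSym_scal (Poly.swap_X i h h')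
  · rw [u_eq_zero hj]; exact isSym_zero i

theorem scal_mul_scal (p q : Poly n) : scal p * scal q = scal (p * q) := by
  ext1 A B; rw [scal_mul_apply]; by_cases h : A = B <;> simp [scal, h]

theorem scal_add (p q : Poly n) : scal p + scal q = scal (p + q) := by
  ext1 A B; by_cases h : A = B <;> simp [scal, h]

theorem isSym_u_add (i : Pos n) : IsSym i (u i + u (i + 1)) := by
  rw [u_eq_scal i.mem, u_eq_scal i.succ_mem, scal_add]
  refine isSym_scal ?_
  rw [map_add]
  exact (congrArg₂ _ (Poly.swap_xl i) (Poly.swap_xr i)).trans (add_comm _ _)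

theorem isSym_u_mul (i : Pos n) : IsSym i (u i * u (i + 1)) := by
  rw [u_eq_scal i.mem, u_eq_scal i.succ_mem, scal_mul_scal]
  refine isSym_scal ?_
  rw [map_mul]
  exact (congrArg₂ _ (Poly.swap_xl i) (Poly.swap_xr i)).trans (mul_comm _ _)

/-- The sum of the idempotents `ι_S` over all `S` that do not contain `i + 1`. -/
def e (i : Pos n) : Strands n := ind fun A B => A = B ∧ i.1 + 1 ∉ A.1

theorem e_mul_apply (i : Pos n) (x : Strands n) (S T : Idem n) :
    (e i * x) S T = if i.1 + 1 ∉ S.1 then x S T else 0 := by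
  rw [mul_apply, Finset.sum_eq_single S]
  · by_cases h : i.1 + 1 ∈ S.1 <;> simp [e, ind, h]
  · intro W _ hW; simp [e, ind, hW.symm]
  · simp

theorem mul_e_apply (i : Pos n) (x : Strands n) (S T : Idem n) :
    (x * e i) S T = if i.1 + 1 ∉ T.1 then x S T else 0 := by
  rw [mul_apply, Finset.sum_eq_single T]
  · by_cases h : i.1 + 1 ∈ T.1 <;> simp [e, ind, h]
  · intro W _ hW; simp [e, ind, hW]
  · simp

/-- This is the twisted product rule for a variable, applied to each entry. The factors `e i`
restrict the undifferentiated term to the block where the operator acts. -/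
theorem dem_u_mul (i : Pos n) (x : Strands n) :
    dem i (u i * x) = e i * x * e i + u (i + 1) * dem i x := by
  ext1 S T
  rw [add_apply, u_mul_apply _ i.succ_mem, dem_apply, dem_apply, u_mul_apply _ i.mem, mul_e_apply,
    e_mul_apply]
  by_cases hS : i.1 + 1 ∈ S.1
  · simp [hS]
  · by_cases hT : i.1 + 1 ∈ T.1
    · simp [hT]
    · simp only [hS, hT, not_false_eq_true, and_self, if_true]
      exact Poly.dd_xl_mul _

theorem dem_dem (i : Pos n) (x : Strands n) : dem i (dem i x) = 0 := by
  ext1 S T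
  simp only [dem_apply]
  split_ifs
  · rw [Poly.dd_dd]; rfl
  · rfl

theorem dem_far {i j : Pos n} (h : i.1 + 2 ≤ j.1) (x : Strands n) :
    dem i (dem j x) = dem j (dem i x) := by
  ext1 S T
  simp only [dem_apply]
  split_ifs <;> simp [Poly.dd_zero, Poly.dd_far h]

theorem dem_braid {i j : Pos n} (h : j.1 = i.1 + 1) (x : Strands n) :
    dem i (dem j (dem i x)) = dem j (dem i (dem j x)) := by
  ext1 S T
  simp only [dem_apply]
  split_ifs <;> simp [Poly.dd_zero, Poly.dd_braid h]

theorem dem_ind {i : Pos n} {p : Idem n → Idem n → Prop} [∀ S T, Decidable (p S T)] :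
    dem i (ind p) = 0 := by
  ext1 S T
  rw [dem_apply, ind]
  have h1 : Poly.dd i (1 : Poly n) = 0 := by
    have := Poly.dd_C (i := i) 1; rwa [MvPolynomial.C_1] at this
  split_ifs <;> simp [Poly.dd_zero, h1]

end Strands

/-! ### The Demazure operator on the quotient algebra -/

namespace Alg

/-- The difference of two representatives has entries in the gap ideals, and the divided differences
of these entries stay there. -/
theorem mk_dem_congr {i : Pos n} {x y : Strands n} (h : mk n x = mk n y) :
    mk n (Strands.dem i x) = mk n (Strands.dem i y) := by
  obtain ⟨z, rfl⟩ : ∃ z, x = y + z := ⟨x - y, by abel⟩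
  rw [map_add, add_eq_left, mk_eq_zero_iff] at h
  rw [Strands.dem_add, map_add, add_eq_left, mk_eq_zero_iff]
  intro S T
  rw [Strands.dem_apply]
  split_ifs with hST
  · exact dd_mem_gapIdeal hST.1 hST.2 (h S T)
  · exact zero_mem _

/-- The Demazure operator of the algebra. -/
def dem (i : Pos n) : Alg n →+ Alg n where
  toFun a := mk n (Strands.dem i (Function.surjInv mk_surjective a))
  map_zero' := by
    refine (mk_dem_congr (y := 0) ?_).trans ?_
    · rw [Function.surjInv_eq mk_surjective, map_zero]
    · rw [mk_eq_zero_iff]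
      intro S T
      rw [Strands.dem_apply]
      split_ifs
      · rw [Strands.zero_apply, Poly.dd_zero]; exact zero_mem _
      · exact zero_mem _
  map_add' a b := by
    rw [← map_add, ← Strands.dem_add]
    refine mk_dem_congr ?_
    simp only [map_add, Function.surjInv_eq mk_surjective]

theorem dem_mk (i : Pos n) (x : Strands n) : dem i (mk n x) = mk n (Strands.dem i x) :=
  mk_dem_congr (Function.surjInv_eq mk_surjective _)

/-- The elements over which the Demazure operator is linear from both sides. -/
def IsSym (i : Pos n) (b : Alg n) : Prop :=
  (∀ x, dem i (b * x) = b * dem i x) ∧ ∀ x, dem i (x * b) = dem i x * b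

theorem isSym_mk {i : Pos n} {b : Strands n} (h : Strands.IsSym i b) : IsSym i (mk n b) := by
  constructor
  all_goals
    intro x
    obtain ⟨x, rfl⟩ := mk_surjective x
    rw [← map_mul, dem_mk, dem_mk, ← map_mul]
  · rw [Strands.dem_mul h]
  · rw [Strands.mul_dem h]

theorem IsSym.add {i : Pos n} {a b : Alg n} (ha : IsSym i a) (hb : IsSym i b) :
    IsSym i (a + b) :=
  ⟨fun x => by rw [add_mul, map_add, ha.1, hb.1, add_mul],
    fun x => by rw [mul_add, map_add, ha.2, hb.2, mul_add]⟩

theorem isSym_zero (i : Pos n) : IsSym i (0 : Alg n) := ⟨fun x => by simp, fun x => by simp⟩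

/-- The generators of the algebra of symmetric elements. -/
inductive SymGen (i : Pos n) : Alg n → Prop
  | ι (S : Idem n) : SymGen i (ι S)
  | u {j : ℕ} (h : j ≠ i) (h' : j ≠ i + 1) : SymGen i (u j)
  | sum : SymGen i (Alg.u i + Alg.u (i + 1))
  | prod : SymGen i (Alg.u i * Alg.u (i + 1))
  | R {j : ℕ} (h : j ≠ i) (h' : j ≠ i + 1) : SymGen i (R j)
  | L {j : ℕ} (h : j ≠ i) (h' : j ≠ i + 1) : SymGen i (L j)
  | RR : SymGen i (Alg.R i * Alg.R (i + 1))
  | LL : SymGen i (Alg.L (i + 1) * Alg.L i)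

theorem SymGen.isSym {i : Pos n} {b : Alg n} (h : SymGen i b) : IsSym i b := by
  induction h with
  | ι S => exact isSym_mk (Strands.isSym_ι i S)
  | u h h' => exact isSym_mk (Strands.isSym_u h h')
  | sum =>
    have := isSym_mk (Strands.isSym_u_add i)
    rwa [map_add] at this
  | prod =>
    have := isSym_mk (Strands.isSym_u_mul i)
    rwa [map_mul] at this
  | R h h' => exact isSym_mk (Strands.isSym_R h h')
  | L h h' => exact isSym_mk (Strands.isSym_L h h')
  | RR =>
    have := isSym_mk (Strands.isSym_RR i)
    rwa [map_mul] at this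
  | LL =>
    have := isSym_mk (Strands.isSym_LL i)
    rwa [map_mul] at this

/-- The sum of the idempotents `ι_S` over all `S` that do not contain `i + 1`. -/
def e (i : Pos n) : Alg n := ∑ S : Idem n, if i.1 + 1 ∈ S.1 then 0 else ι S

theorem ι_mul_e (i : Pos n) (S : Idem n) : ι S * e i = if i.1 + 1 ∈ S.1 then 0 else ι S := by
  rw [e, Finset.mul_sum, Finset.sum_eq_single S]
  · split_ifs
    · simp
    · exact ι_mul_ι S
  · intro T _ hne
    split_ifs
    · simp
    · exact ι_mul_ι_ne hne.symm
  · simp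

theorem e_mul_ι (i : Pos n) (S : Idem n) : e i * ι S = if i.1 + 1 ∈ S.1 then 0 else ι S := by
  rw [e, Finset.sum_mul, Finset.sum_eq_single S]
  · split_ifs
    · simp
    · exact ι_mul_ι S
  · intro T _ hne
    split_ifs
    · simp
    · exact ι_mul_ι_ne hne
  · simp

theorem mk_e (i : Pos n) : mk n (Strands.e i) = e i := by
  have : Strands.e i = ∑ S : Idem n, if i.1 + 1 ∈ S.1 then 0 else Strands.ι S := by
    rw [← mul_one (Strands.e i), Strands.eq_sum_sg (Strands.e i * 1)]
    refine Finset.sum_congr rfl fun S _ => ?_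
    rw [Finset.sum_eq_single S]
    · rw [Strands.e_mul_apply, Strands.one_apply, if_pos rfl]
      split_ifs
      · exact Strands.sg_zero S S
      · rfl
    · intro T _ hT
      rw [Strands.e_mul_apply, Strands.one_apply, if_neg hT.symm, ite_self, Strands.sg_zero]
    · simp
  rw [this, map_sum, e]
  refine Finset.sum_congr rfl fun S _ => ?_
  split_ifs
  · exact map_zero _
  · rfl

theorem ext_ι {a b : Alg n} (h : ∀ S, a * ι S = b * ι S) : a = b := by
  rw [← mul_one a, ← mul_one b, ← sum_ι, Finset.mul_sum, Finset.mul_sum]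
  exact Finset.sum_congr rfl fun S _ => h S

theorem ext_ι' {a b : Alg n} (h : ∀ S, ι S * a = ι S * b) : a = b := by
  rw [← one_mul a, ← one_mul b, ← sum_ι, Finset.sum_mul, Finset.sum_mul]
  exact Finset.sum_congr rfl fun S _ => h S

theorem e_mul_e (i : Pos n) : e i * e i = e i := ext_ι fun S => by
  rw [mul_assoc, e_mul_ι]; split_ifs with h
  · rw [mul_zero]
  · rw [e_mul_ι, if_neg h]

variable (i : Pos n)

theorem R_mul_e : R i * e i = 0 := ext_ι fun S => by
  rw [mul_assoc, e_mul_ι, zero_mul]; split_ifs with h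
  · rw [mul_zero]
  · exact R_mul_ι_zero fun T hT => h ((hT.mem _).2 (Or.inl rfl))

theorem e_mul_R : e i * R i = R i := ext_ι' fun S => by
  rw [← mul_assoc, ι_mul_e]; split_ifs with h
  · rw [zero_mul, ι_mul_R_zero fun T hT => hT.2.1 h]
  · rfl

theorem e_mul_L : e i * L i = 0 := ext_ι' fun S => by
  rw [← mul_assoc, ι_mul_e, mul_zero]; split_ifs with h
  · rw [zero_mul]
  · exact ι_mul_L_zero fun T hT => h ((hT.mem _).2 (Or.inl rfl))

theorem e_mul_R_succ : e i * R (i + 1) = 0 := ext_ι' fun S => by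
  rw [← mul_assoc, ι_mul_e, mul_zero]; split_ifs with h
  · rw [zero_mul]
  · exact ι_mul_R_zero fun T hT => h hT.1

theorem e_mul_L_succ : e i * L (i + 1) = L (i + 1) := ext_ι' fun S => by
  rw [← mul_assoc, ι_mul_e]; split_ifs with h
  · rw [zero_mul, ι_mul_L_zero fun T hT => (isShift_iff'.1 hT).2.1 h]
  · rfl

theorem L_succ_mul_e : L (i + 1) * e i = 0 := ext_ι fun S => by
  rw [mul_assoc, e_mul_ι, zero_mul]; split_ifs with h
  · rw [mul_zero]
  · exact L_mul_ι_zero fun T hT => h hT.1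

/-- Here `1 - e i` is the sum of the idempotents of sets containing `i + 1`, so the relation of the
algebra holds without a choice of idempotent. -/
theorem L_mul_R : L i * R i = u i * (1 - e i) := ext_ι fun S => by
  rw [mul_assoc (u i.1), sub_mul, one_mul, e_mul_ι]
  split_ifs with h
  · rw [sub_zero, L_mul_R_ι i.2.1 h]
  · rw [sub_self, mul_zero, mul_assoc, R_mul_ι_zero, mul_zero]
    exact fun T hT => h ((hT.mem _).2 (Or.inl rfl))

theorem R_mul_L_succ : R (i + 1) * L (i + 1) = u (i + 1) * (1 - e i) := ext_ι fun S => by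
  rw [mul_assoc (u (i.1 + 1)), sub_mul, one_mul, e_mul_ι]
  split_ifs with h
  · rw [sub_zero, R_mul_L_ι h]
  · rw [sub_self, mul_zero, mul_assoc, L_mul_ι_zero, mul_zero]
    exact fun T hT => h hT.1

theorem isSym_e (j : Pos n) : IsSym i (e j) := by
  rw [e]
  refine Finset.sum_induction _ (IsSym i) (fun _ _ => IsSym.add) (isSym_zero i) fun S _ => ?_
  split_ifs
  · exact isSym_zero i
  · exact (SymGen.ι S).isSym

theorem dem_u_mul (x : Alg n) : dem i (u i * x) = e i * x * e i + u (i + 1) * dem i x := by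
  obtain ⟨x, rfl⟩ := mk_surjective x
  rw [u, u, ← mk_e, ← map_mul, dem_mk, dem_mk, Strands.dem_u_mul, map_add, map_mul, map_mul,
    map_mul]

/-- The sum `u_i + u_{i+1}` passes through the operator, so this rule follows from the one for
`u_i`. -/
theorem dem_u_succ_mul (x : Alg n) :
    dem i (u (i + 1) * x) = -(e i * x * e i) + u i * dem i x := by
  have h := (SymGen.sum (i := i)).isSym.1 x
  rw [add_mul, map_add, dem_u_mul, add_mul] at h
  rw [eq_sub_of_add_eq' h]; abel

theorem dem_dem (x : Alg n) : dem i (dem i x) = 0 := by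
  obtain ⟨x, rfl⟩ := mk_surjective x
  rw [dem_mk, dem_mk, Strands.dem_dem, map_zero]

variable {i} in
theorem dem_far {j : Pos n} (h : i.1 + 2 ≤ j.1) (x : Alg n) :
    dem i (dem j x) = dem j (dem i x) := by
  obtain ⟨x, rfl⟩ := mk_surjective x
  simp only [dem_mk, Strands.dem_far h]

variable {i} in
theorem dem_braid {j : Pos n} (h : j.1 = i.1 + 1) (x : Alg n) :
    dem i (dem j (dem i x)) = dem j (dem i (dem j x)) := by
  obtain ⟨x, rfl⟩ := mk_surjective x
  simp only [dem_mk, Strands.dem_braid h]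

theorem dem_one : dem i (1 : Alg n) = 0 := by
  have : (1 : Strands n) = Strands.ind fun S T => S = T := rfl
  rw [← map_one (mk n), dem_mk, this, Strands.dem_ind, map_zero]

theorem dem_R (j : ℕ) : dem i (R j) = 0 := by
  rw [R, dem_mk, Strands.R, Strands.dem_ind, map_zero]

theorem dem_L (j : ℕ) : dem i (L j) = 0 := by
  rw [L, dem_mk, Strands.L, Strands.dem_ind, map_zero]

theorem e_mul_dem (x : Alg n) : e i * dem i x = dem i x := by
  obtain ⟨x, rfl⟩ := mk_surjective x
  rw [dem_mk, ← mk_e, ← map_mul]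
  congr 1
  ext1 S T
  rw [Strands.e_mul_apply, Strands.dem_apply]
  by_cases h1 : i.1 + 1 ∈ S.1 <;> by_cases h2 : i.1 + 1 ∈ T.1 <;> simp [h1, h2]

theorem dem_mul_e (x : Alg n) : dem i x * e i = dem i x := by
  obtain ⟨x, rfl⟩ := mk_surjective x
  rw [dem_mk, ← mk_e, ← map_mul]
  congr 1
  ext1 S T
  rw [Strands.mul_e_apply, Strands.dem_apply]
  by_cases h1 : i.1 + 1 ∈ S.1 <;> by_cases h2 : i.1 + 1 ∈ T.1 <;> simp [h1, h2]

theorem dem_u : dem i (u i) = e i := by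
  have := dem_u_mul i 1
  rwa [mul_one, dem_one, mul_zero, add_zero, mul_one, e_mul_e] at this

theorem dem_u_succ : dem i (u (i + 1)) = -e i := by
  have := dem_u_succ_mul i 1
  rwa [mul_one, dem_one, mul_zero, add_zero, mul_one, e_mul_e] at this

end Alg

open Alg
open scoped ModuleCat

/-! ### The left action on a bimodule -/

section left

variable {M N : Type*} [AddCommGroup M] [Module (Env n) M] [AddCommGroup N] [Module (Env n) N]

/-- The left action on a bimodule. -/
instance (priority := low) leftModule : Module (Alg n) M :=
  Module.compHom M (Env.inl (n := n)).toRingHom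

theorem bi_one_right (a : Alg n) (x : M) : bi a 1 x = a • x := rfl

theorem bi_eq (a b : Alg n) (x : M) : bi a b x = a • bi 1 b x := by
  rw [← bi_one_right, bi_bi, mul_one, mul_one]

theorem bi_smul (a b : Alg n) (x : M) : bi 1 b (a • x) = a • bi 1 b x := by
  rw [← bi_one_right, bi_bi, ← bi_eq, one_mul, one_mul]

theorem bi_sum {κ : Type*} (s : Finset κ) (a b : Alg n) (f : κ → M) :
    bi a b (∑ k ∈ s, f k) = ∑ k ∈ s, bi a b (f k) := Finset.smul_sum

@[simp] theorem map_lsmul (f : M →ₗ[Env n] N) (a : Alg n) (x : M) : f (a • x) = a • f x := by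
  rw [← bi_one_right, map_bi, bi_one_right]

/-- A bimodule homomorphism from an additive map. -/
def homMk (f : M →+ N) (hl : ∀ (a : Alg n) x, f (a • x) = a • f x)
    (hr : ∀ (b : Alg n) x, f (bi 1 b x) = bi 1 b (f x)) : M →ₗ[Env n] N :=
  { f with map_smul' := map_env_smul f fun a b x => by rw [bi_eq, hl, hr, ← bi_eq] }

@[simp] theorem homMk_apply (f : M →+ N) (hl : ∀ (a : Alg n) x, f (a • x) = a • f x)
    (hr : ∀ (b : Alg n) x, f (bi 1 b x) = bi 1 b (f x)) (x : M) : homMk f hl hr x = f x := rfl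

theorem ext_ι_smul {x y : M} (h : ∀ S : Idem n, ι S • x = ι S • y) : x = y := by
  rw [← one_smul (Alg n) x, ← one_smul (Alg n) y, ← sum_ι, Finset.sum_smul, Finset.sum_smul]
  exact Finset.sum_congr rfl fun S _ => h S

end left

theorem algebraMap_smul_eq {M : Bimod n} (q : ℚ) (x : M) : algebraMap ℚ (Alg n) q • x = q • x := by
  have : Env.inl (algebraMap ℚ (Alg n) q) = algebraMap ℚ (Env n) q := AlgHom.commutes _ q
  change Env.inl (algebraMap ℚ (Alg n) q) • x = q • x
  rw [this]
  exact algebraMap_smul (Env n) q x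

/-! ### Spaces of linear maps as bimodules -/

/-- The rational linear maps between two bimodules. -/
def HomQ (L P : Bimod n) : Type := L →ₗ[ℚ] P

namespace HomQ

variable (L P : Bimod n)

instance : AddCommGroup (HomQ L P) := inferInstanceAs (AddCommGroup (L →ₗ[ℚ] P))

instance : Module ℚ (HomQ L P) := inferInstanceAs (Module ℚ (L →ₗ[ℚ] P))

instance : FunLike (HomQ L P) L P := inferInstanceAs (FunLike (L →ₗ[ℚ] P) L P)

instance : AddMonoidHomClass (HomQ L P) L P := inferInstanceAs (AddMonoidHomClass (L →ₗ[ℚ] P) L P)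

/-- The left action through the target. -/
def leftAction : Alg n →ₐ[ℚ] Module.End ℚ (HomQ L P) :=
  AlgHom.ofLinearMap
    ((LinearMap.llcomp ℚ L P P).comp ((Algebra.lsmul ℚ ℚ P).comp Env.inl).toLinearMap)
    (LinearMap.ext fun f => LinearMap.ext fun x => by
      change (1 : Alg n) • f x = f x
      rw [one_smul])
    (fun a b => LinearMap.ext fun f => LinearMap.ext fun x => by
      change (a * b) • f x = a • b • f x
      rw [mul_smul])

/-- The right action through the source. -/
def rightAction : (Alg n)ᵐᵒᵖ →ₐ[ℚ] Module.End ℚ (HomQ L P) :=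
  AlgHom.ofLinearMap
    ((LinearMap.llcomp ℚ L L P).flip.comp
      (((Algebra.lsmul ℚ ℚ L).comp Env.inl).toLinearMap.comp
        (MulOpposite.opLinearEquiv ℚ).symm.toLinearMap))
    (LinearMap.ext fun f => LinearMap.ext fun x => by
      change f ((1 : Alg n) • x) = f x
      rw [one_smul])
    (fun a b => LinearMap.ext fun f => LinearMap.ext fun x => by
      change f ((unop b * unop a) • x) = f (unop b • unop a • x)
      rw [mul_smul])

theorem action_commute (a : Alg n) (b : (Alg n)ᵐᵒᵖ) :
    Commute (leftAction L P a) (rightAction L P b) := rfl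

/-- The bimodule structure `(a f b)(x) = a f(b x)`. -/
instance : Module (Env n) (HomQ L P) :=
  Module.compHom _ (Env.lift _ _ (action_commute L P)).toRingHom

variable {L P}

theorem bi_apply (a b : Alg n) (f : HomQ L P) (x : L) : bi a b f x = a • f (b • x) := by
  change Env.lift _ _ (action_commute L P) (Env.mk a b) f x = _
  rw [Env.lift_mk]; rfl

@[ext] theorem ext {f g : HomQ L P} (h : ∀ x, f x = g x) : f = g := LinearMap.ext h

/-- An additive map between bimodules. -/
def of (f : L →+ P) : HomQ L P := f.toRatLinearMap

@[simp] theorem of_apply (f : L →+ P) (x : L) : of f x = f x := rfl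

theorem add_apply (f g : HomQ L P) (x : L) : (f + g) x = f x + g x := rfl

theorem zero_apply (x : L) : (0 : HomQ L P) x = 0 := rfl

end HomQ

/-- The rational linear maps from the algebra to a bimodule. -/
def HomA (P : Bimod n) : Type := Alg n →ₗ[ℚ] P

namespace HomA

variable (P : Bimod n)

instance : AddCommGroup (HomA P) := inferInstanceAs (AddCommGroup (Alg n →ₗ[ℚ] P))

instance : Module ℚ (HomA P) := inferInstanceAs (Module ℚ (Alg n →ₗ[ℚ] P))

instance : FunLike (HomA P) (Alg n) P := inferInstanceAs (FunLike (Alg n →ₗ[ℚ] P) (Alg n) P)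

instance : AddMonoidHomClass (HomA P) (Alg n) P :=
  inferInstanceAs (AddMonoidHomClass (Alg n →ₗ[ℚ] P) (Alg n) P)

/-- The left action through the source. -/
def leftAction : Alg n →ₐ[ℚ] Module.End ℚ (HomA P) :=
  AlgHom.ofLinearMap
    ((LinearMap.llcomp ℚ (Alg n) (Alg n) P).flip.comp (LinearMap.mul ℚ (Alg n)).flip)
    (LinearMap.ext fun f => LinearMap.ext fun x => by
      change f (x * 1) = f x
      rw [mul_one])
    (fun a b => LinearMap.ext fun f => LinearMap.ext fun x => by
      change f (x * (a * b)) = f (x * a * b)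
      rw [mul_assoc])

/-- The right action through the target. -/
def rightAction : (Alg n)ᵐᵒᵖ →ₐ[ℚ] Module.End ℚ (HomA P) :=
  AlgHom.ofLinearMap
    ((LinearMap.llcomp ℚ (Alg n) P P).comp ((Algebra.lsmul ℚ ℚ P).comp Env.inr).toLinearMap)
    (LinearMap.ext fun f => LinearMap.ext fun x => by
      change bi 1 (1 : Alg n) (f x) = f x
      rw [bi_one])
    (fun a b => LinearMap.ext fun f => LinearMap.ext fun x => by
      change bi 1 (unop b * unop a) (f x) = bi 1 (unop a) (bi 1 (unop b) (f x))
      rw [bi_bi, one_mul])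

theorem action_commute (a : Alg n) (b : (Alg n)ᵐᵒᵖ) :
    Commute (leftAction P a) (rightAction P b) := rfl

/-- The bimodule structure `(a f b)(c) = f(c a) b`. -/
instance : Module (Env n) (HomA P) :=
  Module.compHom _ (Env.lift _ _ (action_commute P)).toRingHom

variable {P}

theorem bi_apply (a b : Alg n) (f : HomA P) (c : Alg n) : bi a b f c = bi 1 b (f (c * a)) := by
  change Env.lift _ _ (action_commute P) (Env.mk a b) f c = _
  rw [Env.lift_mk]; rfl

theorem smul_apply (a : Alg n) (f : HomA P) (c : Alg n) : (a • f) c = f (c * a) := by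
  rw [← bi_one_right, bi_apply, bi_one]

@[ext] theorem ext {f g : HomA P} (h : ∀ x, f x = g x) : f = g := LinearMap.ext h

/-- An additive map from the algebra. -/
def of (f : Alg n →+ P) : HomA P := f.toRatLinearMap

@[simp] theorem of_apply (f : Alg n →+ P) (x : Alg n) : of f x = f x := rfl

theorem add_apply (f g : HomA P) (x : Alg n) : (f + g) x = f x + g x := rfl

theorem zero_apply (x : Alg n) : (0 : HomA P) x = 0 := rfl

end HomA

/-! ### Tensor products -/

section tensor

variable {M N P : Bimod n}

/-- The element `x ⊗ y` of a tensor product over the algebra. -/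
def tm (x : M) (y : N) : tensorObj M N := Submodule.Quotient.mk (OuterTensor.tmul x y)

theorem tm_add (x : M) (y y' : N) : tm x (y + y') = tm x y + tm x y' :=
  congrArg Submodule.Quotient.mk (TensorProduct.tmul_add x y y')

theorem add_tm (x x' : M) (y : N) : tm (x + x') y = tm x y + tm x' y :=
  congrArg Submodule.Quotient.mk (TensorProduct.add_tmul x x' y)

theorem zero_tm (y : N) : tm (0 : M) y = 0 :=
  congrArg Submodule.Quotient.mk (TensorProduct.zero_tmul M y)

theorem tm_zero (x : M) : tm x (0 : N) = 0 :=
  congrArg Submodule.Quotient.mk (TensorProduct.tmul_zero N x)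

theorem smul_tm (a : Alg n) (x : M) (y : N) : a • tm x y = tm (a • x) y := by
  rw [← bi_one_right, ← bi_one_right]
  have := congrArg (Submodule.Quotient.mk (p := OuterTensor.balanced M N))
    (OuterTensor.bi_tmul a 1 x y)
  rw [bi_one] at this
  exact this

theorem bi_tm (b : Alg n) (x : M) (y : N) : bi 1 b (tm x y) = tm x (bi 1 b y) := by
  have := congrArg (Submodule.Quotient.mk (p := OuterTensor.balanced M N))
    (OuterTensor.bi_tmul 1 b x y)
  rw [bi_one] at this
  exact this

theorem tm_balanced (a : Alg n) (x : M) (y : N) : tm (bi 1 a x) y = tm x (a • y) := by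
  rw [← sub_eq_zero]
  exact (Submodule.Quotient.mk_eq_zero _).2 (Submodule.subset_span ⟨x, a, y, rfl⟩)

theorem tensorObj_induction {p : tensorObj M N → Prop} (h : ∀ x y, p (tm x y))
    (hadd : ∀ z w, p z → p w → p (z + w)) (z : tensorObj M N) : p z := by
  obtain ⟨z, rfl⟩ := Submodule.Quotient.mk_surjective _ z
  induction z using TensorProduct.induction_on with
  | zero =>
    have := h 0 0
    rwa [zero_tm] at this
  | tmul x y => exact h x y
  | add z w hz hw => exact hadd _ _ hz hw

/-- A homomorphism out of a tensor product, from a homomorphism to a space of linear maps. -/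
def tensorLift (g : M →ₗ[Env n] HomQ N P)
    (h : ∀ x (b : Alg n) y, g x (bi 1 b y) = bi 1 b (g x y)) : tensorObj M N →ₗ[Env n] P :=
  let G : OuterTensor M N →+ P :=
    (TensorProduct.lift (R := ℚ) (M := M) (N := N) (P₂ := P)
      (AddMonoidHom.toRatLinearMap
        (⟨⟨fun x => (g x : N →ₗ[ℚ] P), map_zero g⟩, map_add g⟩ : M →+ (N →ₗ[ℚ] P)))).toAddMonoidHom
  have hG : ∀ x y, G (OuterTensor.tmul x y) = g x y := fun x y => TensorProduct.lift.tmul _ _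
  let G' : OuterTensor M N →ₗ[Env n] P :=
    { G with
      map_smul' := map_env_smul G fun a b z => by
        have : G.comp (DistribSMul.toAddMonoidHom _ (Env.mk a b)) =
            (DistribSMul.toAddMonoidHom _ (Env.mk a b)).comp G :=
          OuterTensor.addHom_ext fun x y => by
            change G (bi a b (OuterTensor.tmul x y)) = bi a b (G (OuterTensor.tmul x y))
            rw [OuterTensor.bi_tmul, hG, hG, h, map_bi, HomQ.bi_apply, one_smul, bi_smul,
              ← bi_eq]
        exact DFunLike.congr_fun this z }
  Submodule.liftQ _ G' (by
    rw [OuterTensor.balanced, Submodule.span_le]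
    rintro _ ⟨x, a, y, rfl⟩
    rw [SetLike.mem_coe, LinearMap.mem_ker, map_sub, sub_eq_zero]
    change G _ = G _
    rw [hG, hG, map_bi, HomQ.bi_apply, one_smul]; rfl)

theorem tensorLift_tm (g : M →ₗ[Env n] HomQ N P)
    (h : ∀ x (b : Alg n) y, g x (bi 1 b y) = bi 1 b (g x y)) (x : M) (y : N) :
    tensorLift g h (tm x y) = g x y := TensorProduct.lift.tmul _ _

theorem Presented.induction {Z : Type} {r : (Z →₀ Env n) → (Z →₀ Env n) → Prop}
    {p : Presented r → Prop} (h : ∀ (a b : Alg n) z, p (bi a b (Presented.mk r (fterm 1 1 z))))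
    (hadd : ∀ x y, p x → p y → p (x + y)) (h0 : p 0) (x : Presented r) : p x := by
  obtain ⟨w, rfl⟩ := Submodule.Quotient.mk_surjective _ x
  change p (Presented.mk r w)
  induction w using Finsupp.induction_linear with
  | zero => rwa [map_zero]
  | add f g hf hg => rw [map_add]; exact hadd _ _ hf hg
  | single z e =>
    induction Env.mem_span_mk e using AddSubmonoid.closure_induction with
    | mem e he =>
      obtain ⟨a, b, rfl⟩ := he
      rw [← fterm, Presented.mk_fterm]; exact h a b z
    | zero => rwa [Finsupp.single_zero, map_zero]
    | add e e' _ _ h1 h2 => rw [Finsupp.single_add, map_add]; exact hadd _ _ h1 h2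

theorem Presented.lift_mk {Z : Type} (r : (Z →₀ Env n) → (Z →₀ Env n) → Prop)
    {N : Type} [AddCommGroup N] [Module (Env n) N] (y : Z → N)
    (h : ∀ w₁ w₂, r w₁ w₂ →
      Finsupp.linearCombination (Env n) y w₁ = Finsupp.linearCombination (Env n) y w₂) (z : Z) :
    Presented.lift r y h (Presented.mk r (fterm 1 1 z)) = y z := by
  have : Presented.lift r y h (Presented.mk r (fterm 1 1 z)) =
      Finsupp.linearCombination (Env n) y (fterm 1 1 z) := rfl
  rw [this, linearCombination_fterm, bi_one]

end tensor

theorem tm_algebraMap {M N : Bimod n} (q : ℚ) (x : M) (y : N) :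
    tm x (algebraMap ℚ (Alg n) q • y) = algebraMap ℚ (Alg n) q • tm x y := by
  rw [smul_tm, algebraMap_smul_eq, algebraMap_smul_eq]
  have h : OuterTensor.tmul (q • x) y = OuterTensor.tmul x (q • y) := TensorProduct.smul_tmul q x y
  exact (congrArg Submodule.Quotient.mk h).symm

/-! ### Tensoring with the bimodule of the identity braid -/

variable (n) in
/-- The bimodule of the identity braid, as an object of the category of bimodules. -/
abbrev IdB : Bimod n := ModuleCat.of (Env n) (IdBimod n)

/-- The generator `x_S`, as an element of an object of the category of bimodules. -/
def idG (S : Idem n) : IdB n := idGen S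

section identity

variable {L : Bimod n}

theorem ι_smul_idG (S T : Idem n) : ι S • idG T = if S = T then idG T else 0 := by
  have h : ι T • idG T = idG T := by
    have := id_idem_left T 1 1
    rwa [one_mul, bi_one] at this
  split_ifs with e
  · rw [e, h]
  · rw [← h, smul_smul, ι_mul_ι_ne e, zero_smul]

theorem ι_smul_sum_idG (S : Idem n) (l : L) :
    ι S • ∑ T : Idem n, tm (idG T) l = tm (idG S) l := by
  rw [Finset.smul_sum, Finset.sum_eq_single S]
  · rw [smul_tm, ι_smul_idG, if_pos rfl]
  · intro T _ hT; rw [smul_tm, ι_smul_idG, if_neg hT.symm, zero_tm]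
  · simp

/-- The sum of all generators `x_T` commutes with the algebra. It suffices to check algebra
generators after multiplication by one idempotent, where the claim becomes a defining relation of
the identity bimodule. If a move is impossible, both sides vanish. -/
theorem sum_idG_smul (a : Alg n) (l : L) :
    ∑ T : Idem n, tm (idG T) (a • l) = a • ∑ T : Idem n, tm (idG T) l := by
  revert l
  induction a using closure_induction with
  | hq q =>
    intro l
    refine ext_ι_smul (n := n) fun S => ?_
    rw [ι_smul_sum_idG, smul_smul, ← Algebra.commutes, mul_smul, ι_smul_sum_idG,
      tm_algebraMap]
  | hι S =>
    intro l
    refine ext_ι_smul (n := n) fun T => ?_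
    rw [ι_smul_sum_idG, smul_smul, ← tm_balanced]
    by_cases h : T = S
    · subst h
      rw [ι_mul_ι, ι_smul_sum_idG]
      congr 1
      have := id_idem_right T 1 1
      rwa [mul_one, bi_one] at this
    · rw [ι_mul_ι_ne h, zero_smul]
      have := id_idem_right T 1 (ι S)
      rw [ι_mul_ι_ne h, bi_zero_right] at this
      rw [idG, ← this, zero_tm]
  | hu j =>
    intro l
    refine ext_ι_smul (n := n) fun T => ?_
    rw [ι_smul_sum_idG, smul_smul, ← u_comm, mul_smul, ι_smul_sum_idG, ← tm_balanced, smul_tm]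
    congr 1
    have := id_var j T 1 1
    rw [one_mul, mul_one] at this
    exact this.symm
  | hR j =>
    intro l
    refine ext_ι_smul (n := n) fun T => ?_
    rw [ι_smul_sum_idG, smul_smul, ← tm_balanced]
    by_cases h : ∃ T', IsShift j T T'
    · obtain ⟨T', h⟩ := h
      rw [ι_mul_R h, mul_smul, ι_smul_sum_idG, smul_tm]
      congr 1
      have := id_right h 1 1
      rwa [one_mul, mul_one] at this
    · rw [ι_mul_R_zero (not_exists.1 h), zero_smul]
      have := id_idem_right T 1 (R j)
      rw [ι_mul_R_zero (not_exists.1 h), bi_zero_right] at this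
      rw [idG, ← this, zero_tm]
  | hL j =>
    intro l
    refine ext_ι_smul (n := n) fun T => ?_
    rw [ι_smul_sum_idG, smul_smul, ← tm_balanced]
    by_cases h : ∃ T', IsShift j T' T
    · obtain ⟨T', h⟩ := h
      rw [← L_mul_ι h, mul_smul, ι_smul_sum_idG, smul_tm]
      congr 1
      have := id_left h 1 1
      rw [one_mul, mul_one] at this
      exact this.symm
    · rw [ι_mul_L_zero (not_exists.1 h), zero_smul]
      have := id_idem_right T 1 (Alg.L j)
      rw [ι_mul_L_zero (not_exists.1 h), bi_zero_right] at this
      rw [idG, ← this, zero_tm]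
  | hadd a b ha hb =>
    intro l
    simp only [add_smul, tm_add, Finset.sum_add_distrib, ha, hb]
  | hmul a b ha hb => intro l; rw [mul_smul, ha, hb, mul_smul]

/-- A central element `F` satisfies the relations with `ι_S F` in place of `x_S`, so homomorphisms
from the identity bimodule can be built from central elements. -/
theorem idGen_lift_rel {N : Type} [AddCommGroup N] [Module (Env n) N] (F : N)
    (hF : ∀ a : Alg n, bi a 1 F = bi 1 a F) (w₁ w₂ : Idem n →₀ Env n) (h : IdRel w₁ w₂) :
    Finsupp.linearCombination (Env n) (fun S => bi (ι S) 1 F) w₁ =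
      Finsupp.linearCombination (Env n) (fun S => bi (ι S) 1 F) w₂ := by
  have hF' : ∀ a b c : Alg n, bi a (b * c) F = bi (a * b) c F := fun a b c => by
    have := bi_mul (hF b) a c
    rw [one_mul, mul_one] at this
    exact this.symm
  rcases h with S | ⟨S, j⟩ | ⟨j, S, S', h⟩ | ⟨j, S, S', h⟩ <;>
    simp only [linearCombination_fterm, bi_bi, mul_one, one_mul]
  · rw [← mul_one (ι S), hF', mul_one, ι_mul_ι, ι_mul_ι]
  · rw [← mul_one (u j), hF', mul_one, u_comm]
  · rw [← mul_one (L j), hF', mul_one, L_mul_ι h]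
  · rw [← mul_one (R j), hF', mul_one, ι_mul_R h]

variable (L) in
/-- The isomorphism of the tensor product with the bimodule of the identity braid. -/
def idTensorHom : tensorObj (IdB n) L →ₗ[Env n] L :=
  tensorLift (Presented.lift _ (fun S => bi (ι S) 1 (HomQ.of (AddMonoidHom.id L)))
    (idGen_lift_rel _ fun a => HomQ.ext fun x => by simp [HomQ.bi_apply]))
    (fun x b y => by
      induction x using Presented.induction with
      | h a c S =>
        rw [map_bi, Presented.lift_mk, bi_bi, HomQ.bi_apply, HomQ.bi_apply]
        simp [bi_smul]
      | hadd x x' h h' => rw [map_add, HomQ.add_apply, HomQ.add_apply, h, h', bi_add]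
      | h0 => rw [map_zero, HomQ.zero_apply, HomQ.zero_apply, bi_zero])

theorem idTensorHom_tm (S : Idem n) (l : L) : idTensorHom L (tm (idG S) l) = ι S • l := by
  rw [idTensorHom, tensorLift_tm, idG, idGen, Presented.lift_mk, HomQ.bi_apply]
  simp

variable (L) in
/-- The inverse of the isomorphism `idTensorHom`. -/
def idTensorInv : L →ₗ[Env n] tensorObj (IdB n) L :=
  homMk ⟨⟨fun l => ∑ S : Idem n, tm (idG S) l, by simp [tm_zero]⟩,
    fun l l' => by simp [tm_add, Finset.sum_add_distrib]⟩
    (fun a l => sum_idG_smul a l)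
    (fun b l => by
      change ∑ S : Idem n, tm (idG S) (bi 1 b l) = bi 1 b (∑ S : Idem n, tm (idG S) l)
      rw [bi_sum]; simp only [bi_tm])

theorem idTensorInv_apply (l : L) : idTensorInv L l = ∑ S : Idem n, tm (idG S) l := rfl

theorem idTensorHom_inv (l : L) : idTensorHom L (idTensorInv L l) = l := by
  rw [idTensorInv_apply, map_sum]
  simp only [idTensorHom_tm]
  rw [← Finset.sum_smul, sum_ι, one_smul]

theorem idTensorInv_hom (z : tensorObj (IdB n) L) : idTensorInv L (idTensorHom L z) = z := by
  induction z using tensorObj_induction with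
  | h x l =>
    revert l
    induction x using Presented.induction with
    | h a b S =>
      intro l
      change idTensorInv L (idTensorHom L (tm (bi a b (idG S)) l)) = tm (bi a b (idG S)) l
      rw [bi_eq, ← smul_tm, tm_balanced, map_lsmul, map_lsmul, idTensorHom_tm, map_lsmul,
        idTensorInv_apply, ι_smul_sum_idG]
    | hadd x y hx hy => intro l; rw [add_tm, map_add, map_add, hx, hy]
    | h0 => intro l; rw [zero_tm, map_zero, map_zero]
  | hadd z w hz hw => rw [map_add, map_add, hz, hw]

end identity

/-! ### Tensoring with the bimodule of a singular braid -/

/-- The bimodule of the singular braid `X_i`, as an object of the category of bimodules. -/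
abbrev XB (i : Pos n) : Bimod n := ModuleCat.of (Env n) (XBimod i)

/-- The tensor product of the bimodule of `X_i` with a bimodule. -/
abbrev XT (i : Pos n) (L : Bimod n) : Bimod n := tensorObj (XB i) L

/-- The generator `x_{S,S}`, as an element of an object of the category of bimodules. -/
def xG (i : Pos n) (S : Idem n) : XB i := xDiag i S

section generator

variable {i : Pos n} {L : Bimod n}

theorem ι_smul_xG (S T : Idem n) : ι S • xG i T = if S = T then xG i T else 0 := by
  have h : ι T • xG i T = xG i T := by
    have := xDiag_idem_left (i := i) T 1 1
    rwa [one_mul, bi_one] at this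
  split_ifs with e
  · rw [e, h]
  · rw [← h, smul_smul, ι_mul_ι_ne e, zero_smul]

variable (i L) in
/-- The sum of the elements `x_{S,S} ⊗ l` over all `S` that do not contain `i + 1`. -/
def y : L →+ XT i L where
  toFun l := ∑ S : Idem n, if i.1 + 1 ∈ S.1 then 0 else tm (xG i S) l
  map_zero' := Finset.sum_eq_zero fun S _ => by rw [tm_zero, ite_self]
  map_add' l l' := by
    rw [← Finset.sum_add_distrib]
    refine Finset.sum_congr rfl fun S _ => ?_
    split_ifs
    · rw [add_zero]
    · rw [tm_add]

theorem y_apply (l : L) :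
    y i L l = ∑ S : Idem n, if i.1 + 1 ∈ S.1 then 0 else tm (xG i S) l := rfl

theorem ι_smul_y (S : Idem n) (l : L) :
    ι S • y i L l = if i.1 + 1 ∈ S.1 then 0 else tm (xG i S) l := by
  rw [y_apply, Finset.smul_sum, Finset.sum_eq_single S]
  · split_ifs
    · rw [smul_zero]
    · rw [smul_tm, ι_smul_xG, if_pos rfl]
  · intro T _ hT
    split_ifs
    · rw [smul_zero]
    · rw [smul_tm, ι_smul_xG, if_neg hT.symm, zero_tm]
  · simp

theorem y_bi (b : Alg n) (l : L) : y i L (bi 1 b l) = bi 1 b (y i L l) := by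
  rw [y_apply, y_apply, bi_sum]
  refine Finset.sum_congr rfl fun S _ => ?_
  split_ifs
  · rw [bi_zero]
  · rw [bi_tm]

/-- For each generator of the symmetric elements and each row, this is a relation between the
`x_{S,S}`. The products `R_i R_{i+1}` and `L_{i+1} L_i` need the first two corner relations combined
with the relations at the vertex. -/
theorem y_smul {b : Alg n} (hb : SymGen i b) (l : L) : y i L (b • l) = b • y i L l := by
  refine ext_ι_smul (n := n) fun T => ?_
  rw [ι_smul_y]
  have hzero : ∀ c : Alg n, ι T * c = 0 → bi 1 c (xG i T) = 0 := fun c hc => by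
    have := xDiag_idem_right (i := i) T 1 c
    rw [hc, bi_zero_right] at this
    exact this.symm
  -- Rows of sets containing `i + 1` do not occur in `y`, and a symmetric element carries such rows
  -- only to rows of the same kind.
  by_cases hT : i.1 + 1 ∈ T.1
  · rw [if_pos hT, smul_smul]
    have he : ∀ S, i.1 + 1 ∈ S.1 → ι S • y i L l = 0 := fun S hS => by rw [ι_smul_y, if_pos hS]
    cases hb with
    | ι S =>
      by_cases h : T = S
      · subst h; rw [ι_mul_ι, he T hT]
      · rw [ι_mul_ι_ne h, zero_smul]
    | u h h' => rw [← u_comm, mul_smul, he T hT, smul_zero]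
    | sum => rw [mul_add, ← u_comm, ← u_comm, ← add_mul, mul_smul, he T hT, smul_zero]
    | prod =>
      rw [← mul_assoc, ← u_comm i.1 (ι T), mul_assoc, ← u_comm (i.1 + 1) (ι T), ← mul_assoc, mul_smul,
        he T hT, smul_zero]
    | @R j h h' =>
      by_cases hs : ∃ T', IsShift j T T'
      · obtain ⟨T', hs⟩ := hs
        rw [ι_mul_R hs, mul_smul, he T' ((hs.mem_iff (by omega) (by omega)).2 hT), smul_zero]
      · rw [ι_mul_R_zero (not_exists.1 hs), zero_smul]
    | @L j h h' =>
      by_cases hs : ∃ T', IsShift j T' T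
      · obtain ⟨T', hs⟩ := hs
        rw [← L_mul_ι hs, mul_smul, he T' ((hs.mem_iff (by omega) (by omega)).1 hT), smul_zero]
      · rw [ι_mul_L_zero (not_exists.1 hs), zero_smul]
    | RR => rw [← mul_assoc, ι_mul_R_zero fun T' hs => hs.2.1 hT, zero_mul, zero_smul]
    | LL =>
      rw [← mul_assoc, ι_mul_L_zero fun T' hs => (isShift_iff'.1 hs).2.1 hT, zero_mul, zero_smul]
  · rw [if_neg hT, smul_smul, ← tm_balanced]
    have he : ∀ S, i.1 + 1 ∉ S.1 → ι S • y i L l = tm (xG i S) l := fun S hS => by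
      rw [ι_smul_y, if_neg hS]
    -- This covers the symmetric elements that move no strand: a relation passes them through
    -- `x_{T,T}`, and they commute with `ι T`.
    have key : ∀ c d : Alg n, bi 1 c (xDiag i T) = bi d 1 (xDiag i T) → ι T * c = d * ι T →
        tm (bi 1 c (xG i T)) l = (ι T * c) • y i L l := by
      intro c d h1 h2
      rw [h2, mul_smul, he T hT, smul_tm]
      exact congrArg (fun z => tm z l) h1
    cases hb with
    | ι S =>
      by_cases h : T = S
      · subst h
        rw [ι_mul_ι, he T hT]
        congr 1
        have := xDiag_idem_right (i := i) T 1 1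
        rwa [mul_one, bi_one] at this
      · rw [ι_mul_ι_ne h, zero_smul, hzero _ (ι_mul_ι_ne h), zero_tm]
    | @u j h h' =>
      refine key _ (Alg.u j) ?_ (u_comm _ _).symm
      have := xDiag_var h h' T 1 1
      rw [one_mul, mul_one] at this
      exact this.symm
    | sum =>
      refine key _ (Alg.u i + Alg.u (i + 1)) ?_ ?_
      · have := xDiag_sum (i := i) T 1 1
        simp only [one_mul, mul_one, ← bi_add_left, ← bi_add_right] at this
        exact this.symm
      · rw [mul_add, ← u_comm, ← u_comm, add_mul]
    | prod =>
      refine key _ (Alg.u i * Alg.u (i + 1)) ?_ ?_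
      · have := xDiag_prod (i := i) T 1 1
        simp only [one_mul, mul_one] at this
        exact this.symm
      · rw [← mul_assoc, ← u_comm i.1 (ι T), mul_assoc, ← u_comm (i.1 + 1) (ι T), ← mul_assoc]
    | @R j h h' =>
      by_cases hs : ∃ T', IsShift j T T'
      · obtain ⟨T', hs⟩ := hs
        rw [ι_mul_R hs, mul_smul, he T' (mt (hs.mem_iff (by omega) (by omega)).1 hT), smul_tm]
        have := xDiag_right h h' hs 1 1
        rw [one_mul, mul_one] at this
        exact congrArg (fun z => tm z l) this
      · rw [ι_mul_R_zero (not_exists.1 hs), hzero _ (ι_mul_R_zero (not_exists.1 hs)), zero_tm,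
          zero_smul]
    | @L j h h' =>
      by_cases hs : ∃ T', IsShift j T' T
      · obtain ⟨T', hs⟩ := hs
        rw [← L_mul_ι hs, mul_smul, he T' (mt (hs.mem_iff (by omega) (by omega)).2 hT), smul_tm]
        have := xDiag_left h h' hs 1 1
        rw [one_mul, mul_one] at this
        exact congrArg (fun z => tm z l) this.symm
      · rw [ι_mul_L_zero (not_exists.1 hs), hzero _ (ι_mul_L_zero (not_exists.1 hs)), zero_tm,
          zero_smul]
    | RR =>
      have hz : ι T * (Alg.R i * Alg.R (i + 1)) = 0 →
          tm (bi 1 (Alg.R i * Alg.R (i + 1)) (xG i T)) l =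
            (ι T * (Alg.R i * Alg.R (i + 1))) • y i L l := fun h => by
        rw [h, hzero _ h, zero_tm, zero_smul]
      by_cases hs : ∃ T', IsShift i T T'
      · obtain ⟨T', hs⟩ := hs
        by_cases hs' : ∃ T'', IsShift (i + 1) T' T''
        · obtain ⟨T'', hs'⟩ := hs'
          rw [← mul_assoc, ι_mul_R hs, mul_assoc, ι_mul_R hs', ← mul_assoc, mul_smul,
            he T'' (isShift_iff'.1 hs').2.1, smul_tm]
          have := xDiag_corner₁ hs hs' 1 1
          rw [one_mul, mul_one] at this
          exact congrArg (fun z => tm z l) this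
        · refine hz ?_
          rw [← mul_assoc, ι_mul_R hs, mul_assoc, ι_mul_R_zero (not_exists.1 hs'), mul_zero]
      · refine hz ?_
        rw [← mul_assoc, ι_mul_R_zero (not_exists.1 hs), zero_mul]
    | LL =>
      have hz : ι T * (Alg.L (i + 1) * Alg.L i) = 0 →
          tm (bi 1 (Alg.L (i + 1) * Alg.L i) (xG i T)) l =
            (ι T * (Alg.L (i + 1) * Alg.L i)) • y i L l := fun h => by
        rw [h, hzero _ h, zero_tm, zero_smul]
      by_cases hs' : ∃ T', IsShift (i + 1) T' T
      · obtain ⟨T', hs'⟩ := hs'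
        by_cases hs : ∃ T'', IsShift i T'' T'
        · obtain ⟨T'', hs⟩ := hs
          rw [← mul_assoc, ← L_mul_ι hs', mul_assoc, ← L_mul_ι hs, ← mul_assoc, mul_smul,
            he T'' hs.2.1, smul_tm]
          have := xDiag_corner₂ hs hs' 1 1
          rw [one_mul, mul_one] at this
          exact congrArg (fun z => tm z l) this.symm
        · refine hz ?_
          rw [← mul_assoc, ← L_mul_ι hs', mul_assoc, ι_mul_L_zero (not_exists.1 hs), mul_zero]
      · refine hz ?_
        rw [← mul_assoc, ι_mul_L_zero (not_exists.1 hs'), zero_mul]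

theorem e_smul_y (l : L) : e i • y i L l = y i L l := by
  refine ext_ι_smul (n := n) fun T => ?_
  rw [smul_smul, ι_mul_e, ι_smul_y]
  by_cases h : i.1 + 1 ∈ T.1
  · rw [if_pos h, if_pos h, zero_smul]
  · rw [if_neg h, if_neg h, ι_smul_y, if_neg h]

theorem y_e_smul (j : Pos n) (l : L) : y i L (e j • l) = e j • y i L l := by
  rw [e, Finset.sum_smul, Finset.sum_smul, map_sum]
  refine Finset.sum_congr rfl fun S _ => ?_
  split_ifs
  · rw [zero_smul, zero_smul, map_zero]
  · rw [y_smul (SymGen.ι S)]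

theorem y_e (l : L) : y i L (e i • l) = y i L l := by rw [y_e_smul, e_smul_y]

/-- A path whose top end is `i + 1` comes from a top end `i` by a factor `R_i`, which is absorbed
into `L`. A path whose bottom end is `i + 1` comes from a bottom end `i` by a factor `L_i`, which
remains on the left. -/
theorem tm_xGen (Z : XCycle i) (l : L) : ∃ (a : Alg n) (l' : L),
    tm (M := XB i) (xGen Z) l = a • y i L l' := by
  have hx : ∀ {S : Idem n} (h : i.1 + 1 ∉ S.1) (l : L), tm (xG i S) l = ι S • y i L l := by
    intro S h l; rw [ι_smul_y, if_neg h]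
  have hd : ∀ {S : Idem n} (h : i.1 + 1 ∉ S.1), ∃ h', xG i S = xGen (diag S h') := by
    intro S h
    have h' : ¬ ({i.1, i.1 + 1} ⊆ S.1) := fun e => h (pair_subset.1 e).2
    exact ⟨h', xDiag_eq h'⟩
  have hb : ∀ {Z : XCycle i} (_ : i.1 + 1 ∉ Z.b.1) (l : L), ∃ l' : L,
      tm (M := XB i) (xGen Z) l = tm (xG i Z.b) l' := by
    intro Z h1 l
    obtain ⟨h', hxG⟩ := hd h1
    by_cases h2 : i.1 + 1 ∈ Z.t.1
    · have hs := Z.shift h1 h2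
      have := xGen_rel (XRel.top (diag Z.b h') Z rfl hs)
      rw [bi_one] at this
      refine ⟨(Alg.R i : Alg n) • l, ?_⟩
      rw [hxG, ← tm_balanced]
      exact congrArg (fun z => tm (M := XB i) z l) this.symm
    · have : Z = diag Z.b h' := by
        have := Z.eq_of_notMem h1 h2
        cases Z; simp_all [diag]
      exact ⟨l, by rw [hxG, ← this]⟩
  by_cases h1 : i.1 + 1 ∈ Z.b.1
  · have hi : i.1 ∉ Z.b.1 := fun h => Z.not_both h h1
    obtain ⟨P, hP⟩ := exists_shift' h1 hi i.2.1
    have hsd : P.1 \ {i.1, i.1 + 1} = Z.t.1 \ {i.1, i.1 + 1} := by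
      rw [← Z.sdiff]
      ext x; simp only [Finset.mem_sdiff, hP.mem, Finset.mem_insert, Finset.mem_singleton]; tauto
    let Z' : XCycle i := ⟨P, Z.t, hsd, fun h => hP.2.1 (pair_subset.1 h).2⟩
    have := xGen_rel (XRel.bottom Z' Z hP rfl)
    rw [bi_one] at this
    obtain ⟨l', hl'⟩ := hb (Z := Z') hP.2.1 l
    refine ⟨Alg.L i * ι P, l', ?_⟩
    rw [mul_smul, ← hx hP.2.1]
    have h3 : tm (M := XB i) (xGen Z) l = (Alg.L i : Alg n) • tm (M := XB i) (xGen Z') l := by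
      rw [smul_tm]; exact congrArg (fun z => tm (M := XB i) z l) this.symm
    rw [h3, hl']
  · obtain ⟨l', hl'⟩ := hb h1 l
    exact ⟨ι Z.b, l', by rw [hl', hx h1]⟩

theorem XT_induction {p : XT i L → Prop} (h : ∀ (a : Alg n) l, p (a • y i L l))
    (hadd : ∀ z w, p z → p w → p (z + w)) (z : XT i L) : p z := by
  induction z using tensorObj_induction with
  | h x l =>
    revert l
    induction x using Presented.induction with
    | h a b Z =>
      intro l
      obtain ⟨c, l', hl⟩ := tm_xGen Z (b • l)
      have : tm (M := XB i) (bi a b (xGen Z)) l = (a * c) • y i L l' := by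
        have h1 : (bi a b (xGen Z) : XB i) = a • bi 1 b (xGen Z) := bi_eq a b (xGen Z)
        rw [h1, ← smul_tm, mul_smul, ← hl]
        congr 1
        exact tm_balanced (M := XB i) b (xGen Z) l
      change p (tm (M := XB i) (bi a b (xGen Z)) l)
      rw [this]; exact h _ _
    | hadd x x' hx hx' => intro l; rw [add_tm]; exact hadd _ _ (hx l) (hx' l)
    | h0 => intro l; rw [zero_tm]; simpa using h 0 0
  | hadd z w hz hw => exact hadd _ _ hz hw

theorem XT_hom_ext {P : Type*} [AddCommGroup P] [Module (Env n) P] {f g : XT i L →ₗ[Env n] P}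
    (h : ∀ l, f (y i L l) = g (y i L l)) : f = g := by
  refine LinearMap.ext fun z => ?_
  induction z using XT_induction with
  | h a l => rw [map_lsmul, map_lsmul, h]
  | hadd z w hz hw => rw [map_add, map_add, hz, hw]

end generator

/-! ### The universal property of the tensor product with the bimodule of a singular braid -/

section lift

/-- The left factor of the generator of a cycle with bottom ends `S`. -/
def lam (i : Pos n) (S : Idem n) : Alg n := if i.1 + 1 ∈ S.1 then ι S * L i else ι S

/-- The right factor of the generator of a cycle with top ends `S`. -/
def rho (i : Pos n) (S : Idem n) : Alg n := if i.1 + 1 ∈ S.1 then R i * ι S else ι S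

variable {i : Pos n}

theorem XCycle.not_both_top (Z : XCycle i) (h : i.1 ∈ Z.t.1) : i.1 + 1 ∉ Z.t.1 := fun h' => by
  by_cases hb : i.1 + 1 ∈ Z.b.1
  · exact Z.not_both (Z.eq_of_mem hb h' ▸ h) hb
  · exact (isShift_iff'.1 (Z.shift hb h')).2.1 h

/-- The only neighbouring move not excluded by the first two hypotheses is the one from `i - 1`. It
would fill slot `i` next to the occupied slot `i + 1`, and no cycle has such an end set. -/
theorem far_of_mem {j : ℕ} {S S' : Idem n} (h1 : j ≠ i) (h2 : j ≠ i + 1) (h : IsShift j S S')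
    (hS' : i.1 ∈ S'.1 → i.1 + 1 ∉ S'.1) (hS : i.1 + 1 ∈ S.1) : i.1 + 2 ≤ j ∨ j + 2 ≤ i.1 := by
  have : j + 1 ≠ i := fun e => hS' (e ▸ (h.mem _).2 (Or.inl rfl))
    ((h.mem_iff (by omega) (by omega)).2 hS)
  omega

theorem L_mul_lam {j : ℕ} {S S' : Idem n} (h1 : j ≠ i) (h2 : j ≠ i + 1) (h : IsShift j S S')
    (hS' : i.1 ∈ S'.1 → i.1 + 1 ∉ S'.1) : L j * lam i S = lam i S' * L j := by
  have m : i.1 + 1 ∈ S'.1 ↔ i.1 + 1 ∈ S.1 := h.mem_iff (by omega) (by omega)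
  by_cases hS : i.1 + 1 ∈ S.1
  · rw [lam, lam, if_pos hS, if_pos (m.2 hS), ← mul_assoc, L_mul_ι h, mul_assoc, mul_assoc,
      L_comm_L (far_of_mem h1 h2 h hS' hS)]
  · rw [lam, lam, if_neg hS, if_neg (mt m.1 hS), L_mul_ι h]

theorem L_mul_rho {j : ℕ} {S S' : Idem n} (h1 : j ≠ i) (h2 : j ≠ i + 1) (h : IsShift j S S')
    (hS' : i.1 ∈ S'.1 → i.1 + 1 ∉ S'.1) : L j * rho i S = rho i S' * L j := by
  have m : i.1 + 1 ∈ S'.1 ↔ i.1 + 1 ∈ S.1 := h.mem_iff (by omega) (by omega)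
  by_cases hS : i.1 + 1 ∈ S.1
  · rw [rho, rho, if_pos hS, if_pos (m.2 hS), ← mul_assoc, ← R_comm_L
      (far_of_mem h1 h2 h hS' hS), mul_assoc, L_mul_ι h, mul_assoc]
  · rw [rho, rho, if_neg hS, if_neg (mt m.1 hS), L_mul_ι h]

theorem lam_mul_R {j : ℕ} {S S' : Idem n} (h1 : j ≠ i) (h2 : j ≠ i + 1) (h : IsShift j S S')
    (hS' : i.1 ∈ S'.1 → i.1 + 1 ∉ S'.1) : lam i S * R j = R j * lam i S' := by
  have m : i.1 + 1 ∈ S'.1 ↔ i.1 + 1 ∈ S.1 := h.mem_iff (by omega) (by omega)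
  by_cases hS : i.1 + 1 ∈ S.1
  · rw [lam, lam, if_pos hS, if_pos (m.2 hS), mul_assoc, ← R_comm_L
      (far_of_mem h1 h2 h hS' hS).symm, ← mul_assoc, ι_mul_R h, mul_assoc]
  · rw [lam, lam, if_neg hS, if_neg (mt m.1 hS), ι_mul_R h]

theorem rho_mul_R {j : ℕ} {S S' : Idem n} (h1 : j ≠ i) (h2 : j ≠ i + 1) (h : IsShift j S S')
    (hS' : i.1 ∈ S'.1 → i.1 + 1 ∉ S'.1) : rho i S * R j = R j * rho i S' := by
  have m : i.1 + 1 ∈ S'.1 ↔ i.1 + 1 ∈ S.1 := h.mem_iff (by omega) (by omega)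
  by_cases hS : i.1 + 1 ∈ S.1
  · rw [rho, rho, if_pos hS, if_pos (m.2 hS), mul_assoc, ι_mul_R h, ← mul_assoc,
      R_comm_R (far_of_mem h1 h2 h hS' hS), mul_assoc]
  · rw [rho, rho, if_neg hS, if_neg (mt m.1 hS), ι_mul_R h]

theorem ι_mul_lam (S : Idem n) : ι S * lam i S = lam i S := by
  rw [lam]; split_ifs
  · rw [← mul_assoc, ι_mul_ι]
  · rw [ι_mul_ι]

theorem rho_mul_ι (S : Idem n) : rho i S * ι S = rho i S := by
  rw [rho]; split_ifs
  · rw [mul_assoc, ι_mul_ι]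
  · rw [ι_mul_ι]

/-- The generator of a cycle is `λ x ρ` for a single symmetric `x`, where `λ` and `ρ` move the path
from slot `i` to its ends. Hence an `F` that commutes with `SymGen` satisfies all relations; the
corner relations use exactly that `R_i R_{i+1}` and `L_{i+1} L_i` are symmetric. -/
theorem xGen_lift_rel {N : Type} [AddCommGroup N] [Module (Env n) N] (F : N)
    (hF : ∀ b : Alg n, SymGen i b → bi b 1 F = bi 1 b F) (w₁ w₂ : XCycle i →₀ Env n)
    (h : XRel i w₁ w₂) :
    Finsupp.linearCombination (Env n) (fun Z : XCycle i => bi (lam i Z.b) (rho i Z.t) F) w₁ =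
      Finsupp.linearCombination (Env n) (fun Z : XCycle i => bi (lam i Z.b) (rho i Z.t) F) w₂ := by
  have hF' : ∀ {b : Alg n}, SymGen i b → ∀ a c, bi (a * b) c F = bi a (b * c) F :=
    fun hb a c => by simpa using bi_mul (hF _ hb) a c
  have hc : ∀ {c : Alg n}, SymGen i c → (∀ x, c * x = x * c) → ∀ a b,
      bi (c * a) b F = bi a (b * c) F := fun h h' a b => by rw [h', hF' h, h']
  rcases h with Z | ⟨Z, j, h1, h2⟩ | Z | Z | ⟨j, Z, Z', h1, h2, hb, ht⟩ |
    ⟨j, Z, Z', h1, h2, hb, ht⟩ | ⟨Z, Z', hb, ht⟩ | ⟨Z, Z', hb, ht⟩ | ⟨Z, Z', hb, ht, h1, h2⟩ |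
    ⟨Z, Z', hb, ht, h1, h2⟩ | ⟨Z, Z', hb, ht⟩ | ⟨Z, Z', hb, ht⟩ <;>
  simp only [linearCombination_fterm, bi_bi, mul_one, one_mul]
  · rw [ι_mul_lam, rho_mul_ι]
  · exact hc (SymGen.u h1 h2) (u_comm j) _ _
  · exact hc SymGen.sum (fun x => by rw [add_mul, mul_add, u_comm, u_comm (i + 1)]) _ _
  · exact hc SymGen.prod (fun x => by
      rw [mul_assoc, u_comm (i + 1), ← mul_assoc, u_comm i, mul_assoc]) _ _
  · rw [L_mul_lam h1 h2 hb Z'.not_both, hF' (SymGen.L h1 h2), L_mul_rho h1 h2 ht Z'.not_both_top]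
  · rw [rho_mul_R h1 h2 ht Z'.not_both_top, ← hF' (SymGen.R h1 h2),
      lam_mul_R h1 h2 hb Z'.not_both]
  · rw [ht, lam, lam, if_neg hb.2.1, if_pos ((hb.mem _).2 (Or.inl rfl)), L_mul_ι hb]
  · rw [hb, rho, rho, if_neg ht.2.1, if_pos ((ht.mem _).2 (Or.inl rfl)), ι_mul_R ht]
  · have e1 := Z.not_both hb
    have e3 : i.1 + 1 ∉ Z'.t.1 := (isShift_iff'.1 ht).2.1
    rw [lam, lam, rho, rho, if_neg e1, if_neg h2, if_pos ht.1, if_neg e3, mul_assoc, ι_mul_R ht,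
      ← mul_assoc, ← hF' SymGen.RR, ← mul_assoc, ι_mul_R (Z.shift e1 ht.1), mul_assoc (R i.1),
      ι_mul_R ht, Z'.eq_of_notMem h2 e3, ← mul_assoc]
  · have e2 : i.1 + 1 ∉ Z.t.1 := Z.not_both_top ht
    have e3 : i.1 + 1 ∉ Z'.t.1 := fun e => h1 (Z'.shift h2 e).1
    rw [lam, lam, rho, rho, if_pos hb.1, if_neg h2, if_neg e2, if_neg e3, ← mul_assoc, L_mul_ι hb,
      mul_assoc, hF' SymGen.LL, mul_assoc, L_mul_ι (Z.shift' hb.1 e2), ← mul_assoc, L_mul_ι hb,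
      Z'.eq_of_notMem h2 e3, mul_assoc]
  -- For a path between the right ends, `L_{i+1} L_i` first passes through `F` and then meets `R_i`.
  -- The product `L_i R_i` produces the factor `u_i` of the relation.
  · have e3 : i.1 + 1 ∉ Z'.b.1 := (isShift_iff'.1 hb).2.1
    have e4 : i.1 + 1 ∉ Z'.t.1 := (isShift_iff'.1 ht).2.1
    rw [lam, lam, rho, rho, if_pos hb.1, if_pos ht.1, if_neg e3, if_neg e4, ← mul_assoc,
      L_mul_ι hb, mul_assoc, hF' SymGen.LL, mul_assoc, ← mul_assoc (L i.1), L_mul_R_ι i.2.1 ht.1,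
      u_comm, ← mul_assoc, L_mul_ι ht, mul_assoc, ← u_comm]
  · have e3 : i.1 + 1 ∉ Z'.b.1 := (isShift_iff'.1 hb).2.1
    have e4 : i.1 + 1 ∉ Z'.t.1 := (isShift_iff'.1 ht).2.1
    rw [lam, lam, rho, rho, if_pos hb.1, if_pos ht.1, if_neg e3, if_neg e4, mul_assoc, ι_mul_R ht,
      ← mul_assoc, ← hF' SymGen.RR, mul_assoc (ι Z.b), ← mul_assoc (L i.1), ← mul_assoc,
      ι_mul_L_mul_R i.2.1 hb.1, mul_assoc, ι_mul_R hb, ← mul_assoc, u_comm]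

variable {L P : Bimod n}

/-- The homomorphism from the tensor product with the bimodule of `X_i` that sends `y l` to
`f l`. -/
def xLift (f : L →+ P) (hs : ∀ b : Alg n, SymGen i b → ∀ l, f (b • l) = b • f l)
    (hr : ∀ (b : Alg n) l, f (bi 1 b l) = bi 1 b (f l)) : XT i L →ₗ[Env n] P :=
  tensorLift (M := XB i) (Presented.lift _
    (fun Z : XCycle i => bi (lam i Z.b) (rho i Z.t) (HomQ.of f))
    (xGen_lift_rel _ fun b hb => HomQ.ext fun x => by simp [HomQ.bi_apply, hs b hb]))
    (fun x b l => by
      induction x using Presented.induction with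
      | h a c Z =>
        rw [map_bi, Presented.lift_mk, bi_bi, HomQ.bi_apply, HomQ.bi_apply]
        simp [bi_smul, ← hr]
      | hadd x x' h h' => rw [map_add, HomQ.add_apply, HomQ.add_apply, h, h', bi_add]
      | h0 => rw [map_zero, HomQ.zero_apply, HomQ.zero_apply, bi_zero])

theorem map_e_smul {f : L →+ P} (hs : ∀ b : Alg n, SymGen i b → ∀ l, f (b • l) = b • f l)
    (j : Pos n) (l : L) : f (e j • l) = e j • f l := by
  rw [e, Finset.sum_smul, Finset.sum_smul, map_sum]
  refine Finset.sum_congr rfl fun S _ => ?_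
  split_ifs
  · rw [zero_smul, zero_smul, map_zero]
  · rw [hs _ (SymGen.ι S)]

/-- The factor `e i` is unavoidable, since `y` sums only over sets avoiding `i + 1` and hence
satisfies `y (e i • l) = y l`. -/
theorem xLift_y (f : L →+ P) (hs : ∀ b : Alg n, SymGen i b → ∀ l, f (b • l) = b • f l)
    (hr : ∀ (b : Alg n) l, f (bi 1 b l) = bi 1 b (f l)) (l : L) :
    xLift f hs hr (y i L l) = f (e i • l) := by
  rw [map_e_smul hs, y_apply, map_sum, e, Finset.sum_smul]
  refine Finset.sum_congr rfl fun S _ => ?_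
  by_cases h : i.1 + 1 ∈ S.1
  · rw [if_pos h, if_pos h, map_zero, zero_smul]
  · have h' : ¬ ({i.1, i.1 + 1} ⊆ S.1) := fun e => h (pair_subset.1 e).2
    rw [if_neg h, if_neg h, xLift, tensorLift_tm, xG, xDiag_eq h', xGen, Presented.lift_mk,
      HomQ.bi_apply]
    have h1 : lam i S = ι S := if_neg h
    have h2 : rho i S = ι S := if_neg h
    change bi (lam i S) 1 (f (bi (rho i S) 1 l)) = _
    rw [h1, h2, bi_one_right, bi_one_right, hs _ (SymGen.ι S), smul_smul, ι_mul_ι]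

end lift

/-! ### The structure maps -/

section maps

variable (i : Pos n) (L : Bimod n)

/-- The homomorphism induced by `d⁻`. -/
def dM : XT i L →ₗ[Env n] L :=
  (idTensorHom L).comp (tensorMap (ModuleCat.ofHom (dMinus i)) (𝟙 L)).hom

/-- The homomorphism induced by `d⁺`. -/
def dP : L →ₗ[Env n] XT i L :=
  (tensorMap (ModuleCat.ofHom (dPlus i)) (𝟙 L)).hom.comp (idTensorInv L)

variable {i L}

theorem dM_y (l : L) : dM i L (y i L l) = e i • l := by
  rw [y_apply, map_sum, e, Finset.sum_smul]
  refine Finset.sum_congr rfl fun S _ => ?_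
  by_cases h : i.1 + 1 ∈ S.1
  · rw [if_pos h, if_pos h, map_zero, zero_smul]
  · have h' : ¬ ({i.1, i.1 + 1} ⊆ S.1) := fun e => h (pair_subset.1 e).2
    rw [if_neg h, if_neg h, ← idTensorHom_tm]
    change idTensorHom L (tm (M := IdB n) (dMinus i (xDiag i S)) l) = _
    have : dMinus i (xDiag i S) = idG S := by
      rw [xDiag_eq h', xGen, dMinus, Presented.lift_mk, dMinusGen]
      exact (if_neg h).trans (if_neg h)
    rw [this]

theorem dP_eq_sum (l : L) :
    dP i L l = ∑ S : Idem n, tm (M := XB i) (dPlusGen i S) l := by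
  change (tensorMap (ModuleCat.ofHom (dPlus i)) (𝟙 L)).hom (∑ S : Idem n, tm (idG S) l) = _
  rw [map_sum]
  refine Finset.sum_congr rfl fun S _ => ?_
  change tm (M := XB i) (dPlus i (idGen S)) l = _
  rw [idGen, dPlus, Presented.lift_mk]

theorem ι_smul_dP (T : Idem n) (l : L) :
    ι T • dP i L l = tm (M := XB i) (dPlusGen i T) l := by
  have h : ∀ T, (ι T : Alg n) • (dPlusGen i T : XB i) = dPlusGen i T := fun T => by
    have := dPlusGen_idem_left (i := i) T 1 1
    rwa [one_mul, bi_one] at this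
  rw [dP_eq_sum, Finset.smul_sum, Finset.sum_eq_single T]
  · rw [smul_tm, h]
  · intro S _ hS
    rw [smul_tm, ← h S, smul_smul, ι_mul_ι_ne hS.symm, zero_smul, zero_tm]
  · simp

/-- The first two terms occupy the rows avoiding `i + 1`, the last two the rows containing it, which
are reached from the former by `L_i` and `R_{i+1}`. In this shape `d⁺` is the Casimir element of the
Demazure pairing. -/
theorem dP_apply (l : L) : dP i L l = y i L (u (n := n) i • l) - u (n := n) (i + 1) • y i L l +
    (Alg.L (n := n) i • y i L (R (n := n) i • l) -
      R (n := n) (i + 1) • y i L (Alg.L (n := n) (i + 1) • l)) := by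
  have hbi : ∀ a b S (l : L), a • tm (xG i S) (b • l) =
      tm (M := XB i) (bi a b (xDiag i S)) l := fun a b S l => by
    rw [smul_tm, ← tm_balanced, ← bi_one_right, bi_bi, one_mul, one_mul]; rfl
  have hsub : ∀ x x' : XB i, tm (x - x') l = tm x l - tm x' l := fun x x' => by
    rw [eq_sub_iff_add_eq, ← add_tm, sub_add_cancel]
  refine ext_ι_smul (n := n) fun T => ?_
  rw [ι_smul_dP, smul_add, smul_sub, smul_sub, ι_smul_y, smul_smul, ← u_comm, mul_smul, ι_smul_y,
    smul_smul, smul_smul]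
  by_cases h : i.1 + 1 ∈ T.1
  · rw [if_pos h, if_pos h, smul_zero, sub_zero, zero_add]
    have h1 : (ι T * Alg.L i) • y i L (R (n := n) i • l) = tm (M := XB i) (xDiag i T) l := by
      -- If both `i` and `i + 1` are occupied there is no cycle, and correspondingly no strand can
      -- be moved by `L_i`.
      by_cases h0 : i.1 ∈ T.1
      · rw [ι_mul_L_zero, zero_smul, xDiag_zero h0 h]
        · exact (zero_tm l).symm
        · exact fun S hS => (isShift_iff'.1 hS).2.1 h0
      · obtain ⟨S, hS⟩ := exists_shift' h h0 i.2.1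
        rw [← L_mul_ι hS, mul_smul, ι_smul_y, if_neg hS.2.1, hbi]
        have := xDiag_shift hS 1 1
        rw [one_mul, mul_one, bi_one] at this
        rw [this]
    rw [h1]
    by_cases hT : ∃ S, IsShift (i + 1) T S
    · obtain ⟨S, hS⟩ := hT
      rw [ι_mul_R hS, mul_smul, ι_smul_y, if_neg (isShift_iff'.1 hS).2.1, hbi,
        dPlusGen_of_shift hS]
      exact hsub _ _
    · rw [ι_mul_R_zero (not_exists.1 hT), zero_smul, sub_zero,
        dPlusGen_of_no_shift h (not_exists.1 hT)]
  · rw [if_neg h, if_neg h, ι_mul_L_zero (fun S hS => h ((hS.mem _).2 (Or.inl rfl))),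
      ι_mul_R_zero (fun S hS => h hS.1), zero_smul, zero_smul, sub_zero, add_zero,
      dPlusGen_of_notMem h]
    have h1 := hbi 1 (u i) T l
    have h2 := hbi (u (i + 1)) 1 T l
    rw [one_smul] at h1 h2
    rw [h1, h2]
    exact hsub _ _

/-- The functoriality of the tensor product with the bimodule of `X_i`. -/
def xMap (i : Pos n) {L L' : Bimod n} (f : L →ₗ[Env n] L') : XT i L →ₗ[Env n] XT i L' :=
  (tensorMap (𝟙 (XB i)) (ModuleCat.ofHom f)).hom

theorem xMap_y {L' : Bimod n} (f : L →ₗ[Env n] L') (l : L) :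
    xMap i f (y i L l) = y i L' (f l) := by
  rw [y_apply, y_apply, map_sum]
  refine Finset.sum_congr rfl fun S _ => ?_
  split_ifs
  · rw [map_zero]
  · rfl

theorem xMap_comp {L' L'' : Bimod n} (g : L' →ₗ[Env n] L'') (f : L →ₗ[Env n] L') :
    xMap i (g.comp f) = (xMap i g).comp (xMap i f) :=
  XT_hom_ext fun l => by simp [xMap_y]

theorem xMap_id : xMap i (LinearMap.id : L →ₗ[Env n] L) = LinearMap.id :=
  XT_hom_ext fun l => by simp [xMap_y]

theorem dM_natural {L' : Bimod n} (f : L →ₗ[Env n] L') (x : XT i L) :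
    dM i L' (xMap i f x) = f (dM i L x) := by
  have : (dM i L').comp (xMap i f) = f.comp (dM i L) :=
    XT_hom_ext fun l => by simp [xMap_y, dM_y]
  exact LinearMap.congr_fun this x

theorem dP_natural {L' : Bimod n} (f : L →ₗ[Env n] L') (l : L) :
    dP i L' (f l) = xMap i f (dP i L l) := by
  simp only [dP_apply, map_add, map_sub, map_lsmul, xMap_y]

/-- The terms with `L_i R_i` and `R_{i+1} L_{i+1}` contribute multiples of `1 - e i`, which complete
the multiples of `e i` from the first two terms. -/
theorem dM_dP (l : L) : dM i L (dP i L l) = (u (n := n) i - u (n := n) (i + 1)) • l := by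
  simp only [dP_apply, map_add, map_sub, map_lsmul, dM_y, smul_smul]
  rw [← u_comm, e_mul_R, L_mul_R, e_mul_L_succ, R_mul_L_succ, ← sub_smul, ← sub_smul, ← add_smul]
  congr 1
  noncomm_ring

/-! ### The Demazure pairing, multiplication and comultiplication -/

variable (i L) in
/-- The Demazure pairing. -/
def ev : XT i L →ₗ[Env n] HomA L :=
  xLift (P := ModuleCat.of (Env n) (HomA L))
    ⟨⟨fun l => HomA.of ⟨⟨fun c => dem i c • l, by simp⟩, fun c c' => by simp [add_smul]⟩,
        HomA.ext fun c => smul_zero _⟩,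
      fun l l' => HomA.ext fun c => smul_add _ _ _⟩
    (fun b hb l => HomA.ext fun c => by
      change dem i c • b • l = (b • HomA.of _ : HomA L) c
      rw [HomA.smul_apply, smul_smul, ← hb.isSym.2]; rfl)
    (fun b l => HomA.ext fun c => by
      change dem i c • bi 1 b l = (bi 1 b (HomA.of _) : HomA L) c
      rw [HomA.bi_apply, mul_one, ← bi_smul]; rfl)

theorem ev_y (l : L) (c : Alg n) : ev i L (y i L l) c = dem i c • l := by
  rw [ev, xLift_y]
  change dem i c • e i • l = _
  rw [smul_smul, dem_mul_e]

theorem ev_smul (a : Alg n) (x : XT i L) (c : Alg n) : ev i L (a • x) c = ev i L x (c * a) := by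
  rw [map_lsmul, HomA.smul_apply]

theorem ev_smul_y (a : Alg n) (l : L) (c : Alg n) :
    ev i L (a • y i L l) c = dem i (c * a) • l := by
  rw [ev_smul, ev_y]

theorem ev_add (x x' : XT i L) (c : Alg n) : ev i L (x + x') c = ev i L x c + ev i L x' c := by
  rw [map_add, HomA.add_apply]

theorem ev_mul {b : Alg n} (hb : IsSym i b) (x : XT i L) (c : Alg n) :
    ev i L x (b * c) = b • ev i L x c := by
  induction x using XT_induction with
  | h a l => rw [ev_smul_y, ev_smul_y, mul_assoc, hb.1, mul_smul]
  | hadd x x' h h' => rw [ev_add, ev_add, h, h', smul_add]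

theorem ev_bi (b : Alg n) (x : XT i L) (c : Alg n) :
    ev i L (bi 1 b x) c = bi 1 b (ev i L x c) := by
  rw [map_bi, HomA.bi_apply, mul_one]

theorem ev_natural {L' : Bimod n} (f : L →ₗ[Env n] L') (x : XT i L) (c : Alg n) :
    ev i L' (xMap i f x) c = f (ev i L x c) := by
  induction x using XT_induction with
  | h a l => rw [map_lsmul, xMap_y, ev_smul_y, ev_smul_y, map_lsmul]
  | hadd x x' h h' => rw [map_add, ev_add, ev_add, h, h', map_add]

variable (i L) in
/-- The multiplication. -/
def mu : XT i (XT i L) →ₗ[Env n] XT i L :=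
  xLift ⟨⟨fun w => y i L (ev i L w 1), by rw [map_zero, HomA.zero_apply, map_zero]⟩,
      fun w w' => by
        change y i L (ev i L (w + w') 1) = _
        rw [ev_add, map_add]⟩
    (fun b hb w => by
      change y i L (ev i L (b • w) 1) = b • y i L (ev i L w 1)
      rw [ev_smul, one_mul, ← mul_one b, ev_mul hb.isSym, mul_one, y_smul hb])
    (fun b w => by
      change y i L (ev i L (bi 1 b w) 1) = bi 1 b (y i L (ev i L w 1))
      rw [ev_bi, y_bi])

theorem mu_y (w : XT i L) : mu i L (y i (XT i L) w) = y i L (ev i L w 1) := by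
  rw [mu, xLift_y]
  change y i L (ev i L (e i • w) 1) = _
  rw [ev_smul, one_mul, ← mul_one (e i), ev_mul (isSym_e i i), y_e]

variable (i L) in
/-- The comultiplication. -/
def sig : XT i L →ₗ[Env n] XT i (XT i L) :=
  xLift ((y i (XT i L)).comp (y i L))
    (fun b hb l => by
      change y i _ (y i L (b • l)) = b • y i _ (y i L l)
      rw [y_smul hb, y_smul hb])
    (fun b l => by
      change y i _ (y i L (bi 1 b l)) = bi 1 b (y i _ (y i L l))
      rw [y_bi, y_bi])

theorem sig_y (l : L) : sig i L (y i L l) = y i (XT i L) (y i L l) := by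
  rw [sig, xLift_y]
  change y i _ (y i L (e i • l)) = _
  rw [y_e]

theorem mu_natural {L' : Bimod n} (f : L →ₗ[Env n] L') (x : XT i (XT i L)) :
    mu i L' (xMap i (xMap i f) x) = xMap i f (mu i L x) := by
  have : (mu i L').comp (xMap i (xMap i f)) = (xMap i f).comp (mu i L) :=
    XT_hom_ext fun l => by simp [xMap_y, mu_y, ev_natural]
  exact LinearMap.congr_fun this x

theorem sig_natural {L' : Bimod n} (f : L →ₗ[Env n] L') (x : XT i L) :
    sig i L' (xMap i f x) = xMap i (xMap i f) (sig i L x) := by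
  have : (sig i L').comp (xMap i f) = (xMap i (xMap i f)).comp (sig i L) :=
    XT_hom_ext fun l => by simp [xMap_y, sig_y]
  exact LinearMap.congr_fun this x

/-! ### The relations between the structure maps -/

theorem R_smul_y (l : L) : R (n := n) i • y i L l = 0 := by
  rw [← e_smul_y, smul_smul, R_mul_e, zero_smul]

theorem L_succ_smul_y (l : L) : Alg.L (n := n) (i + 1) • y i L l = 0 := by
  rw [← e_smul_y, smul_smul, L_succ_mul_e, zero_smul]

theorem y_L_smul (l : L) : y i L (Alg.L (n := n) i • l) = 0 := by
  rw [← y_e, smul_smul, e_mul_L, zero_smul, map_zero]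

theorem y_R_succ_smul (l : L) : y i L (R (n := n) (i + 1) • l) = 0 := by
  rw [← y_e, smul_smul, e_mul_R_succ, zero_smul, map_zero]

theorem y_u_succ_smul (l : L) : y i L (u (n := n) (i + 1) • l) =
    (u (n := n) i + u (n := n) (i + 1)) • y i L l - y i L (u (n := n) i • l) := by
  rw [← y_smul SymGen.sum, add_smul, map_add, add_sub_cancel_left]

theorem dP_y (l : L) : dP i (XT i L) (y i L l) =
    y i _ (u (n := n) i • y i L l) - u (n := n) (i + 1) • y i _ (y i L l) := by
  rw [dP_apply, R_smul_y, L_succ_smul_y, map_zero, smul_zero, smul_zero, sub_zero, add_zero]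

/-- On a generator only the term with `u_i` survives, because the operator sends `u_i` to `e i` and
`1` to zero. This is a unit law for the multiplication, and it makes the Casimir expansion possible.
-/
theorem mu_dP (w : XT i L) : mu i L (dP i (XT i L) w) = w := by
  have : (mu i L).comp (dP i (XT i L)) = LinearMap.id := XT_hom_ext fun l => by
    rw [LinearMap.comp_apply, dP_y, map_sub, map_lsmul, mu_y, mu_y, ev_smul, one_mul, ev_y, ev_y,
      dem_u, dem_one, zero_smul, map_zero, smul_zero, sub_zero, y_e]; rfl
  exact LinearMap.congr_fun this w

/-- The expansion of an element of the tensor product in terms of its Demazure pairings. -/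
theorem casimir (w : XT i L) : w = y i L (ev i L w (u i)) - u (n := n) (i + 1) • y i L (ev i L w 1) +
    (Alg.L (n := n) i • y i L (ev i L w (R i)) -
      R (n := n) (i + 1) • y i L (ev i L w (Alg.L (i + 1)))) := by
  -- The unit law followed by the formula for `d⁺` expresses every element through its four
  -- pairings.
  conv_lhs => rw [← mu_dP w, dP_apply]
  simp only [map_add, map_sub, map_lsmul, mu_y, HomA.smul_apply, one_mul]

/-- This is nondegeneracy of the pairing, read off from the expansion. All later well-definedness
arguments rest on it. -/
theorem ev_eq_zero {w : XT i L} (h1 : ev i L w 1 = 0) (h2 : ev i L w (u i) = 0)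
    (h3 : ev i L w (R i) = 0) (h4 : ev i L w (Alg.L (i + 1)) = 0) : w = 0 := by
  rw [casimir w, h1, h2, h3, h4]
  simp only [map_zero, smul_zero, sub_zero, add_zero]

/-- The pairing with `1` is a direct computation. A general `c` is moved into `l`, because `d⁺`
commutes with the left action. -/
theorem ev_dP (l : L) (c : Alg n) : ev i L (dP i L l) c = (e i * c) • l := by
  have h1 : ∀ l : L, ev i L (dP i L l) 1 = e i • l := fun l => by
    have hsub : ∀ x x' : XT i L, ev i L (x - x') 1 = ev i L x 1 - ev i L x' 1 := fun x x' => by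
      rw [eq_sub_iff_add_eq, ← ev_add, sub_add_cancel]
    rw [dP_apply, ev_add, hsub, hsub, ev_y, ev_smul_y, ev_smul_y, ev_smul_y, one_mul, one_mul,
      one_mul, dem_one, dem_u_succ, dem_L, dem_R, zero_smul, zero_smul, zero_smul, neg_smul]
    abel
  rw [← one_mul c, ← ev_smul, ← map_lsmul, h1, one_mul, smul_smul]

theorem mu_xMap_dP (x : XT i L) : mu i L (xMap i (dP i L) x) = x := by
  have : (mu i L).comp (xMap i (dP i L)) = LinearMap.id := XT_hom_ext fun l => by
    rw [LinearMap.comp_apply, xMap_y, mu_y, ev_dP, mul_one, y_e]; rfl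
  exact LinearMap.congr_fun this x

theorem xMap_dM_sig (x : XT i L) : xMap i (dM i L) (sig i L x) = x := by
  have : (xMap i (dM i L)).comp (sig i L) = LinearMap.id := XT_hom_ext fun l => by
    rw [LinearMap.comp_apply, sig_y, xMap_y, dM_y, y_e]; rfl
  exact LinearMap.congr_fun this x

theorem dM_sig (x : XT i L) : dM i (XT i L) (sig i L x) = x := by
  have : (dM i (XT i L)).comp (sig i L) = LinearMap.id := XT_hom_ext fun l => by
    rw [LinearMap.comp_apply, sig_y, dM_y, e_smul_y]; rfl
  exact LinearMap.congr_fun this x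

/-- The multiplication applies the Demazure operator to `1`. This vanishing makes the retraction in
the second Reidemeister move strict. -/
theorem mu_sig (x : XT i L) : mu i L (sig i L x) = 0 := by
  have : (mu i L).comp (sig i L) = 0 := XT_hom_ext fun l => by
    rw [LinearMap.comp_apply, sig_y, mu_y, ev_y, dem_one, zero_smul, map_zero]; rfl
  exact LinearMap.congr_fun this x

/-- In the Casimir expansion of the inner factor, the terms with `L_i` and `R_{i+1}` are killed by
the outer `y`. Two families of generators are left, of the kind that a basis of polynomials over
symmetric polynomials would give. -/
theorem XXT_hom_ext {P : Type*} [AddCommGroup P] [Module (Env n) P]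
    {f g : XT i (XT i L) →ₗ[Env n] P}
    (h1 : ∀ l, f (y i _ (y i L l)) = g (y i _ (y i L l)))
    (h2 : ∀ l, f (y i _ (u (n := n) (i + 1) • y i L l)) =
      g (y i _ (u (n := n) (i + 1) • y i L l))) : f = g := by
  refine XT_hom_ext fun w => ?_
  rw [casimir w]
  simp only [map_add, map_sub, y_L_smul, y_R_succ_smul, sub_zero, add_zero, h1, h2]

theorem mu_y_u_y (l : L) : mu i L (y i _ (u (n := n) (i + 1) • y i L l)) = -y i L l := by
  rw [mu_y, ev_smul_y, one_mul, dem_u_succ, neg_smul, map_neg, y_e]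

/-- This says that `mu` and `sig` contract `X_i X_i` up to the correction on the right. On the first
family of generators `mu` vanishes, and on the second it is `-y`. The identity is the one nontrivial
component of the homotopy for a positive crossing followed by a negative one. -/
theorem dP_mu_add (w : XT i (XT i L)) :
    dP i (XT i L) (mu i L w) + sig i L (xMap i (dM i L) w) =
      w + sig i L (dP i L (dM i L (mu i L w))) := by
  have : (dP i (XT i L)).comp (mu i L) + (sig i L).comp (xMap i (dM i L)) =
      LinearMap.id + (sig i L).comp ((dP i L).comp ((dM i L).comp (mu i L))) := by
    refine XXT_hom_ext (fun l => ?_) (fun l => ?_)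
    · simp only [LinearMap.add_apply, LinearMap.comp_apply, LinearMap.id_apply]
      rw [← sig_y, mu_sig, xMap_dM_sig]
      simp
    · simp only [LinearMap.add_apply, LinearMap.comp_apply, LinearMap.id_apply]
      rw [mu_y_u_y, map_neg, map_neg, map_neg, map_neg, dP_y, xMap_y, map_lsmul, dM_y, smul_smul,
        u_comm, mul_smul, y_e, sig_y, dP_apply]
      simp only [map_add, map_sub, map_lsmul, sig_y, smul_smul, R_mul_e, L_succ_mul_e, zero_smul,
        map_zero, smul_zero]
      rw [u_comm, mul_smul, y_e, y_e, y_u_succ_smul, y_u_succ_smul, map_sub,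
        y_smul SymGen.sum]
      abel
  exact LinearMap.congr_fun this w

/-- The counterpart with inner and outer structure maps exchanged, for a negative crossing followed
by a positive one. -/
theorem xMap_dP_mu_add (w : XT i (XT i L)) :
    xMap i (dP i L) (mu i L w) + sig i L (dM i (XT i L) w) =
      w + sig i L (dP i L (dM i L (mu i L w))) := by
  have : (xMap i (dP i L)).comp (mu i L) + (sig i L).comp (dM i (XT i L)) =
      LinearMap.id + (sig i L).comp ((dP i L).comp ((dM i L).comp (mu i L))) := by
    refine XXT_hom_ext (fun l => ?_) (fun l => ?_)
    · simp only [LinearMap.add_apply, LinearMap.comp_apply, LinearMap.id_apply]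
      rw [← sig_y, mu_sig, dM_sig]
      simp
    · simp only [LinearMap.add_apply, LinearMap.comp_apply, LinearMap.id_apply]
      rw [mu_y_u_y, map_neg, map_neg, map_neg, map_neg, xMap_y, dM_y, smul_smul,
        ← u_comm, mul_smul, e_smul_y, map_lsmul, sig_y, dM_y, ← y_e (dP i L l), ← map_lsmul,
        dP_apply]
      simp only [map_add, map_sub, map_lsmul, sig_y, smul_smul, R_mul_e, L_succ_mul_e, zero_smul,
        map_zero, smul_zero]
      rw [u_comm, mul_smul, y_e, y_e]
      abel
  exact LinearMap.congr_fun this w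

end maps

/-! ### Homomorphisms given by graphs -/

/-- This defines a homomorphism on generators whose relations are not known explicitly.
Single-valuedness need only be checked above zero, where a nondegenerate pairing applies. -/
theorem exists_hom_of_graph {A P Q : Type*} [Ring A] [AddCommGroup P] [AddCommGroup Q] [Module A P]
    [Module A Q] (G : Submodule A (P × Q)) (h1 : ∀ p, ∃ q, (p, q) ∈ G)
    (h2 : ∀ q, (0, q) ∈ G → q = 0) : ∃ f : P →ₗ[A] Q, ∀ p q, (p, q) ∈ G → f p = q := by
  choose F hF using h1
  have key : ∀ p q, (p, q) ∈ G → F p = q := fun p q h => by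
    have := G.sub_mem (hF p) h
    rw [Prod.mk_sub_mk, sub_self] at this
    exact sub_eq_zero.1 (h2 _ this)
  exact ⟨⟨⟨F, fun p p' => key _ _ (G.add_mem (hF p) (hF p'))⟩,
    fun a p => key _ _ (G.smul_mem a (hF p))⟩, key⟩

theorem Env.mk_one_injective : Function.Injective fun a : Alg n => Env.mk a 1 := by
  -- The inclusion of a tensor factor is injective when the scalars embed in the other factor, which
  -- requires a nontrivial algebra.
  cases subsingleton_or_nontrivial (Alg n)
  · exact Function.injective_of_subsingleton _
  · exact Algebra.TensorProduct.includeLeft_injective (R := ℚ) (S := ℚ) (A := Alg n)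
      (B := (Alg n)ᵐᵒᵖ) (algebraMap ℚ (Alg n)ᵐᵒᵖ).injective

/-- The Demazure operators before and after a move. -/
theorem Alg.L_mul_dem_R_mul (j : Pos n) (x : Alg n) :
    L j * dem j (R j * x) = R (j + 1) * dem j (L (j + 1) * x) + (1 - e j) * x * e j := by
  -- The identity is the Casimir expansion of `x • y 1` in the free bimodule of rank one, pushed
  -- forward by `d⁻`. Comparing multiples of `1` gives an equation in the algebra.
  let N : Bimod n := ModuleCat.of (Env n) (Env n)
  have h := congrArg (dM j N) (casimir (i := j) (L := N) (x • y j N (1 : Env n)))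
  simp only [map_add, map_sub, map_lsmul, HomA.smul_apply, dM_y, ev_y, smul_smul] at h
  have h1 : ∀ a : Alg n, a • (1 : N) = Env.mk a 1 := fun a => mul_one _
  rw [← mul_assoc, ← sub_smul, ← sub_smul, ← add_smul, h1, h1] at h
  have h2 := Env.mk_one_injective h
  simp only [one_mul, mul_assoc, e_mul_dem, dem_u_mul, mul_add] at h2
  rw [← mul_assoc (e j) (e j), e_mul_e, ← mul_assoc (e j) (u _), ← u_comm, mul_assoc, e_mul_dem]
    at h2
  rw [sub_mul, one_mul, sub_mul]
  simp only [mul_assoc]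
  rw [add_sub_cancel_right, ← sub_eq_iff_eq_add'] at h2
  rw [h2]; abel

section maps

variable {a b : Pos n} {L : Bimod n}

/-- The sum `u_a + u_{a+1}` is symmetric, so either variable may serve as a test element. Triple
products need `u_{a+1}` for one of the two orders of adjacent crossings. -/
theorem ev_eq_zero' {w : XT a L} (h1 : ev a L w 1 = 0) (h2 : ev a L w (u (a + 1)) = 0)
    (h3 : ev a L w (R a) = 0) (h4 : ev a L w (Alg.L (a + 1)) = 0) : w = 0 := by
  refine ev_eq_zero h1 ?_ h3 h4
  have h := ev_mul (SymGen.sum (i := a)).isSym w 1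
  rwa [mul_one, map_add, h1, smul_zero, h2, add_zero] at h

theorem casimir' (w : XT a L) : w = u (n := n) a • y a L (ev a L w 1) - y a L (ev a L w (u (a + 1))) +
    (Alg.L (n := n) a • y a L (ev a L w (R a)) -
      R (n := n) (a + 1) • y a L (ev a L w (Alg.L (a + 1)))) := by
  have h := congrArg (y a L) (ev_mul (SymGen.sum (i := a)).isSym w 1)
  rw [mul_one, map_add, map_add, y_smul SymGen.sum, add_smul] at h
  conv_lhs => rw [casimir w]
  rw [eq_sub_of_add_eq h]; abel

/-! ### Distant strands -/

/-- `X_a` and `X_b` have no strand in common. -/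
def Far (a b : Pos n) : Prop := a.1 + 2 ≤ b.1 ∨ b.1 + 2 ≤ a.1

theorem Far.symm (h : Far a b) : Far b a := Or.symm h

theorem Far.dem (h : Far a b) (x : Alg n) : dem a (dem b x) = dem b (dem a x) :=
  h.elim (fun h => dem_far h x) (fun h => (dem_far h x).symm)

/-- The coefficients in the Casimir expansion for `b` are symmetric for `a`, so they can be moved
out to the left. -/
theorem Far.mem_span (h : Far a b) (w : XT a (XT b L)) :
    w ∈ Submodule.span (Env n) (Set.range fun l : L => y a _ (y b L l)) := by
  have hz : ∀ l, y a _ (y b L l) ∈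
      Submodule.span (Env n) (Set.range fun l : L => y a _ (y b L l)) :=
    fun l => Submodule.subset_span ⟨l, rfl⟩
  induction w using XT_induction with
  | h c v =>
    refine Submodule.smul_mem _ (Env.mk c 1) ?_
    rw [casimir v, map_add, map_sub, map_sub, y_smul (SymGen.u _ _), y_smul (SymGen.L _ _),
      y_smul (SymGen.R _ _)]
    · exact add_mem (sub_mem (hz _) (Submodule.smul_mem _ (Env.mk _ 1) (hz _)))
        (sub_mem (Submodule.smul_mem _ (Env.mk _ 1) (hz _))
          (Submodule.smul_mem _ (Env.mk _ 1) (hz _)))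
    all_goals rcases h with h | h <;> omega
  | hadd w w' h h' => exact add_mem h h'

theorem ev_ev_bi (c d : Alg n) (w : XT a (XT b L)) (x t : Alg n) :
    ev b L (ev a _ (bi c d w) x) t = bi 1 d (ev b L (ev a _ w (x * c)) t) := by
  rw [map_bi, HomA.bi_apply, ev_bi]

/-- The test elements for `b` are symmetric for `a`. They can be absorbed into the argument of the
outer pairing, so the iterated pairing with `1` already detects zero. -/
theorem Far.eq_zero (h : Far a b) {w : XT a (XT b L)}
    (hw : ∀ c, ev b L (ev a _ w c) 1 = 0) : w = 0 := by
  have key : ∀ t : Alg n, IsSym a t → ∀ c, ev b L (ev a _ w c) t = 0 := fun t ht c => by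
    have : ∀ w : XT a (XT b L), ∀ c, ev b L (ev a _ w c) t = ev b L (ev a _ w (t * c)) 1 := by
      intro w c
      rw [ev_mul ht, ev_smul, one_mul]
    rw [this, hw]
  have hc : ∀ c, ev a _ w c = 0 := fun c => by
    refine ev_eq_zero ?_ ?_ ?_ ?_
    · exact hw c
    · exact key _ (SymGen.u (by rcases h with h | h <;> omega)
        (by rcases h with h | h <;> omega)).isSym c
    · exact key _ (SymGen.R (by rcases h with h | h <;> omega)
        (by rcases h with h | h <;> omega)).isSym c
    · exact key _ (SymGen.L (by rcases h with h | h <;> omega)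
        (by rcases h with h | h <;> omega)).isSym c
  exact ev_eq_zero (hc _) (hc _) (hc _) (hc _)

/-- The graph is generated by pairs of corresponding generators. It is single-valued because the
iterated pairings of the two components agree. -/
theorem Far.exists_hom (h : Far a b) (L : Bimod n) :
    ∃ f : XT a (XT b L) →ₗ[Env n] XT b (XT a L), ∀ l, f (y a _ (y b L l)) = y b _ (y a L l) := by
  let G : Submodule (Env n) (XT a (XT b L) × XT b (XT a L)) :=
    Submodule.span (Env n) (Set.range fun l : L => (y a _ (y b L l), y b _ (y a L l)))
  have hG : ∀ l : L, (y a _ (y b L l), y b _ (y a L l)) ∈ G :=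
    fun l => Submodule.subset_span ⟨l, rfl⟩
  -- On generators this is the commutation of the two Demazure operators, and it extends to the
  -- submodule since both pairings respect the bimodule action in the same way.
  have hev : ∀ p ∈ G, ∀ c, ev b L (ev a _ p.1 c) 1 = ev a L (ev b _ p.2 c) 1 := by
    intro p hp
    induction hp using Submodule.span_induction with
    | mem x hx =>
      obtain ⟨l, rfl⟩ := hx
      intro c
      rw [ev_y, ev_smul_y, ev_y, ev_smul_y, one_mul, one_mul, h.dem]
    | zero => intro c; simp [HomA.zero_apply]
    | add x x' _ _ h h' =>
      intro c
      rw [Prod.fst_add, Prod.snd_add, ev_add, ev_add, ev_add, ev_add, h, h']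
    | smul t x _ h =>
      revert x
      induction Env.mem_span_mk t using AddSubmonoid.closure_induction with
      | mem t ht =>
        obtain ⟨r, s, rfl⟩ := ht
        intro x _ h c
        change ev b L (ev a _ (bi r s x.1) c) 1 = ev a L (ev b _ (bi r s x.2) c) 1
        rw [ev_ev_bi, ev_ev_bi, h]
      | zero => intro x _ _ c; simp [HomA.zero_apply]
      | add t t' _ _ h h' =>
        intro x hx hx' c
        rw [add_smul, Prod.fst_add, Prod.snd_add, ev_add, ev_add, ev_add, ev_add, h x hx hx',
          h' x hx hx']
  obtain ⟨f, hf⟩ := exists_hom_of_graph G (fun p => by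
    induction h.mem_span p using Submodule.span_induction with
    | mem x hx => obtain ⟨l, rfl⟩ := hx; exact ⟨_, hG l⟩
    | zero => exact ⟨0, G.zero_mem⟩
    | add x x' _ _ h h' =>
      obtain ⟨q, hq⟩ := h; obtain ⟨q', hq'⟩ := h'; exact ⟨_, G.add_mem hq hq'⟩
    | smul t x _ h => obtain ⟨q, hq⟩ := h; exact ⟨_, G.smul_mem t hq⟩)
    (fun q hq => h.symm.eq_zero fun c => by
      rw [← hev _ hq c]; simp [HomA.zero_apply])
  exact ⟨f, fun l => hf _ _ (hG l)⟩

theorem Far.hom_ext (h : Far a b) {P : Type*} [AddCommGroup P] [Module (Env n) P]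
    {f g : XT a (XT b L) →ₗ[Env n] P} (hfg : ∀ l, f (y a _ (y b L l)) = g (y a _ (y b L l))) :
    f = g :=
  LinearMap.ext fun w => LinearMap.eqOn_span (by rintro _ ⟨l, rfl⟩; exact hfg l) (h.mem_span w)

/-- The exchange of two distant singular crossings. -/
def Far.swap (h : Far a b) (L : Bimod n) : XT a (XT b L) →ₗ[Env n] XT b (XT a L) :=
  (h.exists_hom L).choose

theorem Far.swap_y (h : Far a b) (l : L) :
    h.swap L (y a _ (y b L l)) = y b _ (y a L l) := (h.exists_hom L).choose_spec l

theorem Far.swap_swap (h : Far a b) (h' : Far b a) (w : XT a (XT b L)) :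
    h'.swap L (h.swap L w) = w :=
  LinearMap.congr_fun (f := (h'.swap L).comp (h.swap L)) (g := LinearMap.id)
    (h.hom_ext fun l => by simp [swap_y]) w

theorem Far.dM_swap (h : Far a b) (w : XT a (XT b L)) :
    dM b _ (h.swap L w) = xMap a (dM b L) w :=
  LinearMap.congr_fun (f := (dM b _).comp (h.swap L)) (g := xMap a (dM b L))
    (h.hom_ext fun l => by simp [swap_y, dM_y, xMap_y, y_e_smul]) w

theorem Far.xMap_dM_swap (h : Far a b) (w : XT a (XT b L)) :
    xMap b (dM a L) (h.swap L w) = dM a _ w :=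
  LinearMap.congr_fun (f := (xMap b (dM a L)).comp (h.swap L)) (g := dM a _)
    (h.hom_ext fun l => by simp [swap_y, dM_y, xMap_y, y_e_smul]) w

theorem Far.swap_natural (h : Far a b) {L' : Bimod n} (f : L →ₗ[Env n] L') (w : XT a (XT b L)) :
    h.swap L' (xMap a (xMap b f) w) = xMap b (xMap a f) (h.swap L w) :=
  LinearMap.congr_fun (f := (h.swap L').comp (xMap a (xMap b f)))
    (g := (xMap b (xMap a f)).comp (h.swap L)) (h.hom_ext fun l => by simp [swap_y, xMap_y]) w

end maps

/-! ### Adjacent singular crossings -/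

section adjacent

variable {a b i j : Pos n} {L : Bimod n}

/-- The strands of `X_a` and `X_b` meet in exactly one strand. -/
def Adjacent (a b : Pos n) : Prop := b.1 = a.1 + 1 ∨ a.1 = b.1 + 1

theorem Adjacent.symm (h : Adjacent a b) : Adjacent b a := Or.symm h

variable (a b L) in
/-- The generators of the triple product `X_a X_b X_a`. -/
def yyy (l : L) : XT a (XT b (XT a L)) := y a _ (y b _ (y a L l))

variable (a b L) in
/-- The inclusion of `X_a` into the triple product `X_a X_b X_a`. -/
def incl : XT a L →ₗ[Env n] XT a (XT b (XT a L)) := (xMap a (dP b (XT a L))).comp (sig a L)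

variable (a b L) in
/-- The projection of the triple product `X_a X_b X_a` to `X_a`. -/
def proj : XT a (XT b (XT a L)) →ₗ[Env n] XT a L := (mu a L).comp (xMap a (dM b (XT a L)))

theorem incl_y (l : L) : incl a b L (y a L l) = y a _ (dP b _ (y a L l)) := by
  rw [incl, LinearMap.comp_apply, sig_y, xMap_y]

theorem proj_y (w : XT b (XT a L)) : proj a b L (y a _ w) = y a L (ev a L (dM b _ w) 1) := by
  rw [proj, LinearMap.comp_apply, xMap_y, mu_y]

/-- The inner `d⁻` leaves `e b`, which is symmetric for `a` and is therefore killed by the Demazure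
operator. -/
theorem proj_yyy (l : L) : proj a b L (yyy a b L l) = 0 := by
  rw [yyy, proj_y, dM_y, ev_smul_y, one_mul, ← mul_one (e b), (isSym_e a b).1, dem_one, mul_zero,
    zero_smul, map_zero]

/-- Exactly one of the two variables is exchanged by `a`. It is `u_{a+1}` with a positive sign if
`b` is on the right, and `u_a` with a negative sign if `b` is on the left, so the result is the
same. -/
theorem dem_u_sub (h : Adjacent a b) : dem a (u b - u (b + 1)) = -e a := by
  have hz : ∀ {k : ℕ}, k ≠ a → k ≠ a + 1 → dem a (u k : Alg n) = 0 := fun h h' => by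
    rw [← mul_one (u _), (SymGen.u h h').isSym.1, dem_one, mul_zero]
  rcases h with h | h
  · rw [map_sub, hz (k := b + 1) (by omega) (by omega), h, dem_u_succ, sub_zero]
  · rw [map_sub, hz (k := b) (by omega) (by omega), ← h, dem_u, zero_sub]

/-- The composite of `d⁺` and `d⁻` for `b` is `u_b - u_{b+1}`, whose Demazure image is `-e a`. Hence
`-incl ∘ proj` is idempotent and `X_a` is a direct summand of the triple product. -/
theorem proj_incl (h : Adjacent a b) (x : XT a L) : proj a b L (incl a b L x) = -x :=
  LinearMap.congr_fun (f := (proj a b L).comp (incl a b L)) (g := -LinearMap.id)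
    (XT_hom_ext fun l => by
      rw [LinearMap.comp_apply, incl_y, proj_y, dM_dP, ev_smul_y, one_mul, dem_u_sub h, neg_smul,
        map_neg, y_e]; rfl) x

variable (a b L) in
/-- The Demazure pairing on the triple product. -/
def ev₃ (w : XT a (XT b (XT a L))) (c : Alg n) : L := ev a L (ev b _ (ev a _ w c) 1) 1

theorem ev_ev_ev_add (w w' : XT a (XT b (XT a L))) (c t s : Alg n) :
    ev a L (ev b _ (ev a _ (w + w') c) t) s =
      ev a L (ev b _ (ev a _ w c) t) s + ev a L (ev b _ (ev a _ w' c) t) s := by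
  rw [ev_add, ev_add, ev_add]

theorem ev_ev_ev_bi (r r' : Alg n) (w : XT a (XT b (XT a L))) (c t s : Alg n) :
    ev a L (ev b _ (ev a _ (bi r r' w) c) t) s =
      bi 1 r' (ev a L (ev b _ (ev a _ w (c * r)) t) s) := by
  rw [map_bi, HomA.bi_apply, ev_bi, ev_bi]

theorem ev_ev_ev_zero (c t s : Alg n) :
    ev a L (ev b _ (ev a (XT b (XT a L)) 0 c) t) s = 0 := by
  simp [HomA.zero_apply]

theorem ev_ev_ev_yyy (l : L) (c t s : Alg n) :
    ev a L (ev b _ (ev a _ (yyy a b L l) c) t) s = dem a (s * dem b (t * dem a c)) • l := by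
  rw [yyy, ev_y, ev_smul_y, ev_smul_y]

/-- The pairing of `d⁺` contributes only `e b`, so two Demazure operators for `a` meet and their
composite vanishes. The triple pairing therefore ignores the summand `X_a`. -/
theorem ev₃_incl_y (l : L) (c : Alg n) : ev₃ a b L (incl a b L (y a L l)) c = 0 := by
  rw [ev₃, incl_y, ev_y, ev_smul, ev_dP, ev_smul_y, one_mul, one_mul, (isSym_e a b).1, dem_dem,
    mul_zero, zero_smul]

variable (a b L) in
/-- The submodule of the triple product spanned by its generators. -/
def yyySpan : Submodule (Env n) (XT a (XT b (XT a L))) :=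
  Submodule.span (Env n) (Set.range (yyy a b L))

theorem env_smul_induction {P : Type*} [AddCommGroup P] [Module (Env n) P] {p : P → Prop} {x : P}
    (h0 : p 0) (hadd : ∀ y z, p y → p z → p (y + z)) (h : ∀ r r' : Alg n, p (bi r r' x))
    (t : Env n) : p (t • x) := by
  induction Env.mem_span_mk t using AddSubmonoid.closure_induction with
  | mem t ht => obtain ⟨r, s, rfl⟩ := ht; exact h r s
  | zero => rwa [zero_smul]
  | add t t' _ _ h h' => rw [add_smul]; exact hadd _ _ h h'

/-- On the span of the generators `yyy`, pairings are Demazure expressions acting on `L`. An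
operator identity therefore transfers to the pairing with the two inner test elements `t` and `s`.
-/
theorem ev_ev_ev_of_dem {t s α β : Alg n}
    (h : ∀ x, dem a (s * dem b (t * dem a x)) = α * dem a (dem b (dem a (β * x))))
    {w : XT a (XT b (XT a L))} (hw : w ∈ yyySpan a b L) (c : Alg n) :
    ev a L (ev b _ (ev a _ w c) t) s = α • ev₃ a b L w (β * c) := by
  have h1 : ∀ (l : L) r r' c, ev a L (ev b _ (ev a _ (bi r r' (yyy a b L l)) c) t) s =
      α • ev₃ a b L (bi r r' (yyy a b L l)) (β * c) := fun l r r' c => by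
    rw [ev₃, ev_ev_ev_bi, ev_ev_ev_bi, ev_ev_ev_yyy, ev_ev_ev_yyy, h, one_mul, one_mul, mul_smul,
      bi_smul, mul_assoc]
  revert c
  induction hw using Submodule.closure_induction with
  | zero => intro c; rw [ev₃, ev_ev_ev_zero, ev_ev_ev_zero, smul_zero]
  | add x x' _ _ h h' =>
    intro c
    rw [ev₃, ev_ev_ev_add, ev_ev_ev_add, h, h', smul_add]; rfl
  | smul_mem t x hx =>
    obtain ⟨l, rfl⟩ := hx
    refine env_smul_induction (p := fun x => ∀ c, ev a L (ev b _ (ev a _ x c) _) s =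
      α • ev₃ a b L x (β * c)) ?_ ?_ (h1 l) t
    · intro c; rw [ev₃, ev_ev_ev_zero, ev_ev_ev_zero, smul_zero]
    · intro x x' h h' c
      rw [ev₃, ev_ev_ev_add, ev_ev_ev_add, h, h', smul_add]; rfl

/-- A pair of test elements for which the pairing is determined by the pairing with `1`, `1`. -/
def Test (a b : Pos n) (t s : Alg n) : Prop :=
  ∃ α β : Alg n, ∀ x, dem a (s * dem b (t * dem a x)) = α * dem a (dem b (dem a (β * x)))

theorem Test.of_isSym {t s : Alg n} (h : Test a b 1 s) (ht : IsSym a t) : Test a b t s := by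
  obtain ⟨α, β, h⟩ := h
  exact ⟨α, β * t, fun x => by rw [← ht.1, ← one_mul (dem a (t * x)), h, mul_assoc]⟩

theorem Test.of_eq_zero {t s : Alg n} (h : ∀ x, dem a (s * dem b (t * dem a x)) = 0) :
    Test a b t s := ⟨0, 0, fun x => by rw [h, zero_mul]⟩

theorem Test.one_of_mul_e {s : Alg n} (h : s * e a = 0) : Test a b 1 s :=
  .of_eq_zero fun x => by
    rw [one_mul, ← e_mul_dem a x, (isSym_e b a).1, ← mul_assoc, h, zero_mul, map_zero]

/-- The idempotent `e a` can be inserted behind the outermost operator, moved past the central `s`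
and the operator for `b`, and then it annihilates `t`. -/
theorem Test.of_e_mul {t s : Alg n} (h : e a * t = 0) (hs : ∀ x, s * x = x * s) : Test a b t s :=
  .of_eq_zero fun x => by
    rw [← e_mul_dem, ← (isSym_e a a).1, ← mul_assoc, ← hs, mul_assoc, ← (isSym_e b a).1,
      ← mul_assoc, h, zero_mul, map_zero, mul_zero, map_zero]

theorem dem_e_mul_mul_e (x : Alg n) : dem a (e b * dem a x * e b) = 0 := by
  rw [mul_assoc, (isSym_e a b).1, (isSym_e a b).2, dem_dem, zero_mul, mul_zero]

theorem dem_one_sub_e_mul_mul_e (x : Alg n) : dem a ((1 - e b) * dem a x * e b) = 0 := by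
  rw [sub_mul, one_mul, sub_mul, map_sub, dem_e_mul_mul_e, (isSym_e a b).2, dem_dem, zero_mul,
    sub_zero]

theorem test_one_one : Test a b 1 1 := ⟨1, 1, fun x => by simp only [one_mul]⟩

theorem test_one_right (h : j.1 = i.1 + 1) (s : Alg n)
    (hs : s = 1 ∨ s = u (i + 1) ∨ s = R i ∨ s = Alg.L (i + 1)) : Test i j 1 s := by
  rcases hs with rfl | rfl | rfl | rfl
  · exact test_one_one
  -- The variable `u_{j+1}` passes the operator for `i`. On passing the operator for `j` it becomes
  -- `u_j = u_{i+1}`, up to a term that the last operator kills.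
  · refine ⟨1, u (j + 1), fun x => ?_⟩
    rw [(SymGen.u (i := i) (j := j + 1) (by omega) (by omega)).isSym.1, dem_u_succ_mul j, map_add,
      map_neg, dem_e_mul_mul_e, neg_zero, zero_add, one_mul, one_mul, h]
  · exact .one_of_mul_e (R_mul_e i)
  · exact .one_of_mul_e (L_succ_mul_e i)

theorem test_right (h : j.1 = i.1 + 1) (t s : Alg n)
    (ht : t = 1 ∨ t = u (j + 1) ∨ t = R j ∨ t = Alg.L (j + 1))
    (hs : s = 1 ∨ s = u (i + 1) ∨ s = R i ∨ s = Alg.L (i + 1)) : Test i j t s := by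
  have h1 := test_one_right h s hs
  rcases ht with rfl | rfl | rfl | rfl
  · exact h1
  · exact h1.of_isSym (SymGen.u (by omega) (by omega)).isSym
  · have e0 : e i * R j = 0 := by rw [h, e_mul_R_succ]
    rcases hs with rfl | rfl | rfl | rfl
    · exact .of_e_mul e0 fun x => by rw [one_mul, mul_one]
    · exact .of_e_mul e0 (u_comm _)
    -- The product `R_i R_j` is symmetric for `i`, and `R_i` alone is symmetric for `j`. Pulling it
    -- in from both sides gives the required form.
    · refine ⟨1, R i * R j, fun x => ?_⟩
      have := (SymGen.RR (i := i)).isSym.1 x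
      rw [← h] at this
      rw [this, mul_assoc (R i.1),
        ← (SymGen.R (i := j) (j := i) (by omega) (by omega)).isSym.1, one_mul]
    -- Here `s = L_j` and `t = R_j`, so `L_mul_dem_R_mul` replaces them by `R_{j+1}` and `L_{j+1}`,
    -- which are symmetric for `i`. The error term of that identity is killed.
    · refine ⟨R (j + 1), Alg.L (j + 1), fun x => ?_⟩
      rw [← h, L_mul_dem_R_mul, map_add, dem_one_sub_e_mul_mul_e, add_zero,
        (SymGen.R (i := i) (j := j + 1) (by omega) (by omega)).isSym.1,
        (SymGen.L (i := i) (j := j + 1) (by omega) (by omega)).isSym.1]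
  · exact h1.of_isSym (SymGen.L (by omega) (by omega)).isSym

theorem test_one_left (h : j.1 = i.1 + 1) (s : Alg n)
    (hs : s = 1 ∨ s = u j ∨ s = R j ∨ s = Alg.L (j + 1)) : Test j i 1 s := by
  rcases hs with rfl | rfl | rfl | rfl
  · exact test_one_one
  · refine ⟨1, u i, fun x => ?_⟩
    rw [(SymGen.u (i := j) (j := i) (by omega) (by omega)).isSym.1, dem_u_mul i, map_add,
      dem_e_mul_mul_e, zero_add, one_mul, one_mul, h]
  · exact .one_of_mul_e (R_mul_e j)
  · exact .one_of_mul_e (L_succ_mul_e j)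

theorem test_left (h : j.1 = i.1 + 1) (t s : Alg n)
    (ht : t = 1 ∨ t = u i ∨ t = R i ∨ t = Alg.L (i + 1))
    (hs : s = 1 ∨ s = u j ∨ s = R j ∨ s = Alg.L (j + 1)) : Test j i t s := by
  have h1 := test_one_left h s hs
  rcases ht with rfl | rfl | rfl | rfl
  · exact h1
  · exact h1.of_isSym (SymGen.u (by omega) (by omega)).isSym
  · exact h1.of_isSym (SymGen.R (by omega) (by omega)).isSym
  · have e0 : e j * Alg.L (i + 1) = 0 := by rw [← h, e_mul_L]
    rcases hs with rfl | rfl | rfl | rfl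
    · exact .of_e_mul e0 fun x => by rw [one_mul, mul_one]
    · exact .of_e_mul e0 (u_comm _)
    -- The identity `L_mul_dem_R_mul` is now read backwards: `R_j` and `L_j` around the operator for
    -- `i` become `L_i` and `R_i`, which are symmetric for `j`.
    · refine ⟨Alg.L i, R i, fun x => ?_⟩
      have := L_mul_dem_R_mul i (dem j x)
      rw [← h, ← sub_eq_iff_eq_add] at this
      rw [← h, ← this, map_sub, dem_one_sub_e_mul_mul_e, sub_zero,
        (SymGen.L (i := j) (j := i) (by omega) (by omega)).isSym.1,
        (SymGen.R (i := j) (j := i) (by omega) (by omega)).isSym.1]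
    · refine ⟨1, Alg.L (j + 1) * Alg.L j, fun x => ?_⟩
      rw [(SymGen.LL (i := j)).isSym.1 x, mul_assoc (Alg.L (j.1 + 1)),
        ← (SymGen.L (i := i) (j := j + 1) (by omega) (by omega)).isSym.1, one_mul, ← h]

/-- Every iterated pairing with Casimir test elements is a multiple of the triple pairing with `1`,
so the latter is nondegenerate on the span of `yyy`. On the whole triple product it is not
guaranteed to be, since it vanishes on the image of `X_a`. -/
theorem Adjacent.eq_zero (h : Adjacent a b) {w : XT a (XT b (XT a L))} (hw : w ∈ yyySpan a b L)
    (h0 : ∀ c, ev₃ a b L w c = 0) : w = 0 := by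
  have key : ∀ {t s : Alg n}, Test a b t s → ∀ c, ev a L (ev b _ (ev a _ w c) t) s = 0 := by
    rintro t s ⟨α, β, h⟩ c
    rw [ev_ev_ev_of_dem h hw, h0, smul_zero]
  have hc : ∀ c, ev a _ w c = 0 := fun c => by
    rcases h with h | h
    · have hT : ∀ {t : Alg n}, t = 1 ∨ t = u (b + 1) ∨ t = R b ∨ t = Alg.L (b + 1) →
          ev b _ (ev a _ w c) t = 0 := fun {t} ht =>
        ev_eq_zero' (key (test_right h t _ ht (by simp)) c) (key (test_right h t _ ht (by simp)) c)
          (key (test_right h t _ ht (by simp)) c) (key (test_right h t _ ht (by simp)) c)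
      exact ev_eq_zero' (hT (by simp)) (hT (by simp)) (hT (by simp)) (hT (by simp))
    · have hT : ∀ {t : Alg n}, t = 1 ∨ t = u b ∨ t = R b ∨ t = Alg.L (b + 1) →
          ev b _ (ev a _ w c) t = 0 := fun {t} ht =>
        ev_eq_zero (key (test_left h t _ ht (by simp)) c) (key (test_left h t _ ht (by simp)) c)
          (key (test_left h t _ ht (by simp)) c) (key (test_left h t _ ht (by simp)) c)
      exact ev_eq_zero (hT (by simp)) (hT (by simp)) (hT (by simp)) (hT (by simp))
  exact ev_eq_zero (hc _) (hc _) (hc _) (hc _)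

end adjacent

/-! ### Generators of the triple product and the braid homomorphism -/

section adjacent

variable {a b i j : Pos n} {L : Bimod n}

variable (a b L) in
/-- The submodule of the triple product generated by `yyy` and the image of `X_a`. -/
def tripleSpan : Submodule (Env n) (XT a (XT b (XT a L))) :=
  Submodule.span (Env n) (Set.range (yyy a b L) ∪ Set.range fun l => incl a b L (y a L l))

theorem yyy_mem (l : L) : y a _ (y b _ (y a L l)) ∈ tripleSpan a b L :=
  Submodule.subset_span (Or.inl ⟨l, rfl⟩)

theorem incl_mem (l : L) : y a _ (dP b _ (y a L l)) ∈ tripleSpan a b L :=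
  Submodule.subset_span (Or.inr ⟨l, incl_y l⟩)

theorem lsmul_mem (c : Alg n) {w : XT a (XT b (XT a L))} (h : w ∈ tripleSpan a b L) :
    c • w ∈ tripleSpan a b L := Submodule.smul_mem _ (Env.mk c 1) h

/-- All Casimir coefficients for `b` are symmetric for `a`, apart from `L_b = L_{a+1}`. The elements
that arise from it and from the inner variable `u_b` are recovered from the image of `X_a`. -/
theorem Adjacent.tripleSpan_right (h : b.1 = a.1 + 1) (w : XT a (XT b (XT a L))) :
    w ∈ tripleSpan a b L := by
  have hz (l : L) := yyy_mem (a := a) (b := b) l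
  -- the two parts of the image of `X_a`
  have hincl (q : L) : y a _ (y b _ (u (n := n) b • y a L q)) + y a _ (Alg.L (n := n) b •
      y b _ (R (n := n) b • y a L q)) ∈ tripleSpan a b L := by
    have := incl_mem (a := a) (b := b) q
    rw [dP_apply, map_add, map_sub, map_sub, y_smul (i := a) (SymGen.u (by omega) (by omega)),
      y_smul (i := a) (SymGen.R (by omega) (by omega)),
      ← y_smul (i := a) (b := Alg.L (b + 1)) (SymGen.L (by omega) (by omega))] at this
    have := add_mem (add_mem this (lsmul_mem (u (b + 1)) (hz q)))
      (lsmul_mem (R (b + 1)) (hz (Alg.L (n := n) (b + 1) • q)))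
    convert this using 1; abel
  -- Replacing `q` by `e b • q` kills the second summand, because `R_b` annihilates `e b`, and
  -- leaves the first unchanged. This separates the two parts.
  have h1 (q : L) : y a _ (y b _ (u (n := n) b • y a L q)) ∈ tripleSpan a b L := by
    have := hincl (e b • q)
    rwa [y_e_smul, smul_smul, smul_smul, R_mul_e, zero_smul, map_zero, smul_zero, map_zero, add_zero,
      u_comm, mul_smul, y_e] at this
  have h2 (q : L) : y a _ (Alg.L (n := n) b • y b _ (R (n := n) b • y a L q)) ∈
      tripleSpan a b L := (Submodule.add_mem_iff_right _ (h1 q)).1 (hincl q)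
  have hLe : Alg.L b * e a = (0 : Alg n) := by rw [h, L_succ_mul_e]
  have hL (m : XT a L) : Alg.L (n := n) b • y b _ (e a • m) = 0 := by
    rw [y_e_smul, smul_smul, hLe, zero_smul]
  have hL0 (l : L) : Alg.L (n := n) b • y b _ (y a L l) = 0 := by rw [← e_smul_y l, hL]
  have hLu (k : ℕ) (l : L) : Alg.L (n := n) b • y b _ (u (n := n) k • y a L l) = 0 := by
    rw [← e_smul_y l, smul_smul, u_comm, mul_smul, hL]
  have h3 (m : XT a L) : y a _ (y b _ m) ∈ tripleSpan a b L := by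
    rw [casimir m, ← h]
    simp only [map_add, map_sub]
    rw [y_smul (i := b) (SymGen.L (by omega) (by omega)), y_L_smul, zero_sub,
      ← y_e (y b _ (R (n := n) b • _)), ← y_e_smul, smul_smul, h, e_mul_R_succ, zero_smul, map_zero,
      map_zero, neg_zero, add_zero, ← h]
    exact sub_mem (hz _) (h1 _)
  have h4 (m : XT a L) : y a _ (Alg.L (n := n) b • y b _ m) ∈ tripleSpan a b L := by
    rw [casimir m, ← h]
    simp only [map_add, map_sub, smul_add, smul_sub]
    rw [y_smul (i := b) (SymGen.L (by omega) (by omega)), smul_smul, hL0, hLu, map_zero, sub_zero,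
      zero_add]
    have hLL : SymGen a (Alg.L b * Alg.L a : Alg n) := h ▸ SymGen.LL
    rw [y_smul hLL]
    exact sub_mem (lsmul_mem _ (hz _)) (h2 _)
  induction w using XT_induction with
  | h c v =>
    refine lsmul_mem c ?_
    rw [casimir v, map_add, map_sub, map_sub, y_smul (i := a) (SymGen.u (by omega) (by omega)),
      y_smul (i := a) (SymGen.R (by omega) (by omega))]
    exact add_mem (sub_mem (h3 _) (lsmul_mem _ (h3 _))) (sub_mem (h4 _) (lsmul_mem _ (h3 _)))
  | hadd w w' h h' => exact add_mem h h'

theorem Adjacent.tripleSpan_left (h : a.1 = b.1 + 1) (w : XT a (XT b (XT a L))) :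
    w ∈ tripleSpan a b L := by
  have hz (l : L) := yyy_mem (a := a) (b := b) l
  have hincl (q : L) : y a _ (u (n := n) a • y b _ (y a L q)) + y a _ (R (n := n) a •
      y b _ (Alg.L (n := n) a • y a L q)) ∈ tripleSpan a b L := by
    have := incl_mem (a := a) (b := b) q
    rw [dP_apply, ← h, map_add, map_sub, map_sub,
      ← y_smul (i := a) (b := u b) (SymGen.u (by omega) (by omega)),
      y_smul (i := a) (SymGen.L (by omega) (by omega)),
      ← y_smul (i := a) (b := R b) (SymGen.R (by omega) (by omega))] at this
    have := sub_mem (add_mem (hz (u (n := n) b • q)) (lsmul_mem (Alg.L b)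
      (hz (R (n := n) b • q)))) this
    convert this using 1; abel
  -- As on the other side, `e b` separates the two summands; now `L_a = L_{b+1}` annihilates it.
  have h1 (q : L) : y a _ (u (n := n) a • y b _ (y a L q)) ∈ tripleSpan a b L := by
    have := hincl (e b • q)
    have e0 : Alg.L a * e b = (0 : Alg n) := by rw [h, L_succ_mul_e]
    rwa [y_e_smul, smul_smul, e0, zero_smul, map_zero, smul_zero, map_zero, add_zero, y_e] at this
  have h2 (q : L) : y a _ (R (n := n) a • y b _ (Alg.L (n := n) a • y a L q)) ∈
      tripleSpan a b L := (Submodule.add_mem_iff_right _ (h1 q)).1 (hincl q)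
  have hR (m : XT a L) : R (n := n) a • y b _ (e a • m) = 0 := by
    rw [y_e_smul, smul_smul, R_mul_e, zero_smul]
  have hR0 (l : L) : R (n := n) a • y b _ (y a L l) = 0 := by rw [← e_smul_y l, hR]
  have hRu (k : ℕ) (l : L) : R (n := n) a • y b _ (u (n := n) k • y a L l) = 0 := by
    rw [← e_smul_y l, smul_smul, u_comm, mul_smul, hR]
  have h3 (m : XT a L) : y a _ (y b _ m) ∈ tripleSpan a b L := by
    rw [casimir' m]
    simp only [map_add, map_sub]
    rw [y_smul (i := b) (SymGen.R (by omega) (by omega)), y_R_succ_smul, sub_zero,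
      ← y_e (y b _ (Alg.L (n := n) a • _)), ← y_e_smul, smul_smul, e_mul_L, zero_smul, map_zero,
      map_zero, add_zero]
    refine sub_mem ?_ (hz _)
    have := y_u_succ_smul (i := b) (y a L (ev a L m 1))
    rw [← h, ← y_smul (i := a) (b := u b) (SymGen.u (by omega) (by omega))] at this
    rw [this, map_sub, add_smul, map_add, y_smul (i := a) (SymGen.u (by omega) (by omega))]
    exact sub_mem (add_mem (lsmul_mem _ (hz _)) (h1 _)) (hz _)
  have h4 (m : XT a L) : y a _ (R (n := n) a • y b _ m) ∈ tripleSpan a b L := by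
    rw [casimir m]
    simp only [map_add, map_sub, smul_add, smul_sub]
    rw [y_smul (i := b) (SymGen.R (by omega) (by omega)), smul_smul (R (n := n) a), hR0, hRu,
      map_zero, sub_zero, zero_add, y_smul SymGen.RR]
    exact sub_mem (h2 _) (lsmul_mem _ (hz _))
  induction w using XT_induction with
  | h c v =>
    refine lsmul_mem c ?_
    rw [casimir' v, map_add, map_sub, map_sub, y_smul (i := a) (SymGen.u (by omega) (by omega)),
      y_smul (i := a) (SymGen.L (by omega) (by omega)), ← h]
    exact add_mem (sub_mem (lsmul_mem _ (h3 _)) (h3 _)) (sub_mem (lsmul_mem _ (h3 _)) (h4 _))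
  | hadd w w' h h' => exact add_mem h h'

theorem Adjacent.mem_tripleSpan (h : Adjacent a b) (w : XT a (XT b (XT a L))) :
    w ∈ tripleSpan a b L := h.elim (fun h => tripleSpan_right h w) (fun h => tripleSpan_left h w)

theorem Adjacent.dem (h : Adjacent a b) (x : Alg n) :
    dem a (dem b (dem a x)) = dem b (dem a (dem b x)) :=
  h.elim (fun h => dem_braid h x) (fun h => (dem_braid h x).symm)

theorem Adjacent.hom_ext (h : Adjacent a b) {P : Type*} [AddCommGroup P] [Module (Env n) P]
    {f g : XT a (XT b (XT a L)) →ₗ[Env n] P} (h1 : ∀ l, f (yyy a b L l) = g (yyy a b L l))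
    (h2 : ∀ l, f (incl a b L (y a L l)) = g (incl a b L (y a L l))) : f = g :=
  LinearMap.ext fun w => LinearMap.eqOn_span
    (by rintro _ (⟨l, rfl⟩ | ⟨l, rfl⟩); exacts [h1 l, h2 l]) (h.mem_tripleSpan w)

theorem ev₃_smul {w : XT a (XT b (XT a L))} {w' : XT b (XT a (XT b L))}
    (h : ∀ c, ev₃ a b L w c = ev₃ b a L w' c) (t : Env n) (c : Alg n) :
    ev₃ a b L (t • w) c = ev₃ b a L (t • w') c := by
  revert c
  induction Env.mem_span_mk t using AddSubmonoid.closure_induction with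
  | mem t ht =>
    obtain ⟨r, s, rfl⟩ := ht
    intro c
    have h1 := ev_ev_ev_bi r s w c 1 1
    have h2 := ev_ev_ev_bi r s w' c 1 1
    exact h1.trans ((congrArg (bi 1 s) (h (c * r))).trans h2.symm)
  | zero => intro c; rw [zero_smul, zero_smul, ev₃, ev₃, ev_ev_ev_zero, ev_ev_ev_zero]
  | add t t' _ _ h h' =>
    intro c
    rw [add_smul, add_smul, ev₃, ev₃, ev_ev_ev_add, ev_ev_ev_add]
    exact congrArg₂ _ (h c) (h' c)

/-- The generators `yyy` correspond to each other and the copy of `X_a` is sent to zero. By the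
braid relation for Demazure operators, and because the triple pairing ignores `X_a`, the two
components of the graph have equal triple pairings. -/
theorem Adjacent.exists_hom (h : Adjacent a b) (L : Bimod n) :
    ∃ f : XT a (XT b (XT a L)) →ₗ[Env n] XT b (XT a (XT b L)),
      (∀ l, f (yyy a b L l) = yyy b a L l) ∧ ∀ l, f (incl a b L (y a L l)) = 0 := by
  let G : Submodule (Env n) (XT a (XT b (XT a L)) × XT b (XT a (XT b L))) :=
    Submodule.span (Env n) (Set.range (fun l : L => (yyy a b L l, yyy b a L l)) ∪
      Set.range fun l : L => (incl a b L (y a L l), 0))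
  have hG1 : ∀ l : L, (yyy a b L l, yyy b a L l) ∈ G :=
    fun l => Submodule.subset_span (Or.inl ⟨l, rfl⟩)
  have hG2 : ∀ l : L, (incl a b L (y a L l), 0) ∈ G :=
    fun l => Submodule.subset_span (Or.inr ⟨l, rfl⟩)
  have hev : ∀ p ∈ G, p.2 ∈ yyySpan b a L ∧ ∀ c, ev₃ a b L p.1 c = ev₃ b a L p.2 c := by
    intro p hp
    induction hp using Submodule.span_induction with
    | mem x hx =>
      rcases hx with ⟨l, rfl⟩ | ⟨l, rfl⟩
      · refine ⟨Submodule.subset_span ⟨l, rfl⟩, fun c => ?_⟩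
        rw [ev₃, ev₃, ev_ev_ev_yyy, ev_ev_ev_yyy]
        simp only [one_mul, h.dem]
      · exact ⟨zero_mem _, fun c => by rw [ev₃_incl_y, ev₃, ev_ev_ev_zero]⟩
    | zero => exact ⟨zero_mem _, fun c => by
        rw [ev₃, ev₃, Prod.fst_zero, Prod.snd_zero, ev_ev_ev_zero, ev_ev_ev_zero]⟩
    | add x x' _ _ h h' =>
      refine ⟨add_mem h.1 h'.1, fun c => ?_⟩
      rw [ev₃, ev₃, Prod.fst_add, Prod.snd_add, ev_ev_ev_add, ev_ev_ev_add]
      exact congrArg₂ _ (h.2 c) (h'.2 c)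
    | smul t x _ h =>
      exact ⟨Submodule.smul_mem _ t h.1, ev₃_smul h.2 t⟩
  obtain ⟨f, hf⟩ := exists_hom_of_graph G (fun p => by
    induction h.mem_tripleSpan p using Submodule.span_induction with
    | mem x hx =>
      rcases hx with ⟨l, rfl⟩ | ⟨l, rfl⟩
      exacts [⟨_, hG1 l⟩, ⟨_, hG2 l⟩]
    | zero => exact ⟨0, G.zero_mem⟩
    | add x x' _ _ h h' =>
      obtain ⟨q, hq⟩ := h; obtain ⟨q', hq'⟩ := h'; exact ⟨_, G.add_mem hq hq'⟩
    | smul t x _ h => obtain ⟨q, hq⟩ := h; exact ⟨_, G.smul_mem t hq⟩)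
    -- Second components stay in the span of `yyy`, where the triple pairing is nondegenerate.
    -- Keeping track of this membership is essential.
    (fun q hq => h.symm.eq_zero (hev _ hq).1 fun c => by
      rw [← (hev _ hq).2 c, ev₃, ev_ev_ev_zero])
  exact ⟨f, fun l => hf _ _ (hG1 l), fun l => hf _ _ (hG2 l)⟩

/-- The homomorphism between the triple products in both orders. -/
def Adjacent.braid (h : Adjacent a b) (L : Bimod n) :
    XT a (XT b (XT a L)) →ₗ[Env n] XT b (XT a (XT b L)) := (h.exists_hom L).choose

theorem Adjacent.braid_yyy (h : Adjacent a b) (l : L) :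
    h.braid L (yyy a b L l) = yyy b a L l := (h.exists_hom L).choose_spec.1 l

theorem Adjacent.braid_incl_y (h : Adjacent a b) (l : L) :
    h.braid L (incl a b L (y a L l)) = 0 := (h.exists_hom L).choose_spec.2 l

theorem Adjacent.braid_incl (h : Adjacent a b) (x : XT a L) : h.braid L (incl a b L x) = 0 :=
  LinearMap.congr_fun (f := (h.braid L).comp (incl a b L)) (g := 0)
    (XT_hom_ext fun l => h.braid_incl_y l) x

/-- On `yyy` the projection vanishes and the two maps are inverse. On the copy of `X_a` the left
side is zero, and so is the right since `proj` splits `incl` up to a sign. -/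
theorem Adjacent.braid_braid (h : Adjacent a b) (h' : Adjacent b a) (w : XT a (XT b (XT a L))) :
    h'.braid L (h.braid L w) = w + incl a b L (proj a b L w) :=
  LinearMap.congr_fun (f := (h'.braid L).comp (h.braid L))
    (g := LinearMap.id + (incl a b L).comp (proj a b L))
    (h.hom_ext (fun l => by simp [braid_yyy, proj_yyy]) (fun l => by
      simp [braid_incl, proj_incl h])) w

theorem xMap_xMap_dM_yyy (l : L) : xMap a (xMap b (dM a L)) (yyy a b L l) = y a _ (y b L l) := by
  rw [yyy, xMap_y, xMap_y, dM_y, y_e_smul, y_e]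

theorem dM_yyy (l : L) : dM a _ (yyy a b L l) = y b _ (y a L l) := by
  rw [yyy, dM_y, ← y_e_smul, e_smul_y]

theorem dM_incl (x : XT a L) : dM a _ (incl a b L x) = dP b _ x := by
  rw [incl, LinearMap.comp_apply, dM_natural, dM_sig]

/-- The term with `proj` corrects for the summand `X_a`, which `braid` forgets but `d⁻` sees. This
and the next two identities make the braid map part of a chain map. -/
theorem Adjacent.dM_braid (h : Adjacent a b) (w : XT a (XT b (XT a L))) :
    dM b _ (h.braid L w) = xMap a (xMap b (dM a L)) w + xMap a (dP b L) (proj a b L w) :=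
  LinearMap.congr_fun (f := (dM b _).comp (h.braid L))
    (g := xMap a (xMap b (dM a L)) + (xMap a (dP b L)).comp (proj a b L))
    (h.hom_ext (fun l => by
      simp [braid_yyy, proj_yyy, xMap_xMap_dM_yyy, dM_yyy]) (fun l => by
      simp only [LinearMap.comp_apply, LinearMap.add_apply, braid_incl, proj_incl h, map_zero,
        map_neg]
      rw [incl_y, xMap_y, xMap_y, ← dP_natural, dM_y, map_lsmul, y_e, add_neg_cancel])) w

theorem Adjacent.xMap_xMap_dM_braid (h : Adjacent a b) (w : XT a (XT b (XT a L))) :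
    xMap b (xMap a (dM b L)) (h.braid L w) = dM a _ w + dP b _ (proj a b L w) :=
  LinearMap.congr_fun (f := (xMap b (xMap a (dM b L))).comp (h.braid L))
    (g := dM a _ + (dP b _).comp (proj a b L))
    (h.hom_ext (fun l => by
      simp [braid_yyy, proj_yyy, xMap_xMap_dM_yyy, dM_yyy]) (fun l => by
      simp [braid_incl, proj_incl h, dM_incl])) w

theorem Adjacent.xMap_dM_braid (h : Adjacent a b) (w : XT a (XT b (XT a L))) :
    xMap b (dM a _) (h.braid L w) =
      sig b L (xMap b (dM a L) (dM a _ w + dP b _ (proj a b L w))) :=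
  LinearMap.congr_fun (f := (xMap b (dM a _)).comp (h.braid L))
    (g := ((sig b L).comp (xMap b (dM a L))).comp (dM a _ + (dP b _).comp (proj a b L)))
    (h.hom_ext (fun l => by
      simp only [LinearMap.comp_apply, LinearMap.add_apply, braid_yyy, proj_yyy, map_zero, add_zero,
        dM_yyy, xMap_y, dM_y, sig_y]
      rw [yyy, xMap_y, dM_y, y_e_smul, y_e_smul, y_e_smul]) (fun l => by
      simp [braid_incl, proj_incl h, dM_incl])) w

/-- Both composites of `d⁺` and `d⁻` for `b` are multiplication by `u_b - u_{b+1}`, taken in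
different positions. The identity governs the term `X_a X_a` in the third Reidemeister move, both
for the chain map and for the homotopy. -/
theorem Adjacent.sig_decomposition (h : Adjacent a b) (w : XT a (XT a L)) :
    w + xMap a (dM b _) (xMap a (dP b _) (sig a L (mu a L w))) =
      sig a L (xMap a (dM a L) w) + sig a L (xMap a (dM b L) (xMap a (dP b L) (mu a L w))) := by
  refine LinearMap.congr_fun
    (f := LinearMap.id + (xMap a (dM b _)).comp ((xMap a (dP b _)).comp ((sig a L).comp (mu a L))))
    (g := (sig a L).comp (xMap a (dM a L)) +
      (sig a L).comp ((xMap a (dM b L)).comp ((xMap a (dP b L)).comp (mu a L))))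
    (XXT_hom_ext (fun l => ?_) (fun l => ?_)) w
  · simp only [LinearMap.add_apply, LinearMap.comp_apply, LinearMap.id_apply]
    rw [← sig_y, mu_sig, xMap_dM_sig]
    simp
  · simp only [LinearMap.add_apply, LinearMap.comp_apply, LinearMap.id_apply, mu_y_u_y, map_neg,
      sig_y, xMap_y, dM_dP, map_lsmul, dM_y]
    rw [smul_smul, u_comm, mul_smul, y_e]
    -- The variable of `b` not shared with `a` passes through every `y`. The shared one is `u_{a+1}`
    -- or `u_a`, and in the latter case the symmetric sum converts it.
    rcases h with h | h
    · rw [sub_smul, sub_smul, map_sub, map_sub, map_sub, ← h,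
        y_smul (i := a) (b := u (b + 1)) (SymGen.u (by omega) (by omega)),
        y_smul (i := a) (b := u (b + 1)) (SymGen.u (by omega) (by omega)),
        y_smul (i := a) (b := u (b + 1)) (SymGen.u (by omega) (by omega))]
      abel
    · rw [sub_smul, sub_smul, map_sub, map_sub, map_sub, ← h,
        y_smul (i := a) (b := u b) (SymGen.u (by omega) (by omega)),
        y_smul (i := a) (b := u b) (SymGen.u (by omega) (by omega)),
        y_smul (i := a) (b := u b) (SymGen.u (by omega) (by omega)), y_u_succ_smul, y_u_succ_smul,
        map_sub, y_smul SymGen.sum]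
      abel

theorem Adjacent.dM_decomposition (h : Adjacent a b) (w : XT a (XT a L)) :
    dM a _ w + dM b _ (dP b _ (mu a L w)) =
      xMap a (dM a L) w + xMap a (dM b L) (xMap a (dP b L) (mu a L w)) := by
  have := congrArg (dM a _) (h.sig_decomposition w)
  rwa [map_add, map_add, dM_sig, dM_sig, dM_natural, dM_natural, dM_sig] at this

end adjacent

/-! ### The tensor product with a complex in two degrees -/

section double

open HomologicalComplex

theorem ne_of_rel {p₀ p₁ : ℤ} (hp : (ComplexShape.up ℤ).Rel p₀ p₁) : p₀ ≠ p₁ := by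
  change p₀ + 1 = p₁ at hp; omega

theorem map_inv_hom {C₁ C₂ D : Type*} [Category* C₁] [Category* C₂] [Category* D]
    (F : C₁ ⥤ C₂ ⥤ D) {X Y : C₁} (e : X ≅ Y) (Z : C₂) :
    (F.map e.inv).app Z ≫ (F.map e.hom).app Z = 𝟙 _ := by
  rw [← NatTrans.comp_app, ← F.map_comp, e.inv_hom_id, F.map_id, NatTrans.id_app]

variable {C₁ C₂ D : Type*} [Category* C₁] [Category* C₂] [Category* D] [Preadditive C₁]
  [Preadditive C₂] [Preadditive D] (F : C₁ ⥤ C₂ ⥤ D) [F.Additive]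
  [∀ X, (F.obj X).Additive] (K : CochainComplex C₁ ℤ) (L : CochainComplex C₂ ℤ)
  [HasMapBifunctor K L F (ComplexShape.up ℤ)]

/-- The projection of the total complex to one summand. -/
def totalProj (p q k : ℤ) (h : p + q = k) :
    (mapBifunctor K L F (ComplexShape.up ℤ)).X k ⟶ (F.obj (K.X p)).obj (L.X q) :=
  mapBifunctorDesc fun p' q' h' => if e : p' = p then
    (F.map (K.XIsoOfEq e).hom).app (L.X q') ≫ (F.obj (K.X p)).map (L.XIsoOfEq
      (show q' = q by change p' + q' = k at h'; omega)).hom else 0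

theorem ι_totalProj (p q k : ℤ) (h : p + q = k) :
    ιMapBifunctor K L F (ComplexShape.up ℤ) p q k h ≫ totalProj F K L p q k h = 𝟙 _ := by
  rw [totalProj, ι_mapBifunctorDesc, dif_pos rfl]
  simp [XIsoOfEq]

theorem ι_totalProj_ne (p q p' q' k : ℤ) (h : p + q = k) (h' : p' + q' = k) (hp : p' ≠ p) :
    ιMapBifunctor K L F (ComplexShape.up ℤ) p' q' k h' ≫ totalProj F K L p q k h = 0 := by
  rw [totalProj, ι_mapBifunctorDesc, dif_neg hp]

/-- All other summands vanish because the first complex is zero outside its two degrees. -/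
theorem totalProj_ι_add (p₀ q₀ p₁ q₁ k : ℤ) (h₀ : p₀ + q₀ = k) (h₁ : p₁ + q₁ = k) (hp : p₀ ≠ p₁)
    (hK : ∀ p, p ≠ p₀ → p ≠ p₁ → Limits.IsZero (K.X p)) :
    totalProj F K L p₀ q₀ k h₀ ≫ ιMapBifunctor K L F (ComplexShape.up ℤ) p₀ q₀ k h₀ +
      totalProj F K L p₁ q₁ k h₁ ≫ ιMapBifunctor K L F (ComplexShape.up ℤ) p₁ q₁ k h₁ = 𝟙 _ := by
  refine mapBifunctor.hom_ext fun p q h => ?_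
  change p + q = k at h
  rw [Preadditive.comp_add, Category.comp_id]
  by_cases e₀ : p = p₀
  · subst e₀
    obtain rfl : q = q₀ := by omega
    rw [← Category.assoc, ← Category.assoc, ι_totalProj, ι_totalProj_ne _ _ _ _ _ _ _ _ _ _ hp,
      Category.id_comp, Limits.zero_comp, add_zero]
  · by_cases e₁ : p = p₁
    · subst e₁
      obtain rfl : q = q₁ := by omega
      rw [← Category.assoc, ← Category.assoc, ι_totalProj,
        ι_totalProj_ne _ _ _ _ _ _ _ _ _ _ hp.symm,
        Category.id_comp, Limits.zero_comp, zero_add]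
    · refine Limits.IsZero.eq_of_src ?_ _ _
      have h0 : Limits.IsZero (F.obj (K.X p)) := F.map_isZero (hK p e₀ e₁)
      rw [Limits.IsZero.iff_id_eq_zero] at h0 ⊢
      exact congrArg (fun α : F.obj (K.X p) ⟶ F.obj (K.X p) => α.app (L.X q)) h0

theorem ι_d (p q p' q' k k' : ℤ) (h : p + q = k) (hp : p + 1 = p') (hq : q + 1 = q')
    (h₁ : p' + q = k') (h₂ : p + q' = k') :
    ιMapBifunctor K L F (ComplexShape.up ℤ) p q k h ≫
        (mapBifunctor K L F (ComplexShape.up ℤ)).d k k' =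
      (F.map (K.d p p')).app (L.X q) ≫ ιMapBifunctor K L F (ComplexShape.up ℤ) p' q k' h₁ +
        p.negOnePow • ((F.obj (K.X p)).map (L.d q q') ≫
          ιMapBifunctor K L F (ComplexShape.up ℤ) p q' k' h₂) := by
  rw [mapBifunctor.d_eq, Preadditive.comp_add, mapBifunctor.ι_D₁, mapBifunctor.ι_D₂,
    mapBifunctor.d₁_eq K L F (ComplexShape.up ℤ) (show (ComplexShape.up ℤ).Rel p p' from hp) q k' h₁,
    mapBifunctor.d₂_eq K L F (ComplexShape.up ℤ) p (show (ComplexShape.up ℤ).Rel q q' from hq) k' h₂]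
  congr 1
  -- The sign of the first partial differential is trivial; only the second carries the sign of the
  -- degree.
  exact one_smul _ _

variable [Limits.HasZeroObject C₁] {A B : C₁} (f : A ⟶ B) {p₀ p₁ : ℤ} (hp : (ComplexShape.up ℤ).Rel p₀ p₁)
  [HasMapBifunctor (double f hp) L F (ComplexShape.up ℤ)]

/-- The inclusion of the summands from the first degree. -/
def totalFst (q k : ℤ) (h : p₀ + q = k) :
    (F.obj A).obj (L.X q) ⟶ (mapBifunctor (double f hp) L F (ComplexShape.up ℤ)).X k :=
  (F.map (doubleXIso₀ f hp).inv).app (L.X q) ≫ ιMapBifunctor _ L F (ComplexShape.up ℤ) p₀ q k h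

/-- The inclusion of the summands from the second degree. -/
def totalSnd (q k : ℤ) (h : p₁ + q = k) :
    (F.obj B).obj (L.X q) ⟶ (mapBifunctor (double f hp) L F (ComplexShape.up ℤ)).X k :=
  (F.map (doubleXIso₁ f hp (ne_of_rel hp)).inv).app (L.X q) ≫
    ιMapBifunctor _ L F (ComplexShape.up ℤ) p₁ q k h

/-- The projection to the summands from the first degree. -/
def totalPrFst (q k : ℤ) (h : p₀ + q = k) :
    (mapBifunctor (double f hp) L F (ComplexShape.up ℤ)).X k ⟶ (F.obj A).obj (L.X q) :=
  totalProj F _ L p₀ q k h ≫ (F.map (doubleXIso₀ f hp).hom).app (L.X q)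

/-- The projection to the summands from the second degree. -/
def totalPrSnd (q k : ℤ) (h : p₁ + q = k) :
    (mapBifunctor (double f hp) L F (ComplexShape.up ℤ)).X k ⟶ (F.obj B).obj (L.X q) :=
  totalProj F _ L p₁ q k h ≫ (F.map (doubleXIso₁ f hp (ne_of_rel hp)).hom).app (L.X q)

theorem totalFst_prFst (q k : ℤ) (h : p₀ + q = k) :
    totalFst F L f hp q k h ≫ totalPrFst F L f hp q k h = 𝟙 _ := by
  rw [totalFst, totalPrFst, Category.assoc, ← Category.assoc (ιMapBifunctor _ _ _ _ _ _ _ _),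
    ι_totalProj, Category.id_comp, map_inv_hom]

theorem totalSnd_prSnd (q k : ℤ) (h : p₁ + q = k) :
    totalSnd F L f hp q k h ≫ totalPrSnd F L f hp q k h = 𝟙 _ := by
  rw [totalSnd, totalPrSnd, Category.assoc, ← Category.assoc (ιMapBifunctor _ _ _ _ _ _ _ _),
    ι_totalProj, Category.id_comp, map_inv_hom]

theorem totalFst_prSnd (q q' k : ℤ) (h : p₀ + q = k) (h' : p₁ + q' = k) :
    totalFst F L f hp q k h ≫ totalPrSnd F L f hp q' k h' = 0 := by
  rw [totalFst, totalPrSnd, Category.assoc, ← Category.assoc (ιMapBifunctor _ _ _ _ _ _ _ _),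
    ι_totalProj_ne _ _ _ _ _ _ _ _ _ _ (ne_of_rel hp), Limits.zero_comp, Limits.comp_zero]

theorem totalSnd_prFst (q q' k : ℤ) (h : p₁ + q = k) (h' : p₀ + q' = k) :
    totalSnd F L f hp q k h ≫ totalPrFst F L f hp q' k h' = 0 := by
  rw [totalSnd, totalPrFst, Category.assoc, ← Category.assoc (ιMapBifunctor _ _ _ _ _ _ _ _),
    ι_totalProj_ne _ _ _ _ _ _ _ _ _ _ (ne_of_rel hp).symm, Limits.zero_comp, Limits.comp_zero]

theorem totalPr_add (q q' k : ℤ) (h : p₀ + q = k) (h' : p₁ + q' = k) :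
    totalPrFst F L f hp q k h ≫ totalFst F L f hp q k h +
      totalPrSnd F L f hp q' k h' ≫ totalSnd F L f hp q' k h' = 𝟙 _ := by
  have e : ∀ {X Y : C₁} (e : X ≅ Y) (Z : C₂) {W : D} (g : (F.obj X).obj Z ⟶ W),
      (F.map e.hom).app Z ≫ (F.map e.inv).app Z ≫ g = g := fun e Z W g => by
    rw [← Category.assoc, ← NatTrans.comp_app, ← F.map_comp, e.hom_inv_id, F.map_id,
      NatTrans.id_app, Category.id_comp]
  rw [totalPrFst, totalFst, totalPrSnd, totalSnd, Category.assoc, Category.assoc, e, e]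
  exact totalProj_ι_add F _ L p₀ q p₁ q' k h h' (ne_of_rel hp)
    fun p h h' => isZero_double_X f hp p h h'

theorem totalFst_d (q q' k k' : ℤ) (h : p₀ + q = k) (hq : q + 1 = q') (hk : p₀ + q' = k')
    (h' : p₁ + q = k') :
    totalFst F L f hp q k h ≫ (mapBifunctor (double f hp) L F (ComplexShape.up ℤ)).d k k' =
      (F.map f).app (L.X q) ≫ totalSnd F L f hp q k' h' +
        p₀.negOnePow • ((F.obj A).map (L.d q q') ≫ totalFst F L f hp q' k' hk) := by
  rw [totalFst, Category.assoc, ι_d F _ L p₀ q p₁ q' k k' h hp hq h' hk, Preadditive.comp_add,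
    double_d f hp (ne_of_rel hp), Linear.comp_units_smul, ← Category.assoc, ← NatTrans.comp_app,
    ← F.map_comp, Iso.inv_hom_id_assoc, F.map_comp, NatTrans.comp_app, Category.assoc,
    ← NatTrans.naturality_assoc]
  rfl

theorem totalSnd_d (q q' k k' : ℤ) (h : p₁ + q = k) (hq : q + 1 = q') (hk : p₁ + q' = k') :
    totalSnd F L f hp q k h ≫ (mapBifunctor (double f hp) L F (ComplexShape.up ℤ)).d k k' =
        p₁.negOnePow • ((F.obj B).map (L.d q q') ≫ totalSnd F L f hp q' k' hk) := by
  rw [totalSnd, Category.assoc, ι_d F _ L p₁ q (p₁ + 1) q' k k' h rfl hq (by omega) hk,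
    Preadditive.comp_add, double_d_eq_zero₀ f hp _ _ (ne_of_rel hp).symm, Linear.comp_units_smul,
    F.map_zero, Limits.zero_app, Limits.zero_comp, Limits.comp_zero, zero_add,
    ← NatTrans.naturality_assoc]
  rfl

end double

/-! ### Coordinates on complexes of bimodules -/

section coord

open HomologicalComplex

variable (L : CochainComplex (Bimod n) ℤ) {A B : Bimod n} (f : A ⟶ B) {p₀ p₁ : ℤ}
  (hp : (ComplexShape.up ℤ).Rel p₀ p₁)

/-- The inclusion of the first summand. -/
def inFst (q k : ℤ) (h : p₀ + q = k) :
    tensorObj A (L.X q) →ₗ[Env n] (tensorComplex (double f hp) L).X k :=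
  (totalFst (tensor n) L f hp q k h).hom

/-- The inclusion of the second summand. -/
def inSnd (q k : ℤ) (h : p₁ + q = k) :
    tensorObj B (L.X q) →ₗ[Env n] (tensorComplex (double f hp) L).X k :=
  (totalSnd (tensor n) L f hp q k h).hom

/-- The projection to the first summand. -/
def prFst (q k : ℤ) (h : p₀ + q = k) :
    (tensorComplex (double f hp) L).X k →ₗ[Env n] tensorObj A (L.X q) :=
  (totalPrFst (tensor n) L f hp q k h).hom

/-- The projection to the second summand. -/
def prSnd (q k : ℤ) (h : p₁ + q = k) :
    (tensorComplex (double f hp) L).X k →ₗ[Env n] tensorObj B (L.X q) :=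
  (totalPrSnd (tensor n) L f hp q k h).hom

theorem prFst_inFst (q k : ℤ) (h : p₀ + q = k) (x : tensorObj A (L.X q)) :
    prFst L f hp q k h (inFst L f hp q k h x) = x :=
  LinearMap.congr_fun (congrArg ModuleCat.Hom.hom (totalFst_prFst (tensor n) L f hp q k h)) x

theorem prSnd_inFst (q q' k : ℤ) (h : p₀ + q = k) (h' : p₁ + q' = k) (x : tensorObj A (L.X q)) :
    prSnd L f hp q' k h' (inFst L f hp q k h x) = 0 :=
  LinearMap.congr_fun (congrArg ModuleCat.Hom.hom
    (totalFst_prSnd (tensor n) L f hp q q' k h h')) x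

theorem prFst_inSnd (q q' k : ℤ) (h : p₁ + q = k) (h' : p₀ + q' = k) (x : tensorObj B (L.X q)) :
    prFst L f hp q' k h' (inSnd L f hp q k h x) = 0 :=
  LinearMap.congr_fun (congrArg ModuleCat.Hom.hom
    (totalSnd_prFst (tensor n) L f hp q q' k h h')) x

theorem prSnd_inSnd (q k : ℤ) (h : p₁ + q = k) (x : tensorObj B (L.X q)) :
    prSnd L f hp q k h (inSnd L f hp q k h x) = x :=
  LinearMap.congr_fun (congrArg ModuleCat.Hom.hom (totalSnd_prSnd (tensor n) L f hp q k h)) x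

theorem in_pr_add (q q' k : ℤ) (h : p₀ + q = k) (h' : p₁ + q' = k)
    (z : (tensorComplex (double f hp) L).X k) :
    inFst L f hp q k h (prFst L f hp q k h z) + inSnd L f hp q' k h' (prSnd L f hp q' k h' z) = z :=
  LinearMap.congr_fun (congrArg ModuleCat.Hom.hom (totalPr_add (tensor n) L f hp q q' k h h')) z

theorem d_inFst (q q' k k' : ℤ) (h : p₀ + q = k) (hq : q + 1 = q') (hk : p₀ + q' = k')
    (h' : p₁ + q = k') (x : tensorObj A (L.X q)) :
    ((tensorComplex (double f hp) L).d k k').hom (inFst L f hp q k h x) =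
      inSnd L f hp q k' h' ((tensorMap f (𝟙 (L.X q))).hom x) +
        inFst L f hp q' k' hk ((p₀.negOnePow • tensorMap (𝟙 A) (L.d q q')).hom x) := by
  have e := totalFst_d (tensor n) L f hp q q' k k' h hq hk h'
  rw [← Linear.units_smul_comp] at e
  exact LinearMap.congr_fun (congrArg ModuleCat.Hom.hom e) x

theorem d_inSnd (q q' k k' : ℤ) (h : p₁ + q = k) (hq : q + 1 = q') (hk : p₁ + q' = k')
    (x : tensorObj B (L.X q)) :
    ((tensorComplex (double f hp) L).d k k').hom (inSnd L f hp q k h x) =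
        inSnd L f hp q' k' hk ((p₁.negOnePow • tensorMap (𝟙 B) (L.d q q')).hom x) := by
  have e := totalSnd_d (tensor n) L f hp q q' k k' h hq hk
  rw [← Linear.units_smul_comp] at e
  exact LinearMap.congr_fun (congrArg ModuleCat.Hom.hom e) x

/-- The summands of the tensor product with a complex in two degrees. -/
def totalEquiv (q q' k : ℤ) (h : p₀ + q = k) (h' : p₁ + q' = k) :
    (tensorComplex (double f hp) L).X k ≃ₗ[Env n] tensorObj A (L.X q) × tensorObj B (L.X q') :=
  { (prFst L f hp q k h).prod (prSnd L f hp q' k h') with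
    invFun := fun z => inFst L f hp q k h z.1 + inSnd L f hp q' k h' z.2
    left_inv := fun z => in_pr_add L f hp q q' k h h' z
    right_inv := fun z => Prod.ext
      ((map_add (prFst L f hp q k h) _ _).trans (by
        rw [prFst_inFst, prFst_inSnd, add_zero]))
      ((map_add (prSnd L f hp q' k h') _ _).trans (by
        rw [prSnd_inFst, prSnd_inSnd, zero_add])) }

theorem totalEquiv_symm (q q' k : ℤ) (h : p₀ + q = k) (h' : p₁ + q' = k)
    (z : tensorObj A (L.X q) × tensorObj B (L.X q')) :
    (totalEquiv L f hp q q' k h h').symm z = inFst L f hp q k h z.1 + inSnd L f hp q' k h' z.2 :=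
  rfl

theorem totalEquiv_d (q₀ q₁ q₂ k k' : ℤ) (h₀ : p₁ + q₀ = k) (h₁ : p₀ + q₁ = k) (hq₀ : q₀ + 1 = q₁)
    (hq₁ : q₁ + 1 = q₂) (h₂ : p₀ + q₂ = k') (h₃ : p₁ + q₁ = k')
    (z : (tensorComplex (double f hp) L).X k) :
    totalEquiv L f hp q₂ q₁ k' h₂ h₃ (((tensorComplex (double f hp) L).d k k').hom z) =
      ((p₀.negOnePow • tensorMap (𝟙 A) (L.d q₁ q₂)).hom (totalEquiv L f hp q₁ q₀ k h₁ h₀ z).1,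
        (tensorMap f (𝟙 (L.X q₁))).hom (totalEquiv L f hp q₁ q₀ k h₁ h₀ z).1 +
          (p₁.negOnePow • tensorMap (𝟙 B) (L.d q₀ q₁)).hom
            (totalEquiv L f hp q₁ q₀ k h₁ h₀ z).2) := by
  obtain ⟨z, rfl⟩ := (totalEquiv L f hp q₁ q₀ k h₁ h₀).symm.surjective z
  rw [LinearEquiv.apply_symm_apply, ← LinearEquiv.eq_symm_apply, totalEquiv_symm, totalEquiv_symm,
    map_add, d_inFst L f hp q₁ q₂ k k' h₁ hq₁ h₂ h₃, d_inSnd L f hp q₀ q₁ k k' h₀ hq₀ h₃, map_add]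
  abel

variable {L}

/-- Coordinates on a complex of bimodules, with a shift of the degrees by `s`. -/
structure Coord (T : CochainComplex (Bimod n) ℤ) (s : ℤ) (M : ℤ → Bimod n)
    (δ : ∀ k, M k →ₗ[Env n] M (k + 1)) where
  /-- The coordinates. -/
  equiv : ∀ k K, k + s = K → (T.X K ≃ₗ[Env n] M k)
  comm : ∀ k K K' (h : k + s = K) (h' : k + 1 + s = K') (x : T.X K),
    equiv (k + 1) K' h' ((T.d K K').hom x) = δ k (equiv k K h x)

variable (L) in
/-- The tautological coordinates. -/
def Coord.refl : Coord L 0 L.X (fun k => (L.d k (k + 1)).hom) where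
  equiv k K h := (L.XIsoOfEq (show K = k by omega)).toLinearEquiv
  comm k K K' h h' x := by
    obtain rfl : K = k := by omega
    obtain rfl : K' = K + 1 := by omega
    rfl

/-- A change of coordinates. -/
def Coord.trans {T : CochainComplex (Bimod n) ℤ} {s : ℤ} {M M' : ℤ → Bimod n}
    {δ : ∀ k, M k →ₗ[Env n] M (k + 1)} {δ' : ∀ k, M' k →ₗ[Env n] M' (k + 1)} (c : Coord T s M δ)
    (e : ∀ k, M k ≃ₗ[Env n] M' k) (h : ∀ k x, e (k + 1) (δ k x) = δ' k (e k x)) :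
    Coord T s M' δ' where
  equiv k K h := (c.equiv k K h).trans (e k)
  comm k K K' h₁ h₂ x := by
    rw [LinearEquiv.trans_apply, c.comm k K K' h₁ h₂, h]; rfl

/-- The functoriality of the tensor product with the bimodule of `X_i`, for isomorphisms. -/
def xEquiv (i : Pos n) {N N' : Bimod n} (e : N ≃ₗ[Env n] N') : XT i N ≃ₗ[Env n] XT i N' :=
  LinearEquiv.ofLinearMap (xMap i e.toLinearMap) (xMap i e.symm.toLinearMap)
    (by rw [← xMap_comp, e.comp_symm, xMap_id]) (by rw [← xMap_comp, e.symm_comp, xMap_id])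

/-- The tensor product with the bimodule of the identity braid. -/
def idEquiv (N : Bimod n) : tensorObj (IdB n) N ≃ₗ[Env n] N :=
  LinearEquiv.ofLinearMap (idTensorHom N) (idTensorInv N)
    (LinearMap.ext fun x => idTensorHom_inv x) (LinearMap.ext fun x => idTensorInv_hom x)

theorem idEquiv_natural {N N' : Bimod n} (g : N ⟶ N') (z : tensorObj (IdB n) N) :
    idEquiv N' ((tensorMap (𝟙 (IdB n)) g).hom z) = g.hom (idEquiv N z) := by
  obtain ⟨l, rfl⟩ := (idEquiv N).symm.surjective z
  rw [LinearEquiv.apply_symm_apply]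
  change idTensorHom N' ((tensorMap (𝟙 (IdB n)) g).hom (idTensorInv N l)) = _
  rw [idTensorInv_apply, map_sum]
  exact idTensorHom_inv (g.hom l)

/-- The differential of the complex of a negative crossing, in coordinates. -/
def negProd (i : Pos n) {M₀ M₁ M₂ : Bimod n} (δ₀ : M₀ →ₗ[Env n] M₁) (δ₁ : M₁ →ₗ[Env n] M₂) :
    XT i M₁ × M₀ →ₗ[Env n] XT i M₂ × M₁ :=
  (-(xMap i δ₁).comp (LinearMap.fst _ _ _)).prod ((dM i M₁).coprod δ₀)

/-- The differential of the complex of a positive crossing, in coordinates. -/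
def posProd (i : Pos n) {M₀ M₁ M₂ : Bimod n} (δ₀ : M₀ →ₗ[Env n] M₁) (δ₁ : M₁ →ₗ[Env n] M₂) :
    M₁ × XT i M₀ →ₗ[Env n] M₂ × XT i M₁ :=
  (δ₁.comp (LinearMap.fst _ _ _)).prod ((dP i M₁).coprod (-xMap i δ₀))

theorem posProd_apply (i : Pos n) {M₀ M₁ M₂ : Bimod n} (δ₀ : M₀ →ₗ[Env n] M₁) (δ₁ : M₁ →ₗ[Env n] M₂)
    (z : M₁ × XT i M₀) : posProd i δ₀ δ₁ z = (δ₁ z.1, dP i M₁ z.1 - xMap i δ₀ z.2) := by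
  rw [sub_eq_add_neg]; rfl

variable {s : ℤ} {M : ℤ → Bimod n} {δ : ∀ k, M k →ₗ[Env n] M (k + 1)}

theorem xEquiv_comm (i : Pos n) (c : Coord L s M δ) {k K K' : ℤ} (h : k + s = K)
    (h' : k + 1 + s = K') (x : XT i (L.X K)) :
    xEquiv i (c.equiv (k + 1) K' h') (xMap i (L.d K K').hom x) =
      xMap i (δ k) (xEquiv i (c.equiv k K h) x) := by
  change xMap i (c.equiv (k + 1) K' h').toLinearMap (xMap i (L.d K K').hom x) =
    xMap i (δ k) (xMap i (c.equiv k K h).toLinearMap x)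
  rw [← LinearMap.comp_apply, ← LinearMap.comp_apply, ← xMap_comp, ← xMap_comp]
  congr 2
  exact LinearMap.ext fun x => c.comm k K K' h h' x

/-- The coordinates on the complex of a negative crossing. -/
def Coord.negAux (i : Pos n) (c : Coord L s M δ)
    (hp : (ComplexShape.up ℤ).Rel (-1) 0) :
    Coord (tensorComplex (double (ModuleCat.ofHom (dMinus i)) hp) L) s
      (fun k => ModuleCat.of (Env n) (XT i (M (k + 1)) × M k)) (fun k => negProd i (δ k) (δ (k + 1))) where
  -- The factor `X_i` sits in degree `-1`, so its partner has degree `K + 1`. The shift `s` stays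
  -- the same.
  equiv k K h := (totalEquiv L (ModuleCat.ofHom (dMinus i)) hp (K + 1) K K (by omega)
    (by omega)).trans (LinearEquiv.prodCongr (xEquiv i (c.equiv (k + 1) (K + 1) (by omega)))
      ((idEquiv (L.X K)).trans (c.equiv k K h)))
  comm k K K' h h' x := by
    obtain rfl : K' = K + 1 := by omega
    rw [LinearEquiv.trans_apply, LinearEquiv.trans_apply,
      totalEquiv_d L (ModuleCat.ofHom (dMinus i)) hp K (K + 1) (K + 1 + 1) K (K + 1) (by omega)
        (by omega) rfl rfl (by omega) (by omega) x, Int.negOnePow_neg, Int.negOnePow_one,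
      Int.negOnePow_zero, one_smul, Units.neg_smul, one_smul]
    generalize totalEquiv L (ModuleCat.ofHom (dMinus i)) hp (K + 1) K K (by omega) (by omega) x = z
    refine Prod.ext ?_ ?_
    · change xEquiv i _ (-xMap i (L.d (K + 1) (K + 1 + 1)).hom z.1) = -xMap i (δ (k + 1)) _
      rw [map_neg, xEquiv_comm i c (by omega)]; rfl
    · change c.equiv (k + 1) (K + 1) h' (idEquiv (L.X (K + 1)) (_ + _)) =
        dM i _ (xMap i (c.equiv (k + 1) (K + 1) h').toLinearMap z.1) +
          δ k (c.equiv k K h (idEquiv _ z.2))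
      rw [map_add, map_add, idEquiv_natural, c.comm k K (K + 1) h h', dM_natural]
      rfl

/-- The coordinates on the complex of a positive crossing. -/
def Coord.posAux (i : Pos n) (c : Coord L s M δ)
    (hp : (ComplexShape.up ℤ).Rel 0 1) :
    Coord (tensorComplex (double (ModuleCat.ofHom (dPlus i)) hp) L) (s + 1)
      (fun k => ModuleCat.of (Env n) (M (k + 1) × XT i (M k))) (fun k => posProd i (δ k) (δ (k + 1))) where
  -- The factor `X_i` sits in degree `1`, so its partner has degree `K - 1`. Raising the shift to `s
  -- + 1` expresses both degrees without subtraction.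
  equiv k K h := (totalEquiv L (ModuleCat.ofHom (dPlus i)) hp (k + s + 1) (k + s) K (by omega)
    (by omega)).trans (LinearEquiv.prodCongr ((idEquiv (L.X (k + s + 1))).trans
      (c.equiv (k + 1) (k + s + 1) (by omega))) (xEquiv i (c.equiv k (k + s) rfl)))
  comm k K K' h h' x := by
    obtain rfl : K' = K + 1 := by omega
    -- The degrees `k + 1 + s` and `k + s + 1` are equal but not definitionally so. This restates
    -- the coordinates in the degrees in which the differential is computed.
    have e : ∀ (q q' : ℤ) (h₀ : q = k + s + 1) (h₁ : q' = k + s + 1 + 1) (a₁ a₂ a₃ a₄)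
        (z : (tensorComplex (double (ModuleCat.ofHom (dPlus i)) hp) L).X (K + 1)),
        (((totalEquiv L (ModuleCat.ofHom (dPlus i)) hp (k + 1 + s + 1) (k + 1 + s) (K + 1) a₁
          a₂).trans (LinearEquiv.prodCongr ((idEquiv (L.X (k + 1 + s + 1))).trans
          (c.equiv (k + 1 + 1) (k + 1 + s + 1) (by omega)))
          (xEquiv i (c.equiv (k + 1) (k + 1 + s) rfl)))) z) =
        (((totalEquiv L (ModuleCat.ofHom (dPlus i)) hp q' q (K + 1) a₃
          a₄).trans (LinearEquiv.prodCongr ((idEquiv (L.X q')).trans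
          (c.equiv (k + 1 + 1) q' (by omega)))
          (xEquiv i (c.equiv (k + 1) q (by omega))))) z) := by
      intro q q' h₀ h₁ a₁ a₂ a₃ a₄ z
      obtain rfl : q = k + 1 + s := by omega
      obtain rfl : q' = k + 1 + s + 1 := by omega
      rfl
    rw [e (k + s + 1) (k + s + 1 + 1) rfl rfl _ _ (by omega) (by omega),
      LinearEquiv.trans_apply, LinearEquiv.trans_apply,
      totalEquiv_d L (ModuleCat.ofHom (dPlus i)) hp (k + s) (k + s + 1) (k + s + 1 + 1) K (K + 1)
        (by omega) (by omega) rfl rfl (by omega) (by omega) x, Int.negOnePow_one,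
      Int.negOnePow_zero, one_smul, Units.neg_smul, one_smul]
    generalize totalEquiv L (ModuleCat.ofHom (dPlus i)) hp (k + s + 1) (k + s) K (by omega)
      (by omega) x = z
    rw [posProd_apply]
    refine Prod.ext ?_ ?_
    · change c.equiv (k + 1 + 1) (k + s + 1 + 1) _ (idEquiv _ _) =
        δ (k + 1) (c.equiv (k + 1) (k + s + 1) _ (idEquiv _ z.1))
      rw [idEquiv_natural, c.comm (k + 1) (k + s + 1) _ (by omega)]
    · change xEquiv i _ (_ + -xMap i (L.d (k + s) (k + s + 1)).hom z.2) =
        dP i _ (c.equiv (k + 1) (k + s + 1) _ (idEquiv _ z.1)) - xMap i (δ k) (xEquiv i _ z.2)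
      rw [map_add, map_neg, xEquiv_comm i c rfl, sub_eq_add_neg]
      congr 1
      have := dP_natural (i := i) (c.equiv (k + 1) (k + s + 1) (by omega)).toLinearMap
        (idEquiv _ z.1)
      refine Eq.trans ?_ this.symm
      refine congrArg (xMap i (c.equiv (k + 1) (k + s + 1) (by omega)).toLinearMap) ?_
      -- The map `dP` begins with the inverse of the isomorphism for the identity bimodule, so the
      -- isomorphism used in the coordinates cancels.
      change _ = (tensorMap (ModuleCat.ofHom (dPlus i)) (𝟙 _)).hom (idTensorInv _ (idTensorHom _ z.1))
      rw [idTensorInv_hom]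

end coord

/-! ### Chain maps and homotopies in coordinates -/

namespace Coord

variable {T T' T'' : CochainComplex (Bimod n) ℤ} {s : ℤ} {M M' M'' : ℤ → Bimod n}
  {δ : ∀ k, M k →ₗ[Env n] M (k + 1)} {δ' : ∀ k, M' k →ₗ[Env n] M' (k + 1)}
  {δ'' : ∀ k, M'' k →ₗ[Env n] M'' (k + 1)}

/-- Coordinates with another shift of the degrees. -/
def shift (c : Coord T s M δ) : Coord T (s + 1) (fun k => M (k + 1)) (fun k => δ (k + 1)) where
  equiv k K h := c.equiv (k + 1) K (by omega)
  comm k K K' h h' x := c.comm (k + 1) K K' (by omega) (by omega) x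

/-- The component of a map that is given in coordinates. -/
def mapX (c : Coord T s M δ) (c' : Coord T' s M' δ') (φ : ∀ k, M k →ₗ[Env n] M' k) (K : ℤ) :
    T.X K →ₗ[Env n] T'.X K :=
  ((c'.equiv (K - s) K (by omega)).symm.toLinearMap.comp (φ (K - s))).comp
    (c.equiv (K - s) K (by omega)).toLinearMap

theorem equiv_mapX (c : Coord T s M δ) (c' : Coord T' s M' δ') (φ : ∀ k, M k →ₗ[Env n] M' k)
    (k K : ℤ) (h : k + s = K) (x : T.X K) :
    c'.equiv k K h (c.mapX c' φ K x) = φ k (c.equiv k K h x) := by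
  obtain rfl : k = K - s := by omega
  exact LinearEquiv.apply_symm_apply _ _

/-- The chain map given in coordinates. -/
def hom (c : Coord T s M δ) (c' : Coord T' s M' δ') (φ : ∀ k, M k →ₗ[Env n] M' k)
    (hφ : ∀ k x, φ (k + 1) (δ k x) = δ' k (φ k x)) : T ⟶ T' where
  f K := ModuleCat.ofHom (c.mapX c' φ K)
  comm' K K' h := by
    change K + 1 = K' at h
    refine ModuleCat.hom_ext (LinearMap.ext fun x => ?_)
    apply (c'.equiv (K - s + 1) K' (by omega)).injective
    change c'.equiv _ K' _ ((T'.d K K').hom (c.mapX c' φ K x)) =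
      c'.equiv _ K' _ (c.mapX c' φ K' ((T.d K K').hom x))
    rw [c'.comm (K - s) K K' (by omega), equiv_mapX, equiv_mapX, c.comm (K - s) K K' (by omega), hφ]

theorem equiv_hom (c : Coord T s M δ) (c' : Coord T' s M' δ') (φ : ∀ k, M k →ₗ[Env n] M' k)
    (hφ : ∀ k x, φ (k + 1) (δ k x) = δ' k (φ k x)) (k K : ℤ) (h : k + s = K) (x : T.X K) :
    c'.equiv k K h (((c.hom c' φ hφ).f K).hom x) = φ k (c.equiv k K h x) :=
  equiv_mapX c c' φ k K h x

theorem hom_comp (c : Coord T s M δ) (c' : Coord T' s M' δ') (c'' : Coord T'' s M'' δ'')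
    (φ : ∀ k, M k →ₗ[Env n] M' k) (hφ : ∀ k x, φ (k + 1) (δ k x) = δ' k (φ k x))
    (ψ : ∀ k, M' k →ₗ[Env n] M'' k) (hψ : ∀ k x, ψ (k + 1) (δ' k x) = δ'' k (ψ k x)) :
    c.hom c' φ hφ ≫ c'.hom c'' ψ hψ = c.hom c'' (fun k => (ψ k).comp (φ k))
      (fun k x => by simp only [LinearMap.comp_apply, hφ, hψ]) := by
  ext K x
  apply (c''.equiv (K - s) K (by omega)).injective
  rw [equiv_hom]
  change c''.equiv _ K _ (((c'.hom c'' ψ hψ).f K).hom (((c.hom c' φ hφ).f K).hom x)) = _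
  rw [equiv_hom, equiv_hom]; rfl

theorem hom_eq_id (c : Coord T s M δ) (φ : ∀ k, M k →ₗ[Env n] M k)
    (hφ : ∀ k x, φ (k + 1) (δ k x) = δ k (φ k x)) (h : ∀ k x, φ k x = x) :
    c.hom c φ hφ = 𝟙 T := by
  ext K x
  apply (c.equiv (K - s) K (by omega)).injective
  rw [equiv_hom, h]; rfl

/-- The homotopy given in coordinates. -/
theorem homotopy (c : Coord T s M δ) (c' : Coord T' s M' δ') {φ ψ : T ⟶ T'}
    (h : ∀ k, M (k + 1) →ₗ[Env n] M' k)
    (hh : ∀ k K (hK : k + 1 + s = K) (x : T.X K), c'.equiv (k + 1) K hK ((φ.f K).hom x) =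
      h (k + 1) (δ (k + 1) (c.equiv (k + 1) K hK x)) + δ' k (h k (c.equiv (k + 1) K hK x)) +
        c'.equiv (k + 1) K hK ((ψ.f K).hom x)) : Nonempty (Homotopy φ ψ) := by
  let H : ∀ K K', K' + 1 = K → (T.X K →ₗ[Env n] T'.X K') := fun K K' e =>
    ((c'.equiv (K' - s) K' (by omega)).symm.toLinearMap.comp (h (K' - s))).comp
      (c.equiv (K' - s + 1) K (by omega)).toLinearMap
  have hH : ∀ k K K' (e : K' + 1 = K) (h' : k + s = K') (x : T.X K),
      c'.equiv k K' h' (H K K' e x) = h k (c.equiv (k + 1) K (by omega) x) := by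
    intro k K K' e h' x
    obtain rfl : k = K' - s := by omega
    exact LinearEquiv.apply_symm_apply _ _
  refine ⟨⟨fun K K' => if e : K' + 1 = K then ModuleCat.ofHom (H K K' e) else 0,
    fun K K' e => dif_neg e, fun K => ?_⟩⟩
  -- Degrees run over all integers, so every degree is a successor and the homotopy needs no
  -- subtraction of indices.
  obtain ⟨K', rfl⟩ : ∃ K', K = K' + 1 := ⟨K - 1, by omega⟩
  rw [dNext_eq _ (show (ComplexShape.up ℤ).Rel (K' + 1) (K' + 1 + 1) from rfl),
    prevD_eq _ (show (ComplexShape.up ℤ).Rel K' (K' + 1) from rfl), dif_pos rfl, dif_pos rfl]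
  refine ModuleCat.hom_ext (LinearMap.ext fun x => ?_)
  apply (c'.equiv (K' - s + 1) (K' + 1) (by omega)).injective
  rw [hh]
  change _ = c'.equiv _ _ _ (H (K' + 1 + 1) (K' + 1) rfl ((T.d _ _).hom x) +
    (T'.d _ _).hom (H (K' + 1) K' rfl x) +
    (ψ.f (K' + 1)).hom x)
  rw [map_add, map_add, hH, c'.comm (K' - s) K' (K' + 1) (by omega), hH,
    c.comm (K' - s + 1) (K' + 1) (K' + 1 + 1)]
  all_goals rfl

end Coord

/-! ### Products of bimodules -/

section prod

variable {i : Pos n} {P Q P' Q' R : Bimod n}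

/-- The direct sum of two bimodules. -/
def prodB (P Q : Bimod n) : Bimod n := ModuleCat.of (Env n) (P × Q)

/-- The first projection. -/
def pfst : prodB P Q →ₗ[Env n] P := LinearMap.fst (Env n) P Q

/-- The second projection. -/
def psnd : prodB P Q →ₗ[Env n] Q := LinearMap.snd (Env n) P Q

/-- The homomorphism to a direct sum with the given components. -/
def plift (f : R →ₗ[Env n] P) (g : R →ₗ[Env n] Q) : R →ₗ[Env n] prodB P Q := LinearMap.prod f g

/-- The first inclusion. -/
def pinl : P →ₗ[Env n] prodB P Q := plift LinearMap.id 0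

/-- The second inclusion. -/
def pinr : Q →ₗ[Env n] prodB P Q := plift 0 LinearMap.id

@[simp] theorem pfst_plift (f : R →ₗ[Env n] P) (g : R →ₗ[Env n] Q) (x : R) :
    pfst (plift f g x) = f x := rfl

@[simp] theorem psnd_plift (f : R →ₗ[Env n] P) (g : R →ₗ[Env n] Q) (x : R) :
    psnd (plift f g x) = g x := rfl

@[simp] theorem pfst_pinl (x : P) : pfst (pinl x : prodB P Q) = x := rfl

@[simp] theorem psnd_pinl (x : P) : psnd (pinl x : prodB P Q) = 0 := rfl

@[simp] theorem pfst_pinr (x : Q) : pfst (pinr x : prodB P Q) = 0 := rfl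

@[simp] theorem psnd_pinr (x : Q) : psnd (pinr x : prodB P Q) = x := rfl

theorem prodB_ext {z z' : prodB P Q} (h : pfst z = pfst z') (h' : psnd z = psnd z') : z = z' :=
  Prod.ext h h'

/-- The direct sum of two isomorphisms. -/
def prodBEquiv (e : P ≃ₗ[Env n] P') (e' : Q ≃ₗ[Env n] Q') : prodB P Q ≃ₗ[Env n] prodB P' Q' :=
  LinearEquiv.prodCongr e e'

@[simp] theorem pfst_prodBEquiv (e : P ≃ₗ[Env n] P') (e' : Q ≃ₗ[Env n] Q') (z : prodB P Q) :
    pfst (prodBEquiv e e' z) = e (pfst z) := rfl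

@[simp] theorem psnd_prodBEquiv (e : P ≃ₗ[Env n] P') (e' : Q ≃ₗ[Env n] Q') (z : prodB P Q) :
    psnd (prodBEquiv e e' z) = e' (psnd z) := rfl

theorem xMap_xMap {L L' L'' : Bimod n} (g : L' →ₗ[Env n] L'') (f : L →ₗ[Env n] L') (x : XT i L) :
    xMap i g (xMap i f x) = xMap i (g.comp f) x := by rw [xMap_comp]; rfl

theorem xMap_add {L L' : Bimod n} (f g : L →ₗ[Env n] L') : xMap i (f + g) = xMap i f + xMap i g :=
  XT_hom_ext fun l => by simp [xMap_y]

theorem xMap_neg {L L' : Bimod n} (f : L →ₗ[Env n] L') : xMap i (-f) = -xMap i f :=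
  XT_hom_ext fun l => by simp [xMap_y]

theorem xMap_zero {L L' : Bimod n} : xMap i (0 : L →ₗ[Env n] L') = 0 :=
  XT_hom_ext fun l => by simp [xMap_y]

@[simp] theorem xMap_pfst_plift (f : R →ₗ[Env n] P) (g : R →ₗ[Env n] Q) (x : XT i R) :
    xMap i pfst (xMap i (plift f g) x) = xMap i f x := by
  rw [xMap_xMap]; rfl

@[simp] theorem xMap_psnd_plift (f : R →ₗ[Env n] P) (g : R →ₗ[Env n] Q) (x : XT i R) :
    xMap i psnd (xMap i (plift f g) x) = xMap i g x := by
  rw [xMap_xMap]; rfl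

@[simp] theorem xMap_pfst_pinl (x : XT i P) :
    xMap i pfst (xMap i (pinl : P →ₗ[Env n] prodB P Q) x) = x := by
  rw [pinl, xMap_pfst_plift, xMap_id]; rfl

@[simp] theorem xMap_psnd_pinr (x : XT i Q) :
    xMap i psnd (xMap i (pinr : Q →ₗ[Env n] prodB P Q) x) = x := by
  rw [pinr, xMap_psnd_plift, xMap_id]; rfl

@[simp] theorem xMap_pfst_pinr (x : XT i Q) :
    xMap i pfst (xMap i (pinr : Q →ₗ[Env n] prodB P Q) x) = 0 := by
  rw [pinr, xMap_pfst_plift, xMap_zero]; rfl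

@[simp] theorem xMap_psnd_pinl (x : XT i P) :
    xMap i psnd (xMap i (pinl : P →ₗ[Env n] prodB P Q) x) = 0 := by
  rw [pinl, xMap_psnd_plift, xMap_zero]; rfl

theorem xMap_prod (w : XT i (prodB P Q)) :
    xMap i pinl (xMap i pfst w) + xMap i pinr (xMap i psnd w) = w := by
  rw [xMap_xMap, xMap_xMap, ← LinearMap.add_apply, ← xMap_add]
  have : (pinl : P →ₗ[Env n] prodB P Q).comp pfst + pinr.comp psnd = LinearMap.id :=
    LinearMap.ext fun x => prodB_ext (add_zero _) (zero_add _)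
  rw [this, xMap_id]; rfl

theorem xProd_ext {w w' : XT i (prodB P Q)} (h : xMap i pfst w = xMap i pfst w')
    (h' : xMap i psnd w = xMap i psnd w') : w = w' := by
  rw [← xMap_prod w, ← xMap_prod w', h, h']

variable (i P Q) in
/-- The tensor product with a direct sum. -/
def xProdEquiv : XT i (prodB P Q) ≃ₗ[Env n] prodB (XT i P) (XT i Q) :=
  { plift (xMap i pfst) (xMap i psnd) with
    invFun := fun z => xMap i pinl (pfst z) + xMap i pinr (psnd z)
    left_inv := fun z => xMap_prod z
    right_inv := fun z => prodB_ext
      ((map_add (xMap i pfst) _ _).trans (by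
        rw [xMap_pfst_pinl, xMap_pfst_pinr, add_zero]))
      ((map_add (xMap i psnd) _ _).trans (by
        rw [xMap_psnd_pinl, xMap_psnd_pinr, zero_add])) }

@[simp] theorem pfst_xProdEquiv (w : XT i (prodB P Q)) : pfst (xProdEquiv i P Q w) = xMap i pfst w :=
  rfl

@[simp] theorem psnd_xProdEquiv (w : XT i (prodB P Q)) : psnd (xProdEquiv i P Q w) = xMap i psnd w :=
  rfl

theorem xMap_pfst_dP (z : prodB P Q) : xMap i pfst (dP i (prodB P Q) z) = dP i P (pfst z) :=
  (dP_natural pfst z).symm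

theorem xMap_psnd_dP (z : prodB P Q) : xMap i psnd (dP i (prodB P Q) z) = dP i Q (psnd z) :=
  (dP_natural psnd z).symm

theorem pfst_dM (w : XT i (prodB P Q)) : pfst (dM i (prodB P Q) w) = dM i P (xMap i pfst w) :=
  (dM_natural pfst w).symm

theorem psnd_dM (w : XT i (prodB P Q)) : psnd (dM i (prodB P Q) w) = dM i Q (xMap i psnd w) :=
  (dM_natural psnd w).symm

end prod

/-! ### The complex of a crossing in coordinates -/

section crossing

variable {i j : Pos n} {M₀ M₁ M₂ : Bimod n} (δ₀ : M₀ →ₗ[Env n] M₁) (δ₁ : M₁ →ₗ[Env n] M₂)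

variable (i) in
/-- The differential of the tensor product with the complex of a negative crossing. -/
def negD : prodB (XT i M₁) M₀ →ₗ[Env n] prodB (XT i M₂) M₁ :=
  plift (-(xMap i δ₁).comp pfst) ((dM i M₁).comp pfst + δ₀.comp psnd)

variable (i) in
/-- The differential of the tensor product with the complex of a positive crossing. -/
def posD : prodB M₁ (XT i M₀) →ₗ[Env n] prodB M₂ (XT i M₁) :=
  plift (δ₁.comp pfst) ((dP i M₁).comp pfst + (-xMap i δ₀).comp psnd)

@[simp] theorem pfst_negD (z : prodB (XT i M₁) M₀) :
    pfst (negD i δ₀ δ₁ z) = -xMap i δ₁ (pfst z) := rfl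

@[simp] theorem psnd_negD (z : prodB (XT i M₁) M₀) :
    psnd (negD i δ₀ δ₁ z) = dM i M₁ (pfst z) + δ₀ (psnd z) := rfl

@[simp] theorem pfst_posD (z : prodB M₁ (XT i M₀)) :
    pfst (posD i δ₀ δ₁ z) = δ₁ (pfst z) := rfl

@[simp] theorem psnd_posD (z : prodB M₁ (XT i M₀)) :
    psnd (posD i δ₀ δ₁ z) = dP i M₁ (pfst z) - xMap i δ₀ (psnd z) := by
  rw [sub_eq_add_neg]; rfl

@[simp] theorem xMap_pfst_negD (w : XT i (prodB (XT j M₁) M₀)) :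
    xMap i pfst (xMap i (negD j δ₀ δ₁) w) = -xMap i (xMap j δ₁) (xMap i pfst w) := by
  rw [negD, xMap_pfst_plift, xMap_neg, LinearMap.neg_apply, xMap_xMap]

@[simp] theorem xMap_psnd_negD (w : XT i (prodB (XT j M₁) M₀)) :
    xMap i psnd (xMap i (negD j δ₀ δ₁) w) =
      xMap i (dM j M₁) (xMap i pfst w) + xMap i δ₀ (xMap i psnd w) := by
  rw [negD, xMap_psnd_plift, xMap_add, LinearMap.add_apply, xMap_xMap, xMap_xMap]

@[simp] theorem xMap_pfst_posD (w : XT i (prodB M₁ (XT j M₀))) :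
    xMap i pfst (xMap i (posD j δ₀ δ₁) w) = xMap i δ₁ (xMap i pfst w) := by
  rw [posD, xMap_pfst_plift, xMap_xMap]

@[simp] theorem xMap_psnd_posD (w : XT i (prodB M₁ (XT j M₀))) :
    xMap i psnd (xMap i (posD j δ₀ δ₁) w) =
      xMap i (dP j M₁) (xMap i pfst w) - xMap i (xMap j δ₀) (xMap i psnd w) := by
  rw [posD, xMap_psnd_plift, xMap_add, LinearMap.add_apply, xMap_xMap, sub_eq_add_neg, xMap_xMap,
    LinearMap.neg_comp, xMap_neg, LinearMap.neg_apply]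

variable {L : CochainComplex (Bimod n) ℤ} {s : ℤ} {M : ℤ → Bimod n}
  {δ : ∀ k, M k →ₗ[Env n] M (k + 1)}

/-- The coordinates on the complex of a negative crossing. -/
def Coord.neg (i : Pos n) (c : Coord L s M δ) :
    Coord (tensorComplex (crossingComplex (i, false)) L) s
      (fun k => prodB (XT i (M (k + 1))) (M k)) (fun k => negD i (δ k) (δ (k + 1))) :=
  c.negAux i (by simp)

/-- The coordinates on the complex of a positive crossing. -/
def Coord.pos (i : Pos n) (c : Coord L s M δ) :
    Coord (tensorComplex (crossingComplex (i, true)) L) (s + 1)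
      (fun k => prodB (M (k + 1)) (XT i (M k))) (fun k => posD i (δ k) (δ (k + 1))) :=
  c.posAux i (by simp)

end crossing

/-! ### The second Reidemeister move -/

section reidemeisterTwo

variable {i : Pos n} {M₀ M₁ M₂ M₃ : Bimod n} (δ₀ : M₀ →ₗ[Env n] M₁) (δ₁ : M₁ →ₗ[Env n] M₂)
  (δ₂ : M₂ →ₗ[Env n] M₃)

variable (i M₀ M₁ M₂) in
/-- The inclusion of a complex into its tensor product with a positive and a negative crossing. -/
def posNegIn : M₁ →ₗ[Env n] prodB (prodB (XT i M₂) M₁) (XT i (prodB (XT i M₁) M₀)) :=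
  plift pinr ((xMap i pinl).comp ((sig i M₁).comp (dP i M₁)))

variable (i M₀ M₁ M₂) in
/-- The projection to a complex of its tensor product with a positive and a negative crossing. -/
def posNegOut : prodB (prodB (XT i M₂) M₁) (XT i (prodB (XT i M₁) M₀)) →ₗ[Env n] M₁ :=
  psnd.comp pfst - (dM i M₁).comp ((mu i M₁).comp ((xMap i pfst).comp psnd))

variable (i M₀ M₁ M₂ M₃) in
/-- The homotopy for a positive and a negative crossing. -/
def posNegHomotopy : prodB (prodB (XT i M₃) M₂) (XT i (prodB (XT i M₂) M₁)) →ₗ[Env n]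
    prodB (prodB (XT i M₂) M₁) (XT i (prodB (XT i M₁) M₀)) :=
  plift (-pinl.comp ((mu i M₂).comp ((xMap i pfst).comp psnd)))
    ((xMap i pinl).comp ((sig i M₁).comp ((xMap i psnd).comp psnd)))

/-- The component `sig (dP l)` is chosen so that the inner `d⁻` returns `dP l`, which cancels the
outer `d⁺`. -/
theorem posNegIn_comm (l : M₁) : posNegIn i M₁ M₂ M₃ (δ₁ l) =
    posD i (negD i δ₀ δ₁) (negD i δ₁ δ₂) (posNegIn i M₀ M₁ M₂ l) := by
  refine prodB_ext (prodB_ext ?_ ?_) (xProd_ext ?_ ?_)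
  · simp [posNegIn]
  · simp [posNegIn]
  · simp [posNegIn, ← sig_natural, ← dP_natural]
  · simp [posNegIn, xMap_psnd_dP, xMap_dM_sig]

theorem posNegOut_comm (z : prodB (prodB (XT i M₂) M₁) (XT i (prodB (XT i M₁) M₀))) :
    posNegOut i M₁ M₂ M₃ (posD i (negD i δ₀ δ₁) (negD i δ₁ δ₂) z) =
      δ₁ (posNegOut i M₀ M₁ M₂ z) := by
  simp only [posNegOut, LinearMap.sub_apply, LinearMap.comp_apply, pfst_posD, psnd_posD, psnd_negD,
    map_sub, map_neg, xMap_pfst_negD, xMap_pfst_dP, mu_dP, mu_natural, dM_natural]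
  abel

theorem posNegOut_in (l : M₁) : posNegOut i M₀ M₁ M₂ (posNegIn i M₀ M₁ M₂ l) = l := by
  simp [posNegOut, posNegIn, mu_sig]

/-- The homotopy cancels `X_i X_i` against the two copies of `X_i`, using `-mu` towards one and
`sig` from the other. On the copies of `X_i` the unit and counit laws suffice. -/
theorem posNeg_homotopy (z : prodB (prodB (XT i M₃) M₂) (XT i (prodB (XT i M₂) M₁)))
    {M₄ : Bimod n} (δ₃ : M₃ →ₗ[Env n] M₄) :
    posNegIn i M₁ M₂ M₃ (posNegOut i M₁ M₂ M₃ z) =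
      posNegHomotopy i M₁ M₂ M₃ M₄ (posD i (negD i δ₁ δ₂) (negD i δ₂ δ₃) z) +
      posD i (negD i δ₀ δ₁) (negD i δ₁ δ₂) (posNegHomotopy i M₀ M₁ M₂ M₃ z) + z := by
  -- The component in `X_i X_i` is exactly this identity.
  have h0 := dP_mu_add (xMap i pfst (psnd z))
  refine prodB_ext (prodB_ext ?_ ?_) (xProd_ext ?_ ?_)
  · simp [posNegIn, posNegHomotopy, xMap_pfst_dP, mu_dP, mu_natural]
  · simp [posNegIn, posNegOut, posNegHomotopy]
    abel
  · simp only [posNegIn, posNegOut, posNegHomotopy, psnd_plift, pfst_plift, LinearMap.comp_apply,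
      LinearMap.sub_apply, LinearMap.neg_apply, psnd_posD, map_sub, map_add, map_neg,
      xMap_pfst_negD, xMap_psnd_negD, xMap_pfst_pinl, xMap_pfst_dP, xMap_psnd_dP, pfst_pinl,
      ← sig_natural] at h0 ⊢
    rw [← sub_eq_zero] at h0 ⊢
    rw [← h0]
    abel
  · simp [posNegIn, posNegHomotopy, xMap_psnd_dP, xMap_dM_sig]

variable (i M₀ M₁ M₂) in
/-- The inclusion of a complex into its tensor product with a negative and a positive crossing. -/
def negPosIn : M₁ →ₗ[Env n] prodB (XT i (prodB M₂ (XT i M₁))) (prodB M₁ (XT i M₀)) :=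
  plift (-(xMap i pinr).comp ((sig i M₁).comp (dP i M₁))) pinl

variable (i M₀ M₁ M₂) in
/-- The projection to a complex of its tensor product with a negative and a positive crossing. -/
def negPosOut : prodB (XT i (prodB M₂ (XT i M₁))) (prodB M₁ (XT i M₀)) →ₗ[Env n] M₁ :=
  (dM i M₁).comp ((mu i M₁).comp ((xMap i psnd).comp pfst)) + pfst.comp psnd

variable (i M₀ M₁ M₂ M₃) in
/-- The homotopy for a negative and a positive crossing. -/
def negPosHomotopy : prodB (XT i (prodB M₃ (XT i M₂))) (prodB M₂ (XT i M₁)) →ₗ[Env n]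
    prodB (XT i (prodB M₂ (XT i M₁))) (prodB M₁ (XT i M₀)) :=
  pinl.comp ((xMap i pinl).comp ((mu i M₂).comp ((xMap i psnd).comp pfst)) -
    (xMap i pinr).comp ((sig i M₁).comp (psnd.comp psnd)))

theorem negPosIn_comm (l : M₁) : negPosIn i M₁ M₂ M₃ (δ₁ l) =
    negD i (posD i δ₀ δ₁) (posD i δ₁ δ₂) (negPosIn i M₀ M₁ M₂ l) := by
  refine prodB_ext (xProd_ext ?_ ?_) (prodB_ext ?_ ?_)
  · simp [negPosIn]
  · simp [negPosIn, ← sig_natural, ← dP_natural]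
  · simp [negPosIn, pfst_dM]
  · simp [negPosIn, psnd_dM, dM_sig]

theorem negPosOut_comm (z : prodB (XT i (prodB M₂ (XT i M₁))) (prodB M₁ (XT i M₀))) :
    negPosOut i M₁ M₂ M₃ (negD i (posD i δ₀ δ₁) (posD i δ₁ δ₂) z) =
      δ₁ (negPosOut i M₀ M₁ M₂ z) := by
  simp only [negPosOut, LinearMap.add_apply, LinearMap.comp_apply, pfst_negD, psnd_negD, pfst_posD,
    map_sub, map_add, map_neg, xMap_psnd_posD, mu_xMap_dP, mu_natural, pfst_dM]
  rw [← dM_natural]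
  abel

theorem negPosOut_in (l : M₁) : negPosOut i M₀ M₁ M₂ (negPosIn i M₀ M₁ M₂ l) = l := by
  simp [negPosOut, negPosIn, mu_sig]

/-- As for the opposite order, but now `d⁺` acts inside and `d⁻` outside, so the component in `X_i
X_i` is `xMap_dP_mu_add`. -/
theorem negPos_homotopy (z : prodB (XT i (prodB M₃ (XT i M₂))) (prodB M₂ (XT i M₁)))
    {M₄ : Bimod n} (δ₃ : M₃ →ₗ[Env n] M₄) :
    negPosIn i M₁ M₂ M₃ (negPosOut i M₁ M₂ M₃ z) =
      negPosHomotopy i M₁ M₂ M₃ M₄ (negD i (posD i δ₁ δ₂) (posD i δ₂ δ₃) z) +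
      negD i (posD i δ₀ δ₁) (posD i δ₁ δ₂) (negPosHomotopy i M₀ M₁ M₂ M₃ z) + z := by
  have h0 := xMap_dP_mu_add (xMap i psnd (pfst z))
  refine prodB_ext (xProd_ext ?_ ?_) (prodB_ext ?_ ?_)
  · simp [negPosIn, negPosHomotopy, mu_xMap_dP, mu_natural]
    abel
  · simp only [negPosIn, negPosOut, negPosHomotopy, pfst_plift, LinearMap.comp_apply,
      LinearMap.sub_apply, LinearMap.add_apply, LinearMap.neg_apply, pfst_negD, psnd_negD,
      psnd_posD, map_sub, map_add, map_neg, xMap_psnd_posD, xMap_psnd_pinl, xMap_psnd_pinr,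
      xMap_pfst_pinl, xMap_pfst_pinr, psnd_dM, pfst_pinl, map_zero,
      ← sig_natural] at h0 ⊢
    rw [← sub_eq_zero] at h0 ⊢
    rw [← neg_eq_zero, ← h0]
    abel
  · simp [negPosIn, negPosOut, negPosHomotopy, pfst_dM]
  · simp [negPosIn, negPosHomotopy, psnd_dM, dM_sig]

end reidemeisterTwo

/-- The invariance under the second Reidemeister move, with a strict retraction. -/
theorem exists_retraction (L : CochainComplex (Bimod n) ℤ) (i : Pos n) (b : Bool) :
    ∃ (f : L ⟶ tensorComplex (crossingComplex (i, b)) (tensorComplex (crossingComplex (i, !b)) L))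
      (g : tensorComplex (crossingComplex (i, b)) (tensorComplex (crossingComplex (i, !b)) L) ⟶ L),
      f ≫ g = 𝟙 L ∧ Nonempty (Homotopy (g ≫ f) (𝟙 _)) := by
  have c := Coord.refl L
  cases b with
  | true =>
    -- The two crossings raise the shift by one in total, so `L` is given coordinates with the same
    -- shift. This places its term `M (k + 1)` opposite the middle of the double complex.
    refine ⟨c.shift.hom ((c.neg i).pos i) (fun k => posNegIn i _ _ _)
        (fun k x => posNegIn_comm _ _ _ x),
      ((c.neg i).pos i).hom c.shift (fun k => posNegOut i _ _ _)
        (fun k x => posNegOut_comm _ _ _ x), ?_, ?_⟩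
    · rw [Coord.hom_comp]
      exact Coord.hom_eq_id _ _ _ fun k x => posNegOut_in _
    · rw [Coord.hom_comp]
      refine Coord.homotopy ((c.neg i).pos i) ((c.neg i).pos i)
        (fun k => posNegHomotopy i _ _ _ _) fun k K hK x => ?_
      rw [Coord.equiv_hom]
      exact posNeg_homotopy _ _ _ (((c.neg i).pos i).equiv (k + 1) K hK x) _
  | false =>
    refine ⟨c.shift.hom ((c.pos i).neg i) (fun k => negPosIn i _ _ _)
        (fun k x => negPosIn_comm _ _ _ x),
      ((c.pos i).neg i).hom c.shift (fun k => negPosOut i _ _ _)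
        (fun k x => negPosOut_comm _ _ _ x), ?_, ?_⟩
    · rw [Coord.hom_comp]
      exact Coord.hom_eq_id _ _ _ fun k x => negPosOut_in _
    · rw [Coord.hom_comp]
      refine Coord.homotopy ((c.pos i).neg i) ((c.pos i).neg i)
        (fun k => negPosHomotopy i _ _ _ _) fun k K hK x => ?_
      rw [Coord.equiv_hom]
      exact negPos_homotopy _ _ _ (((c.pos i).neg i).equiv (k + 1) K hK x) _

/-! ### Naturality of the maps on triple products -/

section natural

variable {a b : Pos n} {L L' : Bimod n}

theorem xMap_comm {P P' Q Q' : Bimod n} {f : P →ₗ[Env n] P'} {g : Q →ₗ[Env n] Q'}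
    {p : P →ₗ[Env n] Q} {q : P' →ₗ[Env n] Q'} (h : ∀ x, q (f x) = g (p x)) (x : XT a P) :
    xMap a q (xMap a f x) = xMap a g (xMap a p x) := by
  rw [xMap_xMap, xMap_xMap, show q.comp f = g.comp p from LinearMap.ext h]

theorem xMap_comp_apply {P Q R : Bimod n} (g : Q →ₗ[Env n] R) (f : P →ₗ[Env n] Q) (x : XT a P) :
    xMap a (g.comp f) x = xMap a g (xMap a f x) := (xMap_xMap g f x).symm

theorem xMap_sub (f g : L →ₗ[Env n] L') : xMap a (f - g) = xMap a f - xMap a g :=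
  XT_hom_ext fun l => by simp [xMap_y]

theorem incl_natural (f : L →ₗ[Env n] L') (x : XT a L) :
    incl a b L' (xMap a f x) = xMap a (xMap b (xMap a f)) (incl a b L x) := by
  rw [incl, LinearMap.comp_apply, sig_natural, incl, LinearMap.comp_apply]
  exact xMap_comm (fun x => dP_natural _ x) _

theorem xMap_xMap_dM_incl (x : XT a L) :
    xMap a (xMap b (dM a L)) (incl a b L x) = xMap a (dP b L) x := by
  rw [incl, LinearMap.comp_apply, ← xMap_comm (fun x => dP_natural (dM a L) x), xMap_dM_sig]

theorem Adjacent.braid_natural (h : Adjacent a b) (f : L →ₗ[Env n] L') (w : XT a (XT b (XT a L))) :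
    h.braid L' (xMap a (xMap b (xMap a f)) w) = xMap b (xMap a (xMap b f)) (h.braid L w) :=
  LinearMap.congr_fun (f := (h.braid L').comp (xMap a (xMap b (xMap a f))))
    (g := (xMap b (xMap a (xMap b f))).comp (h.braid L))
    (h.hom_ext (fun l => by
      have e : xMap a (xMap b (xMap a f)) (yyy a b L l) = yyy a b L' (f l) := by
        simp only [yyy, xMap_y]
      rw [LinearMap.comp_apply, LinearMap.comp_apply, e, h.braid_yyy, h.braid_yyy]
      simp only [yyy, xMap_y]) (fun l => by
      rw [LinearMap.comp_apply, LinearMap.comp_apply, ← incl_natural, h.braid_incl, h.braid_incl,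
        map_zero])) w

end natural

/-! ### Two negative crossings -/

section pair

variable {a b : Pos n} {M₀ M₁ M₂ M₃ : Bimod n} (δ₀ : M₀ →ₗ[Env n] M₁) (δ₁ : M₁ →ₗ[Env n] M₂)
  (δ₂ : M₂ →ₗ[Env n] M₃)

variable (a b M₀ M₁ M₂) in
/-- The terms of the complex of two negative crossings. -/
abbrev PairB : Bimod n := prodB (prodB (XT a (XT b M₂)) (XT a M₁)) (prodB (XT b M₁) M₀)

variable (a b M₀ M₁ M₂) in
/-- The isomorphism to the terms of the complex of two negative crossings. -/
def pairEquiv : prodB (XT a (prodB (XT b M₂) M₁)) (prodB (XT b M₁) M₀) ≃ₗ[Env n]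
    PairB a b M₀ M₁ M₂ :=
  prodBEquiv (xProdEquiv a (XT b M₂) M₁) (LinearEquiv.refl _ _)

variable (a b) in
/-- The differential of the complex of two negative crossings. -/
def pairD : PairB a b M₀ M₁ M₂ →ₗ[Env n] PairB a b M₁ M₂ M₃ :=
  plift
    (plift ((xMap a (xMap b δ₂)).comp (pfst.comp pfst))
      (-(xMap a δ₁).comp (psnd.comp pfst) - (xMap a (dM b M₂)).comp (pfst.comp pfst)))
    (plift (-(xMap b δ₁).comp (pfst.comp psnd) + (dM a (XT b M₂)).comp (pfst.comp pfst))
      (δ₀.comp (psnd.comp psnd) + (dM a M₁).comp (psnd.comp pfst) +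
        (dM b M₁).comp (pfst.comp psnd)))

theorem pairEquiv_comm (z : prodB (XT a (prodB (XT b M₂) M₁)) (prodB (XT b M₁) M₀)) :
    pairEquiv a b M₁ M₂ M₃ (negD a (negD b δ₀ δ₁) (negD b δ₁ δ₂) z) =
      pairD a b δ₀ δ₁ δ₂ (pairEquiv a b M₀ M₁ M₂ z) := by
  refine prodB_ext (prodB_ext ?_ ?_) (prodB_ext ?_ ?_)
  · simp [pairEquiv, pairD]
  · simp [pairEquiv, pairD, sub_eq_add_neg]
  · simp [pairEquiv, pairD, pfst_dM]
    abel
  · simp [pairEquiv, pairD, psnd_dM]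
    abel

variable {L : CochainComplex (Bimod n) ℤ} {s : ℤ} {M : ℤ → Bimod n}
  {δ : ∀ k, M k →ₗ[Env n] M (k + 1)}

/-- The coordinates on the complex of two negative crossings. -/
def Coord.pair (a b : Pos n) (c : Coord L s M δ) :
    Coord (tensorComplex (crossingComplex (a, false)) (tensorComplex (crossingComplex (b, false)) L))
      s (fun k => PairB a b (M k) (M (k + 1)) (M (k + 1 + 1)))
      (fun k => pairD a b (δ k) (δ (k + 1)) (δ (k + 1 + 1))) :=
  ((c.neg b).neg a).trans (fun _ => pairEquiv a b _ _ _) fun _ z => pairEquiv_comm _ _ _ z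

/-- The map that exchanges two distant negative crossings. -/
def Far.pairMap (h : Far a b) (M₀ M₁ M₂ : Bimod n) :
    PairB a b M₀ M₁ M₂ →ₗ[Env n] PairB b a M₀ M₁ M₂ :=
  plift (plift (-(h.swap M₂).comp (pfst.comp pfst)) (pfst.comp psnd))
    (plift (psnd.comp pfst) (psnd.comp psnd))

/-- The two differentials out of the double product carry opposite signs. Exchanging the crossings
interchanges them, so `swap` must enter with a minus sign. -/
theorem Far.pairMap_comm (h : Far a b) (z : PairB a b M₀ M₁ M₂) :
    h.pairMap M₁ M₂ M₃ (pairD a b δ₀ δ₁ δ₂ z) = pairD b a δ₀ δ₁ δ₂ (h.pairMap M₀ M₁ M₂ z) := by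
  refine prodB_ext (prodB_ext ?_ ?_) (prodB_ext ?_ ?_)
  · simp [pairMap, pairD, h.swap_natural]
  · simp [pairMap, pairD, h.xMap_dM_swap]
  · simp [pairMap, pairD, h.dM_swap, sub_eq_add_neg]
  · simp [pairMap, pairD]
    abel

theorem Far.pairMap_pairMap (h : Far a b) (h' : Far b a) (z : PairB a b M₀ M₁ M₂) :
    h'.pairMap M₀ M₁ M₂ (h.pairMap M₀ M₁ M₂ z) = z := by
  refine prodB_ext (prodB_ext ?_ ?_) (prodB_ext ?_ ?_)
  · simp [pairMap, h.swap_swap h']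
  all_goals simp [pairMap]

/-- The invariance under the exchange of two distant negative crossings. -/
theorem Far.nonempty_homotopyEquiv (h : Far a b) (L : CochainComplex (Bimod n) ℤ) :
    Nonempty (HomotopyEquiv
      (tensorComplex (crossingComplex (a, false)) (tensorComplex (crossingComplex (b, false)) L))
      (tensorComplex (crossingComplex (b, false)) (tensorComplex (crossingComplex (a, false)) L))) := by
  have c := Coord.refl L
  refine ⟨⟨(c.pair a b).hom (c.pair b a) (fun k => h.pairMap _ _ _)
      (fun k x => h.pairMap_comm _ _ _ x),
    (c.pair b a).hom (c.pair a b) (fun k => h.symm.pairMap _ _ _)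
      (fun k x => h.symm.pairMap_comm _ _ _ x), Homotopy.ofEq ?_, Homotopy.ofEq ?_⟩⟩
  · rw [Coord.hom_comp]
    exact Coord.hom_eq_id _ _ _ fun k x => h.pairMap_pairMap h.symm _
  · rw [Coord.hom_comp]
    exact Coord.hom_eq_id _ _ _ fun k x => h.symm.pairMap_pairMap h _

end pair

/-! ### Three negative crossings -/

section triple

variable {a b : Pos n} {M₀ M₁ M₂ M₃ M₄ M₅ : Bimod n} (δ₀ : M₀ →ₗ[Env n] M₁)
  (δ₁ : M₁ →ₗ[Env n] M₂) (δ₂ : M₂ →ₗ[Env n] M₃) (δ₃ : M₃ →ₗ[Env n] M₄) (δ₄ : M₄ →ₗ[Env n] M₅)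

variable (a b M₀ M₁ M₂ M₃) in
/-- The terms of the complex of three negative crossings. -/
abbrev TripleB : Bimod n :=
  prodB (prodB (prodB (XT a (XT b (XT a M₃))) (XT a (XT b M₂))) (prodB (XT a (XT a M₂)) (XT a M₁)))
    (PairB b a M₀ M₁ M₂)

variable (a b M₀ M₁ M₂ M₃) in
/-- The isomorphism to the terms of the complex of three negative crossings. -/
def tripleEquiv : prodB (XT a (PairB b a M₁ M₂ M₃)) (PairB b a M₀ M₁ M₂) ≃ₗ[Env n]
    TripleB a b M₀ M₁ M₂ M₃ :=
  prodBEquiv ((xProdEquiv a _ _).trans (prodBEquiv (xProdEquiv a _ _) (xProdEquiv a _ _)))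
    (LinearEquiv.refl _ _)

variable (a b) in
/-- The differential of the complex of three negative crossings. -/
def tripleD : TripleB a b M₀ M₁ M₂ M₃ →ₗ[Env n] TripleB a b M₁ M₂ M₃ M₄ :=
  plift
    (plift
      (plift (-(xMap a (xMap b (xMap a δ₃))).comp (pfst.comp (pfst.comp pfst)))
        ((xMap a (xMap b δ₂)).comp (psnd.comp (pfst.comp pfst)) +
          (xMap a (xMap b (dM a M₃))).comp (pfst.comp (pfst.comp pfst))))
      (plift ((xMap a (xMap a δ₂)).comp (pfst.comp (psnd.comp pfst)) -
          (xMap a (dM b (XT a M₃))).comp (pfst.comp (pfst.comp pfst)))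
        (-(xMap a δ₁).comp (psnd.comp (psnd.comp pfst)) -
          (xMap a (dM a M₂)).comp (pfst.comp (psnd.comp pfst)) -
          (xMap a (dM b M₂)).comp (psnd.comp (pfst.comp pfst)))))
    (plift
      (plift ((xMap b (xMap a δ₂)).comp (pfst.comp (pfst.comp psnd)) +
          (dM a (XT b (XT a M₃))).comp (pfst.comp (pfst.comp pfst)))
        (-(xMap b δ₁).comp (psnd.comp (pfst.comp psnd)) -
          (xMap b (dM a M₂)).comp (pfst.comp (pfst.comp psnd)) +
          (dM a (XT b M₂)).comp (psnd.comp (pfst.comp pfst))))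
      (plift (-(xMap a δ₁).comp (pfst.comp (psnd.comp psnd)) +
          (dM b (XT a M₂)).comp (pfst.comp (pfst.comp psnd)) +
          (dM a (XT a M₂)).comp (pfst.comp (psnd.comp pfst)))
        (δ₀.comp (psnd.comp (psnd.comp psnd)) + (dM a M₁).comp (pfst.comp (psnd.comp psnd)) +
          (dM b M₁).comp (psnd.comp (pfst.comp psnd)) +
          (dM a M₁).comp (psnd.comp (psnd.comp pfst)))))

theorem tripleEquiv_comm (z : prodB (XT a (PairB b a M₁ M₂ M₃)) (PairB b a M₀ M₁ M₂)) :
    tripleEquiv a b M₁ M₂ M₃ M₄ (negD a (pairD b a δ₀ δ₁ δ₂) (pairD b a δ₁ δ₂ δ₃) z) =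
      tripleD a b δ₀ δ₁ δ₂ δ₃ (tripleEquiv a b M₀ M₁ M₂ M₃ z) := by
  refine prodB_ext (prodB_ext (prodB_ext ?_ ?_) (prodB_ext ?_ ?_))
    (prodB_ext (prodB_ext ?_ ?_) (prodB_ext ?_ ?_))
  · simp [tripleEquiv, tripleD, pairD, xMap_comp_apply]
  · simp [tripleEquiv, tripleD, pairD, xMap_comp_apply, xMap_neg, xMap_sub]
    abel
  · simp [tripleEquiv, tripleD, pairD, xMap_comp_apply, xMap_neg, xMap_add]
    abel
  · simp [tripleEquiv, tripleD, pairD, xMap_comp_apply, xMap_add]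
    abel
  · simp [tripleEquiv, tripleD, pairD, pfst_dM]
    abel
  · simp [tripleEquiv, tripleD, pairD, pfst_dM, psnd_dM]
    abel
  · simp [tripleEquiv, tripleD, pairD, pfst_dM, psnd_dM]
    abel
  · simp [tripleEquiv, tripleD, pairD, psnd_dM]
    abel

variable {L : CochainComplex (Bimod n) ℤ} {s : ℤ} {M : ℤ → Bimod n}
  {δ : ∀ k, M k →ₗ[Env n] M (k + 1)}

/-- The coordinates on the complex of three negative crossings. -/
def Coord.triple (a b : Pos n) (c : Coord L s M δ) :
    Coord (tensorComplex (crossingComplex (a, false)) (tensorComplex (crossingComplex (b, false))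
        (tensorComplex (crossingComplex (a, false)) L)))
      s (fun k => TripleB a b (M k) (M (k + 1)) (M (k + 1 + 1)) (M (k + 1 + 1 + 1)))
      (fun k => tripleD a b (δ k) (δ (k + 1)) (δ (k + 1 + 1)) (δ (k + 1 + 1 + 1))) :=
  ((c.pair b a).neg a).trans (fun _ => tripleEquiv a b _ _ _ _) fun _ z =>
    tripleEquiv_comm _ _ _ _ z

variable (a b M₀ M₁ M₂ M₃) in
/-- The component in `X_a X_b` of the third Reidemeister move. -/
def tripleFst : TripleB a b M₀ M₁ M₂ M₃ →ₗ[Env n] XT a (XT b M₂) :=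
  psnd.comp (pfst.comp pfst) -
    (xMap a (dP b M₂)).comp ((mu a M₂).comp (pfst.comp (psnd.comp pfst)))

variable (a b M₀ M₁ M₂ M₃) in
/-- The component in `X_b X_a` of the third Reidemeister move. -/
def tripleSnd : TripleB a b M₀ M₁ M₂ M₃ →ₗ[Env n] XT b (XT a M₂) :=
  pfst.comp (pfst.comp psnd) - (dP b (XT a M₂)).comp ((mu a M₂).comp (pfst.comp (psnd.comp pfst)))

/-- The map for the third Reidemeister move. -/
def Adjacent.tripleMap (h : Adjacent a b) (M₀ M₁ M₂ M₃ : Bimod n) :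
    TripleB a b M₀ M₁ M₂ M₃ →ₗ[Env n] TripleB b a M₀ M₁ M₂ M₃ :=
  plift
    (plift (plift ((h.braid M₃).comp (pfst.comp (pfst.comp pfst))) (tripleSnd a b M₀ M₁ M₂ M₃))
      (plift (-(sig b M₂).comp ((xMap b (dM a M₂)).comp (tripleSnd a b M₀ M₁ M₂ M₃))) 0))
    (plift
      (plift (tripleFst a b M₀ M₁ M₂ M₃)
        (psnd.comp (psnd.comp pfst) + pfst.comp (psnd.comp psnd)))
      (plift (psnd.comp (pfst.comp psnd)) (psnd.comp (psnd.comp psnd))))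

variable (a b M₀ M₁ M₂ M₃ M₄) in
/-- The homotopy for the third Reidemeister move. -/
def tripleHomotopy : TripleB a b M₁ M₂ M₃ M₄ →ₗ[Env n] TripleB a b M₀ M₁ M₂ M₃ :=
  plift
    (plift (plift (-(incl a b M₃).comp ((mu a M₃).comp (pfst.comp (psnd.comp pfst)))) 0)
      (plift ((sig a M₂).comp (psnd.comp (psnd.comp pfst))) 0)) 0

/-- The correction by `mu` removes the contribution of `X_a X_a`. The only new term comes from the
triple product, in the form that `braid` produces. The same holds for the other component. -/
theorem tripleSnd_tripleD (z : TripleB a b M₀ M₁ M₂ M₃) :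
    tripleSnd a b M₁ M₂ M₃ M₄ (tripleD a b δ₀ δ₁ δ₂ δ₃ z) =
      xMap b (xMap a δ₂) (tripleSnd a b M₀ M₁ M₂ M₃ z) +
        (dM a _ (pfst (pfst (pfst z))) + dP b _ (proj a b M₃ (pfst (pfst (pfst z))))) := by
  simp only [tripleSnd, tripleD, proj, LinearMap.sub_apply, LinearMap.add_apply,
    LinearMap.comp_apply, pfst_plift, psnd_plift, map_sub, mu_natural, dP_natural]
  abel

theorem tripleFst_tripleD (z : TripleB a b M₀ M₁ M₂ M₃) :
    tripleFst a b M₁ M₂ M₃ M₄ (tripleD a b δ₀ δ₁ δ₂ δ₃ z) =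
      xMap a (xMap b δ₂) (tripleFst a b M₀ M₁ M₂ M₃ z) +
        (xMap a (xMap b (dM a M₃)) (pfst (pfst (pfst z))) +
          xMap a (dP b M₃) (proj a b M₃ (pfst (pfst (pfst z))))) := by
  simp only [tripleFst, tripleD, proj, LinearMap.sub_apply, LinearMap.add_apply,
    LinearMap.comp_apply, pfst_plift, psnd_plift, map_sub, mu_natural]
  rw [xMap_comm (fun x => dP_natural δ₂ x)]
  abel

/-- The triple product is handled by the compatibility of `braid` with the three maps `d⁻`. The two
copies of `X_a` are added into one, so their incoming differentials must combine, which is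
`dM_decomposition`. -/
theorem Adjacent.tripleMap_comm (h : Adjacent a b) (z : TripleB a b M₀ M₁ M₂ M₃) :
    h.tripleMap M₁ M₂ M₃ M₄ (tripleD a b δ₀ δ₁ δ₂ δ₃ z) =
      tripleD b a δ₀ δ₁ δ₂ δ₃ (h.tripleMap M₀ M₁ M₂ M₃ z) := by
  refine prodB_ext (prodB_ext (prodB_ext ?_ ?_) (prodB_ext ?_ ?_))
    (prodB_ext (prodB_ext ?_ ?_) (prodB_ext ?_ ?_))
  · simp [tripleMap, tripleD, h.braid_natural]
  · simp only [tripleMap, pfst_plift, psnd_plift, tripleSnd_tripleD]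
    simp only [tripleD, LinearMap.add_apply, LinearMap.comp_apply, pfst_plift, psnd_plift,
      h.xMap_xMap_dM_braid]
  · simp only [tripleMap, LinearMap.neg_apply, LinearMap.comp_apply, pfst_plift, psnd_plift,
      tripleSnd_tripleD]
    simp only [tripleD, LinearMap.sub_apply, LinearMap.neg_apply, LinearMap.comp_apply, pfst_plift,
      psnd_plift, h.xMap_dM_braid, map_add (xMap b (dM a _)) (xMap b (xMap a δ₂) _), map_neg]
    rw [xMap_comm (fun x => dM_natural δ₂ x), map_add, sig_natural]
    abel
  · simp [tripleMap, tripleD, xMap_dM_sig]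
  · simp only [tripleMap, pfst_plift, psnd_plift, tripleFst_tripleD]
    simp only [tripleD, LinearMap.add_apply, LinearMap.comp_apply, pfst_plift, psnd_plift,
      h.dM_braid]
  -- Both sides reach `X_a` from `X_a X_a` along several routes, and their difference is this
  -- identity.
  · have e := h.dM_decomposition (pfst (psnd (pfst z)))
    simp only [tripleMap, tripleD, tripleFst, tripleSnd, LinearMap.sub_apply, LinearMap.add_apply,
      LinearMap.neg_apply, LinearMap.comp_apply, pfst_plift, psnd_plift, map_sub, map_add]
    rw [← sub_eq_zero] at e ⊢
    rw [← e]
    abel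
  · simp only [tripleMap, tripleD, tripleFst, tripleSnd, LinearMap.sub_apply, LinearMap.add_apply,
      LinearMap.neg_apply, LinearMap.comp_apply, pfst_plift, psnd_plift, map_sub, map_neg, dM_sig,
      dM_natural, ← dP_natural]
    abel
  · simp [tripleMap, tripleD]
    abel

/-- The homotopy contracts `X_a X_a` against the summand `X_a` of the triple product, by `-incl ∘
mu`, and against one of the two copies of `X_a`, by `sig`. The first accounts for the defect `incl ∘
proj` of `braid`. The component in `X_a X_a` is `sig_decomposition`. -/
theorem Adjacent.triple_homotopy (h : Adjacent a b) (h' : Adjacent b a)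
    (z : TripleB a b M₁ M₂ M₃ M₄) :
    h'.tripleMap M₁ M₂ M₃ M₄ (h.tripleMap M₁ M₂ M₃ M₄ z) =
      tripleHomotopy a b M₁ M₂ M₃ M₄ M₅ (tripleD a b δ₁ δ₂ δ₃ δ₄ z) +
        tripleD a b δ₀ δ₁ δ₂ δ₃ (tripleHomotopy a b M₀ M₁ M₂ M₃ M₄ z) + z := by
  refine prodB_ext (prodB_ext (prodB_ext ?_ ?_) (prodB_ext ?_ ?_))
    (prodB_ext (prodB_ext ?_ ?_) (prodB_ext ?_ ?_))
  · simp only [tripleMap, tripleD, tripleHomotopy, LinearMap.sub_apply, LinearMap.neg_apply,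
      LinearMap.comp_apply, pfst_plift, psnd_plift, map_sub, map_neg, map_add, h.braid_braid h',
      mu_natural, incl_natural, proj]
    abel
  · simp only [tripleMap, tripleD, tripleHomotopy, tripleFst, tripleSnd, LinearMap.sub_apply,
      LinearMap.neg_apply, LinearMap.add_apply, LinearMap.zero_apply,
      LinearMap.comp_apply, pfst_plift, psnd_plift, map_sub, map_neg, map_add, mu_sig, map_zero,
      xMap_xMap_dM_incl]
    abel
  · have e := h.sig_decomposition (pfst (psnd (pfst z)))
    simp only [tripleMap, tripleD, tripleHomotopy, tripleFst, tripleSnd, LinearMap.sub_apply,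
      LinearMap.neg_apply, incl, LinearMap.comp_apply, pfst_plift, psnd_plift, map_sub, map_neg,
      map_add, mu_sig, map_zero, ← sig_natural] at e ⊢
    rw [← sub_eq_zero] at e ⊢
    rw [← neg_eq_zero, ← e]
    abel
  · simp [tripleMap, tripleD, tripleHomotopy, xMap_dM_sig]
  · simp only [tripleMap, tripleD, tripleHomotopy, tripleFst, tripleSnd, LinearMap.sub_apply,
      LinearMap.neg_apply, LinearMap.add_apply, LinearMap.zero_apply, dM_incl,
      LinearMap.comp_apply, pfst_plift, psnd_plift, map_sub, map_neg, map_add, mu_sig, map_zero]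
    abel
  · simp [tripleMap, tripleD, tripleHomotopy]
  · simp [tripleMap, tripleD, tripleHomotopy, dM_sig]
  · simp [tripleMap, tripleD, tripleHomotopy]

/-- The invariance under the third Reidemeister move with three negative crossings. -/
theorem Adjacent.nonempty_homotopyEquiv (h : Adjacent a b) (L : CochainComplex (Bimod n) ℤ) :
    Nonempty (HomotopyEquiv
      (tensorComplex (crossingComplex (a, false)) (tensorComplex (crossingComplex (b, false))
        (tensorComplex (crossingComplex (a, false)) L)))
      (tensorComplex (crossingComplex (b, false)) (tensorComplex (crossingComplex (a, false))
        (tensorComplex (crossingComplex (b, false)) L)))) := by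
  have c := Coord.refl L
  obtain ⟨H⟩ : Nonempty (Homotopy
      ((c.triple a b).hom (c.triple b a) (fun k => h.tripleMap _ _ _ _)
        (fun k x => h.tripleMap_comm _ _ _ _ x) ≫
      (c.triple b a).hom (c.triple a b) (fun k => h.symm.tripleMap _ _ _ _)
        (fun k x => h.symm.tripleMap_comm _ _ _ _ x)) (𝟙 _)) := by
    rw [Coord.hom_comp]
    refine Coord.homotopy (c.triple a b) (c.triple a b)
      (fun k => tripleHomotopy a b _ _ _ _ _) fun k K hK x => ?_
    rw [Coord.equiv_hom]
    exact h.triple_homotopy _ _ _ _ _ h.symm ((c.triple a b).equiv (k + 1) K hK x)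
  obtain ⟨H'⟩ : Nonempty (Homotopy
      ((c.triple b a).hom (c.triple a b) (fun k => h.symm.tripleMap _ _ _ _)
        (fun k x => h.symm.tripleMap_comm _ _ _ _ x) ≫
      (c.triple a b).hom (c.triple b a) (fun k => h.tripleMap _ _ _ _)
        (fun k x => h.tripleMap_comm _ _ _ _ x)) (𝟙 _)) := by
    rw [Coord.hom_comp]
    refine Coord.homotopy (c.triple b a) (c.triple b a)
      (fun k => tripleHomotopy b a _ _ _ _ _) fun k K hK x => ?_
    rw [Coord.equiv_hom]
    exact h.symm.triple_homotopy _ _ _ _ _ h ((c.triple b a).equiv (k + 1) K hK x)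
  exact ⟨⟨_, _, H, H'⟩⟩

end triple

/-! ### Functoriality of the tensor product of complexes -/

section functoriality

variable {K L L' L'' : CochainComplex (Bimod n) ℤ}

variable (K) in
/-- The functoriality of the tensor product of complexes in the second factor. -/
def tensorComplexMap (f : L ⟶ L') : tensorComplex K L ⟶ tensorComplex K L' :=
  HomologicalComplex.mapBifunctorMap (𝟙 K) f (tensor n) (ComplexShape.up ℤ)

theorem tensorComplexMap_id : tensorComplexMap K (𝟙 L) = 𝟙 (tensorComplex K L) :=
  (((tensor n).map₂CochainComplex).obj K).map_id L

theorem tensorComplexMap_comp (f : L ⟶ L') (g : L' ⟶ L'') :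
    tensorComplexMap K (f ≫ g) = tensorComplexMap K f ≫ tensorComplexMap K g :=
  (((tensor n).map₂CochainComplex).obj K).map_comp f g

variable (K) in
/-- The tensor product of complexes respects homotopies in the second factor. -/
def tensorComplexMapHomotopy {f g : L ⟶ L'} (h : Homotopy f g) :
    Homotopy (tensorComplexMap K f) (tensorComplexMap K g) :=
  HomologicalComplex.mapBifunctorMapHomotopy₂ (𝟙 K) h (tensor n) (ComplexShape.up ℤ)

variable (K) in
/-- The tensor product of complexes respects homotopy equivalences in the second factor. -/
def tensorComplexHomotopyEquiv (e : HomotopyEquiv L L') :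
    HomotopyEquiv (tensorComplex K L) (tensorComplex K L') where
  hom := tensorComplexMap K e.hom
  inv := tensorComplexMap K e.inv
  homotopyHomInvId := ((Homotopy.ofEq (tensorComplexMap_comp _ _).symm).trans
    (tensorComplexMapHomotopy K e.homotopyHomInvId)).trans (Homotopy.ofEq tensorComplexMap_id)
  homotopyInvHomId := ((Homotopy.ofEq (tensorComplexMap_comp _ _).symm).trans
    (tensorComplexMapHomotopy K e.homotopyInvHomId)).trans (Homotopy.ofEq tensorComplexMap_id)

end functoriality

/-! ### The congruence of braid words -/

/-- The tensor product of the complexes of the crossings of a word with a complex. -/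
def wordComplex (T : List (Crossing n)) (L : CochainComplex (Bimod n) ℤ) :
    CochainComplex (Bimod n) ℤ :=
  T.foldr (fun c K => tensorComplex (crossingComplex c) K) L

theorem wordComplex_append (v w : List (Crossing n)) (L : CochainComplex (Bimod n) ℤ) :
    wordComplex (v ++ w) L = wordComplex v (wordComplex w L) :=
  List.foldr_append

theorem braidComplex_append (v w : List (Crossing n)) :
    braidComplex (v ++ w) = wordComplex v (braidComplex w) := by
  induction v with
  | nil => rfl
  | cons c v ih => exact congrArg (tensorComplex (crossingComplex c)) ih

/-- A word respects homotopy equivalences. -/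
def wordHomotopyEquiv {L L' : CochainComplex (Bimod n) ℤ} (e : HomotopyEquiv L L') :
    ∀ v : List (Crossing n), HomotopyEquiv (wordComplex v L) (wordComplex v L')
  | [] => e
  | c :: v => tensorComplexHomotopyEquiv (crossingComplex c) (wordHomotopyEquiv e v)

variable (n) in
/-- Two words are congruent if their tensor products with every complex are homotopy equivalent. -/
def wordCon : Con (FreeMonoid (Crossing n)) where
  r x y := ∀ L, Nonempty (HomotopyEquiv (wordComplex x.toList L) (wordComplex y.toList L))
  iseqv :=
    { refl := fun _ _ => ⟨HomotopyEquiv.refl _⟩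
      symm := fun h L => (h L).map HomotopyEquiv.symm
      trans := fun h h' L => (h L).elim fun e => (h' L).map fun e' => e.trans e' }
  mul' {w x y z} h h' L := by
    rw [FreeMonoid.toList_mul, FreeMonoid.toList_mul, wordComplex_append, wordComplex_append]
    -- The congruence quantifies over all complexes, so the left word can be exchanged over the
    -- complex of the right word, and the right one is then exchanged underneath.
    obtain ⟨e⟩ := h (wordComplex y.toList L)
    obtain ⟨e'⟩ := h' L
    exact ⟨e.trans (wordHomotopyEquiv e' x.toList)⟩

/-- The class of a crossing. -/
def crossingClass (c : Crossing n) : (wordCon n).Quotient := ((FreeMonoid.of c : FreeMonoid _) : _)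

theorem crossingClass_mul_not (i : Pos n) (b : Bool) :
    crossingClass (i, b) * crossingClass (i, !b) = 1 := by
  refine ((wordCon n).eq (a := FreeMonoid.of (i, b) * FreeMonoid.of (i, !b)) (b := 1)).2 fun L => ?_
  obtain ⟨f, g, h, ⟨H⟩⟩ := exists_retraction L i b
  exact ⟨⟨g, f, H, Homotopy.ofEq h⟩⟩

/-- The class of a negative crossing, as a unit. -/
def negUnit (i : Pos n) : (wordCon n).Quotientˣ where
  val := crossingClass (i, false)
  inv := crossingClass (i, true)
  val_inv := crossingClass_mul_not i false
  inv_val := crossingClass_mul_not i true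

theorem crossingClass_eq (i : Pos n) (b : Bool) :
    crossingClass (i, b) = ((if b then (negUnit i)⁻¹ else negUnit i : (wordCon n).Quotientˣ) : _) := by
  cases b <;> rfl

theorem Far.negUnit_commute {i j : Pos n} (h : Far i j) : Commute (negUnit i) (negUnit j) :=
  Units.ext <| ((wordCon n).eq (a := FreeMonoid.of (i, false) * FreeMonoid.of (j, false))
    (b := FreeMonoid.of (j, false) * FreeMonoid.of (i, false))).2 fun L => h.nonempty_homotopyEquiv L

theorem Adjacent.negUnit_braid {i j : Pos n} (h : Adjacent i j) :
    negUnit i * negUnit j * negUnit i = negUnit j * negUnit i * negUnit j :=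
  Units.ext <| ((wordCon n).eq
    (a := FreeMonoid.of (i, false) * FreeMonoid.of (j, false) * FreeMonoid.of (i, false))
    (b := FreeMonoid.of (j, false) * FreeMonoid.of (i, false) * FreeMonoid.of (j, false))).2
    fun L => h.nonempty_homotopyEquiv L

/-- Conjugating the braid relation gives two mixed relations, and inversion doubles the three to
six. These are precisely the admissible sign patterns. -/
theorem braid_signs {G : Type*} [Group G] {x y : G} (h : x * y * x = y * x * y) {r s t : Bool}
    (hs : ¬(r = t ∧ s ≠ r)) :
    (if r then x⁻¹ else x) * (if s then y⁻¹ else y) * (if t then x⁻¹ else x) =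
      (if t then y⁻¹ else y) * (if s then x⁻¹ else x) * (if r then y⁻¹ else y) := by
  have h₁ : x * y * x⁻¹ = y⁻¹ * x * y := by
    rw [mul_inv_eq_iff_eq_mul, mul_assoc, mul_assoc, eq_inv_mul_iff_mul_eq, ← mul_assoc, ← mul_assoc, h]
  have h₂ : x⁻¹ * y * x = y * x * y⁻¹ := by
    rw [eq_mul_inv_iff_mul_eq, mul_assoc, mul_assoc, inv_mul_eq_iff_eq_mul, ← mul_assoc, ← mul_assoc, h]
  have h₃ := congrArg Inv.inv h
  have h₄ := congrArg Inv.inv h₁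
  have h₅ := congrArg Inv.inv h₂
  simp only [mul_inv_rev, inv_inv, ← mul_assoc] at h₃ h₄ h₅
  cases r <;> cases s <;> cases t <;> simp_all

/-- Congruent words can be exchanged within a braid. -/
theorem nonempty_homotopyEquiv_of_con {x y : List (Crossing n)}
    (h : wordCon n (FreeMonoid.ofList x) (FreeMonoid.ofList y)) (v w : List (Crossing n)) :
    Nonempty (HomotopyEquiv (braidComplex (v ++ x ++ w)) (braidComplex (v ++ y ++ w))) := by
  rw [List.append_assoc, List.append_assoc, braidComplex_append, braidComplex_append,
    braidComplex_append, braidComplex_append]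
  obtain ⟨e⟩ := h (braidComplex w)
  exact ⟨wordHomotopyEquiv e v⟩

/-- The functoriality of the complex of a word in strict retractions. -/
theorem exists_retraction_word {L L' : CochainComplex (Bimod n) ℤ}
    (h : ∃ (f : L' ⟶ L) (g : L ⟶ L'), f ≫ g = 𝟙 L' ∧ Nonempty (Homotopy (g ≫ f) (𝟙 L)))
    (v : List (Crossing n)) :
    ∃ (f : wordComplex v L' ⟶ wordComplex v L) (g : wordComplex v L ⟶ wordComplex v L'),
      f ≫ g = 𝟙 _ ∧ Nonempty (Homotopy (g ≫ f) (𝟙 _)) := by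
  induction v with
  | nil => exact h
  | cons c v ih =>
    obtain ⟨f, g, hfg, ⟨H⟩⟩ := ih
    exact ⟨tensorComplexMap _ f, tensorComplexMap _ g,
      (tensorComplexMap_comp f g).symm.trans ((congrArg _ hfg).trans tensorComplexMap_id),
      ⟨((Homotopy.ofEq (tensorComplexMap_comp _ _).symm).trans
        (tensorComplexMapHomotopy _ H)).trans (Homotopy.ofEq tensorComplexMap_id)⟩⟩

/-- The congruence forgets that one composite is equal to the identity and not only homotopic to it.
The strict retraction is therefore carried through the lower part of the word by functoriality. -/
theorem ReidemeisterII.exists_retraction {T T' : List (Crossing n)} (h : ReidemeisterII T T') :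
    ∃ (f : braidComplex T' ⟶ braidComplex T) (g : braidComplex T ⟶ braidComplex T'),
      f ≫ g = 𝟙 (braidComplex T') ∧ Nonempty (Homotopy (g ≫ f) (𝟙 (braidComplex T))) := by
  obtain ⟨v, w, i, s, rfl, rfl⟩ := h
  rw [List.append_assoc, braidComplex_append, braidComplex_append]
  exact exists_retraction_word (OpenBraid.exists_retraction (braidComplex w) i s) v

theorem ReidemeisterIII.nonempty_homotopyEquiv {T T' : List (Crossing n)}
    (h : ReidemeisterIII T T') : Nonempty (HomotopyEquiv (braidComplex T) (braidComplex T')) := by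
  obtain ⟨v, w, i, j, r, s, t, hij, hs, rfl, rfl⟩ := h
  refine nonempty_homotopyEquiv_of_con ((wordCon n).eq.1 ?_) v w
  have e := congrArg Units.val (braid_signs (Adjacent.negUnit_braid (Or.inl hij)) hs)
  rw [Units.val_mul, Units.val_mul, Units.val_mul, Units.val_mul] at e
  simp only [← crossingClass_eq] at e
  exact e

theorem FarCommutation.nonempty_homotopyEquiv {T T' : List (Crossing n)}
    (h : FarCommutation T T') : Nonempty (HomotopyEquiv (braidComplex T) (braidComplex T')) := by
  obtain ⟨v, w, i, j, r, s, hij, rfl, rfl⟩ := h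
  refine nonempty_homotopyEquiv_of_con ((wordCon n).eq.1 ?_) v w
  have hc : Commute (negUnit i) (negUnit j) := Far.negUnit_commute (Or.inl hij)
  have e : Commute (if r then (negUnit i)⁻¹ else negUnit i)
      (if s then (negUnit j)⁻¹ else negUnit j) := by
    cases r <;> cases s <;> simp [hc]
  have e := congrArg Units.val e.eq
  rw [Units.val_mul, Units.val_mul, ← crossingClass_eq, ← crossingClass_eq] at e
  exact e

theorem BraidIsotopic.nonempty_homotopyEquiv {T T' : List (Crossing n)} (h : BraidIsotopic T T') :
    Nonempty (HomotopyEquiv (braidComplex T) (braidComplex T')) := by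
  induction h with
  | rel T T' h =>
    rcases h with h | h | h
    · obtain ⟨f, g, hfg, ⟨H⟩⟩ := h.exists_retraction
      exact ⟨⟨g, f, H, Homotopy.ofEq hfg⟩⟩
    · exact h.nonempty_homotopyEquiv
    · exact h.nonempty_homotopyEquiv
  | refl T => exact ⟨HomotopyEquiv.refl _⟩
  | symm T T' _ ih => exact ih.map HomotopyEquiv.symm
  | trans T T' T'' _ _ ih ih' => exact ih.elim fun e => ih'.map fun e' => e.trans e'

end OpenBraid

end

theorem mainTheorem7 (n : ℕ) :
    (∀ T T' : List (OpenBraid.Crossing n), OpenBraid.BraidIsotopic T T' →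
      Nonempty (HomotopyEquiv (OpenBraid.braidComplex T) (OpenBraid.braidComplex T'))) ∧
    (∀ T T' : List (OpenBraid.Crossing n), OpenBraid.ReidemeisterII T T' →
      ∃ (f : OpenBraid.braidComplex T' ⟶ OpenBraid.braidComplex T)
        (g : OpenBraid.braidComplex T ⟶ OpenBraid.braidComplex T'),
        f ≫ g = 𝟙 (OpenBraid.braidComplex T') ∧
        Nonempty (Homotopy (g ≫ f) (𝟙 (OpenBraid.braidComplex T)))) :=
  ⟨fun _ _ h => h.nonempty_homotopyEquiv, fun _ _ h => h.exists_retraction⟩
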